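/- Let $k$ be an algebraically closed field of characteristic zero and let $R_2$ be the space of quadratic forms in $X,Y,Z$ over $k$. A net of conics is a 3-dimensional subspace of $R_2$; nets are the points of $\mathrm{Grass}(3,R_2)$, with its Zariski topology, on which $\mathrm{PGL}_3(k)$ acts by linear change of coordinates. An orbit $A$ specializes to an orbit $B$ if $B\subset\overline{A}$; the specialization is elementary if $A\ne B$ and every orbit $C$ such that $A$ specializes to $C$ and $C$ specializes to $B$ is equal to $A$ or $B$. Every net belongs to the orbit of one of the following nets (Table 1), where the number in a label is the dimension of the orbit: - 8a: $\langle XY,\,X^2+YZ,\,Y^2+XZ\rangle$; 8b$_\lambda$: $\langle X^2+\lambda YZ,\,Y^2+\lambda XZ,\,Z^2+\lambda XY\rangle$ with $\lambda\in k$, $\lambda^3\neq 0,-1,8$; 8c: $\langle Z^2,\,X^2-YZ,\,Y^2-XZ\rangle$; - 7a: $\langle X^2+YZ,\,XY,\,XZ\rangle$; 7b: $\langle X^2+YZ,\,XY,\,Z^2\rangle$; 7c: $\langle X^2,\,Y^2,\,Z^2+XY\rangle$; - 6a: $\langle XY,\,XZ,\,YZ\rangle$; 6b: $\langle X^2,\,XY,\,Z^2+YZ\rangle$;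 6c: $\langle XY,\,X^2+YZ,\,X^2+Y^2\rangle$; 6d: $\langle X^2,\,Y^2,\,Z^2\rangle$; - 5a: $\langle X^2,\,XY,\,YZ\rangle$; 5b: $\langle X^2,\,XY,\,Z^2\rangle$; - 4: $\langle XY,\,X^2+YZ,\,Y^2\rangle$; - 2a: $\langle X^2,\,XY,\,XZ\rangle$; 2b: $\langle X^2,\,XY,\,Y^2\rangle$. The orbits of these nets are pairwise distinct, except that 8b$_\lambda$ and 8b$_\mu$ have the same orbit if and only if $\mathsf j(\lambda)=\mathsf j(\mu)$, where $$\mathsf j(\lambda)=\frac{\lambda^3(\lambda^3-8)^3}{27(\lambda^3+1)^3}$$ is the $\mathsf j$-invariant of the cubic $X^3+Y^3+Z^3+3\lambda XYZ$. Their dimensions are 8, 7, 6, 5, 4 and 2, as the labels indicate. The elementary specializations are exactly $$8a\to 7a,\,7b;\qquad 8b_\lambda\to 7b\ (\text{each }\lambda);\qquad 8c\to 7b,\,7c;$$ $$7a\to 6a,\,6b,\,6c;\qquad 7b\to 6b,\,6c;\qquad 7c\to 6b,\,6c,\,6d;$$ $$6a\to 5a;\qquad 6b\to 5a,\,5b;\qquad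 6c\to 5a,\,5b;\qquad 6d\to 5b;$$ $$5a\to 4;\qquad 5b\to 4;\qquad 4\to 2a,\,2b,$$ and an orbit $A$ specializes to an orbit $B$ if and only if $A=B$ or $B$ is reached from $A$ by a chain of these arrows. Moreover each elementary specialization $A\to B$ is realized by a one-parameter family: there are three quadratic forms with coefficients in $k[t]$ which span, for every value of $t\in k$, a net $F_t$, with $F_t\in A$ for all $t\neq 0$ and $F_0\in B$. -/

import Mathlib

open MvPolynomial

noncomputable section

namespace NetsOfConics

/-- A net of conics: a point of `Grass(3, R_2)`, that is, a 3-dimensional vector space of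
quadratic forms in the three variables `X 0, X 1, X 2`. -/
@[ext]
structure Net (k : Type*) [Field k] where
  /-- The underlying vector space of quadratic forms. -/
  carrier : Submodule k (MvPolynomial (Fin 3) k)
  le_homogeneous : carrier ≤ homogeneousSubmodule (Fin 3) k 2
  finrank_eq : Module.finrank k carrier = 3

/-- The linear substitution `X i ↦ ∑ j, g i j * X j`. -/
def subst {k : Type*} [Field k] (g : GL (Fin 3) k) :
    MvPolynomial (Fin 3) k →ₐ[k] MvPolynomial (Fin 3) k :=
  aeval fun i => ∑ j, C (g.1 i j) * X j

/-- The orbit of a net under invertible linear changes of coordinates. Scalar matrices fix every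
net, so this is the orbit under the projective linear group. -/
def orbit {k : Type*} [Field k] (V : Net k) : Set (Net k) :=
  {W | ∃ g : GL (Fin 3) k, W.carrier = V.carrier.map (subst g).toLinearMap}

/-! ### The Zariski topology on the Grassmannian -/

/-- The polynomial functions on a vector space: the algebra of functions generated by the linear
forms. -/
def polyFun (k W : Type*) [Field k] [AddCommGroup W] [Module k W] : Subalgebra k (W → k) :=
  Algebra.adjoin k (Set.range fun (φ : Module.Dual k W) (w : W) => φ w)

/-- The Zariski topology on (the `k`-points of) a finite-dimensional vector space: the nonvanishing
loci of polynomial functions are a basis of open sets. -/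
@[reducible] def zariski (k W : Type*) [Field k] [AddCommGroup W] [Module k W] : TopologicalSpace W :=
  TopologicalSpace.generateFrom {U | ∃ f ∈ polyFun k W, U = {w | f w ≠ 0}}

/-- Linearly independent triples of quadratic forms. -/
abbrev Frame (k : Type*) [Field k] : Type _ :=
  {q : Fin 3 → homogeneousSubmodule (Fin 3) k 2 // LinearIndependent k q}

/-- The net spanned by a frame. -/
def spanNet {k : Type*} [Field k] (q : Frame k) : Net k where
  carrier := Submodule.span k (Set.range fun i => (q.1 i : MvPolynomial (Fin 3) k))
  le_homogeneous := by
    rw [Submodule.span_le]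
    rintro _ ⟨i, rfl⟩
    exact (q.1 i).2
  finrank_eq := by
    have h : LinearIndependent k fun i => (q.1 i : MvPolynomial (Fin 3) k) :=
      q.2.map' (homogeneousSubmodule (Fin 3) k 2).subtype (Submodule.ker_subtype _)
    simpa using finrank_span_eq_card h

/-- The Zariski topology of `Grass(3, R_2)`, as the quotient of the variety of frames (an open
subvariety of the affine space `(R_2)^3`) by the action of the group of base changes. -/
instance netTopology (k : Type*) [Field k] : TopologicalSpace (Net k) :=
  TopologicalSpace.coinduced spanNet
    (TopologicalSpace.induced Subtype.val (zariski k (Fin 3 → homogeneousSubmodule (Fin 3) k 2)))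

/-! ### Specializations -/

/-- The orbit of `V` specializes to the orbit of `W`: the latter lies in the Zariski closure of the
former. -/
def SpecializesTo {k : Type*} [Field k] (V W : Net k) : Prop :=
  orbit W ⊆ closure (orbit V)

/-- An elementary specialization: the two orbits are distinct and there is no orbit strictly
between them. -/
def IsElementary {k : Type*} [Field k] (V W : Net k) : Prop :=
  SpecializesTo V W ∧ orbit V ≠ orbit W ∧
    ∀ U : Net k, SpecializesTo V U → SpecializesTo U W → orbit U = orbit V ∨ orbit U = orbit W

/-- A family of nets over the affine line, spanned by three quadratic forms whose coefficients are
polynomials in the parameter. -/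
def IsAlgebraicFamily {k : Type*} [Field k] (F : k → Net k) : Prop :=
  ∃ q : Fin 3 → MvPolynomial (Fin 3) (Polynomial k), ∀ t : k,
    (F t).carrier =
      Submodule.span k (Set.range fun i => MvPolynomial.map (Polynomial.evalRingHom t) (q i))

/-! ### The table -/

/-- The values of `lam` for which `X³ + Y³ + Z³ + 3 lam XYZ` is smooth (`lam³ ≠ -1`) and not
isomorphic to `X³ + Y³ + Z³` (`lam³ ≠ 0, 8`). -/
def Permissible {k : Type*} [Field k] (lam : k) : Prop :=
  lam ≠ 0 ∧ lam ^ 3 ≠ -1 ∧ lam ^ 3 ≠ 8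

/-- The `j`-invariant of the cubic `X³ + Y³ + Z³ + 3 lam XYZ`. -/
def jInv {k : Type*} [Field k] (lam : k) : k :=
  lam ^ 3 * (lam ^ 3 - 8) ^ 3 / (27 * (lam ^ 3 + 1) ^ 3)

/-- The entries of the table: fourteen isolated orbits and a one-parameter family. The number is
the dimension of the orbit, the letter is its place in the row of the table. -/
inductive Entry (k : Type*) [Field k] : Type _
  | e8a | e8b (lam : k) (h : Permissible lam) | e8c
  | e7a | e7b | e7c
  | e6a | e6b | e6c | e6d
  | e5a | e5b
  | e4
  | e2a | e2b

/-- The dimension of the orbit, as given by its height in the table. -/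
def Entry.dim {k : Type*} [Field k] : Entry k → ℕ
  | e8a => 8 | e8b _ _ => 8 | e8c => 8
  | e7a => 7 | e7b => 7 | e7c => 7
  | e6a => 6 | e6b => 6 | e6c => 6 | e6d => 6
  | e5a => 5 | e5b => 5
  | e4 => 4
  | e2a => 2 | e2b => 2

/-- Three quadratic forms (in `X = X 0`, `Y = X 1`, `Z = X 2`) spanning a net in the orbit. -/
def Entry.forms {k : Type*} [Field k] : Entry k → Fin 3 → MvPolynomial (Fin 3) k
  | e8a => ![X 0 * X 1, X 0 ^ 2 + X 1 * X 2, X 1 ^ 2 + X 0 * X 2]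
  | e8b lam _ =>
      ![X 0 ^ 2 + C lam * (X 1 * X 2), X 1 ^ 2 + C lam * (X 0 * X 2),
        X 2 ^ 2 + C lam * (X 0 * X 1)]
  | e8c => ![X 2 ^ 2, X 0 ^ 2 - X 1 * X 2, X 1 ^ 2 - X 0 * X 2]
  | e7a => ![X 0 ^ 2 + X 1 * X 2, X 0 * X 1, X 0 * X 2]
  | e7b => ![X 0 ^ 2 + X 1 * X 2, X 0 * X 1, X 2 ^ 2]
  | e7c => ![X 0 ^ 2, X 1 ^ 2, X 2 ^ 2 + X 0 * X 1]
  | e6a => ![X 0 * X 1, X 0 * X 2, X 1 * X 2]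
  | e6b => ![X 0 ^ 2, X 0 * X 1, X 2 ^ 2 + X 1 * X 2]
  | e6c => ![X 0 * X 1, X 0 ^ 2 + X 1 * X 2, X 0 ^ 2 + X 1 ^ 2]
  | e6d => ![X 0 ^ 2, X 1 ^ 2, X 2 ^ 2]
  | e5a => ![X 0 ^ 2, X 0 * X 1, X 1 * X 2]
  | e5b => ![X 0 ^ 2, X 0 * X 1, X 2 ^ 2]
  | e4 => ![X 0 * X 1, X 0 ^ 2 + X 1 * X 2, X 1 ^ 2]
  | e2a => ![X 0 ^ 2, X 0 * X 1, X 0 * X 2]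
  | e2b => ![X 0 ^ 2, X 0 * X 1, X 1 ^ 2]

theorem Entry.forms_mem {k : Type*} [Field k] (a : Entry k) (i : Fin 3) :
    a.forms i ∈ homogeneousSubmodule (Fin 3) k 2 := by
  rw [mem_homogeneousSubmodule]
  have hm : ∀ i j : Fin 3, (X i * X j : MvPolynomial (Fin 3) k).IsHomogeneous 2 := fun i j =>
    (isHomogeneous_X k i).mul (isHomogeneous_X k j)
  have hs : ∀ i : Fin 3, (X i ^ 2 : MvPolynomial (Fin 3) k).IsHomogeneous 2 := fun i =>
    by simpa [sq] using hm i i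
  have hc : ∀ (c : k) (i j : Fin 3),
      (C c * (X i * X j) : MvPolynomial (Fin 3) k).IsHomogeneous 2 := fun c i j => by
    simpa using (isHomogeneous_C (Fin 3) c).mul (hm i j)
  have h3 : ∀ p q r : MvPolynomial (Fin 3) k, p.IsHomogeneous 2 → q.IsHomogeneous 2 →
      r.IsHomogeneous 2 → (![p, q, r] i).IsHomogeneous 2 := fun p q r hp hq hr => by
    fin_cases i
    exacts [hp, hq, hr]
  cases a with
  | e8a => exact h3 _ _ _ (hm _ _) ((hs _).add (hm _ _)) ((hs _).add (hm _ _))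
  | e8b lam _ =>
    exact h3 _ _ _ ((hs _).add (hc _ _ _)) ((hs _).add (hc _ _ _)) ((hs _).add (hc _ _ _))
  | e8c => exact h3 _ _ _ (hs _) ((hs _).sub (hm _ _)) ((hs _).sub (hm _ _))
  | e7a => exact h3 _ _ _ ((hs _).add (hm _ _)) (hm _ _) (hm _ _)
  | e7b => exact h3 _ _ _ ((hs _).add (hm _ _)) (hm _ _) (hs _)
  | e7c => exact h3 _ _ _ (hs _) (hs _) ((hs _).add (hm _ _))
  | e6a => exact h3 _ _ _ (hm _ _) (hm _ _) (hm _ _)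
  | e6b => exact h3 _ _ _ (hs _) (hm _ _) ((hs _).add (hm _ _))
  | e6c => exact h3 _ _ _ (hm _ _) ((hs _).add (hm _ _)) ((hs _).add (hs _))
  | e6d => exact h3 _ _ _ (hs _) (hs _) (hs _)
  | e5a => exact h3 _ _ _ (hs _) (hm _ _) (hm _ _)
  | e5b => exact h3 _ _ _ (hs _) (hm _ _) (hs _)
  | e4 => exact h3 _ _ _ (hm _ _) ((hs _).add (hm _ _)) (hs _)
  | e2a => exact h3 _ _ _ (hs _) (hm _ _) (hm _ _)
  | e2b => exact h3 _ _ _ (hs _) (hm _ _) (hs _)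

theorem Entry.forms_linearIndependent {k : Type*} [Field k] [CharZero k] (a : Entry k) :
    LinearIndependent k a.forms := by
  rw [Fintype.linearIndependent_iff]
  intro g hg
  have key : ∀ p : Fin 3 → k, ∑ i, g i * eval p (a.forms i) = 0 := fun p => by
    simpa [smul_eval] using congrArg (eval p) hg
  have h1 := key ![1, 0, 0]
  have h2 := key ![0, 1, 0]
  have h3 := key ![0, 0, 1]
  have h4 := key ![1, 1, 0]
  have h5 := key ![1, 0, 1]
  have h6 := key ![0, 1, 1]
  suffices g 0 = 0 ∧ g 1 = 0 ∧ g 2 = 0 by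
    intro i; fin_cases i
    exacts [this.1, this.2.1, this.2.2]
  cases a <;> simp [Entry.forms, Fin.sum_univ_three] at h1 h2 h3 h4 h5 h6 <;>
    refine ⟨?_, ?_, ?_⟩ <;> grind

/-- The net listed in the table. -/
def Entry.net {k : Type*} [Field k] [CharZero k] (a : Entry k) : Net k :=
  spanNet ⟨fun i => ⟨a.forms i, a.forms_mem i⟩,
    LinearIndependent.of_comp (homogeneousSubmodule (Fin 3) k 2).subtype a.forms_linearIndependent⟩

/-- Two entries are the same up to the choice of the parameter in the one-parameter family, which is
classified by the `j`-invariant. -/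
inductive SameEntry {k : Type*} [Field k] : Entry k → Entry k → Prop
  | refl (a : Entry k) : SameEntry a a
  | family (lam mu : k) (hl : Permissible lam) (hm : Permissible mu) (hj : jInv lam = jInv mu) :
      SameEntry (.e8b lam hl) (.e8b mu hm)

/-- The arrows of the table. -/
inductive Arrow {k : Type*} [Field k] : Entry k → Entry k → Prop
  | a_8a_7a : Arrow .e8a .e7a
  | a_8a_7b : Arrow .e8a .e7b
  | a_8b_7b (lam : k) (h : Permissible lam) : Arrow (.e8b lam h) .e7b
  | a_8c_7b : Arrow .e8c .e7b
  | a_8c_7c : Arrow .e8c .e7c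
  | a_7a_6a : Arrow .e7a .e6a
  | a_7a_6b : Arrow .e7a .e6b
  | a_7a_6c : Arrow .e7a .e6c
  | a_7b_6b : Arrow .e7b .e6b
  | a_7b_6c : Arrow .e7b .e6c
  | a_7c_6b : Arrow .e7c .e6b
  | a_7c_6c : Arrow .e7c .e6c
  | a_7c_6d : Arrow .e7c .e6d
  | a_6a_5a : Arrow .e6a .e5a
  | a_6b_5a : Arrow .e6b .e5a
  | a_6b_5b : Arrow .e6b .e5b
  | a_6c_5a : Arrow .e6c .e5a
  | a_6c_5b : Arrow .e6c .e5b
  | a_6d_5b : Arrow .e6d .e5b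
  | a_5a_4 : Arrow .e5a .e4
  | a_5b_4 : Arrow .e5b .e4
  | a_4_2a : Arrow .e4 .e2a
  | a_4_2b : Arrow .e4 .e2b

end NetsOfConics

end

open MvPolynomial

noncomputable section

namespace NetsOfConics

/-! ### Orbits -/

section Orbits

variable {k : Type*} [Field k]

/-! A specialization is proved by exhibiting a family, and refuted by a polynomial condition that
holds for every frame of every net in one orbit and fails at a frame of the other
(`mem_closure_of_curve`, `notMem_closure_of_polyFun`). Transitivity propagates both, so that a short
list of families and a short list of obstructions settle all pairs.

Families: each arrow has an explicit triple of forms over `k[t]`, with coordinate changes certifying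
the general and the special member (`degenerates_of_realizes`, `realizes_of_matrix`).

Obstructions: a frame is replaced by its three Hessian matrices. Four closed conditions are used.
(1) The Aronhold invariant of the discriminant cubic and the determinant of the 6×6 matrix of the
map from the symmetric square of the net to dual conics both have degree twelve and the same weight,
so their ratio survives specialization (`invariants_of_specializesTo`). On `8b` this ratio is
equivalent to the j-invariant; `8a`, `7a`, `6a` behave as j = ∞ and `8c`, `7c`, `6d` as j = 0. (2)
The rank of the 6×6 matrix cannot increase (`not_specializesTo_of_dualMat`). (3) Nor can the
dimension of the space of cubics generated by the net (`not_specializesTo_of_products`). (4) A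
double line in the Jacobian cubic or in the discriminant cubic persists; this separates `6b` from
`6c` in both directions. Conversely, equal j gives equal orbits in `8b` through the symmetries of
the Hesse pencil (`orbit_8b_of_jInv_eq`). Given the order, the elementary specializations follow by
counting: arrows lower the table's dimension by one, except from 4 to 2, and 3 does not occur.

Completeness: every net contains the three polars of some nonzero cubic, since three members of the
net carry nine parameters and closedness of the triple costs only eight equations
(`exists_isPolarCubic`). A singular cubic leads either to a node or to a double line in the net, and
nets with a double line are normalized by hand (`classified_of_square`). A smooth cubic has a flex;
the flex gives a Weierstrass form, three collinear flexes turn it into a triangle form, and a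
Fourier transform turns that into Hesse form.

Dimensions: for the lower bound, an orbit contains a chain of irreducible closed sets made of
translates by matrices supported on growing sets of entries transversal to the infinitesimal
stabilizer; the Jacobian criterion for algebraic independence keeps the chain strict
(`card_le_topologicalKrullDim`). For the upper bound, `netDim` is an integer-valued, strictly
increasing function on irreducible closed sets of nets, bounded by nine. Orbits at the top of the
table are not dense, every arrow lowers `netDim`, and an intermediate closed set accounts for the
double step from 4 to 2. -/

/-- The linear form with given coefficients. -/
def lin (v : Fin 3 → k) : MvPolynomial (Fin 3) k := ∑ j, C (v j) * X j

theorem lin_isHomogeneous (v : Fin 3 → k) : (lin v).IsHomogeneous 1 := by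
  refine IsHomogeneous.sum _ _ _ fun j _ => ?_
  simpa using (isHomogeneous_C (Fin 3) (v j)).mul (isHomogeneous_X k j)

theorem lin_eq (v : Fin 3 → k) : lin v = C (v 0) * X 0 + C (v 1) * X 1 + C (v 2) * X 2 := by
  simp [lin, Fin.sum_univ_three]

@[simp] theorem subst_X (g : GL (Fin 3) k) (i : Fin 3) : subst g (X i) = lin (g.1 i) := by
  simp [subst, lin]

theorem subst_lin (g : GL (Fin 3) k) (v : Fin 3 → k) :
    subst g (lin v) = lin (Matrix.vecMul v g.1) := by
  simp only [lin, map_sum, map_mul, subst_X, algHom_C, algebraMap_eq, Matrix.vecMul, dotProduct,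
    Finset.mul_sum, Finset.sum_mul]
  rw [Finset.sum_comm]
  simp [mul_assoc]

/-- Coefficient vectors of linear forms are rows, so successive substitutions multiply in the
opposite order: nets carry a right action. -/
theorem subst_subst (g h : GL (Fin 3) k) (p : MvPolynomial (Fin 3) k) :
    subst g (subst h p) = subst (h * g) p := by
  have : (subst g).comp (subst h) = subst (h * g) := by
    apply MvPolynomial.algHom_ext
    intro i
    simp only [AlgHom.comp_apply, subst_X, subst_lin]
    congr 1
  exact DFunLike.congr_fun this p

@[simp] theorem subst_one (p : MvPolynomial (Fin 3) k) : subst 1 p = p := by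
  have : subst (1 : GL (Fin 3) k) = AlgHom.id k _ := by
    apply MvPolynomial.algHom_ext
    intro i
    simp [lin, Matrix.one_apply]
  rw [this]; rfl

theorem subst_injective (g : GL (Fin 3) k) : Function.Injective (subst g) := by
  intro p q h
  have := congrArg (subst g⁻¹) h
  simpa [subst_subst] using this

theorem subst_isHomogeneous (g : GL (Fin 3) k) {p : MvPolynomial (Fin 3) k} {n : ℕ}
    (hp : p.IsHomogeneous n) : (subst g p).IsHomogeneous n := by
  have := hp.aeval (fun i => ∑ j, C (g.1 i j) * X j) (n := 1) fun i => lin_isHomogeneous (g.1 i)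
  rwa [one_mul] at this

/-- A linear substitution applied to a net. -/
def Net.act (g : GL (Fin 3) k) (V : Net k) : Net k where
  carrier := V.carrier.map (subst g).toLinearMap
  le_homogeneous := by
    rintro _ ⟨p, hp, rfl⟩
    exact subst_isHomogeneous g (V.le_homogeneous hp)
  finrank_eq := by
    exact ((Submodule.equivMapOfInjective (subst g).toLinearMap (subst_injective g)
      V.carrier).finrank_eq).symm.trans V.finrank_eq

theorem Net.act_act (g h : GL (Fin 3) k) (V : Net k) : (V.act h).act g = V.act (h * g) := by
  ext1
  have : (subst g).toLinearMap ∘ₗ (subst h).toLinearMap = (subst (h * g)).toLinearMap :=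
    LinearMap.ext fun p => subst_subst g h p
  change (V.carrier.map (subst h).toLinearMap).map (subst g).toLinearMap = _
  rw [← Submodule.map_comp, this]
  rfl

@[simp] theorem Net.act_one (V : Net k) : V.act 1 = V := by
  ext1
  have : (subst (1 : GL (Fin 3) k)).toLinearMap = LinearMap.id := by
    exact LinearMap.ext fun p => subst_one p
  simp [Net.act, this]

theorem mem_orbit_iff_act {V W : Net k} : W ∈ orbit V ↔ ∃ g, W = V.act g := by
  simp only [orbit, Set.mem_ofPred_eq, Net.ext_iff, Net.act]

theorem act_mem_orbit (g : GL (Fin 3) k) (V : Net k) : V.act g ∈ orbit V :=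
  mem_orbit_iff_act.2 ⟨g, rfl⟩

@[simp] theorem mem_orbit_self (V : Net k) : V ∈ orbit V := mem_orbit_iff_act.2 ⟨1, by simp⟩

theorem mem_orbit_trans {U V W : Net k} (h₁ : U ∈ orbit V) (h₂ : V ∈ orbit W) : U ∈ orbit W := by
  obtain ⟨g, rfl⟩ := mem_orbit_iff_act.1 h₁
  obtain ⟨h, rfl⟩ := mem_orbit_iff_act.1 h₂
  rw [Net.act_act]; exact act_mem_orbit _ _

theorem mem_orbit_symm {V W : Net k} (h : V ∈ orbit W) : W ∈ orbit V := by
  obtain ⟨g, rfl⟩ := mem_orbit_iff_act.1 h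
  exact mem_orbit_iff_act.2 ⟨g⁻¹, by simp [Net.act_act]⟩

theorem orbit_eq_of_mem {V W : Net k} (h : V ∈ orbit W) : orbit V = orbit W :=
  Set.ext fun _ => ⟨fun h' => mem_orbit_trans h' h, fun h' => mem_orbit_trans h' (mem_orbit_symm h)⟩

theorem Net.finiteDimensional (V : Net k) : FiniteDimensional k V.carrier :=
  Module.finite_of_finrank_pos (by rw [V.finrank_eq]; norm_num)

theorem Net.eq_of_le {V W : Net k} (h : V.carrier ≤ W.carrier) : V = W := by
  ext1
  have := W.finiteDimensional
  exact Submodule.eq_of_le_of_finrank_eq h (by rw [V.finrank_eq, W.finrank_eq])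

/-- A net containing three independent quadratic forms is spanned by them. -/
theorem Net.eq_spanNet {V : Net k} {q : Frame k} (h : ∀ i, (q.1 i).1 ∈ V.carrier) :
    V = spanNet q :=
  (Net.eq_of_le (Submodule.span_le.2 (by rintro _ ⟨i, rfl⟩; exact h i))).symm

theorem spanNet_mem (q : Frame k) (i : Fin 3) : (q.1 i).1 ∈ (spanNet q).carrier :=
  Submodule.subset_span ⟨i, rfl⟩

/-- A matrix of nonzero determinant as an element of the general linear group. -/
def toGL (M : Matrix (Fin 3) (Fin 3) k) (h : M.det ≠ 0) : GL (Fin 3) k :=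
  Matrix.GeneralLinearGroup.mkOfDetNeZero M h

@[simp] theorem toGL_val (M : Matrix (Fin 3) (Fin 3) k) (h : M.det ≠ 0) : (toGL M h).1 = M := rfl

/-- Containment is enough: the transformed forms span a net, and two 3-dimensional spaces one inside
the other coincide. -/
theorem mem_orbit_net_iff [CharZero k] {V : Net k} {a : Entry k} :
    V ∈ orbit a.net ↔ ∃ g : GL (Fin 3) k, ∀ i, subst g (a.forms i) ∈ V.carrier := by
  rw [mem_orbit_iff_act]
  refine exists_congr fun g => ⟨?_, fun h => ?_⟩
  · rintro rfl i
    exact ⟨_, spanNet_mem _ i, rfl⟩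
  · refine (Net.eq_of_le ?_).symm
    simp only [Net.act, Submodule.map_le_iff_le_comap, Entry.net, spanNet]
    rw [Submodule.span_le]
    rintro _ ⟨i, rfl⟩
    exact h i

theorem mem_orbit_net_of_matrix [CharZero k] {V : Net k} {a : Entry k}
    (M : Matrix (Fin 3) (Fin 3) k) (hM : M.det ≠ 0)
    (h : ∀ i, aeval (fun i => lin (M i)) (a.forms i) ∈ V.carrier) : V ∈ orbit a.net :=
  mem_orbit_net_iff.2 ⟨toGL M hM, h⟩

/-- Three quadratic forms whose span contains three independent ones, as a net. -/
theorem exists_net_of_span {p q : Fin 3 → MvPolynomial (Fin 3) k} (hp : LinearIndependent k p)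
    (hq : ∀ i, (q i).IsHomogeneous 2) (h : ∀ i, p i ∈ Submodule.span k (Set.range q)) :
    ∃ V : Net k, V.carrier = Submodule.span k (Set.range q) := by
  refine ⟨⟨Submodule.span k (Set.range q), ?_, ?_⟩, rfl⟩
  · rw [Submodule.span_le]
    rintro _ ⟨i, rfl⟩
    exact hq i
  · refine le_antisymm ((finrank_range_le_card q).trans (by simp)) ?_
    have h1 := finrank_span_eq_card hp
    have h2 : Submodule.span k (Set.range p) ≤ Submodule.span k (Set.range q) := by
      rw [Submodule.span_le]; rintro _ ⟨i, rfl⟩; exact h i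
    have : FiniteDimensional k (Submodule.span k (Set.range q)) :=
      FiniteDimensional.span_of_finite k (Set.finite_range q)
    have := Submodule.finrank_mono h2
    simp at h1; omega

theorem linearIndependent_subst (g : GL (Fin 3) k) {p : Fin 3 → MvPolynomial (Fin 3) k}
    (hp : LinearIndependent k p) : LinearIndependent k fun i => subst g (p i) :=
  hp.map' (subst g).toLinearMap (LinearMap.ker_eq_bot.2 (subst_injective g))

theorem mem_orbit_net_of_span [CharZero k] {V : Net k} {q : Fin 3 → MvPolynomial (Fin 3) k}
    (hV : V.carrier = Submodule.span k (Set.range q)) {a : Entry k}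
    {g : GL (Fin 3) k} (h : ∀ i, subst g (a.forms i) ∈ Submodule.span k (Set.range q)) :
    V ∈ orbit a.net :=
  mem_orbit_net_iff.2 ⟨g, fun i => hV ▸ h i⟩

/-- The span contains the values of the forms of the entry `a` at some coordinate system. -/
def Realizes (q : Fin 3 → MvPolynomial (Fin 3) k) (a : Entry k) : Prop :=
  ∃ g : GL (Fin 3) k, ∀ i, subst g (a.forms i) ∈ Submodule.span k (Set.range q)

/-- A family degenerating one entry of the table to another. -/
def Degenerates [CharZero k] (a b : Entry k) : Prop :=
  ∃ F : k → Net k, IsAlgebraicFamily F ∧ (∀ t : k, t ≠ 0 → F t ∈ orbit a.net) ∧ F 0 ∈ orbit b.net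

/-- Independence of the three forms at each `t` needs no separate check: their span contains three
independent forms, namely the transformed forms of a table entry. -/
theorem degenerates_of_realizes [CharZero k] {a b : Entry k}
    (q : Fin 3 → MvPolynomial (Fin 3) (Polynomial k)) (hq : ∀ i, (q i).IsHomogeneous 2)
    (h : ∀ t : k, t ≠ 0 → Realizes (fun i => MvPolynomial.map (Polynomial.evalRingHom t) (q i)) a)
    (h0 : Realizes (fun i => MvPolynomial.map (Polynomial.evalRingHom (0 : k)) (q i)) b) :
    Degenerates a b := by
  have hex : ∀ t : k, ∃ V : Net k, V.carrier =
      Submodule.span k (Set.range fun i => MvPolynomial.map (Polynomial.evalRingHom t) (q i)) := by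
    intro t
    by_cases ht : t = 0
    · subst ht
      obtain ⟨g, hg⟩ := h0
      exact exists_net_of_span (linearIndependent_subst g b.forms_linearIndependent)
        (fun i => (hq i).map _) hg
    · obtain ⟨g, hg⟩ := h t ht
      exact exists_net_of_span (linearIndependent_subst g a.forms_linearIndependent)
        (fun i => (hq i).map _) hg
  choose F hF using hex
  refine ⟨F, ⟨q, hF⟩, fun t ht => ?_, ?_⟩
  · obtain ⟨g, hg⟩ := h t ht
    exact mem_orbit_net_of_span (hF t) hg
  · obtain ⟨g, hg⟩ := h0
    exact mem_orbit_net_of_span (hF 0) hg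

end Orbits

end NetsOfConics

end

open MvPolynomial

noncomputable section

namespace NetsOfConics

/-! ### The arrows are degenerations -/

section Families

variable {k : Type*} [Field k]

/-- The certificate format: a substitution `M`, a coefficient matrix `c`, and a nonzero scalar `e`
clearing denominators. What remains is one polynomial identity per form. Only the arrow out of `8b`
needs `e` other than `1`. -/
theorem realizes_of_matrix {q : Fin 3 → MvPolynomial (Fin 3) k} {a : Entry k}
    (M : Matrix (Fin 3) (Fin 3) k) (hM : M.det ≠ 0) {e : k} (he : e ≠ 0)
    (c : Matrix (Fin 3) (Fin 3) k)
    (h : ∀ i, C e * aeval (fun i => lin (M i)) (a.forms i) = ∑ j, C (c i j) * q j) :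
    Realizes q a := by
  refine ⟨toGL M hM, fun i => ?_⟩
  rw [← Submodule.smul_mem_iff _ he, smul_eq_C_mul]
  change C e * aeval (fun i => lin (M i)) (a.forms i) ∈ _
  rw [h]
  refine Submodule.sum_mem _ fun j _ => ?_
  rw [← smul_eq_C_mul]
  exact Submodule.smul_mem _ _ (Submodule.subset_span ⟨j, rfl⟩)

theorem isHomogeneous_vec {R : Type*} [CommRing R] {p q r : MvPolynomial (Fin 3) R}
    (hp : p.IsHomogeneous 2) (hq : q.IsHomogeneous 2) (hr : r.IsHomogeneous 2) (i : Fin 3) :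
    (![p, q, r] i).IsHomogeneous 2 := by
  fin_cases i
  exacts [hp, hq, hr]

theorem isHomogeneous_mul {R : Type*} [CommRing R] (i j : Fin 3) :
    (X i * X j : MvPolynomial (Fin 3) R).IsHomogeneous 2 :=
  (isHomogeneous_X R i).mul (isHomogeneous_X R j)

theorem isHomogeneous_sq {R : Type*} [CommRing R] (i : Fin 3) :
    (X i ^ 2 : MvPolynomial (Fin 3) R).IsHomogeneous 2 := by
  simpa [sq] using isHomogeneous_mul (R := R) i i

theorem isHomogeneous_C_mul' {R : Type*} [CommRing R] {p : MvPolynomial (Fin 3) R} (c : R)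
    (hp : p.IsHomogeneous 2) : (C c * p).IsHomogeneous 2 := by
  simpa using (isHomogeneous_C (Fin 3) c).mul hp

variable [CharZero k]

/-- A diagonal one-parameter subgroup: up to scalars it fixes the first two generators and puts
weight `t ^ 3` on `Y²` in the third. Several later families have the same shape. -/
theorem degenerates_8a_7a : Degenerates (k := k) .e8a .e7a := by
  refine degenerates_of_realizes
    ![X 0 * X 1, X 0 ^ 2 + X 1 * X 2,
      C (Polynomial.X ^ 3) * X 1 ^ 2 + X 0 * X 2]
    (isHomogeneous_vec (isHomogeneous_mul _ _) ((isHomogeneous_sq _).add (isHomogeneous_mul _ _))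
      ((isHomogeneous_C_mul' _ (isHomogeneous_sq _)).add (isHomogeneous_mul _ _)))
    (fun t ht => realizes_of_matrix !![t, 0, 0; 0, t ^ 2, 0; 0, 0, 1] ?_ one_ne_zero
      !![t ^ 3, 0, 0; 0, t ^ 2, 0; 0, 0, t] fun i => ?_)
    (realizes_of_matrix !![1, 0, 0; 0, 1, 0; 0, 0, 1] ?_ one_ne_zero
      !![0, 1, 0; 1, 0, 0; 0, 0, 1] fun i => ?_)
  · simp [Matrix.det_fin_three, ht]
  · fin_cases i <;> simp [Entry.forms, lin_eq, Fin.sum_univ_three, map_ofNat] <;> ring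
  · simp [Matrix.det_fin_three]
  · fin_cases i <;> simp [Entry.forms, lin_eq, Fin.sum_univ_three, map_ofNat]

/-- The two lines of the reducible conic `XY` become `Y + tZ` and `Y - tZ`; they merge at `t = 0`
into the double line that `7b` requires. -/
theorem degenerates_8a_7b : Degenerates (k := k) .e8a .e7b := by
  refine degenerates_of_realizes
    ![X 2 ^ 2 - X 0 * X 1, X 0 * X 2,
      X 1 ^ 2 - C (Polynomial.X ^ 2) * (X 0 * X 1)]
    (isHomogeneous_vec ((isHomogeneous_sq _).sub (isHomogeneous_mul _ _)) (isHomogeneous_mul _ _)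
      ((isHomogeneous_sq _).sub (isHomogeneous_C_mul' _ (isHomogeneous_mul _ _))))
    (fun t ht => realizes_of_matrix !![0, 1, t; 0, 1, -t; -4 * t ^ 2, 2, 0] ?_ one_ne_zero
      !![-t ^ 2, 0, 1; t ^ 2, 4 * t ^ 3, 3; t ^ 2, -4 * t ^ 3, 3] fun i => ?_)
    (realizes_of_matrix !![0, 0, 1; 1, 0, 0; 0, -1, 0] ?_ one_ne_zero
      !![1, 0, 0; 0, 1, 0; 0, 0, 1] fun i => ?_)
  · simp [Matrix.det_fin_three, ht]
  · fin_cases i <;> simp [Entry.forms, lin_eq, Fin.sum_univ_three, map_ofNat] <;> ring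
  · simp [Matrix.det_fin_three]
  · fin_cases i <;> simp [Entry.forms, lin_eq, Fin.sum_univ_three, map_ofNat] <;> ring

theorem degenerates_8c_7b : Degenerates (k := k) .e8c .e7b := by
  refine degenerates_of_realizes
    ![X 0 ^ 2, X 1 ^ 2 + X 0 * X 2,
      X 1 * X 2 + C Polynomial.X * X 2 ^ 2]
    (isHomogeneous_vec (isHomogeneous_sq _) ((isHomogeneous_sq _).add (isHomogeneous_mul _ _))
      ((isHomogeneous_mul _ _).add (isHomogeneous_C_mul' _ (isHomogeneous_sq _))))
    (fun t ht => realizes_of_matrix !![-1, 4 * t, 0; -1, -4 * t, -8 * t ^ 2; 2, 0, 0] ?_ one_ne_zero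
      !![4, 0, 0; 3, 16 * t ^ 2, 0; 3, 16 * t ^ 2, 64 * t ^ 3] fun i => ?_)
    (realizes_of_matrix !![0, 1, 0; 0, 0, 1; 1, 0, 0] ?_ one_ne_zero
      !![0, 1, 0; 0, 0, 1; 1, 0, 0] fun i => ?_)
  · simp [Matrix.det_fin_three, ht]
  · fin_cases i <;> simp [Entry.forms, lin_eq, Fin.sum_univ_three, map_ofNat] <;> ring
  · simp [Matrix.det_fin_three]
  · fin_cases i <;> simp [Entry.forms, lin_eq, Fin.sum_univ_three, map_ofNat] <;> ring

theorem degenerates_8c_7c : Degenerates (k := k) .e8c .e7c := by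
  refine degenerates_of_realizes
    ![X 0 ^ 2, X 1 ^ 2 + X 0 * X 2,
      X 2 ^ 2 + C (Polynomial.X ^ 3) * (X 0 * X 1)]
    (isHomogeneous_vec (isHomogeneous_sq _) ((isHomogeneous_sq _).add (isHomogeneous_mul _ _))
      ((isHomogeneous_sq _).add (isHomogeneous_C_mul' _ (isHomogeneous_mul _ _))))
    (fun t ht => realizes_of_matrix !![0, t, 0; 0, 0, 1; -t ^ 2, 0, 0] ?_ one_ne_zero
      !![t ^ 4, 0, 0; 0, t ^ 2, 0; 0, 0, 1] fun i => ?_)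
    (realizes_of_matrix !![1, 0, 0; 0, 0, 1; 0, 1, 0] ?_ one_ne_zero
      !![1, 0, 0; 0, 0, 1; 0, 1, 0] fun i => ?_)
  · simp [Matrix.det_fin_three, ht]
  · fin_cases i <;> simp [Entry.forms, lin_eq, Fin.sum_univ_three, map_ofNat] <;> ring
  · simp [Matrix.det_fin_three]
  · fin_cases i <;> simp [Entry.forms, lin_eq, Fin.sum_univ_three, map_ofNat]

theorem degenerates_7a_6a : Degenerates (k := k) .e7a .e6a := by
  refine degenerates_of_realizes
    ![X 0 * X 1, X 0 * X 2,
      C (Polynomial.X ^ 2) * X 0 ^ 2 + X 1 * X 2]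
    (isHomogeneous_vec (isHomogeneous_mul _ _) (isHomogeneous_mul _ _)
      ((isHomogeneous_C_mul' _ (isHomogeneous_sq _)).add (isHomogeneous_mul _ _)))
    (fun t ht => realizes_of_matrix !![t, 0, 0; 0, 1, 0; 0, 0, 1] ?_ one_ne_zero
      !![0, 0, 1; t, 0, 0; 0, t, 0] fun i => ?_)
    (realizes_of_matrix !![1, 0, 0; 0, 1, 0; 0, 0, 1] ?_ one_ne_zero
      !![1, 0, 0; 0, 1, 0; 0, 0, 1] fun i => ?_)
  · simp [Matrix.det_fin_three, ht]
  · fin_cases i <;> simp [Entry.forms, lin_eq, Fin.sum_univ_three, map_ofNat] <;> ring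
  · simp [Matrix.det_fin_three]
  · fin_cases i <;> simp [Entry.forms, lin_eq, Fin.sum_univ_three, map_ofNat]

theorem degenerates_7a_6b : Degenerates (k := k) .e7a .e6b := by
  refine degenerates_of_realizes
    ![X 0 * X 1, X 0 ^ 2 - C Polynomial.X * (X 0 * X 2),
      X 2 ^ 2 + X 1 * X 2]
    (isHomogeneous_vec (isHomogeneous_mul _ _) ((isHomogeneous_sq _).sub (isHomogeneous_C_mul' _ (isHomogeneous_mul _ _)))
      ((isHomogeneous_sq _).add (isHomogeneous_mul _ _)))
    (fun t ht => realizes_of_matrix !![1, 0, 0; -1, 0, t; -1, t, t] ?_ one_ne_zero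
      !![-t, 2, t ^ 2; 0, -1, 0; t, -1, 0] fun i => ?_)
    (realizes_of_matrix !![1, 0, 0; 0, 1, 0; 0, 0, 1] ?_ one_ne_zero
      !![0, 1, 0; 1, 0, 0; 0, 0, 1] fun i => ?_)
  · simp [Matrix.det_fin_three, ht]
  · fin_cases i <;> simp [Entry.forms, lin_eq, Fin.sum_univ_three, map_ofNat] <;> ring
  · simp [Matrix.det_fin_three]
  · fin_cases i <;> simp [Entry.forms, lin_eq, Fin.sum_univ_three, map_ofNat]

theorem degenerates_7a_6c : Degenerates (k := k) .e7a .e6c := by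
  refine degenerates_of_realizes
    ![X 0 * X 1, X 0 * X 2,
      X 0 ^ 2 + X 1 ^ 2 + C Polynomial.X * (X 1 * X 2)]
    (isHomogeneous_vec (isHomogeneous_mul _ _) (isHomogeneous_mul _ _)
      (((isHomogeneous_sq _).add (isHomogeneous_sq _)).add (isHomogeneous_C_mul' _ (isHomogeneous_mul _ _))))
    (fun t ht => realizes_of_matrix !![1, 0, 0; 0, 1, 0; 0, 1, t] ?_ one_ne_zero
      !![0, 0, 1; 1, 0, 0; 1, t, 0] fun i => ?_)
    (realizes_of_matrix !![0, 1, 0; 1, 0, 0; 1, 0, 1] ?_ one_ne_zero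
      !![1, 0, 0; 0, 1, 1; 0, 0, 1] fun i => ?_)
  · simp [Matrix.det_fin_three, ht]
  · fin_cases i <;> simp [Entry.forms, lin_eq, Fin.sum_univ_three, map_ofNat] <;> ring
  · simp [Matrix.det_fin_three]
  · fin_cases i <;> simp [Entry.forms, lin_eq, Fin.sum_univ_three, map_ofNat] <;> ring

theorem degenerates_7b_6b : Degenerates (k := k) .e7b .e6b := by
  refine degenerates_of_realizes
    ![X 0 ^ 2, C Polynomial.X * X 1 ^ 2 + X 0 * X 1 + X 0 * X 2,
      X 1 * X 2]
    (isHomogeneous_vec (isHomogeneous_sq _) (((isHomogeneous_C_mul' _ (isHomogeneous_sq _)).add (isHomogeneous_mul _ _)).add (isHomogeneous_mul _ _))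
      (isHomogeneous_mul _ _))
    (fun t ht => realizes_of_matrix !![1, 3 * t, 0; 2, 3 * t, 9 * t; 1, 0, 0] ?_ one_ne_zero
      !![3, 9 * t, 0; 2, 9 * t, 27 * t ^ 2; 1, 0, 0] fun i => ?_)
    (realizes_of_matrix !![1, 0, 0; 0, 1, 1; 0, 0, -1] ?_ one_ne_zero
      !![1, 0, 0; 0, 1, 0; 0, 0, -1] fun i => ?_)
  · simp [Matrix.det_fin_three, ht]
  · fin_cases i <;> simp [Entry.forms, lin_eq, Fin.sum_univ_three, map_ofNat] <;> ring
  · simp [Matrix.det_fin_three]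
  · fin_cases i <;> simp [Entry.forms, lin_eq, Fin.sum_univ_three, map_ofNat] <;> ring

theorem degenerates_7b_6c : Degenerates (k := k) .e7b .e6c := by
  refine degenerates_of_realizes
    ![X 0 ^ 2, X 1 ^ 2 + C Polynomial.X * (X 0 * X 2),
      X 0 * X 2 + X 1 * X 2]
    (isHomogeneous_vec (isHomogeneous_sq _) ((isHomogeneous_sq _).add (isHomogeneous_C_mul' _ (isHomogeneous_mul _ _)))
      ((isHomogeneous_mul _ _).add (isHomogeneous_mul _ _)))
    (fun t ht => realizes_of_matrix !![1, 3, 0; 2, -6, 9 * t; 1, 0, 0] ?_ one_ne_zero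
      !![3, 9, 0; 2, -18, 27 * t; 1, 0, 0] fun i => ?_)
    (realizes_of_matrix !![1, -1, 0; 1, 1, 0; 1, 1, 1] ?_ one_ne_zero
      !![1, -1, 0; 2, 2, 1; 2, 2, 0] fun i => ?_)
  · simp [Matrix.det_fin_three, ht]
  · fin_cases i <;> simp [Entry.forms, lin_eq, Fin.sum_univ_three, map_ofNat] <;> ring
  · simp [Matrix.det_fin_three]
  · fin_cases i <;> simp [Entry.forms, lin_eq, Fin.sum_univ_three, map_ofNat] <;> ring

/-- Two double lines `X²` and `(X + tY)²` come together. Their difference divided by `t` is `2XY +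
tY²`, whose limit supplies the generator `XY`. -/
theorem degenerates_7c_6b : Degenerates (k := k) .e7c .e6b := by
  refine degenerates_of_realizes
    ![X 0 ^ 2, C 2 * (X 0 * X 1) + C Polynomial.X * X 1 ^ 2,
      X 2 ^ 2 - X 1 ^ 2]
    (isHomogeneous_vec (isHomogeneous_sq _) ((isHomogeneous_C_mul' _ (isHomogeneous_mul _ _)).add (isHomogeneous_C_mul' _ (isHomogeneous_sq _)))
      ((isHomogeneous_sq _).sub (isHomogeneous_sq _)))
    (fun t ht => realizes_of_matrix !![2, 0, 0; 1, t, 0; 0, 0, t] ?_ one_ne_zero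
      !![4, 0, 0; 1, t, 0; 2, t, t ^ 2] fun i => ?_)
    (realizes_of_matrix !![1, 0, 0; 0, 2, 0; 0, -1, 1] ?_ one_ne_zero
      !![1, 0, 0; 0, 1, 0; 0, 0, 1] fun i => ?_)
  · simp [Matrix.det_fin_three, ht]
  · fin_cases i <;> simp [Entry.forms, lin_eq, Fin.sum_univ_three, map_ofNat] <;> ring
  · simp [Matrix.det_fin_three]
  · fin_cases i <;> simp [Entry.forms, lin_eq, Fin.sum_univ_three, map_ofNat] <;> ring

theorem degenerates_7c_6c : Degenerates (k := k) .e7c .e6c := by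
  refine degenerates_of_realizes
    ![X 0 ^ 2, X 1 ^ 2,
      C Polynomial.X * X 2 ^ 2 + X 0 * X 2 + X 1 * X 2]
    (isHomogeneous_vec (isHomogeneous_sq _) (isHomogeneous_sq _)
      (((isHomogeneous_C_mul' _ (isHomogeneous_sq _)).add (isHomogeneous_mul _ _)).add (isHomogeneous_mul _ _)))
    (fun t ht => realizes_of_matrix !![-2, 0, 0; 0, 1, 0; 1, 1, 2 * t] ?_ one_ne_zero
      !![4, 0, 0; 0, 1, 0; 1, 1, 4 * t] fun i => ?_)
    (realizes_of_matrix !![1, -1, 0; 1, 1, 0; 1, 1, 1] ?_ one_ne_zero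
      !![1, -1, 0; 2, 2, 1; 2, 2, 0] fun i => ?_)
  · simp [Matrix.det_fin_three, ht]
  · fin_cases i <;> simp [Entry.forms, lin_eq, Fin.sum_univ_three, map_ofNat] <;> ring
  · simp [Matrix.det_fin_three]
  · fin_cases i <;> simp [Entry.forms, lin_eq, Fin.sum_univ_three, map_ofNat] <;> ring

theorem degenerates_7c_6d : Degenerates (k := k) .e7c .e6d := by
  refine degenerates_of_realizes
    ![X 0 ^ 2, X 1 ^ 2,
      X 2 ^ 2 + C Polynomial.X * (X 0 * X 1)]
    (isHomogeneous_vec (isHomogeneous_sq _) (isHomogeneous_sq _)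
      ((isHomogeneous_sq _).add (isHomogeneous_C_mul' _ (isHomogeneous_mul _ _))))
    (fun t ht => realizes_of_matrix !![t, 0, 0; 0, 1, 0; 0, 0, 1] ?_ one_ne_zero
      !![t ^ 2, 0, 0; 0, 1, 0; 0, 0, 1] fun i => ?_)
    (realizes_of_matrix !![1, 0, 0; 0, 1, 0; 0, 0, 1] ?_ one_ne_zero
      !![1, 0, 0; 0, 1, 0; 0, 0, 1] fun i => ?_)
  · simp [Matrix.det_fin_three, ht]
  · fin_cases i <;> simp [Entry.forms, lin_eq, Fin.sum_univ_three, map_ofNat] <;> ring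
  · simp [Matrix.det_fin_three]
  · fin_cases i <;> simp [Entry.forms, lin_eq, Fin.sum_univ_three, map_ofNat]

theorem degenerates_6a_5a : Degenerates (k := k) .e6a .e5a := by
  refine degenerates_of_realizes
    ![X 0 ^ 2 + C Polynomial.X * (X 0 * X 2), X 0 * X 1,
      X 1 * X 2]
    (isHomogeneous_vec ((isHomogeneous_sq _).add (isHomogeneous_C_mul' _ (isHomogeneous_mul _ _))) (isHomogeneous_mul _ _)
      (isHomogeneous_mul _ _))
    (fun t ht => realizes_of_matrix !![1, 0, 0; 0, 1, 0; 1, 0, t] ?_ one_ne_zero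
      !![0, 1, 0; 1, 0, 0; 0, 1, t] fun i => ?_)
    (realizes_of_matrix !![1, 0, 0; 0, 1, 0; 0, 0, 1] ?_ one_ne_zero
      !![1, 0, 0; 0, 1, 0; 0, 0, 1] fun i => ?_)
  · simp [Matrix.det_fin_three, ht]
  · fin_cases i <;> simp [Entry.forms, lin_eq, Fin.sum_univ_three, map_ofNat] <;> ring
  · simp [Matrix.det_fin_three]
  · fin_cases i <;> simp [Entry.forms, lin_eq, Fin.sum_univ_three, map_ofNat]

theorem degenerates_6b_5a : Degenerates (k := k) .e6b .e5a := by
  refine degenerates_of_realizes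
    ![X 0 ^ 2, X 0 * X 1,
      C Polynomial.X * X 2 ^ 2 + X 1 * X 2]
    (isHomogeneous_vec (isHomogeneous_sq _) (isHomogeneous_mul _ _)
      ((isHomogeneous_C_mul' _ (isHomogeneous_sq _)).add (isHomogeneous_mul _ _)))
    (fun t ht => realizes_of_matrix !![1, 0, 0; 0, 1, 0; 0, 0, t] ?_ one_ne_zero
      !![1, 0, 0; 0, 1, 0; 0, 0, t] fun i => ?_)
    (realizes_of_matrix !![1, 0, 0; 0, 1, 0; 0, 0, 1] ?_ one_ne_zero
      !![1, 0, 0; 0, 1, 0; 0, 0, 1] fun i => ?_)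
  · simp [Matrix.det_fin_three, ht]
  · fin_cases i <;> simp [Entry.forms, lin_eq, Fin.sum_univ_three, map_ofNat] <;> ring
  · simp [Matrix.det_fin_three]
  · fin_cases i <;> simp [Entry.forms, lin_eq, Fin.sum_univ_three, map_ofNat]

theorem degenerates_6b_5b : Degenerates (k := k) .e6b .e5b := by
  refine degenerates_of_realizes
    ![X 0 ^ 2, X 0 * X 1,
      X 2 ^ 2 + C Polynomial.X * (X 1 * X 2)]
    (isHomogeneous_vec (isHomogeneous_sq _) (isHomogeneous_mul _ _)
      ((isHomogeneous_sq _).add (isHomogeneous_C_mul' _ (isHomogeneous_mul _ _))))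
    (fun t ht => realizes_of_matrix !![1, 0, 0; 0, t, 0; 0, 0, 1] ?_ one_ne_zero
      !![1, 0, 0; 0, t, 0; 0, 0, 1] fun i => ?_)
    (realizes_of_matrix !![1, 0, 0; 0, 1, 0; 0, 0, 1] ?_ one_ne_zero
      !![1, 0, 0; 0, 1, 0; 0, 0, 1] fun i => ?_)
  · simp [Matrix.det_fin_three, ht]
  · fin_cases i <;> simp [Entry.forms, lin_eq, Fin.sum_univ_three, map_ofNat] <;> ring
  · simp [Matrix.det_fin_three]
  · fin_cases i <;> simp [Entry.forms, lin_eq, Fin.sum_univ_three, map_ofNat]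

theorem degenerates_6c_5a : Degenerates (k := k) .e6c .e5a := by
  refine degenerates_of_realizes
    ![X 0 ^ 2, C Polynomial.X * X 1 ^ 2 - C 2 * (X 0 * X 1),
      X 1 * X 2]
    (isHomogeneous_vec (isHomogeneous_sq _) ((isHomogeneous_C_mul' _ (isHomogeneous_sq _)).sub (isHomogeneous_C_mul' _ (isHomogeneous_mul _ _)))
      (isHomogeneous_mul _ _))
    (fun t ht => realizes_of_matrix !![2, -t, 0; 0, t, 0; 0, t, 1] ?_ one_ne_zero
      !![0, -t, 0; 4, 2 * t, t; 4, 2 * t, 0] fun i => ?_)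
    (realizes_of_matrix !![1, 0, 0; 0, -2, 0; 0, 0, 1] ?_ one_ne_zero
      !![1, 0, 0; 0, 1, 0; 0, 0, -2] fun i => ?_)
  · simp [Matrix.det_fin_three, ht]
  · fin_cases i <;> simp [Entry.forms, lin_eq, Fin.sum_univ_three, map_ofNat] <;> ring
  · simp [Matrix.det_fin_three]
  · fin_cases i <;> simp [Entry.forms, lin_eq, Fin.sum_univ_three, map_ofNat] <;> ring

theorem degenerates_6c_5b : Degenerates (k := k) .e6c .e5b := by
  refine degenerates_of_realizes
    ![X 0 ^ 2, X 2 ^ 2,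
      X 0 * X 1 + C Polynomial.X * (X 1 * X 2)]
    (isHomogeneous_vec (isHomogeneous_sq _) (isHomogeneous_sq _)
      ((isHomogeneous_mul _ _).add (isHomogeneous_C_mul' _ (isHomogeneous_mul _ _))))
    (fun t ht => realizes_of_matrix !![1, 0, -t; 1, 0, t; 1, 1, t] ?_ one_ne_zero
      !![1, -t ^ 2, 0; 2, 2 * t ^ 2, 1; 2, 2 * t ^ 2, 0] fun i => ?_)
    (realizes_of_matrix !![1, 0, 0; 0, 1, 0; 0, 0, 1] ?_ one_ne_zero
      !![1, 0, 0; 0, 0, 1; 0, 1, 0] fun i => ?_)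
  · simp [Matrix.det_fin_three, ht]
  · fin_cases i <;> simp [Entry.forms, lin_eq, Fin.sum_univ_three, map_ofNat] <;> ring
  · simp [Matrix.det_fin_three]
  · fin_cases i <;> simp [Entry.forms, lin_eq, Fin.sum_univ_three, map_ofNat]

theorem degenerates_6d_5b : Degenerates (k := k) .e6d .e5b := by
  refine degenerates_of_realizes
    ![X 0 ^ 2, C 2 * (X 0 * X 1) + C Polynomial.X * X 1 ^ 2,
      X 2 ^ 2]
    (isHomogeneous_vec (isHomogeneous_sq _) ((isHomogeneous_C_mul' _ (isHomogeneous_mul _ _)).add (isHomogeneous_C_mul' _ (isHomogeneous_sq _)))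
      (isHomogeneous_sq _))
    (fun t ht => realizes_of_matrix !![1, 0, 0; 1, t, 0; 0, 0, 1] ?_ one_ne_zero
      !![1, 0, 0; 1, t, 0; 0, 0, 1] fun i => ?_)
    (realizes_of_matrix !![1, 0, 0; 0, 2, 0; 0, 0, 1] ?_ one_ne_zero
      !![1, 0, 0; 0, 1, 0; 0, 0, 1] fun i => ?_)
  · simp [Matrix.det_fin_three, ht]
  · fin_cases i <;> simp [Entry.forms, lin_eq, Fin.sum_univ_three, map_ofNat] <;> ring
  · simp [Matrix.det_fin_three]
  · fin_cases i <;> simp [Entry.forms, lin_eq, Fin.sum_univ_three, map_ofNat] <;> ring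

theorem degenerates_5a_4 : Degenerates (k := k) .e5a .e4 := by
  refine degenerates_of_realizes
    ![X 0 ^ 2, X 0 * X 1,
      X 1 ^ 2 + X 0 * X 2 + C Polynomial.X * (X 1 * X 2)]
    (isHomogeneous_vec (isHomogeneous_sq _) (isHomogeneous_mul _ _)
      (((isHomogeneous_sq _).add (isHomogeneous_mul _ _)).add (isHomogeneous_C_mul' _ (isHomogeneous_mul _ _))))
    (fun t ht => realizes_of_matrix !![1, 0, 0; 1, t, 0; 0, 1, t] ?_ one_ne_zero
      !![1, 0, 0; 1, t, 0; 0, 1, t] fun i => ?_)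
    (realizes_of_matrix !![0, 1, 0; 1, 0, 0; 0, 0, 1] ?_ one_ne_zero
      !![0, 1, 0; 0, 0, 1; 1, 0, 0] fun i => ?_)
  · simp [Matrix.det_fin_three, ht]
  · fin_cases i <;> simp [Entry.forms, lin_eq, Fin.sum_univ_three, map_ofNat] <;> ring
  · simp [Matrix.det_fin_three]
  · fin_cases i <;> simp [Entry.forms, lin_eq, Fin.sum_univ_three, map_ofNat] <;> ring

theorem degenerates_5b_4 : Degenerates (k := k) .e5b .e4 := by
  refine degenerates_of_realizes
    ![X 0 ^ 2, X 0 * X 1 + C Polynomial.X * (X 0 * X 2),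
      X 1 ^ 2 + X 0 * X 2]
    (isHomogeneous_vec (isHomogeneous_sq _) ((isHomogeneous_mul _ _).add (isHomogeneous_C_mul' _ (isHomogeneous_mul _ _)))
      ((isHomogeneous_sq _).add (isHomogeneous_mul _ _)))
    (fun t ht => realizes_of_matrix !![1, 0, 0; 0, 1, t; -1, 2 * t, 0] ?_ one_ne_zero
      !![1, 0, 0; 0, 1, 0; 1, -4 * t, 4 * t ^ 2] fun i => ?_)
    (realizes_of_matrix !![0, 1, 0; 1, 0, 0; 0, 0, 1] ?_ one_ne_zero
      !![0, 1, 0; 0, 0, 1; 1, 0, 0] fun i => ?_)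
  · simp [Matrix.det_fin_three, ht]
  · fin_cases i <;> simp [Entry.forms, lin_eq, Fin.sum_univ_three, map_ofNat] <;> ring
  · simp [Matrix.det_fin_three]
  · fin_cases i <;> simp [Entry.forms, lin_eq, Fin.sum_univ_three, map_ofNat] <;> ring

theorem degenerates_4_2a : Degenerates (k := k) .e4 .e2a := by
  refine degenerates_of_realizes
    ![X 0 * X 1, C (Polynomial.X ^ 2) * X 0 ^ 2 + X 1 * X 2,
      X 1 ^ 2]
    (isHomogeneous_vec (isHomogeneous_mul _ _) ((isHomogeneous_C_mul' _ (isHomogeneous_sq _)).add (isHomogeneous_mul _ _))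
      (isHomogeneous_sq _))
    (fun t ht => realizes_of_matrix !![t, 0, 0; 0, 1, 0; 0, 0, 1] ?_ one_ne_zero
      !![t, 0, 0; 0, 1, 0; 0, 0, 1] fun i => ?_)
    (realizes_of_matrix !![0, 1, 0; 1, 0, 0; 0, 0, 1] ?_ one_ne_zero
      !![0, 0, 1; 1, 0, 0; 0, 1, 0] fun i => ?_)
  · simp [Matrix.det_fin_three, ht]
  · fin_cases i <;> simp [Entry.forms, lin_eq, Fin.sum_univ_three, map_ofNat] <;> ring
  · simp [Matrix.det_fin_three]
  · fin_cases i <;> simp [Entry.forms, lin_eq, Fin.sum_univ_three, map_ofNat] <;> ring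

theorem degenerates_4_2b : Degenerates (k := k) .e4 .e2b := by
  refine degenerates_of_realizes
    ![X 0 * X 1, X 0 ^ 2 + C Polynomial.X * (X 1 * X 2),
      X 1 ^ 2]
    (isHomogeneous_vec (isHomogeneous_mul _ _) ((isHomogeneous_sq _).add (isHomogeneous_C_mul' _ (isHomogeneous_mul _ _)))
      (isHomogeneous_sq _))
    (fun t ht => realizes_of_matrix !![1, 0, 0; 0, 1, 0; 0, 0, t] ?_ one_ne_zero
      !![1, 0, 0; 0, 1, 0; 0, 0, 1] fun i => ?_)
    (realizes_of_matrix !![1, 0, 0; 0, 1, 0; 0, 0, 1] ?_ one_ne_zero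
      !![0, 1, 0; 1, 0, 0; 0, 0, 1] fun i => ?_)
  · simp [Matrix.det_fin_three, ht]
  · fin_cases i <;> simp [Entry.forms, lin_eq, Fin.sum_univ_three, map_ofNat] <;> ring
  · simp [Matrix.det_fin_three]
  · fin_cases i <;> simp [Entry.forms, lin_eq, Fin.sum_univ_three, map_ofNat]

/-- The substitution is a one-parameter subgroup of weights 0, 2, 1 in coordinates adapted to `lam`.
The limit has coefficients `2 * (1 + lam ^ 3)` and `lam * (8 - lam ^ 3)`, so permissibility is
exactly what keeps it in `7b`. -/
theorem degenerates_8b_7b (lam : k) (h : Permissible lam) :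
    Degenerates (.e8b lam h) .e7b := by
  obtain ⟨h0, h1, h8⟩ := h
  have hu : 1 + lam ^ 3 ≠ 0 := fun h => h1 (by linear_combination h)
  have hv : 8 - lam ^ 3 ≠ 0 := fun h => h8 (by linear_combination -h)
  refine degenerates_of_realizes
    ![X 1 * X 2,
      C (Polynomial.C (2 * (1 + lam ^ 3))) * X 2 ^ 2
        + C (Polynomial.C (lam * (8 - lam ^ 3))) * (X 0 * X 1)
        + C (Polynomial.C (2 - lam ^ 3) * Polynomial.X ^ 2) * X 1 ^ 2,
      C (Polynomial.C (2 * (1 + lam ^ 3))) * X 0 ^ 2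
        + C (Polynomial.C (3 * lam ^ 2) * Polynomial.X ^ 2) * (X 0 * X 1)
        + C (Polynomial.C lam * Polynomial.X ^ 4) * X 1 ^ 2]
    (isHomogeneous_vec (isHomogeneous_mul _ _)
      (((isHomogeneous_C_mul' _ (isHomogeneous_sq _)).add
        (isHomogeneous_C_mul' _ (isHomogeneous_mul _ _))).add
        (isHomogeneous_C_mul' _ (isHomogeneous_sq _)))
      (((isHomogeneous_C_mul' _ (isHomogeneous_sq _)).add
        (isHomogeneous_C_mul' _ (isHomogeneous_mul _ _))).add
        (isHomogeneous_C_mul' _ (isHomogeneous_sq _))))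
    (fun t ht => realizes_of_matrix !![2, 0, 0; lam, t ^ 2, t; lam, t ^ 2, -t] ?_
      (mul_ne_zero two_ne_zero hu)
      !![0, -lam * t ^ 2, 4 + lam ^ 3; 4 * t ^ 3 * (1 + lam ^ 3), t ^ 2, 3 * lam ^ 2;
        -4 * t ^ 3 * (1 + lam ^ 3), t ^ 2, 3 * lam ^ 2] fun i => ?_)
    (realizes_of_matrix
      !![0, 0, 2 * (1 + lam ^ 3); 0, 1, 0; 2 * (1 + lam ^ 3) * (lam * (8 - lam ^ 3)), 0, 0] ?_
      one_ne_zero !![0, 2 * (1 + lam ^ 3), 0; 2 * (1 + lam ^ 3), 0, 0;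
        0, 0, 2 * (1 + lam ^ 3) * (lam * (8 - lam ^ 3)) ^ 2] fun i => ?_)
  · simp [Matrix.det_fin_three] <;> ring_nf <;> simp [ht]
  · fin_cases i <;> simp [Entry.forms, lin_eq, Fin.sum_univ_three, map_ofNat] <;> ring
  · simp [Matrix.det_fin_three, hu, hv, h0]
  · fin_cases i <;> simp [Entry.forms, lin_eq, Fin.sum_univ_three, map_ofNat] <;> ring

theorem Arrow.degenerates {a b : Entry k} (h : Arrow a b) : Degenerates a b := by
  cases h
  exacts [degenerates_8a_7a, degenerates_8a_7b, degenerates_8b_7b _ _,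
    degenerates_8c_7b, degenerates_8c_7c, degenerates_7a_6a, degenerates_7a_6b,
    degenerates_7a_6c, degenerates_7b_6b, degenerates_7b_6c, degenerates_7c_6b,
    degenerates_7c_6c, degenerates_7c_6d, degenerates_6a_5a, degenerates_6b_5a, degenerates_6b_5b,
    degenerates_6c_5a, degenerates_6c_5b, degenerates_6d_5b, degenerates_5a_4,
    degenerates_5b_4, degenerates_4_2a, degenerates_4_2b]

end Families

end NetsOfConics

end

open MvPolynomial

noncomputable section

namespace NetsOfConics

/-! ### Polynomial functions -/

section PolyFun

variable {k : Type*} [Field k] {W W' : Type*} [AddCommGroup W] [Module k W] [AddCommGroup W']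
  [Module k W']

theorem polyFun_const (c : k) : (fun _ : W => c) ∈ polyFun k W :=
  (polyFun k W).algebraMap_mem c

theorem polyFun_add {f g : W → k} (hf : f ∈ polyFun k W) (hg : g ∈ polyFun k W) :
    (fun w => f w + g w) ∈ polyFun k W := (polyFun k W).add_mem hf hg

theorem polyFun_sub {f g : W → k} (hf : f ∈ polyFun k W) (hg : g ∈ polyFun k W) :
    (fun w => f w - g w) ∈ polyFun k W := (polyFun k W).sub_mem hf hg

theorem polyFun_mul {f g : W → k} (hf : f ∈ polyFun k W) (hg : g ∈ polyFun k W) :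
    (fun w => f w * g w) ∈ polyFun k W := (polyFun k W).mul_mem hf hg

theorem polyFun_pow {f : W → k} (hf : f ∈ polyFun k W) (n : ℕ) :
    (fun w => f w ^ n) ∈ polyFun k W := (polyFun k W).pow_mem hf n

theorem polyFun_sum {ι : Type*} {s : Finset ι} {f : ι → W → k} (hf : ∀ i ∈ s, f i ∈ polyFun k W) :
    (fun w => ∑ i ∈ s, f i w) ∈ polyFun k W := by
  simpa only [Finset.sum_fn] using (polyFun k W).sum_mem hf

theorem polyFun_prod {ι : Type*} {s : Finset ι} {f : ι → W → k} (hf : ∀ i ∈ s, f i ∈ polyFun k W) :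
    (fun w => ∏ i ∈ s, f i w) ∈ polyFun k W := by
  simpa only [Finset.prod_fn] using (polyFun k W).prod_mem hf

theorem polyFun_dual (φ : Module.Dual k W) : (fun w => φ w) ∈ polyFun k W :=
  Algebra.subset_adjoin ⟨φ, rfl⟩

theorem polyFun_of_dual {f : W → k} (φ : Module.Dual k W) (h : ∀ w, f w = φ w) :
    f ∈ polyFun k W :=
  (funext h : f = fun w => φ w) ▸ polyFun_dual φ

theorem polyFun_id : (fun t : k => t) ∈ polyFun k k := polyFun_of_dual LinearMap.id fun _ => rfl

theorem polyFun_apply {m n : Type*} (i : m) (j : n) :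
    (fun M : Matrix m n k => M i j) ∈ polyFun k (Matrix m n k) :=
  polyFun_of_dual (Matrix.entryLinearMap k k i j) fun _ => rfl

theorem polyFun_det {n : Type*} [Fintype n] [DecidableEq n] {M : W → Matrix n n k}
    (hM : ∀ i j, (fun w => M w i j) ∈ polyFun k W) : (fun w => (M w).det) ∈ polyFun k W := by
  simp only [Matrix.det_apply']
  exact polyFun_sum fun σ _ => polyFun_mul (polyFun_const _) (polyFun_prod fun i _ => hM _ _)

/-- A map is polynomial if it pulls back linear forms to polynomial functions. -/
def IsPolyMap (k : Type*) [Field k] {W W' : Type*} [AddCommGroup W] [Module k W] [AddCommGroup W']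
    [Module k W'] (c : W → W') : Prop :=
  ∀ φ : Module.Dual k W', (fun w => φ (c w)) ∈ polyFun k W

theorem IsPolyMap.comp {c : W → W'} (hc : IsPolyMap k c) {f : W' → k} (hf : f ∈ polyFun k W') :
    (fun w => f (c w)) ∈ polyFun k W := by
  induction hf using Algebra.adjoin_induction with
  | mem x hx => obtain ⟨φ, rfl⟩ := hx; exact hc φ
  | algebraMap r => exact polyFun_const r
  | add x y _ _ hx hy => exact polyFun_add hx hy
  | mul x y _ _ hx hy => exact polyFun_mul hx hy

theorem _root_.LinearMap.isPolyMap (L : W →ₗ[k] W') : IsPolyMap k L :=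
  fun φ => polyFun_dual (φ ∘ₗ L)

theorem mem_polyFun_self_iff {f : k → k} :
    f ∈ polyFun k k ↔ ∃ p : Polynomial k, ∀ t, f t = p.eval t := by
  constructor
  · intro hf
    induction hf using Algebra.adjoin_induction with
    | mem x hx =>
      obtain ⟨φ, rfl⟩ := hx
      refine ⟨Polynomial.X * Polynomial.C (φ 1), fun t => ?_⟩
      rw [Polynomial.eval_mul, Polynomial.eval_X, Polynomial.eval_C, ← smul_eq_mul, ← map_smul,
        smul_eq_mul, mul_one]
    | algebraMap r => exact ⟨Polynomial.C r, fun t => by simp⟩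
    | add x y _ _ hx hy =>
      obtain ⟨p, hp⟩ := hx
      obtain ⟨q, hq⟩ := hy
      exact ⟨p + q, fun t => by simp [hp, hq]⟩
    | mul x y _ _ hx hy =>
      obtain ⟨p, hp⟩ := hx
      obtain ⟨q, hq⟩ := hy
      exact ⟨p * q, fun t => by simp [hp, hq]⟩
  · rintro ⟨p, hp⟩
    have : f = fun t => p.eval t := funext hp
    subst this
    simp only [Polynomial.eval_eq_sum, Polynomial.sum]
    exact polyFun_sum fun i _ => polyFun_mul (polyFun_const _)
      (polyFun_pow polyFun_id i)

/-- Irreducibility of affine space: on the line joining `x` and `y` both functions become nonzero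
polynomials in one variable, and their product has a non-root because `k` is infinite. -/
theorem exists_polyFun_mul_ne_zero [Infinite k] {f g : W → k} (hf : f ∈ polyFun k W)
    (hg : g ∈ polyFun k W) {x y : W} (hx : f x ≠ 0) (hy : g y ≠ 0) : ∃ z, f z ≠ 0 ∧ g z ≠ 0 := by
  have hl : IsPolyMap k fun t : k => x + t • (y - x) := fun φ => by
    simp only [map_add, map_smul]
    exact polyFun_add (polyFun_const _) (polyFun_mul polyFun_id (polyFun_const _))
  obtain ⟨p, hp⟩ := mem_polyFun_self_iff.1 (hl.comp hf)
  obtain ⟨q, hq⟩ := mem_polyFun_self_iff.1 (hl.comp hg)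
  have hp0 : p ≠ 0 := by
    rintro rfl
    exact hx (by simpa using hp 0)
  have hq0 : q ≠ 0 := by
    rintro rfl
    exact hy (by simpa using hq 1)
  obtain ⟨t, ht⟩ := Polynomial.exists_eval_ne_zero_of_natDegree_lt_card (p * q)
    (mul_ne_zero hp0 hq0) (by simpa using Cardinal.natCast_lt_aleph0 |>.trans_le (Cardinal.aleph0_le_mk k))
  rw [Polynomial.eval_mul] at ht
  exact ⟨_, by rw [hp]; exact left_ne_zero_of_mul ht, by rw [hq]; exact right_ne_zero_of_mul ht⟩

/-- Nonvanishing loci form a basis and not merely a subbasis, because the intersection of two of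
them is the nonvanishing locus of a product. -/
theorem isOpen_zariski_iff {U : Set W} : @IsOpen W (zariski k W) U ↔
    ∀ x ∈ U, ∃ f ∈ polyFun k W, f x ≠ 0 ∧ ∀ y, f y ≠ 0 → y ∈ U := by
  constructor
  · intro h
    induction h with
    | basic s hs =>
      obtain ⟨f, hf, rfl⟩ := hs
      exact fun x hx => ⟨f, hf, hx, fun _ h => h⟩
    | univ => exact fun x _ => ⟨_, polyFun_const 1, one_ne_zero, fun _ _ => trivial⟩
    | inter s t _ _ hs ht =>
      rintro x ⟨h1, h2⟩
      obtain ⟨f, hf, hfx, hf'⟩ := hs x h1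
      obtain ⟨g, hg, hgx, hg'⟩ := ht x h2
      exact ⟨_, polyFun_mul hf hg, mul_ne_zero hfx hgx, fun y hy =>
        ⟨hf' y (left_ne_zero_of_mul hy), hg' y (right_ne_zero_of_mul hy)⟩⟩
    | sUnion S _ hS =>
      rintro x ⟨s, hs, hx⟩
      obtain ⟨f, hf, hfx, hf'⟩ := hS s hs x hx
      exact ⟨f, hf, hfx, fun y hy => ⟨s, hs, hf' y hy⟩⟩
  · intro h
    choose! f hf hfx hf' using h
    have : U = ⋃₀ {s | ∃ x ∈ U, s = {y | f x y ≠ 0}} := by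
      ext y
      constructor
      · exact fun hy => ⟨_, ⟨y, hy, rfl⟩, hfx y hy⟩
      · rintro ⟨_, ⟨x, hx, rfl⟩, hy⟩
        exact hf' x hx y hy
    rw [this]
    refine TopologicalSpace.GenerateOpen.sUnion _ ?_
    rintro _ ⟨x, hx, rfl⟩
    exact .basic _ ⟨f x, hf x hx, rfl⟩

end PolyFun

/-! ### The topology of the Grassmannian -/

section Topology

variable {k : Type*} [Field k]

/-- Triples of quadratic forms. -/
abbrev Triple (k : Type*) [Field k] : Type _ := Fin 3 → homogeneousSubmodule (Fin 3) k 2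

theorem homogeneous_eq_sum (p : homogeneousSubmodule (Fin 3) k 2) :
    p = ∑ m : (Finset.univ : Finset (Fin 3)).finsuppAntidiag 2, coeff m.1 p.1 •
      (⟨monomial m.1 1, isHomogeneous_monomial _ (by
        have := (Finset.mem_finsuppAntidiag.1 m.2).1
        rw [Finsupp.degree_eq_sum]; exact this)⟩ : homogeneousSubmodule (Fin 3) k 2) := by
  apply Subtype.ext
  ext n
  simp only [Submodule.coe_sum, Submodule.coe_smul, coeff_sum, coeff_smul, coeff_monomial,
    smul_eq_mul, mul_ite, mul_one, mul_zero]
  by_cases hn : n ∈ (Finset.univ : Finset (Fin 3)).finsuppAntidiag 2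
  · rw [Finset.sum_eq_single ⟨n, hn⟩]
    · simp
    · intro b _ hb
      rw [if_neg]
      rintro rfl
      exact hb rfl
    · simp
  · rw [Finset.sum_eq_zero]
    · refine p.2.coeff_eq_zero ?_
      intro h
      refine hn (Finset.mem_finsuppAntidiag.2 ⟨?_, by simp⟩)
      rw [← h, Finsupp.degree_eq_sum]
    · intro b _
      rw [if_neg]
      rintro rfl
      exact hn b.2

/-- Monomial coefficients are linear coordinates on triples, so every linear form on triples is a
combination of them. -/
theorem isPolyMap_of_coeff {W : Type*} [AddCommGroup W] [Module k W] {c : W → Triple k}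
    (h : ∀ i m, (fun w => coeff m (c w i).1) ∈ polyFun k W) : IsPolyMap k c := by
  intro φ
  have key : ∀ x : Triple k, φ x = ∑ i, ∑ m : (Finset.univ : Finset (Fin 3)).finsuppAntidiag 2,
      coeff m.1 (x i).1 * φ (Pi.single i ⟨monomial m.1 1, isHomogeneous_monomial _ (by
        have := (Finset.mem_finsuppAntidiag.1 m.2).1
        rw [Finsupp.degree_eq_sum]; exact this)⟩) := by
    intro x
    conv_lhs => rw [← Finset.univ_sum_single x, map_sum]
    refine Finset.sum_congr rfl fun i _ => ?_
    conv_lhs => rw [homogeneous_eq_sum (x i)]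
    rw [← LinearMap.single_apply (R := k), map_sum, map_sum]
    refine Finset.sum_congr rfl fun m _ => ?_
    rw [map_smul, map_smul, smul_eq_mul]
    rfl
  rw [funext fun w => key (c w)]
  exact polyFun_sum fun i _ => polyFun_sum fun m _ => polyFun_mul (h i m.1) (polyFun_const _)

/-- The values of a basis of a net, as a frame. -/
theorem exists_spanNet (V : Net k) : ∃ q : Frame k, spanNet q = V := by
  have := V.finiteDimensional
  let b := Module.finBasisOfFinrankEq k V.carrier V.finrank_eq
  refine ⟨⟨fun i => ⟨b i, V.le_homogeneous (b i).2⟩, ?_⟩, ?_⟩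
  · refine LinearIndependent.of_comp (homogeneousSubmodule (Fin 3) k 2).subtype ?_
    exact b.linearIndependent.map' V.carrier.subtype (Submodule.ker_subtype _)
  · exact (Net.eq_spanNet fun i => (b i).2).symm

/-- This unwinds the quotient of the induced topology: openness is tested on principal open sets of
triples, and triples that are not frames play no role. -/
theorem net_isOpen_iff {U : Set (Net k)} : IsOpen U ↔ ∀ q : Frame k, spanNet q ∈ U →
    ∃ f ∈ polyFun k (Triple k), f q.1 ≠ 0 ∧ ∀ q' : Frame k, f q'.1 ≠ 0 → spanNet q' ∈ U := by
  let := zariski k (Triple k)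
  rw [show IsOpen U ↔ ∃ t, IsOpen t ∧ Subtype.val ⁻¹' t = (spanNet (k := k)) ⁻¹' U from Iff.rfl]
  constructor
  · rintro ⟨t, ht, h⟩ q hq
    obtain ⟨f, hf, hfq, h'⟩ := isOpen_zariski_iff.1 ht q.1 (by
      change q ∈ Subtype.val ⁻¹' t; rw [h]; exact hq)
    refine ⟨f, hf, hfq, fun q' hq' => ?_⟩
    have : q' ∈ Subtype.val ⁻¹' t := h' _ hq'
    rw [h] at this; exact this
  · intro h
    refine ⟨{x | ∃ f ∈ polyFun k (Triple k), f x ≠ 0 ∧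
      ∀ q' : Frame k, f q'.1 ≠ 0 → spanNet q' ∈ U}, ?_, ?_⟩
    · rw [isOpen_zariski_iff]
      rintro x ⟨f, hf, hfx, hU⟩
      exact ⟨f, hf, hfx, fun y hy => ⟨f, hf, hy, hU⟩⟩
    · ext q
      constructor
      · rintro ⟨f, hf, hfx, hU⟩
        exact hU q hfx
      · exact h q

/-- The linear action of matrices on triples of forms by change of basis. -/
def mixLinear (h : Matrix (Fin 3) (Fin 3) k) : Triple k →ₗ[k] Triple k :=
  LinearMap.pi fun i => ∑ j, h i j • LinearMap.proj j

theorem mixLinear_apply (h : Matrix (Fin 3) (Fin 3) k) (q : Triple k) (i : Fin 3) :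
    mixLinear h q i = ∑ j, h i j • q j := by simp [mixLinear]

theorem linearIndependent_mix {h : Matrix (Fin 3) (Fin 3) k} (hh : h.det ≠ 0) {q : Triple k}
    (hq : LinearIndependent k q) : LinearIndependent k (mixLinear h q) := by
  rw [Fintype.linearIndependent_iff] at hq ⊢
  intro c hc
  have h1 : ∑ j, (Matrix.vecMul c h) j • q j = 0 := by
    rw [← hc]
    simp only [mixLinear_apply, Matrix.vecMul, dotProduct, Finset.sum_smul, Finset.smul_sum,
      smul_smul]
    exact Finset.sum_comm
  have h2 : Matrix.vecMul c h = 0 := funext (hq _ h1)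
  exact fun i => congrFun (Matrix.eq_zero_of_vecMul_eq_zero hh h2) i

theorem spanNet_mix {h : Matrix (Fin 3) (Fin 3) k} (hh : h.det ≠ 0) (q : Frame k) :
    spanNet ⟨mixLinear h q.1, linearIndependent_mix hh q.2⟩ = spanNet q := by
  refine (Net.eq_spanNet fun i => ?_).symm
  simp only [mixLinear_apply, Submodule.coe_sum, Submodule.coe_smul]
  exact Submodule.sum_mem _ fun j _ => Submodule.smul_mem _ _ (spanNet_mem q j)

/-- The transition matrix is invertible because a vector in its left kernel would be a linear
relation among the members of `q'`. -/
theorem exists_mix {q q' : Frame k} (h : spanNet q' = spanNet q) :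
    ∃ m : Matrix (Fin 3) (Fin 3) k, m.det ≠ 0 ∧ q'.1 = mixLinear m q.1 := by
  have key : ∀ q q' : Frame k, spanNet q' = spanNet q →
      ∃ m : Matrix (Fin 3) (Fin 3) k, q'.1 = mixLinear m q.1 := by
    intro q q' h
    have : ∀ i, ∃ c : Fin 3 → k, ∑ j, c j • (q.1 j).1 = (q'.1 i).1 := fun i =>
      (Submodule.mem_span_range_iff_exists_fun k).1 (h ▸ spanNet_mem q' i : _ ∈ (spanNet q).carrier)
    choose c hc using this
    refine ⟨Matrix.of c, funext fun i => Subtype.ext ?_⟩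
    rw [mixLinear_apply, ← hc]
    simp
  obtain ⟨m, hm⟩ := key q q' h
  obtain ⟨n, hn⟩ := key q' q h.symm
  refine ⟨m, fun h0 => ?_, hm⟩
  obtain ⟨v, hv, hv'⟩ := Matrix.exists_vecMul_eq_zero_iff.2 h0
  have := Fintype.linearIndependent_iff.1 q'.2 v (by
    rw [hm]
    simp only [mixLinear_apply, Finset.smul_sum, smul_smul]
    rw [Finset.sum_comm]
    simp only [← Finset.sum_smul]
    have : ∀ j, ∑ i, v i * m i j = 0 := fun j => congrFun hv' j
    simp [this])
  exact hv (funext this)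

/-- The nets spanned by a frame on which a polynomial function does not vanish. -/
theorem isOpen_exists_frame {f : Triple k → k} (hf : f ∈ polyFun k (Triple k)) :
    IsOpen {V : Net k | ∃ q : Frame k, spanNet q = V ∧ f q.1 ≠ 0} := by
  rw [net_isOpen_iff]
  rintro q₀ ⟨q, hq, hfq⟩
  -- The span map is open because base changes act by linear maps: around the other frame `q₀` of
  -- the same net, `f` composed with the transition matrix is the required function.
  obtain ⟨m, hm, h⟩ := exists_mix hq
  refine ⟨_, (mixLinear m).isPolyMap.comp hf, h ▸ hfq, fun q' hq' => ?_⟩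
  exact ⟨_, spanNet_mix hm q', hq'⟩

/-- The source of all non-specializations. The function need not be invariant under base change,
since its vanishing is demanded on all frames of nets in `S`. -/
theorem notMem_closure_of_polyFun {S : Set (Net k)} {f : Triple k → k}
    (hf : f ∈ polyFun k (Triple k)) (hS : ∀ q : Frame k, spanNet q ∈ S → f q.1 = 0) (q : Frame k)
    (hq : f q.1 ≠ 0) : spanNet q ∉ closure S := by
  intro h
  obtain ⟨_, ⟨q', rfl, hq'⟩, hV⟩ := mem_closure_iff.1 h _ (isOpen_exists_frame hf) ⟨q, rfl, hq⟩
  exact hq' (hS q' hV)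

/-- A neighbourhood of the net at `t₀` pulls back to a nonempty principal open set of the parameter
line, which must meet the locus `f ≠ 0`. -/
theorem mem_closure_of_curve [Infinite k] {S : Set (Net k)} {c : k → Triple k}
    (hc : IsPolyMap k c) {f : k → k} (hf : f ∈ polyFun k k) {t₁ : k} (ht₁ : f t₁ ≠ 0)
    (hS : ∀ t, f t ≠ 0 → ∀ h : LinearIndependent k (c t), spanNet ⟨c t, h⟩ ∈ S)
    (hi : ∀ t, f t ≠ 0 → LinearIndependent k (c t)) {t₀ : k} (h0 : LinearIndependent k (c t₀)) :
    spanNet ⟨c t₀, h0⟩ ∈ closure S := by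
  rw [mem_closure_iff]
  intro U hU hU0
  obtain ⟨g, hg, hg0, hg'⟩ := net_isOpen_iff.1 hU _ hU0
  obtain ⟨t, h1, h2⟩ := exists_polyFun_mul_ne_zero hf (hc.comp hg) ht₁ hg0
  exact ⟨_, hg' ⟨c t, hi t h1⟩ h2, hS t h1 _⟩

/-- Irreducibility descends from a principal open subset of the affine space `W` along a polynomial
parametrization. -/
theorem isIrreducible_of_isPolyMap [Infinite k] {W : Type*} [AddCommGroup W] [Module k W]
    {c : W → Triple k} (hc : IsPolyMap k c) {f : W → k} (hf : f ∈ polyFun k W) {w₁ : W}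
    (hw₁ : f w₁ ≠ 0) (hi : ∀ w, f w ≠ 0 → LinearIndependent k (c w)) :
    IsIrreducible {V : Net k | ∃ w, ∃ h : f w ≠ 0, V = spanNet ⟨c w, hi w h⟩} := by
  refine ⟨⟨_, w₁, hw₁, rfl⟩, ?_⟩
  rintro U U' hU hU' ⟨_, ⟨w, hw, rfl⟩, hwU⟩ ⟨_, ⟨w', hw', rfl⟩, hwU'⟩
  obtain ⟨g, hg, hg0, hg'⟩ := net_isOpen_iff.1 hU _ hwU
  obtain ⟨g₁, hg₁, hg₁0, hg₁'⟩ := net_isOpen_iff.1 hU' _ hwU'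
  obtain ⟨z, hz, hz'⟩ := exists_polyFun_mul_ne_zero (polyFun_mul hf (hc.comp hg))
    (polyFun_mul hf (hc.comp hg₁)) (mul_ne_zero hw hg0) (mul_ne_zero hw' hg₁0)
  exact ⟨_, ⟨z, left_ne_zero_of_mul hz, rfl⟩, hg' ⟨c z, _⟩ (right_ne_zero_of_mul hz),
    hg₁' ⟨c z, _⟩ (right_ne_zero_of_mul hz')⟩

/-- Substitution, as a linear map on triples. -/
def substLinear (g : GL (Fin 3) k) : Triple k →ₗ[k] Triple k :=
  LinearMap.pi fun i => ((subst g).toLinearMap.restrict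
    (p := homogeneousSubmodule (Fin 3) k 2) (q := homogeneousSubmodule (Fin 3) k 2)
    fun _ h => subst_isHomogeneous g h) ∘ₗ LinearMap.proj i

@[simp] theorem substLinear_apply (g : GL (Fin 3) k) (q : Triple k) (i : Fin 3) :
    (substLinear g q i).1 = subst g (q i).1 := rfl

theorem linearIndependent_substLinear (g : GL (Fin 3) k) {q : Triple k}
    (hq : LinearIndependent k q) : LinearIndependent k (substLinear g q) := by
  refine LinearIndependent.of_comp (homogeneousSubmodule (Fin 3) k 2).subtype ?_
  exact linearIndependent_subst g
    (hq.map' (homogeneousSubmodule (Fin 3) k 2).subtype (Submodule.ker_subtype _))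

theorem spanNet_substLinear (g : GL (Fin 3) k) (q : Frame k) :
    spanNet ⟨substLinear g q.1, linearIndependent_substLinear g q.2⟩ = (spanNet q).act g :=
  (Net.eq_spanNet fun i => Submodule.mem_map_of_mem (spanNet_mem q i)).symm

theorem continuous_act (g : GL (Fin 3) k) : Continuous fun V : Net k => V.act g := by
  refine ⟨fun U hU => net_isOpen_iff.2 fun q hq => ?_⟩
  rw [Set.mem_preimage, ← spanNet_substLinear] at hq
  obtain ⟨f, hf, hfq, h⟩ := net_isOpen_iff.1 hU _ hq
  refine ⟨_, (substLinear g).isPolyMap.comp hf, hfq, fun q' hq' => ?_⟩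
  rw [Set.mem_preimage, ← spanNet_substLinear]
  exact h _ hq'

theorem act_mem_closure_orbit {V W : Net k} (h : W ∈ closure (orbit V)) (g : GL (Fin 3) k) :
    W.act g ∈ closure (orbit V) := by
  refine map_mem_closure (continuous_act g) h fun U hU => ?_
  exact mem_orbit_trans (act_mem_orbit g U) hU

/-- Coordinate changes act continuously and preserve the orbit, hence its closure; a single net of
the target orbit therefore decides. -/
theorem specializesTo_iff {V W : Net k} : SpecializesTo V W ↔ W ∈ closure (orbit V) := by
  refine ⟨fun h => h (mem_orbit_self W), fun h U hU => ?_⟩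
  obtain ⟨g, rfl⟩ := mem_orbit_iff_act.1 hU
  exact act_mem_closure_orbit h g

theorem specializesTo_refl (V : Net k) : SpecializesTo V V := subset_closure

theorem SpecializesTo.trans {U V W : Net k} (h₁ : SpecializesTo U V) (h₂ : SpecializesTo V W) :
    SpecializesTo U W :=
  Set.Subset.trans h₂ (closure_minimal h₁ isClosed_closure)

theorem specializesTo_congr {V V' W W' : Net k} (hV : orbit V = orbit V')
    (hW : orbit W = orbit W') : SpecializesTo V W ↔ SpecializesTo V' W' := by
  rw [SpecializesTo, SpecializesTo, hV, hW]

theorem specializesTo_of_orbit_eq {V W : Net k} (h : orbit V = orbit W) : SpecializesTo V W :=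
  (specializesTo_congr rfl h).1 (specializesTo_refl V)

theorem Degenerates.specializesTo [CharZero k] {a b : Entry k} (h : Degenerates a b) :
    SpecializesTo a.net b.net := by
  obtain ⟨F, ⟨q, hq⟩, ht, h0⟩ := h
  have hmem : ∀ t i, MvPolynomial.map (Polynomial.evalRingHom t) (q i) ∈ (F t).carrier :=
    fun t i => hq t ▸ Submodule.subset_span ⟨i, rfl⟩
  let c : k → Triple k := fun t i => ⟨_, (F t).le_homogeneous (hmem t i)⟩
  have hc : IsPolyMap k c := isPolyMap_of_coeff fun i m => mem_polyFun_self_iff.2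
    ⟨coeff m (q i), fun t => by simp [c, coeff_map]⟩
  have hi : ∀ t, LinearIndependent k (c t) := fun t => by
    refine LinearIndependent.of_comp (homogeneousSubmodule (Fin 3) k 2).subtype ?_
    rw [linearIndependent_iff_card_eq_finrank_span, Set.finrank]
    have := (F t).finrank_eq
    rw [hq t] at this
    rw [Fintype.card_fin]
    exact this.symm
  have hF : ∀ t, spanNet ⟨c t, hi t⟩ = F t := fun t => (Net.eq_spanNet (hmem t)).symm
  have := mem_closure_of_curve (S := orbit a.net) hc (f := fun t => t)
    polyFun_id (t₁ := 1) one_ne_zero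
    (fun t h _ => by rw [hF]; exact ht t h) (fun t _ => hi t) (hi 0)
  rw [hF] at this
  exact (specializesTo_iff.2 this).trans (specializesTo_of_orbit_eq (orbit_eq_of_mem h0))

theorem polyFun_coeff_aeval (p : MvPolynomial (Fin 3) k) (m : Fin 3 →₀ ℕ) :
    (fun M : Matrix (Fin 3) (Fin 3) k => coeff m (aeval (fun i => lin (M i)) p)) ∈
      polyFun k (Matrix (Fin 3) (Fin 3) k) := by
  induction p using MvPolynomial.induction_on generalizing m with
  | C a => simpa using polyFun_const _
  | add p q hp hq => simpa using polyFun_add (hp m) (hq m)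
  | mul_X p i hp =>
    simp only [map_mul, aeval_X, coeff_mul]
    refine polyFun_sum fun x _ => polyFun_mul (hp _) ?_
    simp only [lin, coeff_sum, coeff_C_mul]
    exact polyFun_sum fun j _ => polyFun_mul
      (polyFun_apply i j) (polyFun_const _)

/-- An orbit is parametrized polynomially by the locus `det ≠ 0` in the space of all matrices. -/
theorem isIrreducible_orbit [Infinite k] (V : Net k) : IsIrreducible (orbit V) := by
  obtain ⟨q, rfl⟩ := exists_spanNet V
  let c : Matrix (Fin 3) (Fin 3) k → Triple k := fun M i =>
    ⟨aeval (fun i => lin (M i)) (q.1 i).1, by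
      simpa using (q.1 i).2.aeval (fun i => lin (M i)) (n := 1) fun i => lin_isHomogeneous (M i)⟩
  have hc : IsPolyMap k c := isPolyMap_of_coeff fun i m => polyFun_coeff_aeval _ _
  have hd : (fun M : Matrix (Fin 3) (Fin 3) k => M.det) ∈ polyFun k _ :=
    polyFun_det polyFun_apply
  have hi : ∀ M, Matrix.det M ≠ 0 → LinearIndependent k (c M) := fun M hM =>
    linearIndependent_substLinear (toGL M hM) q.2
  convert isIrreducible_of_isPolyMap hc hd (w₁ := 1) (by simp) hi using 1
  ext W
  rw [mem_orbit_iff_act]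
  constructor
  · rintro ⟨g, rfl⟩
    exact ⟨g.1, g.det_ne_zero, (spanNet_substLinear g q).symm⟩
  · rintro ⟨M, hM, rfl⟩
    exact ⟨toGL M hM, spanNet_substLinear (toGL M hM) q⟩

end Topology

end NetsOfConics

end

open MvPolynomial

noncomputable section

namespace NetsOfConics

/-! ### Hessian matrices of quadratic forms -/

section Hessian

variable {k : Type*} [Field k]

theorem pderiv_lin (i : Fin 3) (v : Fin 3 → k) : pderiv i (lin v) = C (v i) := by
  simp [lin, pderiv_X, Pi.single_apply]

/-- The chain rule for linear substitutions. -/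
theorem pderiv_subst (g : GL (Fin 3) k) (j : Fin 3) (p : MvPolynomial (Fin 3) k) :
    pderiv j (subst g p) = ∑ i, C (g.1 i j) * subst g (pderiv i p) := by
  induction p using MvPolynomial.induction_on with
  | C a => simp only [algHom_C, algebraMap_eq, derivation_C, map_zero, mul_zero,
      Finset.sum_const_zero]
  | add p q hp hq => simp only [map_add, hp, hq, mul_add, Finset.sum_add_distrib]
  | mul_X p n hp =>
    have e : ∀ i, C (g.1 i j) * subst g (pderiv i (p * X n)) =
        subst g p * (if n = i then C (g.1 i j) else 0)
          + lin (g.1 n) * (C (g.1 i j) * subst g (pderiv i p)) := by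
      intro i
      rw [Derivation.leibniz, pderiv_X, Pi.single_apply, map_add, smul_eq_mul, smul_eq_mul, map_mul,
        map_mul, subst_X]
      split_ifs <;> simp only [map_one, map_zero] <;> ring
    rw [map_mul, subst_X, Derivation.leibniz, pderiv_lin, hp, smul_eq_mul, smul_eq_mul,
      Finset.sum_congr rfl fun i _ => e i, Finset.sum_add_distrib, ← Finset.mul_sum,
      ← Finset.mul_sum, Finset.sum_ite_eq]
    simp

theorem constantCoeff_subst (g : GL (Fin 3) k) (p : MvPolynomial (Fin 3) k) :
    constantCoeff (subst g p) = constantCoeff p := by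
  have : (constantCoeff (σ := Fin 3) (R := k)).comp (subst g).toRingHom = constantCoeff := by
    apply MvPolynomial.ringHom_ext
    · intro r; simp [subst]
    · intro i; simp [lin]
  exact DFunLike.congr_fun this p

/-- The Hessian matrix of a quadratic form. -/
def hess : MvPolynomial (Fin 3) k →ₗ[k] Matrix (Fin 3) (Fin 3) k where
  toFun p := Matrix.of fun i j => constantCoeff (pderiv i (pderiv j p))
  map_add' p q := by ext; simp
  map_smul' c p := by ext; simp

theorem hess_apply (p : MvPolynomial (Fin 3) k) (i j : Fin 3) :
    hess p i j = constantCoeff (pderiv i (pderiv j p)) := rfl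

/-- Homogeneous linear substitutions preserve constant terms, so the chain rule becomes congruence
of matrices. -/
theorem hess_subst (g : GL (Fin 3) k) (p : MvPolynomial (Fin 3) k) :
    hess (subst g p) = g.1.transpose * hess p * g.1 := by
  ext i j
  simp only [hess_apply, pderiv_subst, map_sum, Derivation.leibniz, smul_eq_mul, derivation_C,
    map_mul, constantCoeff_C, constantCoeff_subst, Matrix.mul_apply, Matrix.transpose_apply,
    Finset.sum_mul, Finset.mul_sum, mul_zero, add_zero]
  exact Finset.sum_congr rfl fun a _ => Finset.sum_congr rfl fun b _ => by ring

theorem hess_lin_mul_lin (u v : Fin 3 → k) :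
    hess (lin u * lin v) = Matrix.vecMulVec u v + Matrix.vecMulVec v u := by
  ext i j
  rw [hess_apply, Derivation.leibniz, pderiv_lin, pderiv_lin, smul_eq_mul, smul_eq_mul, mul_comm,
    mul_comm (lin v), map_add, pderiv_C_mul, pderiv_C_mul, pderiv_lin, pderiv_lin]
  simp only [map_add, map_mul, constantCoeff_C, Matrix.add_apply, Matrix.vecMulVec_apply]
  ring

theorem hess_X_mul_X (i j : Fin 3) :
    hess (X i * X j : MvPolynomial (Fin 3) k) =
      Matrix.single i j (1 : k) + Matrix.single j i 1 := by
  have h : ∀ i, (X i : MvPolynomial (Fin 3) k) = lin (Pi.single i 1) := fun i => by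
    simp [lin, Pi.single_apply]
  rw [h i, h j, hess_lin_mul_lin]
  rw [Matrix.single_eq_single_vecMulVec_single, Matrix.single_eq_single_vecMulVec_single]

/-- The commutator of two partial derivatives is a derivation that kills every variable. -/
theorem pderiv_comm (p : MvPolynomial (Fin 3) k) (i j : Fin 3) :
    pderiv i (pderiv j p) = pderiv j (pderiv i p) := by
  have h : ⁅pderiv i, pderiv (R := k) (σ := Fin 3) j⁆ = 0 :=
    MvPolynomial.derivation_ext fun a => by
      rw [Derivation.commutator_apply, pderiv_X, pderiv_X, Pi.single_apply, Pi.single_apply]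
      split_ifs <;> simp
  have := DFunLike.congr_fun h p
  rwa [Derivation.commutator_apply, Derivation.zero_apply, sub_eq_zero] at this

theorem hess_symm (p : MvPolynomial (Fin 3) k) (i j : Fin 3) : hess p i j = hess p j i := by
  rw [hess_apply, hess_apply, pderiv_comm]

/-- The Hessian matrices of a triple of quadratic forms. -/
def hessTriple (q : Triple k) : Fin 3 → Matrix (Fin 3) (Fin 3) k := fun i => hess (q i).1

theorem polyFun_hessTriple (i a b : Fin 3) :
    (fun q : Triple k => hessTriple q i a b) ∈ polyFun k (Triple k) :=
  polyFun_of_dual (Matrix.entryLinearMap k k a b ∘ₗ hess ∘ₗ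
    (homogeneousSubmodule (Fin 3) k 2).subtype ∘ₗ LinearMap.proj i) fun _ => rfl

/-- Change of basis of a triple of matrices. -/
def mix (h : Matrix (Fin 3) (Fin 3) k) (A : Fin 3 → Matrix (Fin 3) (Fin 3) k) :
    Fin 3 → Matrix (Fin 3) (Fin 3) k := fun i => ∑ j, h i j • A j

/-- Change of coordinates of a triple of matrices. -/
def conj (g : Matrix (Fin 3) (Fin 3) k) (A : Fin 3 → Matrix (Fin 3) (Fin 3) k) :
    Fin 3 → Matrix (Fin 3) (Fin 3) k := fun i => g.transpose * A i * g

/-- The Hessian matrices of the forms of an entry. -/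
def Entry.mat (a : Entry k) : Fin 3 → Matrix (Fin 3) (Fin 3) k := fun i => hess (a.forms i)

/-- This passes from nets to matrices: any frame of any net in the orbit is reached from the table
by a coordinate change followed by a base change, so closed conditions need testing only on `mix h
(conj g a.mat)`. -/
theorem exists_mix_conj [CharZero k] {a : Entry k} {q : Frame k} (hq : spanNet q ∈ orbit a.net) :
    ∃ h g : Matrix (Fin 3) (Fin 3) k, h.det ≠ 0 ∧ g.det ≠ 0 ∧
      hessTriple q.1 = mix h (conj g a.mat) := by
  obtain ⟨g, hg⟩ := mem_orbit_iff_act.1 hq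
  rw [Entry.net, ← spanNet_substLinear] at hg
  obtain ⟨m, hm, h⟩ := exists_mix hg
  refine ⟨m, g.1, hm, g.det_ne_zero, funext fun i => ?_⟩
  rw [hessTriple, h, mixLinear_apply]
  simp only [Submodule.coe_sum, Submodule.coe_smul, map_sum, map_smul, mix, conj,
    substLinear_apply, hess_subst]
  rfl

/-- Invariants which vanish on all frames of nets in one orbit but not at another net obstruct
specialization. -/
theorem not_specializesTo [CharZero k] {a b : Entry k}
    {f : (Fin 3 → Matrix (Fin 3) (Fin 3) k) → k}
    (hf : (fun q => f (hessTriple q)) ∈ polyFun k (Triple k))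
    (ha : ∀ h g : Matrix (Fin 3) (Fin 3) k, h.det ≠ 0 → g.det ≠ 0 → f (mix h (conj g a.mat)) = 0)
    (hb : f b.mat ≠ 0) : ¬ SpecializesTo a.net b.net := by
  rw [specializesTo_iff]
  refine notMem_closure_of_polyFun hf (fun q hq => ?_) _ hb
  obtain ⟨h, g, hh, hg, e⟩ := exists_mix_conj hq
  rw [e, ha h g hh hg]

end Hessian

end NetsOfConics

end

open MvPolynomial

noncomputable section

namespace NetsOfConics

/-! ### Invariants of nets -/

section Invariants

variable {k : Type*} [Field k]

theorem hess_X_mul_X_eq : hess (X 0 * X 1 : MvPolynomial (Fin 3) k) = !![0, 1, 0; 1, 0, 0; 0, 0, 0] ∧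
    hess (X 0 * X 2 : MvPolynomial (Fin 3) k) = !![0, 0, 1; 0, 0, 0; 1, 0, 0] ∧
    hess (X 1 * X 2 : MvPolynomial (Fin 3) k) = !![0, 0, 0; 0, 0, 1; 0, 1, 0] ∧
    hess (X 0 ^ 2 : MvPolynomial (Fin 3) k) = !![2, 0, 0; 0, 0, 0; 0, 0, 0] ∧
    hess (X 1 ^ 2 : MvPolynomial (Fin 3) k) = !![0, 0, 0; 0, 2, 0; 0, 0, 0] ∧
    hess (X 2 ^ 2 : MvPolynomial (Fin 3) k) = !![0, 0, 0; 0, 0, 0; 0, 0, 2] := by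
  simp only [sq]
  refine ⟨?_, ?_, ?_, ?_, ?_, ?_⟩ <;> ext a b <;> fin_cases a <;> fin_cases b <;>
    simp [hess_X_mul_X, one_add_one_eq_two]

theorem Entry.mat_8a : (Entry.e8a : Entry k).mat =
    ![!![0, 1, 0; 1, 0, 0; 0, 0, 0], !![2, 0, 0; 0, 0, 1; 0, 1, 0],
      !![0, 0, 1; 0, 2, 0; 1, 0, 0]] := by
  funext i; fin_cases i <;> simp [Entry.mat, Entry.forms, hess_X_mul_X_eq]

theorem Entry.mat_8c : (Entry.e8c : Entry k).mat =
    ![!![0, 0, 0; 0, 0, 0; 0, 0, 2], !![2, 0, 0; 0, 0, -1; 0, -1, 0],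
      !![0, 0, -1; 0, 2, 0; -1, 0, 0]] := by
  funext i; fin_cases i <;> simp [Entry.mat, Entry.forms, hess_X_mul_X_eq]
  all_goals exact ⟨by ext i; fin_cases i <;> rfl, by ext i; fin_cases i <;> rfl⟩

theorem Entry.mat_7a : (Entry.e7a : Entry k).mat =
    ![!![2, 0, 0; 0, 0, 1; 0, 1, 0], !![0, 1, 0; 1, 0, 0; 0, 0, 0],
      !![0, 0, 1; 0, 0, 0; 1, 0, 0]] := by
  funext i; fin_cases i <;> simp [Entry.mat, Entry.forms, hess_X_mul_X_eq]

theorem Entry.mat_7b : (Entry.e7b : Entry k).mat =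
    ![!![2, 0, 0; 0, 0, 1; 0, 1, 0], !![0, 1, 0; 1, 0, 0; 0, 0, 0],
      !![0, 0, 0; 0, 0, 0; 0, 0, 2]] := by
  funext i; fin_cases i <;> simp [Entry.mat, Entry.forms, hess_X_mul_X_eq]

theorem Entry.mat_7c : (Entry.e7c : Entry k).mat =
    ![!![2, 0, 0; 0, 0, 0; 0, 0, 0], !![0, 0, 0; 0, 2, 0; 0, 0, 0],
      !![0, 1, 0; 1, 0, 0; 0, 0, 2]] := by
  funext i; fin_cases i <;> simp [Entry.mat, Entry.forms, hess_X_mul_X_eq]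

theorem Entry.mat_6a : (Entry.e6a : Entry k).mat =
    ![!![0, 1, 0; 1, 0, 0; 0, 0, 0], !![0, 0, 1; 0, 0, 0; 1, 0, 0],
      !![0, 0, 0; 0, 0, 1; 0, 1, 0]] := by
  funext i; fin_cases i <;> simp [Entry.mat, Entry.forms, hess_X_mul_X_eq]

theorem Entry.mat_6b : (Entry.e6b : Entry k).mat =
    ![!![2, 0, 0; 0, 0, 0; 0, 0, 0], !![0, 1, 0; 1, 0, 0; 0, 0, 0],
      !![0, 0, 0; 0, 0, 1; 0, 1, 2]] := by
  funext i; fin_cases i <;> simp [Entry.mat, Entry.forms, hess_X_mul_X_eq]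

theorem Entry.mat_6c : (Entry.e6c : Entry k).mat =
    ![!![0, 1, 0; 1, 0, 0; 0, 0, 0], !![2, 0, 0; 0, 0, 1; 0, 1, 0],
      !![2, 0, 0; 0, 2, 0; 0, 0, 0]] := by
  funext i; fin_cases i <;> simp [Entry.mat, Entry.forms, hess_X_mul_X_eq]

theorem Entry.mat_6d : (Entry.e6d : Entry k).mat =
    ![!![2, 0, 0; 0, 0, 0; 0, 0, 0], !![0, 0, 0; 0, 2, 0; 0, 0, 0],
      !![0, 0, 0; 0, 0, 0; 0, 0, 2]] := by
  funext i; fin_cases i <;> simp [Entry.mat, Entry.forms, hess_X_mul_X_eq]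

theorem Entry.mat_5a : (Entry.e5a : Entry k).mat =
    ![!![2, 0, 0; 0, 0, 0; 0, 0, 0], !![0, 1, 0; 1, 0, 0; 0, 0, 0],
      !![0, 0, 0; 0, 0, 1; 0, 1, 0]] := by
  funext i; fin_cases i <;> simp [Entry.mat, Entry.forms, hess_X_mul_X_eq]

theorem Entry.mat_5b : (Entry.e5b : Entry k).mat =
    ![!![2, 0, 0; 0, 0, 0; 0, 0, 0], !![0, 1, 0; 1, 0, 0; 0, 0, 0],
      !![0, 0, 0; 0, 0, 0; 0, 0, 2]] := by
  funext i; fin_cases i <;> simp [Entry.mat, Entry.forms, hess_X_mul_X_eq]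

theorem Entry.mat_4 : (Entry.e4 : Entry k).mat =
    ![!![0, 1, 0; 1, 0, 0; 0, 0, 0], !![2, 0, 0; 0, 0, 1; 0, 1, 0],
      !![0, 0, 0; 0, 2, 0; 0, 0, 0]] := by
  funext i; fin_cases i <;> simp [Entry.mat, Entry.forms, hess_X_mul_X_eq]

theorem Entry.mat_2a : (Entry.e2a : Entry k).mat =
    ![!![2, 0, 0; 0, 0, 0; 0, 0, 0], !![0, 1, 0; 1, 0, 0; 0, 0, 0],
      !![0, 0, 1; 0, 0, 0; 1, 0, 0]] := by
  funext i; fin_cases i <;> simp [Entry.mat, Entry.forms, hess_X_mul_X_eq]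

theorem Entry.mat_2b : (Entry.e2b : Entry k).mat =
    ![!![2, 0, 0; 0, 0, 0; 0, 0, 0], !![0, 1, 0; 1, 0, 0; 0, 0, 0],
      !![0, 0, 0; 0, 2, 0; 0, 0, 0]] := by
  funext i; fin_cases i <;> simp [Entry.mat, Entry.forms, hess_X_mul_X_eq]

theorem Entry.mat_8b (lam : k) (h : Permissible lam) : (Entry.e8b lam h).mat =
    ![!![2, 0, 0; 0, 0, lam; 0, lam, 0], !![0, 0, lam; 0, 2, 0; lam, 0, 0],
      !![0, lam, 0; lam, 0, 0; 0, 0, 2]] := by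
  funext i; fin_cases i <;> simp [Entry.mat, Entry.forms, ← smul_eq_C_mul, hess_X_mul_X_eq]

/-- The polarization of the adjugate. -/
def adjp (A B : Matrix (Fin 3) (Fin 3) k) : Matrix (Fin 3) (Fin 3) k :=
  (A + B).adjugate - A.adjugate - B.adjugate

theorem adjp_eq (A B : Matrix (Fin 3) (Fin 3) k) : adjp A B =
    !![A 1 1 * B 2 2 + A 2 2 * B 1 1 - A 1 2 * B 2 1 - A 2 1 * B 1 2,
       A 0 2 * B 2 1 + A 2 1 * B 0 2 - A 0 1 * B 2 2 - A 2 2 * B 0 1,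
       A 0 1 * B 1 2 + A 1 2 * B 0 1 - A 0 2 * B 1 1 - A 1 1 * B 0 2;
       A 1 2 * B 2 0 + A 2 0 * B 1 2 - A 1 0 * B 2 2 - A 2 2 * B 1 0,
       A 0 0 * B 2 2 + A 2 2 * B 0 0 - A 0 2 * B 2 0 - A 2 0 * B 0 2,
       A 0 2 * B 1 0 + A 1 0 * B 0 2 - A 0 0 * B 1 2 - A 1 2 * B 0 0;
       A 1 0 * B 2 1 + A 2 1 * B 1 0 - A 1 1 * B 2 0 - A 2 0 * B 1 1,
       A 0 1 * B 2 0 + A 2 0 * B 0 1 - A 0 0 * B 2 1 - A 2 1 * B 0 0,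
       A 0 0 * B 1 1 + A 1 1 * B 0 0 - A 0 1 * B 1 0 - A 1 0 * B 0 1] := by
  ext i j
  fin_cases i <;> fin_cases j <;> simp [adjp, Matrix.adjugate_fin_three] <;> ring

theorem adjp_comm (A B : Matrix (Fin 3) (Fin 3) k) : adjp A B = adjp B A := by
  rw [adjp, adjp, add_comm A B]; abel

theorem adjp_add (A B C : Matrix (Fin 3) (Fin 3) k) : adjp A (B + C) = adjp A B + adjp A C := by
  ext i j
  fin_cases i <;> fin_cases j <;> simp [adjp_eq] <;> ring

theorem adjp_smul (c : k) (A B : Matrix (Fin 3) (Fin 3) k) : adjp A (c • B) = c • adjp A B := by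
  ext i j
  fin_cases i <;> fin_cases j <;> simp [adjp_eq] <;> ring

/-- The polarized adjugate as a bilinear map. -/
def adjpₗ : Matrix (Fin 3) (Fin 3) k →ₗ[k] Matrix (Fin 3) (Fin 3) k →ₗ[k]
    Matrix (Fin 3) (Fin 3) k :=
  LinearMap.mk₂ k adjp (fun A B C => by rw [adjp_comm, adjp_add, adjp_comm C, adjp_comm C])
    (fun c A B => by rw [adjp_comm, adjp_smul, adjp_comm B]) adjp_add (fun c A B => adjp_smul c A B)

/-- The adjugate reverses products, so dual conics transform through the adjugate of `g`;
polarization preserves this. -/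
theorem adjp_conj (g A B : Matrix (Fin 3) (Fin 3) k) :
    adjp (g.transpose * A * g) (g.transpose * B * g) =
      g.adjugate * adjp A B * g.adjugate.transpose := by
  have h : ∀ A : Matrix (Fin 3) (Fin 3) k, (g.transpose * A * g).adjugate =
      g.adjugate * A.adjugate * g.adjugate.transpose := fun A => by
    rw [Matrix.adjugate_mul_distrib, Matrix.adjugate_mul_distrib, Matrix.adjugate_transpose,
      mul_assoc]
  rw [adjp, ← Matrix.add_mul, ← Matrix.mul_add, h, h, h, adjp]
  noncomm_ring

theorem adjp_symm {A B : Matrix (Fin 3) (Fin 3) k} (hA : A.IsSymm) (hB : B.IsSymm) :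
    (adjp A B).IsSymm := by
  simp only [Matrix.IsSymm, adjp, Matrix.transpose_sub, Matrix.adjugate_transpose,
    Matrix.transpose_add, hA.eq, hB.eq]

/-- The polarized discriminant of a triple of matrices. -/
def disc (A : Fin 3 → Matrix (Fin 3) (Fin 3) k) (i j l : Fin 3) : k :=
  (adjp (A i) (A j) * A l).trace

/-- The trilinear form of a cubic form after a linear substitution. -/
def mixCubic (h : Matrix (Fin 3) (Fin 3) k) (d : Fin 3 → Fin 3 → Fin 3 → k) (i j l : Fin 3) : k :=
  ∑ a, ∑ b, ∑ c, h i a * h j b * h l c * d a b c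

theorem disc_mix (h : Matrix (Fin 3) (Fin 3) k) (A : Fin 3 → Matrix (Fin 3) (Fin 3) k) :
    disc (mix h A) = mixCubic h (disc A) := by
  funext i j l
  have e : adjp (∑ a, h i a • A a) (∑ b, h j b • A b) = ∑ a, ∑ b, (h i a * h j b) •
      adjp (A a) (A b) := by
    change adjpₗ _ _ = _
    simp only [map_sum, LinearMap.sum_apply, map_smul, LinearMap.smul_apply, Finset.smul_sum,
      smul_smul, mul_comm]
    rw [Finset.sum_comm]
    rfl
  simp only [disc, mix, mixCubic, e, Finset.sum_mul, Finset.mul_sum, Matrix.trace_sum,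
    Matrix.smul_mul, Matrix.mul_smul, Matrix.trace_smul, smul_eq_mul]
  simp only [Fin.sum_univ_three]
  ring

/-- Cyclicity of the trace brings `g` next to its adjugate twice, and each meeting contributes a
factor `g.det`. -/
theorem disc_conj (g : Matrix (Fin 3) (Fin 3) k) (A : Fin 3 → Matrix (Fin 3) (Fin 3) k)
    (i j l : Fin 3) : disc (conj g A) i j l = g.det ^ 2 * disc A i j l := by
  have h1 : g.adjugate.transpose * g.transpose = g.det • 1 := by
    rw [← Matrix.transpose_mul, Matrix.mul_adjugate]; simp
  simp only [disc, conj, adjp_conj]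
  rw [show g.adjugate * adjp (A i) (A j) * g.adjugate.transpose * (g.transpose * A l * g) =
    g.adjugate * adjp (A i) (A j) * (g.adjugate.transpose * g.transpose) * A l * g by noncomm_ring,
    h1, Matrix.trace_mul_comm]
  simp only [Matrix.mul_smul, Matrix.mul_one, Matrix.smul_mul, ← Matrix.mul_assoc,
    Matrix.mul_adjugate, Matrix.one_mul, smul_smul, Matrix.trace_smul, smul_eq_mul]
  ring

/-- Symmetry of a trilinear form. -/
def SymmCubic (d : Fin 3 → Fin 3 → Fin 3 → k) : Prop :=
  (∀ i j l, d i j l = d j i l) ∧ ∀ i j l, d i j l = d i l j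

/-- On equal arguments the value is six times the determinant: this is the full polarization of
`det`, hence symmetric. The remaining symmetry is checked on entries. -/
theorem symmCubic_disc (A : Fin 3 → Matrix (Fin 3) (Fin 3) k) : SymmCubic (disc A) := by
  refine ⟨fun i j l => by rw [disc, disc, adjp_comm], fun i j l => ?_⟩
  simp only [disc, adjp_eq, Matrix.trace_fin_three, Matrix.mul_apply, Fin.sum_univ_three]
  simp
  ring

theorem SymmCubic.mix {d : Fin 3 → Fin 3 → Fin 3 → k} (hd : SymmCubic d)
    (h : Matrix (Fin 3) (Fin 3) k) : SymmCubic (mixCubic h d) := by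
  refine ⟨fun i j l => ?_, fun i j l => ?_⟩
  · rw [mixCubic, mixCubic, Finset.sum_comm]
    refine Finset.sum_congr rfl fun a _ => Finset.sum_congr rfl fun b _ =>
      Finset.sum_congr rfl fun c _ => ?_
    rw [hd.1 b a c]; ring
  · refine Finset.sum_congr rfl fun a _ => ?_
    rw [Finset.sum_comm]
    refine Finset.sum_congr rfl fun b _ => Finset.sum_congr rfl fun c _ => ?_
    rw [hd.2 a c b]; ring

theorem mixCubic_mul (g h : Matrix (Fin 3) (Fin 3) k) (d : Fin 3 → Fin 3 → Fin 3 → k) :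
    mixCubic (g * h) d = mixCubic g (mixCubic h d) := by
  funext i j l
  simp only [mixCubic, Matrix.mul_apply, Fin.sum_univ_three]
  ring

/-- The Aronhold invariant of degree four of a ternary cubic. -/
def aron (d : Fin 3 → Fin 3 → Fin 3 → k) : k :=
  let a := d 0 0 0
  let b := d 1 1 1
  let c := d 2 2 2
  let a₂ := d 0 0 1
  let a₃ := d 0 0 2
  let b₁ := d 0 1 1
  let b₃ := d 1 1 2
  let c₁ := d 0 2 2
  let c₂ := d 1 2 2
  let m := d 0 1 2
  a * b * c * m - (b * c * a₂ * a₃ + c * a * b₁ * b₃ + a * b * c₁ * c₂)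
    - m * (a * b₃ * c₂ + b * c₁ * a₃ + c * a₂ * b₁)
    + (a * b₁ * c₂ ^ 2 + a * c₁ * b₃ ^ 2 + b * a₂ * c₁ ^ 2 + b * c₂ * a₃ ^ 2 + c * b₃ * a₂ ^ 2
      + c * a₃ * b₁ ^ 2)
    - m ^ 4 + 2 * m ^ 2 * (b₁ * c₁ + c₂ * a₂ + a₃ * b₃) - 3 * m * (a₂ * b₃ * c₁ + a₃ * b₁ * c₂)
    - (b₁ ^ 2 * c₁ ^ 2 + c₂ ^ 2 * a₂ ^ 2 + a₃ ^ 2 * b₃ ^ 2)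
    + (c₂ * a₂ * a₃ * b₃ + a₃ * b₃ * b₁ * c₁ + b₁ * c₁ * c₂ * a₂)

/-- Invertible matrices are products of diagonal matrices and transvections, and the claimed factor
is multiplicative, so invariance reduces to polynomial identities for these generators. -/
theorem aron_mix {d : Fin 3 → Fin 3 → Fin 3 → k} (hd : SymmCubic d)
    {h : Matrix (Fin 3) (Fin 3) k} (hh : h.det ≠ 0) :
    aron (mixCubic h d) = h.det ^ 4 * aron d := by
  refine Matrix.diagonal_transvection_induction_of_det_ne_zero
    (fun h => ∀ d, SymmCubic d → aron (mixCubic h d) = h.det ^ 4 * aron d) h hh ?_ ?_ ?_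
    d hd
  · intro D _ d hd
    simp only [aron, mixCubic, Fin.sum_univ_three, Matrix.det_diagonal, Fin.prod_univ_three,
      Matrix.diagonal_apply]
    simp
    ring
  · intro t d hd
    obtain ⟨i, j, hij, c⟩ := t
    -- Seventeen relations express all twenty-seven trilinear entries through the ten that occur in
    -- `aron`.
    have s1 : d 1 0 0 = d 0 0 1 := by rw [hd.1, hd.2]
    have s2 : d 0 1 0 = d 0 0 1 := hd.2 _ _ _
    have s3 : d 2 0 0 = d 0 0 2 := by rw [hd.1, hd.2]
    have s4 : d 0 2 0 = d 0 0 2 := hd.2 _ _ _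
    have s5 : d 1 0 1 = d 0 1 1 := hd.1 _ _ _
    have s6 : d 1 1 0 = d 0 1 1 := by rw [hd.2, hd.1]
    have s7 : d 2 1 1 = d 1 1 2 := by rw [hd.1, hd.2]
    have s8 : d 1 2 1 = d 1 1 2 := hd.2 _ _ _
    have s9 : d 2 0 2 = d 0 2 2 := hd.1 _ _ _
    have s10 : d 2 2 0 = d 0 2 2 := by rw [hd.2, hd.1]
    have s11 : d 2 1 2 = d 1 2 2 := hd.1 _ _ _
    have s12 : d 2 2 1 = d 1 2 2 := by rw [hd.2, hd.1]
    have s13 : d 0 2 1 = d 0 1 2 := hd.2 _ _ _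
    have s14 : d 1 0 2 = d 0 1 2 := hd.1 _ _ _
    have s15 : d 1 2 0 = d 0 1 2 := by rw [hd.2, hd.1]
    have s16 : d 2 0 1 = d 0 1 2 := by rw [hd.1, hd.2]
    have s17 : d 2 1 0 = d 0 1 2 := by rw [hd.2, hd.1, hd.2]
    rw [Matrix.TransvectionStruct.det]
    simp only [Matrix.TransvectionStruct.toMatrix, Matrix.transvection]
    fin_cases i <;> fin_cases j <;>
      simp [aron, mixCubic, Fin.sum_univ_three, s1, s2, s3, s4, s5, s6, s7, s8,
        s9, s10, s11, s12, s13, s14, s15, s16, s17] at hij ⊢ <;> ring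
  · intro A B _ _ hA hB d hd
    rw [mixCubic_mul, hA _ (hd.mix B), hB _ hd, Matrix.det_mul]
    ring

end Invariants

end NetsOfConics

end

open MvPolynomial

noncomputable section

namespace NetsOfConics

/-! ### The symmetric square and the map from a net to its dual conics. -/

section Invariants

variable {k : Type*} [Field k]

/-- First index of a pair `i ≤ j`. -/
def pairFst : Fin 6 → Fin 3 := ![0, 0, 0, 1, 1, 2]

/-- Second index of a pair `i ≤ j`. -/
def pairSnd : Fin 6 → Fin 3 := ![0, 1, 2, 1, 2, 2]

/-- The coefficients of the symmetric square of a matrix. -/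
def sqCoeff (x y : Fin 3 → k) (c : Fin 6) : k :=
  if pairFst c = pairSnd c then x (pairFst c) * y (pairFst c)
  else x (pairFst c) * y (pairSnd c) + x (pairSnd c) * y (pairFst c)

/-- The symmetric square of a matrix. -/
def symSq (h : Matrix (Fin 3) (Fin 3) k) : Matrix (Fin 6) (Fin 6) k :=
  Matrix.of fun r c => sqCoeff (h (pairFst r)) (h (pairSnd r)) c

/-- Off-diagonal coefficients contain both orderings of a pair, so a sum over unordered pairs
against a symmetric function equals the sum over ordered pairs. This makes the symmetric square
multiplicative. -/
theorem sum_sqCoeff (x y : Fin 3 → k) {F : Fin 3 → Fin 3 → k} (hF : ∀ a b, F a b = F b a) :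
    ∑ c, sqCoeff x y c * F (pairFst c) (pairSnd c) = ∑ a, ∑ b, x a * y b * F a b := by
  simp only [Fin.sum_univ_six, Fin.sum_univ_three, sqCoeff, pairFst, pairSnd]
  simp
  rw [hF 1 0, hF 2 0, hF 2 1]
  ring

theorem symSq_mul (g h : Matrix (Fin 3) (Fin 3) k) : symSq (g * h) = symSq g * symSq h := by
  ext r c
  rw [Matrix.mul_apply]
  simp only [symSq, Matrix.of_apply]
  rw [sum_sqCoeff (F := fun a b => sqCoeff (h a) (h b) c) _ _ fun a b => by
    simp only [sqCoeff]; split_ifs <;> ring]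
  simp only [sqCoeff, Matrix.mul_apply]
  split_ifs <;> simp only [Fin.sum_univ_three] <;> ring

theorem symSq_diagonal (d : Fin 3 → k) :
    symSq (Matrix.diagonal d) = Matrix.diagonal fun r => d (pairFst r) * d (pairSnd r) := by
  ext r c
  simp only [symSq, Matrix.of_apply, sqCoeff, Matrix.diagonal_apply]
  fin_cases r <;> fin_cases c <;> simp [pairFst, pairSnd]

theorem symSq_one : symSq (1 : Matrix (Fin 3) (Fin 3) k) = 1 := by
  rw [← Matrix.diagonal_one, symSq_diagonal]; simp

theorem det_symSq_diagonal (d : Fin 3 → k) :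
    (symSq (Matrix.diagonal d)).det = (Matrix.diagonal d).det ^ 4 := by
  rw [symSq_diagonal, Matrix.det_diagonal, Matrix.det_diagonal, Fin.prod_univ_six,
    Fin.prod_univ_three]
  simp [pairFst, pairSnd]
  ring

/-- Conjugation by the diagonal matrix with entry 2 at place `i` doubles the parameter of the
transvection, which is the same as squaring it. The determinant therefore equals its own square, and
it is nonzero. -/
theorem det_symSq_transvection [CharZero k] {i j : Fin 3} (hij : i ≠ j) (c : k) :
    (symSq (Matrix.transvection i j c)).det = 1 := by
  have hm : ∀ g h : Matrix (Fin 3) (Fin 3) k,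
      (symSq (g * h)).det = (symSq g).det * (symSq h).det := fun g h => by
    rw [symSq_mul, Matrix.det_mul]
  have h1 : (symSq (Matrix.transvection i j c)).det *
      (symSq (Matrix.transvection i j (-c))).det = 1 := by
    rw [← hm, Matrix.transvection_mul_transvection_same _ _ hij]; simp [symSq_one]
  let d : Fin 3 → k := Pi.single i 1 + 1
  have hd : Matrix.diagonal d * Matrix.transvection i j c =
      Matrix.transvection i j c * Matrix.transvection i j c * Matrix.diagonal d := by
    rw [Matrix.transvection_mul_transvection_same _ _ hij]
    ext a b
    simp only [Matrix.diagonal_mul, Matrix.mul_diagonal, Matrix.transvection, Matrix.add_apply,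
      Matrix.one_apply, Matrix.single_apply, d, Pi.add_apply, Pi.single_apply, Pi.one_apply]
    split_ifs <;> grind
  have hd0 : (symSq (Matrix.diagonal d)).det ≠ 0 := by
    rw [det_symSq_diagonal, Matrix.det_diagonal]
    refine pow_ne_zero _ (Finset.prod_ne_zero_iff.2 fun a _ => ?_)
    simp only [d, Pi.add_apply, Pi.single_apply, Pi.one_apply]
    split_ifs <;> norm_num
  have h2 := congrArg (fun M => (symSq M).det) hd
  simp only [hm] at h2
  have h3 := left_ne_zero_of_mul_eq_one h1
  have h4 : (symSq (Matrix.diagonal d)).det * (symSq (Matrix.transvection i j c)).det * (1 -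
      (symSq (Matrix.transvection i j c)).det) = 0 := by linear_combination h2
  simp only [mul_eq_zero, hd0, h3, false_or] at h4
  exact (sub_eq_zero.1 h4).symm

/-- The exponent four is the number of times a given variable occurs among the six monomials of
degree two, counted with multiplicity. -/
theorem det_symSq [CharZero k] {h : Matrix (Fin 3) (Fin 3) k} (hh : h.det ≠ 0) :
    (symSq h).det = h.det ^ 4 := by
  refine Matrix.diagonal_transvection_induction_of_det_ne_zero
    (fun h => (symSq h).det = h.det ^ 4) h hh (fun d _ => det_symSq_diagonal d) (fun t => ?_) ?_
  · rw [Matrix.TransvectionStruct.det, Matrix.TransvectionStruct.toMatrix,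
      det_symSq_transvection t.hij, one_pow]
  · intro A B _ _ hA hB
    rw [symSq_mul, Matrix.det_mul, hA, hB, Matrix.det_mul, mul_pow]

/-- The matrix of the quadratic map from a net to its dual conics. -/
def dualMat (A : Fin 3 → Matrix (Fin 3) (Fin 3) k) : Matrix (Fin 6) (Fin 6) k :=
  Matrix.of fun r c => adjp (A (pairFst r)) (A (pairSnd r)) (pairFst c) (pairSnd c)

theorem adjp_mix (h : Matrix (Fin 3) (Fin 3) k) (A : Fin 3 → Matrix (Fin 3) (Fin 3) k)
    (i j : Fin 3) : adjp (mix h A i) (mix h A j) =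
      ∑ a, ∑ b, (h i a * h j b) • adjp (A a) (A b) := by
  change adjpₗ _ _ = _
  simp only [mix, map_sum, LinearMap.sum_apply, map_smul, LinearMap.smul_apply, Finset.smul_sum,
    smul_smul, mul_comm]
  rw [Finset.sum_comm]
  rfl

theorem dualMat_mix (h : Matrix (Fin 3) (Fin 3) k) (A : Fin 3 → Matrix (Fin 3) (Fin 3) k) :
    dualMat (mix h A) = symSq h * dualMat A := by
  ext r c
  rw [Matrix.mul_apply]
  simp only [dualMat, symSq, Matrix.of_apply]
  rw [sum_sqCoeff (F := fun a b => adjp (A a) (A b) (pairFst c) (pairSnd c)) _ _ fun a b => by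
    rw [adjp_comm], adjp_mix]
  simp only [Matrix.sum_apply, Matrix.smul_apply, smul_eq_mul]

/-- Symmetry of the matrices makes the dual conics symmetric, so the six columns retain all their
entries. -/
theorem dualMat_conj (g : Matrix (Fin 3) (Fin 3) k) {A : Fin 3 → Matrix (Fin 3) (Fin 3) k}
    (hA : ∀ i, (A i).IsSymm) :
    dualMat (conj g A) = dualMat A * (symSq g.adjugate).transpose := by
  ext r c
  rw [Matrix.mul_apply]
  simp only [dualMat, symSq, Matrix.of_apply, Matrix.transpose_apply, conj, adjp_conj]
  simp only [mul_comm _ (sqCoeff _ _ _)]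
  rw [sum_sqCoeff (F := fun a b => adjp (A (pairFst r)) (A (pairSnd r)) a b) _ _ fun a b =>
    (adjp_symm (hA _) (hA _)).apply _ _]
  simp only [Matrix.mul_apply, Matrix.transpose_apply, Fin.sum_univ_three]
  ring

theorem Entry.mat_isSymm (a : Entry k) (i : Fin 3) : (a.mat i).IsSymm :=
  Matrix.IsSymm.ext fun _ _ => hess_symm _ _ _

theorem polyFun_adjugate {W : Type*} [AddCommGroup W] [Module k W]
    {M : W → Matrix (Fin 3) (Fin 3) k} (hM : ∀ i j, (fun w => M w i j) ∈ polyFun k W)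
    (i j : Fin 3) : (fun w => (M w).adjugate i j) ∈ polyFun k W := by
  simp only [Matrix.adjugate_apply]
  refine polyFun_det fun a b => ?_
  by_cases h : a = j
  · subst h; simp only [Matrix.updateRow_self]; exact polyFun_const _
  · simp only [Matrix.updateRow_ne h]; exact hM a b

theorem polyFun_adjp (i j a b : Fin 3) :
    (fun q : Triple k => adjp (hessTriple q i) (hessTriple q j) a b) ∈ polyFun k (Triple k) := by
  simp only [adjp, Matrix.sub_apply]
  have h := fun i a b => polyFun_hessTriple (k := k) i a b
  exact polyFun_sub (polyFun_sub (polyFun_adjugate (fun a b => by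
    simpa only [Matrix.add_apply] using polyFun_add (h i a b) (h j a b)) _ _)
    (polyFun_adjugate (h i) _ _)) (polyFun_adjugate (h j) _ _)

theorem polyFun_disc (i j l : Fin 3) :
    (fun q : Triple k => disc (hessTriple q) i j l) ∈ polyFun k (Triple k) := by
  simp only [disc, Matrix.trace, Matrix.diag_apply, Matrix.mul_apply]
  exact polyFun_sum fun a _ => polyFun_sum fun b _ =>
    polyFun_mul (polyFun_adjp _ _ _ _) (polyFun_hessTriple _ _ _)

theorem polyFun_aron {W : Type*} [AddCommGroup W] [Module k W]
    {d : W → Fin 3 → Fin 3 → Fin 3 → k} (hd : ∀ i j l, (fun w => d w i j l) ∈ polyFun k W) :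
    (fun w => aron (d w)) ∈ polyFun k W := by
  simp only [aron]
  repeat' first
    | with_reducible exact hd _ _ _
    | with_reducible exact polyFun_const _
    | with_reducible refine polyFun_add ?_ ?_
    | with_reducible refine polyFun_sub ?_ ?_
    | with_reducible refine polyFun_mul ?_ ?_
    | with_reducible refine polyFun_pow ?_ _

theorem aron_disc_mix_conj {h : Matrix (Fin 3) (Fin 3) k} (hh : h.det ≠ 0)
    (g : Matrix (Fin 3) (Fin 3) k) (A : Fin 3 → Matrix (Fin 3) (Fin 3) k) :
    aron (disc (mix h (conj g A))) = h.det ^ 4 * g.det ^ 8 * aron (disc A) := by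
  rw [disc_mix, aron_mix (symmCubic_disc _) hh]
  simp only [aron, disc_conj]
  ring

/-- The factor is the same as in `aron_disc_mix_conj`; here `g` enters through the symmetric square
of its adjugate, of determinant `(g.det ^ 2) ^ 4`. Equal weights make the ratio of the two
invariants depend on the net alone. -/
theorem det_dualMat_mix_conj [CharZero k] {h g : Matrix (Fin 3) (Fin 3) k} (hh : h.det ≠ 0)
    (hg : g.det ≠ 0) {A : Fin 3 → Matrix (Fin 3) (Fin 3) k} (hA : ∀ i, (A i).IsSymm) :
    (dualMat (mix h (conj g A))).det = h.det ^ 4 * g.det ^ 8 * (dualMat A).det := by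
  have e : g.adjugate.det = g.det ^ 2 := Matrix.det_adjugate g
  rw [dualMat_mix, dualMat_conj g hA, Matrix.det_mul, Matrix.det_mul, Matrix.det_transpose,
    det_symSq hh, det_symSq (by rw [e]; exact pow_ne_zero _ hg), e]
  ring

/-- The two invariants of degree twelve are proportional along specializations. -/
theorem invariants_of_specializesTo [CharZero k] {a b : Entry k} (h : SpecializesTo a.net b.net) :
    aron (disc b.mat) * (dualMat a.mat).det = (dualMat b.mat).det * aron (disc a.mat) := by
  by_contra hne
  refine not_specializesTo (f := fun A => aron (disc A) * (dualMat a.mat).det -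
    (dualMat A).det * aron (disc a.mat)) ?_ ?_ (sub_ne_zero.2 hne) h
  · exact polyFun_sub (polyFun_mul (polyFun_aron polyFun_disc) (polyFun_const _))
      (polyFun_mul (polyFun_det fun _ _ => polyFun_adjp _ _ _ _) (polyFun_const _))
  · intro h g hh hg
    simp only [aron_disc_mix_conj hh, det_dualMat_mix_conj hh hg a.mat_isSymm]
    ring

/-- The rank of the dual-conic matrix cannot increase under specialization. For `a` it is bounded by
the number of nonzero columns; for `b` a triangular minor bounds it from below. -/
theorem not_specializesTo_of_dualMat [CharZero k] {a b : Entry k} (t : Finset (Fin 6))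
    (ht : ∀ r, ∀ c ∉ t, dualMat a.mat r c = 0) {n : ℕ} (hn : t.card < n) (e e' : Fin n → Fin 6)
    (htri : ∀ i j, j < i → dualMat b.mat (e i) (e' j) = 0)
    (hdiag : ∀ i, dualMat b.mat (e i) (e' i) ≠ 0) : ¬ SpecializesTo a.net b.net := by
  refine not_specializesTo (f := fun A => ((dualMat A).submatrix e e').det)
    (polyFun_det fun _ _ => polyFun_adjp _ _ _ _) (fun h g hh hg => ?_) ?_
  · by_contra hne
    have h1 := Matrix.rank_of_isUnit _ ((Matrix.isUnit_iff_isUnit_det _).2 (Ne.isUnit hne))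
    -- Writing the matrix with a diagonal mask bounds the rank by `t.card`; base and coordinate
    -- changes only multiply on the two sides.
    have h2 : dualMat a.mat = dualMat a.mat * Matrix.diagonal fun c => if c ∈ t then 1 else 0 := by
      ext r c
      rw [Matrix.mul_diagonal]
      split_ifs with hc
      · rw [mul_one]
      · rw [ht r c hc, zero_mul]
    rw [dualMat_mix, dualMat_conj g a.mat_isSymm, h2] at h1
    have h3 := h1.symm.le.trans ((Matrix.rank_submatrix_le _ _ _).trans
      ((Matrix.rank_mul_le_right _ _).trans ((Matrix.rank_mul_le_left _ _).trans
      (Matrix.rank_mul_le_right _ _))))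
    classical
    rw [Matrix.rank_diagonal, Fintype.card_fin] at h3
    simp [Fintype.card_subtype] at h3
    omega
  · rw [Matrix.det_of_isUpperTriangular (M := (dualMat b.mat).submatrix e e') (fun i j hij => htri i j hij)]
    exact Finset.prod_ne_zero_iff.2 fun i _ => hdiag i

end Invariants

end NetsOfConics

end

open MvPolynomial

noncomputable section

namespace NetsOfConics

/-! ### Dual-conic matrices of the isolated entries. -/

section Values

variable {k : Type*} [Field k]

theorem adjp_pair (A B : Matrix (Fin 3) (Fin 3) k) :
    (fun c => adjp A B (pairFst c) (pairSnd c)) =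
      ![A 1 1 * B 2 2 + A 2 2 * B 1 1 - A 1 2 * B 2 1 - A 2 1 * B 1 2,
       A 0 2 * B 2 1 + A 2 1 * B 0 2 - A 0 1 * B 2 2 - A 2 2 * B 0 1,
       A 0 1 * B 1 2 + A 1 2 * B 0 1 - A 0 2 * B 1 1 - A 1 1 * B 0 2,
       A 0 0 * B 2 2 + A 2 2 * B 0 0 - A 0 2 * B 2 0 - A 2 0 * B 0 2,
       A 0 2 * B 1 0 + A 1 0 * B 0 2 - A 0 0 * B 1 2 - A 1 2 * B 0 0,
       A 0 0 * B 1 1 + A 1 1 * B 0 0 - A 0 1 * B 1 0 - A 1 0 * B 0 1] := by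
  funext c
  rw [adjp_eq]
  fin_cases c <;> rfl

theorem dualMat_eq (A B C : Matrix (Fin 3) (Fin 3) k) : dualMat ![A, B, C] =
    Matrix.of ![fun c => adjp A A (pairFst c) (pairSnd c), fun c => adjp A B (pairFst c) (pairSnd c),
      fun c => adjp A C (pairFst c) (pairSnd c), fun c => adjp B B (pairFst c) (pairSnd c),
      fun c => adjp B C (pairFst c) (pairSnd c), fun c => adjp C C (pairFst c) (pairSnd c)] := by
  ext r c
  fin_cases r <;> rfl

theorem dualMat_8a : dualMat (Entry.e8a : Entry k).mat =
    !![0, 0, 0, 0, 0, -2;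
      0, 0, 1, 0, 0, 0;
      0, 0, 0, 0, 1, 0;
      -2, 0, 0, 0, -4, 0;
      0, 1, 0, 0, 0, 4;
      0, 0, -4, -2, 0, 0] := by
  rw [Entry.mat_8a, dualMat_eq]
  simp only [adjp_pair]
  simp
  norm_num

theorem dualMat_8c : dualMat (Entry.e8c : Entry k).mat =
    !![0, 0, 0, 0, 0, 0;
      0, 0, 0, 4, 0, 0;
      4, 0, 0, 0, 0, 0;
      -2, 0, 0, 0, 4, 0;
      0, 1, 0, 0, 0, 4;
      0, 0, 4, -2, 0, 0] := by
  rw [Entry.mat_8c, dualMat_eq]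
  simp only [adjp_pair]
  simp
  norm_num

theorem dualMat_7a : dualMat (Entry.e7a : Entry k).mat =
    !![-2, 0, 0, 0, -4, 0;
      0, 0, 1, 0, 0, 0;
      0, 1, 0, 0, 0, 0;
      0, 0, 0, 0, 0, -2;
      0, 0, 0, 0, 1, 0;
      0, 0, 0, -2, 0, 0] := by
  rw [Entry.mat_7a, dualMat_eq]
  simp only [adjp_pair]
  simp
  norm_num

theorem dualMat_7b : dualMat (Entry.e7b : Entry k).mat =
    !![-2, 0, 0, 0, -4, 0;
      0, 0, 1, 0, 0, 0;
      0, 0, 0, 4, 0, 0;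
      0, 0, 0, 0, 0, -2;
      0, -2, 0, 0, 0, 0;
      0, 0, 0, 0, 0, 0] := by
  rw [Entry.mat_7b, dualMat_eq]
  simp only [adjp_pair]
  simp
  norm_num

theorem dualMat_7c : dualMat (Entry.e7c : Entry k).mat =
    !![0, 0, 0, 0, 0, 0;
      0, 0, 0, 0, 0, 4;
      0, 0, 0, 4, 0, 0;
      0, 0, 0, 0, 0, 0;
      4, 0, 0, 0, 0, 0;
      0, -4, 0, 0, 0, -2] := by
  rw [Entry.mat_7c, dualMat_eq]
  simp only [adjp_pair]
  simp
  norm_num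

theorem dualMat_6a : dualMat (Entry.e6a : Entry k).mat =
    !![0, 0, 0, 0, 0, -2;
      0, 0, 0, 0, 1, 0;
      0, 0, 1, 0, 0, 0;
      0, 0, 0, -2, 0, 0;
      0, 1, 0, 0, 0, 0;
      -2, 0, 0, 0, 0, 0] := by
  rw [Entry.mat_6a, dualMat_eq]
  simp only [adjp_pair]
  simp
  norm_num

theorem dualMat_6b : dualMat (Entry.e6b : Entry k).mat =
    !![0, 0, 0, 0, 0, 0;
      0, 0, 0, 0, 0, 0;
      0, 0, 0, 4, -2, 0;
      0, 0, 0, 0, 0, -2;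
      0, -2, 1, 0, 0, 0;
      -2, 0, 0, 0, 0, 0] := by
  rw [Entry.mat_6b, dualMat_eq]
  simp only [adjp_pair]
  simp
  norm_num

theorem dualMat_6c : dualMat (Entry.e6c : Entry k).mat =
    !![0, 0, 0, 0, 0, -2;
      0, 0, 1, 0, 0, 0;
      0, 0, 0, 0, 0, 0;
      -2, 0, 0, 0, -4, 0;
      0, 0, 0, 0, -2, 4;
      0, 0, 0, 0, 0, 8] := by
  rw [Entry.mat_6c, dualMat_eq]
  simp only [adjp_pair]
  simp
  norm_num

theorem dualMat_6d : dualMat (Entry.e6d : Entry k).mat =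
    !![0, 0, 0, 0, 0, 0;
      0, 0, 0, 0, 0, 4;
      0, 0, 0, 4, 0, 0;
      0, 0, 0, 0, 0, 0;
      4, 0, 0, 0, 0, 0;
      0, 0, 0, 0, 0, 0] := by
  rw [Entry.mat_6d, dualMat_eq]
  simp only [adjp_pair]
  simp
  norm_num

theorem dualMat_5a : dualMat (Entry.e5a : Entry k).mat =
    !![0, 0, 0, 0, 0, 0;
      0, 0, 0, 0, 0, 0;
      0, 0, 0, 0, -2, 0;
      0, 0, 0, 0, 0, -2;
      0, 0, 1, 0, 0, 0;
      -2, 0, 0, 0, 0, 0] := by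
  rw [Entry.mat_5a, dualMat_eq]
  simp only [adjp_pair]
  simp
  norm_num

theorem dualMat_2a : dualMat (Entry.e2a : Entry k).mat =
    !![0, 0, 0, 0, 0, 0;
      0, 0, 0, 0, 0, 0;
      0, 0, 0, 0, 0, 0;
      0, 0, 0, 0, 0, -2;
      0, 0, 0, 0, 1, 0;
      0, 0, 0, -2, 0, 0] := by
  rw [Entry.mat_2a, dualMat_eq]
  simp only [adjp_pair]
  simp
  norm_num

theorem dualMat_2b : dualMat (Entry.e2b : Entry k).mat =
    !![0, 0, 0, 0, 0, 0;
      0, 0, 0, 0, 0, 0;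
      0, 0, 0, 0, 0, 4;
      0, 0, 0, 0, 0, -2;
      0, 0, 0, 0, 0, 0;
      0, 0, 0, 0, 0, 0] := by
  rw [Entry.mat_2b, dualMat_eq]
  simp only [adjp_pair]
  simp
  norm_num

theorem dualMat_4 : dualMat (Entry.e4 : Entry k).mat =
    !![0, 0, 0, 0, 0, -2;
      0, 0, 1, 0, 0, 0;
      0, 0, 0, 0, 0, 0;
      -2, 0, 0, 0, -4, 0;
      0, 0, 0, 0, 0, 4;
      0, 0, 0, 0, 0, 0] := by
  rw [Entry.mat_4, dualMat_eq]
  simp only [adjp_pair]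
  simp
  norm_num

end Values

end NetsOfConics

end

open MvPolynomial

noncomputable section

namespace NetsOfConics

/-! ### Values of the two invariants of degree twelve, and rank obstructions. -/

section Values

variable {k : Type*} [Field k]

theorem dualMat_8b (lam : k) (h : Permissible lam) : dualMat (Entry.e8b lam h).mat =
    !![-2 * lam ^ 2, 0, 0, 0, -4 * lam, 0; 0, lam ^ 2, 0, 0, 0, 4; 0, 0, lam ^ 2, 4, 0, 0;
      0, 0, -4 * lam, -2 * lam ^ 2, 0, 0; 4, 0, 0, 0, lam ^ 2, 0;
      0, -4 * lam, 0, 0, 0, -2 * lam ^ 2] := by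
  rw [Entry.mat_8b, dualMat_eq]
  simp only [adjp_pair]
  simp
  ring_nf
  simp only [and_self]

theorem aron_8a : aron (disc (Entry.e8a : Entry k).mat) = -16 := by
  simp [aron, disc, adjp_eq, Entry.mat_8a, Matrix.trace_fin_three]
  norm_num

theorem aron_8c : aron (disc (Entry.e8c : Entry k).mat) = -4096 := by
  simp [aron, disc, adjp_eq, Entry.mat_8c, Matrix.trace_fin_three]
  norm_num

theorem aron_7c : aron (disc (Entry.e7c : Entry k).mat) = -4096 := by
  simp [aron, disc, adjp_eq, Entry.mat_7c, Matrix.trace_fin_three]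
  norm_num

theorem aron_6d : aron (disc (Entry.e6d : Entry k).mat) = -4096 := by
  simp [aron, disc, adjp_eq, Entry.mat_6d, Matrix.trace_fin_three]
  norm_num

theorem aron_7a : aron (disc (Entry.e7a : Entry k).mat) = -16 := by
  simp [aron, disc, adjp_eq, Entry.mat_7a, Matrix.trace_fin_three]
  norm_num

theorem aron_6a : aron (disc (Entry.e6a : Entry k).mat) = -16 := by
  simp [aron, disc, adjp_eq, Entry.mat_6a, Matrix.trace_fin_three]
  norm_num

/-- With p = λ³(λ³ - 8)³ and q = (λ³ + 1)³ the two invariants are -16(p + 256q) and -8p, so their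
ratio determines p : q, that is, j. The values at `8a` are those for (p, q) = (1, 0), and the values
at `8c` those for (0, 1). -/
theorem aron_8b (lam : k) (h : Permissible lam) : aron (disc (Entry.e8b lam h).mat) =
    -16 * (lam ^ 3 * (lam ^ 3 - 8) ^ 3 + 256 * (lam ^ 3 + 1) ^ 3) := by
  simp [aron, disc, adjp_eq, Entry.mat_8b, Matrix.trace_fin_three]
  ring

theorem det_dualMat_8a : (dualMat (Entry.e8a : Entry k).mat).det = -8 := by
  rw [dualMat_8a]
  simp [Matrix.det_succ_row_zero, Fin.sum_univ_succ, Fin.succAbove]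
  norm_num

theorem det_dualMat_7a : (dualMat (Entry.e7a : Entry k).mat).det = -8 := by
  rw [dualMat_7a]
  simp [Matrix.det_succ_row_zero, Fin.sum_univ_succ, Fin.succAbove]
  norm_num

theorem det_dualMat_6a : (dualMat (Entry.e6a : Entry k).mat).det = -8 := by
  rw [dualMat_6a]
  simp [Matrix.det_succ_row_zero, Fin.sum_univ_succ, Fin.succAbove]
  norm_num

theorem det_dualMat_8c : (dualMat (Entry.e8c : Entry k).mat).det = 0 :=
  Matrix.det_eq_zero_of_row_eq_zero 0 fun j => by rw [dualMat_8c]; fin_cases j <;> rfl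

theorem det_dualMat_7c : (dualMat (Entry.e7c : Entry k).mat).det = 0 :=
  Matrix.det_eq_zero_of_row_eq_zero 0 fun j => by rw [dualMat_7c]; fin_cases j <;> rfl

theorem det_dualMat_6d : (dualMat (Entry.e6d : Entry k).mat).det = 0 :=
  Matrix.det_eq_zero_of_row_eq_zero 0 fun j => by rw [dualMat_6d]; fin_cases j <;> rfl

theorem det_dualMat_8b (lam : k) (h : Permissible lam) :
    (dualMat (Entry.e8b lam h).mat).det = -8 * (lam ^ 3 * (lam ^ 3 - 8) ^ 3) := by
  rw [dualMat_8b]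
  simp [Matrix.det_succ_row_zero, Fin.sum_univ_succ, Fin.succAbove]
  ring

variable [CharZero k]

/-- Only four columns of the matrix of `7c` are nonzero, while `7b` has a triangular 5×5 minor. -/
theorem not_specializesTo_7c_7b : ¬ SpecializesTo (Entry.e7c : Entry k).net Entry.e7b.net := by
  refine not_specializesTo_of_dualMat {0, 1, 3, 5} ?_ (n := 5) (by decide) ![0, 1, 2, 3, 4]
    ![0, 2, 3, 5, 1] ?_ ?_
  · intro r c hc
    rw [dualMat_7c]
    fin_cases c <;> simp at hc <;> fin_cases r <;> rfl
  · intro i j hij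
    rw [dualMat_7b]
    fin_cases i <;> fin_cases j <;> first | rfl | exact absurd hij (by decide)
  · intro i
    rw [dualMat_7b]
    fin_cases i <;> simp

theorem not_specializesTo_6d_6b : ¬ SpecializesTo (Entry.e6d : Entry k).net Entry.e6b.net := by
  refine not_specializesTo_of_dualMat {0, 3, 5} ?_ (n := 4) (by decide) ![2, 3, 4, 5]
    ![3, 5, 1, 0] ?_ ?_
  · intro r c hc
    rw [dualMat_6d]
    fin_cases c <;> simp at hc <;> fin_cases r <;> rfl
  · intro i j hij
    rw [dualMat_6b]
    fin_cases i <;> fin_cases j <;> first | rfl | exact absurd hij (by decide)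
  · intro i
    rw [dualMat_6b]
    fin_cases i <;> simp

theorem not_specializesTo_6d_6c : ¬ SpecializesTo (Entry.e6d : Entry k).net Entry.e6c.net := by
  refine not_specializesTo_of_dualMat {0, 3, 5} ?_ (n := 4) (by decide) ![3, 4, 0, 1]
    ![0, 4, 5, 2] ?_ ?_
  · intro r c hc
    rw [dualMat_6d]
    fin_cases c <;> simp at hc <;> fin_cases r <;> rfl
  · intro i j hij
    rw [dualMat_6c]
    fin_cases i <;> fin_cases j <;> first | rfl | exact absurd hij (by decide)
  · intro i
    rw [dualMat_6c]
    fin_cases i <;> simp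

theorem not_specializesTo_6d_5a : ¬ SpecializesTo (Entry.e6d : Entry k).net Entry.e5a.net := by
  refine not_specializesTo_of_dualMat {0, 3, 5} ?_ (n := 4) (by decide) ![2, 3, 4, 5]
    ![4, 5, 2, 0] ?_ ?_
  · intro r c hc
    rw [dualMat_6d]
    fin_cases c <;> simp at hc <;> fin_cases r <;> rfl
  · intro i j hij
    rw [dualMat_5a]
    fin_cases i <;> fin_cases j <;> first | rfl | exact absurd hij (by decide)
  · intro i
    rw [dualMat_5a]
    fin_cases i <;> simp

theorem not_specializesTo_2b_2a : ¬ SpecializesTo (Entry.e2b : Entry k).net Entry.e2a.net := by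
  refine not_specializesTo_of_dualMat {5} ?_ (n := 2) (by decide) ![3, 4] ![5, 4] ?_ ?_
  · intro r c hc
    rw [dualMat_2b]
    fin_cases c <;> simp at hc <;> fin_cases r <;> rfl
  · intro i j hij
    rw [dualMat_2a]
    fin_cases i <;> fin_cases j <;> first | rfl | exact absurd hij (by decide)
  · intro i
    rw [dualMat_2a]
    fin_cases i <;> simp

end Values

end NetsOfConics

end

open MvPolynomial

noncomputable section

namespace NetsOfConics

/-! ### Cubic forms generated by a net. -/

section Products

variable {k : Type*} [Field k]

/-- The coefficients (up to factorials) of the product of a coordinate with the quadratic form with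
a given Hessian matrix. -/
def productCoeff (A : Fin 3 → Matrix (Fin 3) (Fin 3) k) (r : Fin 3 × Fin 3)
    (m : Fin 3 × Fin 3 × Fin 3) : k :=
  (if r.2 = m.1 then A r.1 m.2.1 m.2.2 else 0) + (if r.2 = m.2.1 then A r.1 m.1 m.2.2 else 0) +
    (if r.2 = m.2.2 then A r.1 m.1 m.2.1 else 0)

/-- The third derivatives of a cubic form. -/
def thirdDeriv (m : Fin 3 × Fin 3 × Fin 3) : MvPolynomial (Fin 3) k →ₗ[k] k :=
  Matrix.entryLinearMap k k m.1 m.2.1 ∘ₗ hess ∘ₗ (pderiv m.2.2).toLinearMap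

/-- By the Leibniz rule, third derivatives of a variable times a conic are sums of Hessian entries
of the conic; hence minors of the multiplication map are polynomial functions of the Hessians. -/
theorem thirdDeriv_X_mul (A : Fin 3 → MvPolynomial (Fin 3) k) (r : Fin 3 × Fin 3)
    (m : Fin 3 × Fin 3 × Fin 3) :
    thirdDeriv m (X r.2 * A r.1) = productCoeff (fun i => hess (A i)) r m := by
  obtain ⟨i, j⟩ := r
  obtain ⟨a, b, c⟩ := m
  change constantCoeff (pderiv a (pderiv b (pderiv c (X j * A i)))) = _
  simp only [Derivation.leibniz, pderiv_X, Pi.single_apply, smul_eq_mul, map_add, map_mul,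
    constantCoeff_X, productCoeff, hess_apply]
  rw [pderiv_comm _ a b, pderiv_comm _ a c, pderiv_comm _ b c]
  split_ifs <;> simp <;> ring

/-- The products of the coordinates with the forms of an entry span a space of dimension at most
`m`. -/
def ProductsSpan (a : Entry k) (m : ℕ) : Prop :=
  ∃ s : Fin m → MvPolynomial (Fin 3) k, ∀ i j, X j * a.forms i ∈ Submodule.span k (Set.range s)

/-- There are `n` independent products of the coordinates with the forms of an entry, as witnessed
by a triangular matrix of coefficients. -/
def ProductsIndependent (a : Entry k) (n : ℕ) : Prop :=
  ∃ (e : Fin n → Fin 3 × Fin 3) (e' : Fin n → Fin 3 × Fin 3 × Fin 3),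
    (∀ i j, j < i → productCoeff a.mat (e i) (e' j) = 0) ∧
      ∀ i, productCoeff a.mat (e i) (e' i) ≠ 0

/-- The dimension of the space of cubics generated by a net can only drop under specialization,
since a nonzero minor of the multiplication map is an open condition. -/
theorem not_specializesTo_of_products [CharZero k] {a b : Entry k} {m n : ℕ}
    (ha : ProductsSpan a m) (hb : ProductsIndependent b n) (hmn : m < n) :
    ¬ SpecializesTo a.net b.net := by
  obtain ⟨s, hs⟩ := ha
  obtain ⟨e, e', htri, hdiag⟩ := hb
  rw [specializesTo_iff]
  let M : Triple k → Matrix (Fin n) (Fin n) k := fun q => Matrix.of fun r c =>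
    productCoeff (hessTriple q) (e r) (e' c)
  have hM : (fun q => (M q).det) ∈ polyFun k (Triple k) := by
    refine polyFun_det fun r c => ?_
    simp only [M, Matrix.of_apply, productCoeff]
    refine polyFun_add (polyFun_add ?_ ?_) ?_ <;> split_ifs <;>
      first | exact polyFun_hessTriple _ _ _ | exact polyFun_const _
  refine notMem_closure_of_polyFun hM (fun q hq => ?_) _ ?_
  · obtain ⟨g, hg⟩ := mem_orbit_iff_act.1 hq
    -- Each variable is the image under `g` of a linear form, so products with variables can be
    -- formed before the substitution.
    have hX : ∀ j, (X j : MvPolynomial (Fin 3) k) = subst g (lin ((g⁻¹).1 j)) := fun j => by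
      rw [← subst_X, subst_subst, inv_mul_cancel, subst_one]
    set S := (Submodule.span k (Set.range s)).map (subst g).toLinearMap with hS
    have hmem : ∀ i j, X j * (q.1 i).1 ∈ S := by
      intro i j
      have h1 : (q.1 i).1 ∈ (a.net.act g).carrier := hg ▸ spanNet_mem q i
      obtain ⟨p, hp, hpq⟩ := h1
      rw [← hpq, hX, AlgHom.toLinearMap_apply, ← map_mul]
      refine Submodule.mem_map_of_mem (f := (subst g).toLinearMap) ?_
      have hp' : p ∈ Submodule.span k (Set.range a.forms) := hp
      refine Submodule.span_induction (p := fun p _ => lin ((g⁻¹).1 j) * p ∈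
        Submodule.span k (Set.range s)) ?_ (by simp) (fun x y _ _ hx hy => ?_)
        (fun c x _ hx => ?_) hp'
      · rintro _ ⟨i, rfl⟩
        simp only [lin, Finset.sum_mul, ← smul_eq_C_mul, smul_mul_assoc]
        exact Submodule.sum_mem _ fun l _ => Submodule.smul_mem _ _ (hs i l)
      · rw [mul_add]; exact Submodule.add_mem _ hx hy
      · rw [mul_smul_comm]; exact Submodule.smul_mem _ _ hx
    by_contra hne
    have hli : LinearIndependent k fun r => X (e r).2 * (q.1 (e r).1).1 := by
      rw [Fintype.linearIndependent_iff]
      intro c hc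
      have h0 : Matrix.vecMul c (M q) = 0 := by
        ext x
        have := congrArg (thirdDeriv (e' x)) hc
        rw [map_sum, map_zero] at this
        simp only [map_smul, smul_eq_mul,
          thirdDeriv_X_mul (fun i => (q.1 i).1)] at this
        exact this
      exact fun i => congrFun (Matrix.eq_zero_of_vecMul_eq_zero hne h0) i
    have : Module.Finite k (Submodule.span k (Set.range s)) :=
      Module.Finite.span_of_finite k (Set.finite_range s)
    have hfin : Module.Finite k S := Module.Finite.map _ _
    have h1 := finrank_span_eq_card hli
    have h2 : Submodule.span k (Set.range fun r => X (e r).2 * (q.1 (e r).1).1) ≤ S := by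
      rw [Submodule.span_le]
      rintro _ ⟨r, rfl⟩
      exact hmem _ _
    have h3 := Submodule.finrank_mono h2
    have h4 : Module.finrank k S ≤ m := by
      have h5 := finrank_range_le_card (R := k) s
      rw [Fintype.card_fin] at h5
      exact (Submodule.finrank_map_le _ _).trans h5
    rw [h1, Fintype.card_fin] at h3
    omega
  · change (Matrix.det (Matrix.of fun r c => productCoeff b.mat (e r) (e' c))) ≠ 0
    rw [Matrix.det_of_isUpperTriangular (M := Matrix.of fun r c => productCoeff b.mat (e r) (e' c))
      (fun i j hij => htri i j hij)]
    exact Finset.prod_ne_zero_iff.2 fun i _ => hdiag i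

/-- Of the nine products two coincide: `Z * (X * Y)` and `Y * (X * Z)`. -/
theorem productsSpan_7a : ProductsSpan (Entry.e7a : Entry k) 8 := by
  refine ⟨![X 0 * (X 0 ^ 2 + X 1 * X 2), X 1 * (X 0 ^ 2 + X 1 * X 2), X 2 * (X 0 ^ 2 + X 1 * X 2),
    X 0 * (X 0 * X 1), X 1 * (X 0 * X 1), X 2 * (X 0 * X 1), X 0 * (X 0 * X 2),
    X 2 * (X 0 * X 2)], fun i j => Submodule.subset_span ⟨![![0, 3, 6], ![1, 4, 5], ![2, 5, 7]] j i, ?_⟩⟩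
  fin_cases i <;> fin_cases j <;> simp [Entry.forms] <;> ring

/-- The monomial `XYZ` arises three times among the nine products. -/
theorem productsSpan_6a : ProductsSpan (Entry.e6a : Entry k) 7 := by
  refine ⟨![X 0 * (X 0 * X 1), X 1 * (X 0 * X 1), X 0 * X 1 * X 2, X 0 * (X 0 * X 2),
    X 2 * (X 0 * X 2), X 1 * (X 1 * X 2), X 2 * (X 1 * X 2)],
    fun i j => Submodule.subset_span ⟨![![0, 3, 2], ![1, 2, 5], ![2, 4, 6]] j i, ?_⟩⟩
  fin_cases i <;> fin_cases j <;> simp [Entry.forms] <;> ring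

theorem productsSpan_2a : ProductsSpan (Entry.e2a : Entry k) 6 := by
  refine ⟨![X 0 * (X 0 * X 0), X 0 * (X 0 * X 1), X 0 * (X 0 * X 2), X 0 * (X 1 * X 1),
    X 0 * (X 1 * X 2), X 0 * (X 2 * X 2)],
    fun i j => Submodule.subset_span ⟨![![0, 1, 2], ![1, 3, 4], ![2, 4, 5]] j i, ?_⟩⟩
  fin_cases i <;> fin_cases j <;> simp [Entry.forms] <;> ring

variable [CharZero k]

theorem productsIndependent_7b : ProductsIndependent (Entry.e7b : Entry k) 9 := by
  refine ⟨![(0, 0), (0, 2), (1, 1), (1, 2), (2, 0), (0, 1), (1, 0), (2, 1), (2, 2)], ![(0, 0, 0), (0, 0, 2), (0, 1, 1), (0, 1, 2), (0, 2, 2), (1, 1, 2), (0, 0, 1), (1, 2, 2), (2, 2, 2)], ?_, ?_⟩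
  · intro i j hij
    rw [Entry.mat_7b]
    fin_cases i <;> fin_cases j <;>
      first | exact absurd hij (by decide) | simp [productCoeff]
  · intro i
    rw [Entry.mat_7b]
    fin_cases i <;> simp [productCoeff] <;> norm_num

theorem productsIndependent_6b : ProductsIndependent (Entry.e6b : Entry k) 8 := by
  refine ⟨![(0, 0), (1, 0), (0, 2), (1, 1), (2, 0), (1, 2), (2, 1), (2, 2)], ![(0, 0, 0), (0, 0, 1), (0, 0, 2), (0, 1, 1), (0, 2, 2), (0, 1, 2), (1, 1, 2), (1, 2, 2)], ?_, ?_⟩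
  · intro i j hij
    rw [Entry.mat_6b]
    fin_cases i <;> fin_cases j <;>
      first | exact absurd hij (by decide) | simp [productCoeff]
  · intro i
    rw [Entry.mat_6b]
    fin_cases i <;> simp [productCoeff] <;> norm_num

theorem productsIndependent_6c : ProductsIndependent (Entry.e6c : Entry k) 8 := by
  refine ⟨![(1, 0), (0, 1), (0, 2), (2, 1), (1, 2), (2, 2), (1, 1), (0, 0)], ![(0, 0, 0), (0, 1, 1), (0, 1, 2), (1, 1, 1), (1, 2, 2), (0, 0, 2), (1, 1, 2), (0, 0, 1)], ?_, ?_⟩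
  · intro i j hij
    rw [Entry.mat_6c]
    fin_cases i <;> fin_cases j <;>
      first | exact absurd hij (by decide) | simp [productCoeff]
  · intro i
    rw [Entry.mat_6c]
    fin_cases i <;> simp [productCoeff] <;> norm_num

theorem productsIndependent_5b : ProductsIndependent (Entry.e5b : Entry k) 8 := by
  refine ⟨![(0, 0), (1, 0), (0, 2), (1, 1), (1, 2), (2, 0), (2, 1), (2, 2)], ![(0, 0, 0), (0, 0, 1), (0, 0, 2), (0, 1, 1), (0, 1, 2), (0, 2, 2), (1, 2, 2), (2, 2, 2)], ?_, ?_⟩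
  · intro i j hij
    rw [Entry.mat_5b]
    fin_cases i <;> fin_cases j <;>
      first | exact absurd hij (by decide) | simp [productCoeff]
  · intro i
    rw [Entry.mat_5b]
    fin_cases i <;> simp [productCoeff] <;> norm_num

theorem productsIndependent_4 : ProductsIndependent (Entry.e4 : Entry k) 7 := by
  refine ⟨![(1, 0), (1, 1), (1, 2), (0, 1), (0, 2), (2, 1), (2, 2)], ![(0, 0, 0), (0, 0, 1), (0, 0, 2), (0, 1, 1), (0, 1, 2), (1, 1, 1), (1, 1, 2)], ?_, ?_⟩
  · intro i j hij
    rw [Entry.mat_4]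
    fin_cases i <;> fin_cases j <;>
      first | exact absurd hij (by decide) | simp [productCoeff]
  · intro i
    rw [Entry.mat_4]
    fin_cases i <;> simp [productCoeff] <;> norm_num

theorem productsIndependent_2b : ProductsIndependent (Entry.e2b : Entry k) 7 := by
  refine ⟨![(0, 0), (0, 1), (0, 2), (1, 1), (1, 2), (2, 1), (2, 2)], ![(0, 0, 0), (0, 0, 1), (0, 0, 2), (0, 1, 1), (0, 1, 2), (1, 1, 1), (1, 1, 2)], ?_, ?_⟩
  · intro i j hij
    rw [Entry.mat_2b]
    fin_cases i <;> fin_cases j <;>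
      first | exact absurd hij (by decide) | simp [productCoeff]
  · intro i
    rw [Entry.mat_2b]
    fin_cases i <;> simp [productCoeff] <;> norm_num

end Products

end NetsOfConics

end

open MvPolynomial

noncomputable section

namespace NetsOfConics

/-! ### Double lines in the Jacobian and discriminant cubics. -/

section BinaryCubic

variable {k : Type*} [Field k]

/-- The discriminant of the restriction of a cubic form to the line spanned by two vectors. -/
def lineDisc (F : (Fin 3 → k) → k) (u v : Fin 3 → k) : k :=
  let c₀ := F u
  let c₃ := F v
  -- The two middle coefficients of the restricted binary cubic are recovered from its values at `u
  -- + v` and `u - v`.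
  let c₁ := 2⁻¹ * (F (u + v) - F (u - v)) - c₃
  let c₂ := 2⁻¹ * (F (u + v) + F (u - v)) - c₀
  c₁ ^ 2 * c₂ ^ 2 - 4 * c₀ * c₂ ^ 3 - 4 * c₁ ^ 3 * c₃ - 27 * c₀ ^ 2 * c₃ ^ 2
    + 18 * c₀ * c₁ * c₂ * c₃

theorem polyFun_lineDisc {W : Type*} [AddCommGroup W] [Module k W] {F : W → (Fin 3 → k) → k}
    (hF : ∀ u, (fun w => F w u) ∈ polyFun k W) (u v : Fin 3 → k) :
    (fun w => lineDisc (F w) u v) ∈ polyFun k W := by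
  simp only [lineDisc]
  repeat' first
    | with_reducible exact hF _
    | with_reducible exact polyFun_const _
    | with_reducible refine polyFun_add ?_ ?_
    | with_reducible refine polyFun_sub ?_ ?_
    | with_reducible refine polyFun_mul ?_ ?_
    | with_reducible refine polyFun_pow ?_ _

/-- A double line cuts every other line in a repeated root. -/
theorem lineDisc_sq_mul [CharZero k] (a b : Module.Dual k (Fin 3 → k)) (u v : Fin 3 → k) :
    lineDisc (fun x => a x ^ 2 * b x) u v = 0 := by
  simp only [lineDisc, map_add, map_sub]
  field_simp
  ring

/-- The Jacobian determinant of a net. -/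
def jac (A : Fin 3 → Matrix (Fin 3) (Fin 3) k) (x : Fin 3 → k) : k :=
  (Matrix.of fun i => (A i).mulVec x).det

theorem jac_mix (h : Matrix (Fin 3) (Fin 3) k) (A : Fin 3 → Matrix (Fin 3) (Fin 3) k)
    (x : Fin 3 → k) : jac (mix h A) x = h.det * jac A x := by
  rw [jac, jac, ← Matrix.det_mul]
  congr 1
  ext i j
  simp [mix, Matrix.mul_apply, Matrix.mulVec, dotProduct, Fin.sum_univ_three]
  ring

theorem jac_conj (g : Matrix (Fin 3) (Fin 3) k) (A : Fin 3 → Matrix (Fin 3) (Fin 3) k)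
    (x : Fin 3 → k) : jac (conj g A) x = g.det * jac A (g.mulVec x) := by
  rw [jac, jac, mul_comm, ← Matrix.det_mul]
  congr 1
  ext i j
  simp only [conj, Matrix.of_apply, Matrix.mul_apply, ← Matrix.mulVec_mulVec]
  simp only [Matrix.mulVec, dotProduct, Matrix.transpose_apply]
  exact Finset.sum_congr rfl fun _ _ => mul_comm _ _

/-- The discriminant cubic of a net. -/
def discCubic (A : Fin 3 → Matrix (Fin 3) (Fin 3) k) (t : Fin 3 → k) : k :=
  (∑ i, t i • A i).det

theorem discCubic_mix (h : Matrix (Fin 3) (Fin 3) k) (A : Fin 3 → Matrix (Fin 3) (Fin 3) k)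
    (t : Fin 3 → k) : discCubic (mix h A) t = discCubic A (h.transpose.mulVec t) := by
  simp only [discCubic, mix, Finset.smul_sum, smul_smul]
  rw [Finset.sum_comm]
  simp only [← Finset.sum_smul, Matrix.mulVec, dotProduct, Matrix.transpose_apply, mul_comm]

theorem discCubic_conj (g : Matrix (Fin 3) (Fin 3) k) (A : Fin 3 → Matrix (Fin 3) (Fin 3) k)
    (t : Fin 3 → k) : discCubic (conj g A) t = g.det ^ 2 * discCubic A t := by
  have : ∑ i, t i • conj g A i = g.transpose * (∑ i, t i • A i) * g := by
    simp [conj, Finset.mul_sum, Finset.sum_mul]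
  rw [discCubic, this, Matrix.det_mul, Matrix.det_mul, Matrix.det_transpose, discCubic]
  ring

theorem jac_6b (x : Fin 3 → k) :
    jac (Entry.e6b : Entry k).mat x = 2 * x 0 ^ 2 * (x 1 + 2 * x 2) := by
  simp [jac, Matrix.det_fin_three, Entry.mat_6b, Matrix.mulVec, dotProduct, Fin.sum_univ_three]
  exact Or.inl (by ring)

theorem jac_6c (x : Fin 3 → k) :
    jac (Entry.e6c : Entry k).mat x = 2 * x 1 * (x 0 ^ 2 - x 1 ^ 2) := by
  simp [jac, Matrix.det_fin_three, Entry.mat_6c, Matrix.mulVec, dotProduct, Fin.sum_univ_three]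
  ring

theorem discCubic_6b (t : Fin 3 → k) :
    discCubic (Entry.e6b : Entry k).mat t = -2 * t 2 * (t 0 * t 2 + t 1 ^ 2) := by
  simp [discCubic, Matrix.det_fin_three, Entry.mat_6b, Fin.sum_univ_three]
  ring

theorem discCubic_6c (t : Fin 3 → k) :
    discCubic (Entry.e6c : Entry k).mat t = -2 * t 1 ^ 2 * (t 1 + t 2) := by
  simp [discCubic, Matrix.det_fin_three, Entry.mat_6c, Fin.sum_univ_three]
  ring

variable [CharZero k]

/-- The Jacobian cubic of `6b` contains a double line for every frame. That of `6c` consists of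
three distinct lines, which meet the line `Z = 0` in three distinct points. -/
theorem not_specializesTo_6b_6c : ¬ SpecializesTo (Entry.e6b : Entry k).net Entry.e6c.net := by
  refine not_specializesTo (f := fun A => lineDisc (jac A) ![1, 0, 0] ![0, 1, 0]) ?_
    (fun h g _ _ => ?_) ?_
  · refine polyFun_lineDisc (fun x => polyFun_det fun i j => ?_) _ _
    simp only [Matrix.of_apply, Matrix.mulVec, dotProduct]
    exact polyFun_sum fun c _ => polyFun_mul (polyFun_hessTriple _ _ _) (polyFun_const _)
  · let a : Module.Dual k (Fin 3 → k) := (LinearMap.proj 0 : Module.Dual k (Fin 3 → k)) ∘ₗ g.mulVecLin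
    let b : Module.Dual k (Fin 3 → k) :=
      (2 * h.det * g.det) • ((LinearMap.proj 1 + (2 : k) • LinearMap.proj 2 : Module.Dual k (Fin 3 → k)) ∘ₗ g.mulVecLin)
    have e : jac (mix h (conj g (Entry.e6b : Entry k).mat)) = fun x => a x ^ 2 * b x := by
      funext x
      rw [jac_mix, jac_conj, jac_6b]
      simp [a, b]
      ring
    simp only [e, lineDisc_sq_mul]
  · simp [lineDisc, jac_6c]

/-- Here the discriminant cubic decides: a double line and a line for `6c`, a conic and a line for
`6b`. On the chosen test line the latter restricts to a binary cubic with three distinct roots. -/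
theorem not_specializesTo_6c_6b : ¬ SpecializesTo (Entry.e6c : Entry k).net Entry.e6b.net := by
  refine not_specializesTo (f := fun A => lineDisc (discCubic A) ![0, 0, 1] ![1, 1, 0]) ?_
    (fun h g _ _ => ?_) ?_
  · refine polyFun_lineDisc (fun x => polyFun_det fun i j => ?_) _ _
    simp only [Matrix.sum_apply, Matrix.smul_apply, smul_eq_mul]
    exact polyFun_sum fun c _ => polyFun_mul (polyFun_const _) (polyFun_hessTriple _ _ _)
  · let a : Module.Dual k (Fin 3 → k) := (LinearMap.proj 1 : Module.Dual k (Fin 3 → k)) ∘ₗ h.transpose.mulVecLin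
    let b : Module.Dual k (Fin 3 → k) :=
      (-2 * g.det ^ 2) • ((LinearMap.proj 1 + (LinearMap.proj 2 : Module.Dual k (Fin 3 → k)) : Module.Dual k (Fin 3 → k)) ∘ₗ h.transpose.mulVecLin)
    have e : discCubic (mix h (conj g (Entry.e6c : Entry k).mat)) = fun x => a x ^ 2 * b x := by
      funext x
      rw [discCubic_mix, discCubic_conj, discCubic_6c]
      simp [a, b, Matrix.mulVec_transpose]
      ring
    simp only [e, lineDisc_sq_mul]
  · simp [lineDisc, discCubic_6b]

theorem not_specializesTo_2b_4 : ¬ SpecializesTo (Entry.e2b : Entry k).net Entry.e4.net := by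
  refine not_specializesTo_of_dualMat {5} ?_ (n := 2) (by decide) ![0, 1] ![5, 2] ?_ ?_
  · intro r c hc
    rw [dualMat_2b]
    fin_cases c <;> simp at hc <;> fin_cases r <;> rfl
  · intro i j hij
    rw [dualMat_4]
    fin_cases i <;> fin_cases j <;> first | rfl | exact absurd hij (by decide)
  · intro i
    rw [dualMat_4]
    fin_cases i <;> simp

end BinaryCubic

end NetsOfConics

end

open MvPolynomial

noncomputable section

namespace NetsOfConics

/-! ### Symmetries of the Hesse pencil and the j-invariant. -/

section HessePencil

variable {k : Type*} [Field k] [CharZero k]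

theorem mem_orbit_of_realizes {V : Net k} {q : Fin 3 → MvPolynomial (Fin 3) k} {a : Entry k}
    (hq : ∀ i, q i ∈ V.carrier) (h : Realizes q a) : V ∈ orbit a.net := by
  obtain ⟨g, hg⟩ := h
  refine mem_orbit_net_iff.2 ⟨g, fun i => ?_⟩
  exact (Submodule.span_le.2 (by rintro _ ⟨i, rfl⟩; exact hq i) : Submodule.span k _ ≤ _) (hg i)

theorem Entry.forms_mem_net (a : Entry k) (i : Fin 3) : a.forms i ∈ a.net.carrier :=
  spanNet_mem _ i

theorem orbit_eq_of_realizes {a b : Entry k} (h : Realizes b.forms a) :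
    orbit a.net = orbit b.net :=
  (orbit_eq_of_mem (mem_orbit_of_realizes b.forms_mem_net h)).symm

theorem exists_cubeRoot [IsAlgClosed k] : ∃ w : k, w ^ 2 + w + 1 = 0 := by
  obtain ⟨z, hz⟩ := IsAlgClosed.exists_pow_nat_eq (-3 : k) (n := 2) (by norm_num)
  exact ⟨(z - 1) / 2, by field_simp; linear_combination hz⟩

omit [CharZero k] in
theorem cubeRoot_cases {w : k} (hw : w ^ 2 + w + 1 = 0) {x y : k} (h : x ^ 3 = y ^ 3) :
    x = y ∨ x = w * y ∨ x = w * (w * y) := by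
  have : (x - y) * ((x - w * y) * (x - w * (w * y))) = 0 := by
    linear_combination h + (-x * (x - y) * y + (w - 1) * (x - y) * y ^ 2) * hw
  rcases mul_eq_zero.1 this with h | h
  · exact Or.inl (sub_eq_zero.1 h)
  · rcases mul_eq_zero.1 h with h | h
    · exact Or.inr (Or.inl (sub_eq_zero.1 h))
    · exact Or.inr (Or.inr (sub_eq_zero.1 h))

/-- Scaling `Z` by a cube root of unity multiplies the parameter by it. -/
theorem orbit_8b_mul_cubeRoot {w : k} (hw : w ^ 2 + w + 1 = 0) {l m : k} (hl : Permissible l)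
    (hm : Permissible m) (h : m = w * l) :
    orbit (Entry.e8b l hl).net = orbit (Entry.e8b m hm).net := by
  have hw3 : w ^ 3 = 1 := by linear_combination (w - 1) * hw
  have hw0 : w ≠ 0 := by rintro rfl; simp at hw
  have hC : (C w : MvPolynomial (Fin 3) k) ^ 3 = 1 := by rw [← C_pow, hw3, C_1]
  subst h
  refine orbit_eq_of_realizes (realizes_of_matrix !![1, 0, 0; 0, 1, 0; 0, 0, w] ?_ one_ne_zero
    !![1, 0, 0; 0, 1, 0; 0, 0, w ^ 2] fun i => ?_)
  · simp [Matrix.det_fin_three, hw0]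
  · fin_cases i <;> simp [Entry.forms, lin_eq, Fin.sum_univ_three]
    · ring
    · ring
    · linear_combination -(C l * X 0 * X 1) * hC

/-- The discrete Fourier transform preserves the Hesse pencil and acts on its parameter by λ ↦ (2 -
λ)/(1 + λ). -/
theorem orbit_8b_fourier {w : k} (hw : w ^ 2 + w + 1 = 0) {l m : k} (hl : Permissible l)
    (hm : Permissible m) (h : (1 + l) * m = 2 - l) :
    orbit (Entry.e8b l hl).net = orbit (Entry.e8b m hm).net := by
  have hC : (C w : MvPolynomial (Fin 3) k) ^ 2 + C w + 1 = 0 := by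
    simpa using congrArg (C (σ := Fin 3)) hw
  have hm' : (1 + C l : MvPolynomial (Fin 3) k) * C m = 2 - C l := by
    simpa [map_ofNat] using congrArg (C (σ := Fin 3)) h
  refine orbit_eq_of_realizes (realizes_of_matrix !![1, 1, 1; 1, w, w ^ 2; 1, w ^ 2, w] ?_
    one_ne_zero
    !![1 + l, 1 + l, 1 + l; 1 + l, (1 + l) * w ^ 2, (1 + l) * w; 1 + l, (1 + l) * w, (1 + l) * w ^ 2]
    fun i => ?_)
  · intro h0
    have : (9 : k) * (-3) = 0 := by
      have h1 : (Matrix.det !![1, 1, 1; 1, w, w ^ 2; 1, w ^ 2, w]) ^ 2 = -27 := by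
        simp [Matrix.det_fin_three]
        have hw3 : w ^ 3 = 1 := by linear_combination (w - 1) * hw
        grind
      rw [h0] at h1
      linear_combination -h1
    norm_num at this
  · fin_cases i <;> simp [Entry.forms, lin_eq, Fin.sum_univ_three]
    · grind
    · grind
    · grind

omit [CharZero k] in
theorem prod_cubeRoot {w : k} (hw : w ^ 2 + w + 1 = 0) (p q r : k) :
    (p + q + r) * ((p + q * w + r * w ^ 2) * (p + q * w ^ 2 + r * w)) =
      p ^ 3 + q ^ 3 + r ^ 3 - 3 * p * q * r := by
  have hw3 : w ^ 3 = 1 := by linear_combination (w - 1) * hw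
  have h2 : w ^ 2 = -w - 1 := by linear_combination hw
  have : (p + q * w + r * w ^ 2) * (p + q * w ^ 2 + r * w) =
      p ^ 2 + q ^ 2 + r ^ 2 - p * q - q * r - p * r := by
    linear_combination (q ^ 2 + r ^ 2) * hw3 + q * r * w * hw3 + (p * q + p * r + q * r) * hw
  rw [this]
  ring

theorem orbit_8b_of_cube_eq [IsAlgClosed k] {l m : k} (hl : Permissible l) (hm : Permissible m)
    (h : m ^ 3 = l ^ 3) : orbit (Entry.e8b l hl).net = orbit (Entry.e8b m hm).net := by
  obtain ⟨w, hw⟩ := exists_cubeRoot (k := k)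
  have hw3 : w ^ 3 = 1 := by linear_combination (w - 1) * hw
  rcases cubeRoot_cases hw h with rfl | rfl | rfl
  · rfl
  · exact orbit_8b_mul_cubeRoot hw hl hm rfl
  · have hl' : Permissible (w * l) := by
      have : (w * l) ^ 3 = l ^ 3 := by rw [mul_pow, hw3, one_mul]
      refine ⟨fun h0 => hl.1 ?_, this ▸ hl.2.1, this ▸ hl.2.2⟩
      rw [h0] at this
      exact pow_eq_zero_iff (n := 3) (by norm_num) |>.1 (by rw [← this]; simp)
    exact (orbit_8b_mul_cubeRoot hw hl hl' rfl).trans (orbit_8b_mul_cubeRoot hw hl' hm rfl)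

/-- Multiplication by cube roots of unity and the Fourier involution generate a group of order
twelve on the parameter line. Since j has degree twelve, its fibres are the orbits of this group. -/
theorem orbit_8b_of_jInv_eq [IsAlgClosed k] {l m : k} (hl : Permissible l) (hm : Permissible m)
    (h : jInv l = jInv m) : orbit (Entry.e8b l hl).net = orbit (Entry.e8b m hm).net := by
  obtain ⟨w, hw⟩ := exists_cubeRoot (k := k)
  have hw3 : w ^ 3 = 1 := by linear_combination (w - 1) * hw
  have hl1 : l ^ 3 + 1 ≠ 0 := fun h => hl.2.1 (eq_neg_of_add_eq_zero_left h)
  have hm1 : m ^ 3 + 1 ≠ 0 := fun h => hm.2.1 (eq_neg_of_add_eq_zero_left h)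
  have h1 : l ^ 3 * (l ^ 3 - 8) ^ 3 * (m ^ 3 + 1) ^ 3 =
      m ^ 3 * (m ^ 3 - 8) ^ 3 * (l ^ 3 + 1) ^ 3 := by
    rw [jInv, jInv, div_eq_div_iff (by simpa using hl1) (by simpa using hm1)] at h
    refine mul_left_cancel₀ (show (27 : k) ≠ 0 by norm_num) ?_
    linear_combination h
  -- Modulo `x ^ 3 = l ^ 3` this expression is quadratic in `x`, so its product over the three cube
  -- roots is the norm evaluated by `prod_cubeRoot`.
  have hP : ∀ x : k, x ^ 3 = l ^ 3 → m ^ 3 * (1 + x) ^ 3 - (2 - x) ^ 3 =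
      (m ^ 3 - 8 + (m ^ 3 + 1) * l ^ 3) + 3 * (m ^ 3 + 4) * x + 3 * (m ^ 3 - 2) * x ^ 2 :=
    fun x hx => by linear_combination (m ^ 3 + 1) * hx
  have e1 : (w * l) ^ 3 = l ^ 3 := by rw [mul_pow, hw3, one_mul]
  have e2 : (w ^ 2 * l) ^ 3 = l ^ 3 := by linear_combination l ^ 3 * (w ^ 3 + 1) * hw3
  -- Equality of j is an equation of degree four in `m ^ 3`. Its roots are `l ^ 3` and the cubes of
  -- `(2 - x) / (1 + x)`, where `x` runs over the cube roots of `l ^ 3`.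
  have key : (m ^ 3 - l ^ 3) * ((m ^ 3 * (1 + l) ^ 3 - (2 - l) ^ 3) *
      ((m ^ 3 * (1 + w * l) ^ 3 - (2 - w * l) ^ 3) *
        (m ^ 3 * (1 + w ^ 2 * l) ^ 3 - (2 - w ^ 2 * l) ^ 3))) = 0 := by
    rw [hP l rfl, hP _ e1, hP _ e2]
    have := prod_cubeRoot hw (m ^ 3 - 8 + (m ^ 3 + 1) * l ^ 3) (3 * (m ^ 3 + 4) * l)
      (3 * (m ^ 3 - 2) * l ^ 2)
    have e4 : (w ^ 2 * l) ^ 2 = w * l ^ 2 := by linear_combination w * l ^ 2 * hw3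
    rw [e4]
    linear_combination (m ^ 3 - l ^ 3) * this - h1
  have main : ∀ x : k, x ^ 3 = l ^ 3 → m ^ 3 * (1 + x) ^ 3 - (2 - x) ^ 3 = 0 →
      orbit (Entry.e8b l hl).net = orbit (Entry.e8b m hm).net := by
    intro x hx h0
    have hxp : Permissible x := by
      refine ⟨fun h0 => hl.1 ?_, hx ▸ hl.2.1, hx ▸ hl.2.2⟩
      rw [h0] at hx
      exact pow_eq_zero_iff (n := 3) (by norm_num) |>.1 (by rw [← hx]; simp)
    have hx1 : 1 + x ≠ 0 := fun h => hxp.2.1 (by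
      rw [show x = -1 by linear_combination h]; norm_num)
    have hn : m ^ 3 = ((2 - x) / (1 + x)) ^ 3 := by
      rw [div_pow, eq_div_iff (pow_ne_zero _ hx1)]
      linear_combination h0
    have hnp : Permissible ((2 - x) / (1 + x)) := by
      refine ⟨fun h0 => hm.1 ?_, hn ▸ hm.2.1, hn ▸ hm.2.2⟩
      rw [h0] at hn
      exact pow_eq_zero_iff (n := 3) (by norm_num) |>.1 (by rw [hn]; simp)
    exact (orbit_8b_of_cube_eq hl hxp hx).trans ((orbit_8b_fourier hw hxp hnp
      (mul_div_cancel₀ _ hx1)).trans (orbit_8b_of_cube_eq hnp hm hn))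
  rcases mul_eq_zero.1 key with h | h
  · exact orbit_8b_of_cube_eq hl hm (sub_eq_zero.1 h)
  rcases mul_eq_zero.1 h with h | h
  · exact main l rfl h
  rcases mul_eq_zero.1 h with h | h
  · exact main _ e1 h
  · exact main _ e2 h

end HessePencil

end NetsOfConics

end

open MvPolynomial

noncomputable section

namespace NetsOfConics

/-! ### The specialization order on the table. -/

section Order

variable {k : Type*} [Field k] [CharZero k]

/-- After cross-multiplying the ratios of invariants the products p·p cancel, and the cross terms
that remain say that p : q is the same for both parameters. -/
theorem jInv_eq_of_specializesTo {l m : k} {hl : Permissible l} {hm : Permissible m}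
    (h : SpecializesTo (Entry.e8b l hl).net (Entry.e8b m hm).net) : jInv l = jInv m := by
  have h1 := invariants_of_specializesTo h
  rw [aron_8b, aron_8b, det_dualMat_8b, det_dualMat_8b] at h1
  have hl1 : l ^ 3 + 1 ≠ 0 := fun h => hl.2.1 (eq_neg_of_add_eq_zero_left h)
  have hm1 : m ^ 3 + 1 ≠ 0 := fun h => hm.2.1 (eq_neg_of_add_eq_zero_left h)
  rw [jInv, jInv, div_eq_div_iff (by simpa using hl1) (by simpa using hm1)]
  linear_combination (27 / (8 * 16 * 256)) * h1

/-- Since `8a` behaves as j = ∞, equal ratios would force `m ^ 3 = -1`. The same reasoning covers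
`7a` and `6a`, which share the invariants of `8a`. -/
theorem not_specializesTo_8a_8b {m : k} {hm : Permissible m} :
    ¬ SpecializesTo (Entry.e8a : Entry k).net (Entry.e8b m hm).net := fun h => by
  have h1 := invariants_of_specializesTo h
  rw [aron_8b, aron_8a, det_dualMat_8b, det_dualMat_8a] at h1
  have hm1 : m ^ 3 + 1 ≠ 0 := fun h => hm.2.1 (eq_neg_of_add_eq_zero_left h)
  exact pow_ne_zero 3 hm1 (by linear_combination (1 / (8 * 16 * 256)) * h1)

theorem not_specializesTo_8b_8a {l : k} {hl : Permissible l} :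
    ¬ SpecializesTo (Entry.e8b l hl).net (Entry.e8a : Entry k).net := fun h => by
  have h1 := invariants_of_specializesTo h
  rw [aron_8b, aron_8a, det_dualMat_8b, det_dualMat_8a] at h1
  have hl1 : l ^ 3 + 1 ≠ 0 := fun h => hl.2.1 (eq_neg_of_add_eq_zero_left h)
  exact pow_ne_zero 3 hl1 (by linear_combination (-1 / (8 * 16 * 256)) * h1)

theorem not_specializesTo_8b_7a {l : k} {hl : Permissible l} :
    ¬ SpecializesTo (Entry.e8b l hl).net (Entry.e7a : Entry k).net := fun h => by
  have h1 := invariants_of_specializesTo h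
  rw [aron_8b, aron_7a, det_dualMat_8b, det_dualMat_7a] at h1
  have hl1 : l ^ 3 + 1 ≠ 0 := fun h => hl.2.1 (eq_neg_of_add_eq_zero_left h)
  exact pow_ne_zero 3 hl1 (by linear_combination (-1 / (8 * 16 * 256)) * h1)

theorem not_specializesTo_8b_6a {l : k} {hl : Permissible l} :
    ¬ SpecializesTo (Entry.e8b l hl).net (Entry.e6a : Entry k).net := fun h => by
  have h1 := invariants_of_specializesTo h
  rw [aron_8b, aron_6a, det_dualMat_8b, det_dualMat_6a] at h1
  have hl1 : l ^ 3 + 1 ≠ 0 := fun h => hl.2.1 (eq_neg_of_add_eq_zero_left h)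
  exact pow_ne_zero 3 hl1 (by linear_combination (-1 / (8 * 16 * 256)) * h1)

/-- If exactly one of the two determinants vanishes, proportionality would force the Aronhold
invariant on that side to vanish as well. -/
theorem not_specializesTo_of_invariants {a b : Entry k}
    (ha : (dualMat a.mat).det = 0 ↔ (dualMat b.mat).det ≠ 0)
    (ha' : aron (disc a.mat) ≠ 0 ∨ (dualMat b.mat).det = 0)
    (hb' : aron (disc b.mat) ≠ 0 ∨ (dualMat a.mat).det = 0) : ¬ SpecializesTo a.net b.net := by
  intro h
  have := invariants_of_specializesTo h
  by_cases h0 : (dualMat b.mat).det = 0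
  · have h1 : (dualMat a.mat).det ≠ 0 := fun h => ha.1 h h0
    simp_all
  · have h1 := ha.2 h0
    simp_all

theorem not_specializesTo_8a_8c : ¬ SpecializesTo (Entry.e8a : Entry k).net Entry.e8c.net :=
  not_specializesTo_of_invariants (by simp [det_dualMat_8a, det_dualMat_8c]) (by simp [aron_8a])
    (by simp [aron_8c])

theorem not_specializesTo_8a_7c : ¬ SpecializesTo (Entry.e8a : Entry k).net Entry.e7c.net :=
  not_specializesTo_of_invariants (by simp [det_dualMat_8a, det_dualMat_7c]) (by simp [aron_8a])
    (by simp [aron_7c])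

theorem not_specializesTo_8a_6d : ¬ SpecializesTo (Entry.e8a : Entry k).net Entry.e6d.net :=
  not_specializesTo_of_invariants (by simp [det_dualMat_8a, det_dualMat_6d]) (by simp [aron_8a])
    (by simp [aron_6d])

theorem not_specializesTo_8c_8a : ¬ SpecializesTo (Entry.e8c : Entry k).net Entry.e8a.net :=
  not_specializesTo_of_invariants (by simp [det_dualMat_8a, det_dualMat_8c]) (by simp [aron_8c])
    (by simp [aron_8a])

theorem not_specializesTo_8c_7a : ¬ SpecializesTo (Entry.e8c : Entry k).net Entry.e7a.net :=
  not_specializesTo_of_invariants (by simp [det_dualMat_7a, det_dualMat_8c]) (by simp [aron_8c])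
    (by simp [aron_7a])

theorem not_specializesTo_8c_6a : ¬ SpecializesTo (Entry.e8c : Entry k).net Entry.e6a.net :=
  not_specializesTo_of_invariants (by simp [det_dualMat_6a, det_dualMat_8c]) (by simp [aron_8c])
    (by simp [aron_6a])

theorem det_dualMat_8b_ne_zero {l : k} {hl : Permissible l} :
    (dualMat (Entry.e8b l hl).mat).det ≠ 0 := by
  rw [det_dualMat_8b]
  have := hl.1
  have := sub_ne_zero.2 hl.2.2
  simp_all

theorem not_specializesTo_8c_8b {m : k} {hm : Permissible m} :
    ¬ SpecializesTo (Entry.e8c : Entry k).net (Entry.e8b m hm).net :=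
  not_specializesTo_of_invariants (by simp [det_dualMat_8b_ne_zero, det_dualMat_8c])
    (by simp [aron_8c]) (by simp [det_dualMat_8c])

theorem not_specializesTo_8b_8c {m : k} {hm : Permissible m} :
    ¬ SpecializesTo (Entry.e8b m hm).net (Entry.e8c : Entry k).net :=
  not_specializesTo_of_invariants (by simp [det_dualMat_8b_ne_zero, det_dualMat_8c])
    (by simp [det_dualMat_8c]) (by simp [aron_8c])

theorem not_specializesTo_8b_7c {m : k} {hm : Permissible m} :
    ¬ SpecializesTo (Entry.e8b m hm).net (Entry.e7c : Entry k).net :=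
  not_specializesTo_of_invariants (by simp [det_dualMat_8b_ne_zero, det_dualMat_7c])
    (by simp [det_dualMat_7c]) (by simp [aron_7c])

theorem not_specializesTo_8b_6d {m : k} {hm : Permissible m} :
    ¬ SpecializesTo (Entry.e8b m hm).net (Entry.e6d : Entry k).net :=
  not_specializesTo_of_invariants (by simp [det_dualMat_8b_ne_zero, det_dualMat_6d])
    (by simp [det_dualMat_6d]) (by simp [aron_6d])

theorem not_specializesTo_7a_7b : ¬ SpecializesTo (Entry.e7a : Entry k).net Entry.e7b.net :=
  not_specializesTo_of_products productsSpan_7a productsIndependent_7b (by norm_num)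

theorem not_specializesTo_6a_6b : ¬ SpecializesTo (Entry.e6a : Entry k).net Entry.e6b.net :=
  not_specializesTo_of_products productsSpan_6a productsIndependent_6b (by norm_num)

theorem not_specializesTo_6a_6c : ¬ SpecializesTo (Entry.e6a : Entry k).net Entry.e6c.net :=
  not_specializesTo_of_products productsSpan_6a productsIndependent_6c (by norm_num)

theorem not_specializesTo_6a_5b : ¬ SpecializesTo (Entry.e6a : Entry k).net Entry.e5b.net :=
  not_specializesTo_of_products productsSpan_6a productsIndependent_5b (by norm_num)

theorem not_specializesTo_2a_4 : ¬ SpecializesTo (Entry.e2a : Entry k).net Entry.e4.net :=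
  not_specializesTo_of_products productsSpan_2a productsIndependent_4 (by norm_num)

theorem not_specializesTo_2a_2b : ¬ SpecializesTo (Entry.e2a : Entry k).net Entry.e2b.net :=
  not_specializesTo_of_products productsSpan_2a productsIndependent_2b (by norm_num)

/-- Reachability along the arrows. -/
abbrev Reaches (a b : Entry k) : Prop := Relation.ReflTransGen Arrow a b

omit [CharZero k] in
theorem Reaches.single {a b : Entry k} (h : Arrow a b) : Reaches a b := Relation.ReflTransGen.single h

theorem Reaches.specializesTo {a b : Entry k} (h : Reaches a b) : SpecializesTo a.net b.net := by
  induction h with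
  | refl => exact specializesTo_refl _
  | tail _ h ih => exact ih.trans h.degenerates.specializesTo

/-- A specialization from `a'` to `b'` could be extended at both ends to one from `a` to `b`. Each
basic obstruction thus excludes every source below `a` paired with every target above `b`. -/
theorem not_specializesTo_of_reaches {a a' b b' : Entry k}
    (h : ¬ SpecializesTo a.net b.net) (ha : Reaches a a') (hb : Reaches b' b) :
    ¬ SpecializesTo a'.net b'.net := fun h' =>
  h (ha.specializesTo.trans (h'.trans hb.specializesTo))

/-- This and the fourteen analogous lemmas below decide every pair of the table: either a chain of
arrows is displayed, or a basic obstruction is transported by `not_specializesTo_of_reaches`. -/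
theorem reaches_of_specializesTo_8a {b : Entry k}
    (h : SpecializesTo (Entry.e8a : Entry k).net b.net) :
    SameEntry (Entry.e8a : Entry k) b ∨ Relation.TransGen Arrow (Entry.e8a : Entry k) b := by
  cases b with
  | e8a => exact .inl (.refl _)
  | e8b _ _ => exact absurd h not_specializesTo_8a_8b
  | e8c => exact absurd h not_specializesTo_8a_8c
  | e7a => exact .inr (.head' .a_8a_7a .refl)
  | e7b => exact .inr (.head' .a_8a_7b .refl)
  | e7c => exact absurd h not_specializesTo_8a_7c
  | e6a => exact .inr (.head' .a_8a_7a (.head .a_7a_6a .refl))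
  | e6b => exact .inr (.head' .a_8a_7a (.head .a_7a_6b .refl))
  | e6c => exact .inr (.head' .a_8a_7a (.head .a_7a_6c .refl))
  | e6d => exact absurd h not_specializesTo_8a_6d
  | e5a => exact .inr (.head' .a_8a_7a (.head .a_7a_6a (.head .a_6a_5a .refl)))
  | e5b => exact .inr (.head' .a_8a_7a (.head .a_7a_6b (.head .a_6b_5b .refl)))
  | e4 => exact .inr (.head' .a_8a_7a (.head .a_7a_6a (.head .a_6a_5a (.head .a_5a_4 .refl))))
  | e2a => exact .inr (.head' .a_8a_7a (.head .a_7a_6a (.head .a_6a_5a (.head .a_5a_4 (.head .a_4_2a .refl)))))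
  | e2b => exact .inr (.head' .a_8a_7a (.head .a_7a_6a (.head .a_6a_5a (.head .a_5a_4 (.head .a_4_2b .refl)))))

theorem reaches_of_specializesTo_8b {l : k} {hl : Permissible l} {b : Entry k}
    (h : SpecializesTo (Entry.e8b l hl).net b.net) :
    SameEntry (Entry.e8b l hl) b ∨ Relation.TransGen Arrow (Entry.e8b l hl) b := by
  cases b with
  | e8a => exact absurd h not_specializesTo_8b_8a
  | e8b _ _ => exact .inl (.family _ _ _ _ (jInv_eq_of_specializesTo h))
  | e8c => exact absurd h not_specializesTo_8b_8c
  | e7a => exact absurd h not_specializesTo_8b_7a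
  | e7b => exact .inr (.head' (.a_8b_7b _ _) .refl)
  | e7c => exact absurd h not_specializesTo_8b_7c
  | e6a => exact absurd h not_specializesTo_8b_6a
  | e6b => exact .inr (.head' (.a_8b_7b _ _) (.head .a_7b_6b .refl))
  | e6c => exact .inr (.head' (.a_8b_7b _ _) (.head .a_7b_6c .refl))
  | e6d => exact absurd h not_specializesTo_8b_6d
  | e5a => exact .inr (.head' (.a_8b_7b _ _) (.head .a_7b_6b (.head .a_6b_5a .refl)))
  | e5b => exact .inr (.head' (.a_8b_7b _ _) (.head .a_7b_6b (.head .a_6b_5b .refl)))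
  | e4 => exact .inr (.head' (.a_8b_7b _ _) (.head .a_7b_6b (.head .a_6b_5a (.head .a_5a_4 .refl))))
  | e2a => exact .inr (.head' (.a_8b_7b _ _) (.head .a_7b_6b (.head .a_6b_5a (.head .a_5a_4 (.head .a_4_2a .refl)))))
  | e2b => exact .inr (.head' (.a_8b_7b _ _) (.head .a_7b_6b (.head .a_6b_5a (.head .a_5a_4 (.head .a_4_2b .refl)))))

theorem reaches_of_specializesTo_8c {b : Entry k}
    (h : SpecializesTo (Entry.e8c : Entry k).net b.net) :
    SameEntry (Entry.e8c : Entry k) b ∨ Relation.TransGen Arrow (Entry.e8c : Entry k) b := by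
  cases b with
  | e8a => exact absurd h not_specializesTo_8c_8a
  | e8b _ _ => exact absurd h not_specializesTo_8c_8b
  | e8c => exact .inl (.refl _)
  | e7a => exact absurd h not_specializesTo_8c_7a
  | e7b => exact .inr (.head' .a_8c_7b .refl)
  | e7c => exact .inr (.head' .a_8c_7c .refl)
  | e6a => exact absurd h not_specializesTo_8c_6a
  | e6b => exact .inr (.head' .a_8c_7b (.head .a_7b_6b .refl))
  | e6c => exact .inr (.head' .a_8c_7b (.head .a_7b_6c .refl))
  | e6d => exact .inr (.head' .a_8c_7c (.head .a_7c_6d .refl))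
  | e5a => exact .inr (.head' .a_8c_7b (.head .a_7b_6b (.head .a_6b_5a .refl)))
  | e5b => exact .inr (.head' .a_8c_7b (.head .a_7b_6b (.head .a_6b_5b .refl)))
  | e4 => exact .inr (.head' .a_8c_7b (.head .a_7b_6b (.head .a_6b_5a (.head .a_5a_4 .refl))))
  | e2a => exact .inr (.head' .a_8c_7b (.head .a_7b_6b (.head .a_6b_5a (.head .a_5a_4 (.head .a_4_2a .refl)))))
  | e2b => exact .inr (.head' .a_8c_7b (.head .a_7b_6b (.head .a_6b_5a (.head .a_5a_4 (.head .a_4_2b .refl)))))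

theorem reaches_of_specializesTo_7a {b : Entry k}
    (h : SpecializesTo (Entry.e7a : Entry k).net b.net) :
    SameEntry (Entry.e7a : Entry k) b ∨ Relation.TransGen Arrow (Entry.e7a : Entry k) b := by
  cases b with
  | e8a =>
    exact absurd h (not_specializesTo_of_reaches not_specializesTo_7a_7b .refl (.head .a_8a_7b .refl))
  | e8b _ _ =>
    exact absurd h (not_specializesTo_of_reaches not_specializesTo_8a_8b (.head .a_8a_7a .refl) .refl)
  | e8c =>
    exact absurd h (not_specializesTo_of_reaches not_specializesTo_8a_8c (.head .a_8a_7a .refl) .refl)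
  | e7a => exact .inl (.refl _)
  | e7b => exact absurd h not_specializesTo_7a_7b
  | e7c =>
    exact absurd h (not_specializesTo_of_reaches not_specializesTo_8a_7c (.head .a_8a_7a .refl) .refl)
  | e6a => exact .inr (.head' .a_7a_6a .refl)
  | e6b => exact .inr (.head' .a_7a_6b .refl)
  | e6c => exact .inr (.head' .a_7a_6c .refl)
  | e6d =>
    exact absurd h (not_specializesTo_of_reaches not_specializesTo_8a_6d (.head .a_8a_7a .refl) .refl)
  | e5a => exact .inr (.head' .a_7a_6a (.head .a_6a_5a .refl))
  | e5b => exact .inr (.head' .a_7a_6b (.head .a_6b_5b .refl))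
  | e4 => exact .inr (.head' .a_7a_6a (.head .a_6a_5a (.head .a_5a_4 .refl)))
  | e2a => exact .inr (.head' .a_7a_6a (.head .a_6a_5a (.head .a_5a_4 (.head .a_4_2a .refl))))
  | e2b => exact .inr (.head' .a_7a_6a (.head .a_6a_5a (.head .a_5a_4 (.head .a_4_2b .refl))))

theorem reaches_of_specializesTo_7b {b : Entry k}
    (h : SpecializesTo (Entry.e7b : Entry k).net b.net) :
    SameEntry (Entry.e7b : Entry k) b ∨ Relation.TransGen Arrow (Entry.e7b : Entry k) b := by
  cases b with
  | e8a =>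
    exact absurd h (not_specializesTo_of_reaches not_specializesTo_8c_8a (.head .a_8c_7b .refl) .refl)
  | e8b _ _ =>
    exact absurd h (not_specializesTo_of_reaches not_specializesTo_8a_8b (.head .a_8a_7b .refl) .refl)
  | e8c =>
    exact absurd h (not_specializesTo_of_reaches not_specializesTo_8a_8c (.head .a_8a_7b .refl) .refl)
  | e7a =>
    exact absurd h (not_specializesTo_of_reaches not_specializesTo_8c_7a (.head .a_8c_7b .refl) .refl)
  | e7b => exact .inl (.refl _)
  | e7c =>
    exact absurd h (not_specializesTo_of_reaches not_specializesTo_8a_7c (.head .a_8a_7b .refl) .refl)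
  | e6a =>
    exact absurd h (not_specializesTo_of_reaches not_specializesTo_8c_6a (.head .a_8c_7b .refl) .refl)
  | e6b => exact .inr (.head' .a_7b_6b .refl)
  | e6c => exact .inr (.head' .a_7b_6c .refl)
  | e6d =>
    exact absurd h (not_specializesTo_of_reaches not_specializesTo_8a_6d (.head .a_8a_7b .refl) .refl)
  | e5a => exact .inr (.head' .a_7b_6b (.head .a_6b_5a .refl))
  | e5b => exact .inr (.head' .a_7b_6b (.head .a_6b_5b .refl))
  | e4 => exact .inr (.head' .a_7b_6b (.head .a_6b_5a (.head .a_5a_4 .refl)))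
  | e2a => exact .inr (.head' .a_7b_6b (.head .a_6b_5a (.head .a_5a_4 (.head .a_4_2a .refl))))
  | e2b => exact .inr (.head' .a_7b_6b (.head .a_6b_5a (.head .a_5a_4 (.head .a_4_2b .refl))))

theorem reaches_of_specializesTo_7c {b : Entry k}
    (h : SpecializesTo (Entry.e7c : Entry k).net b.net) :
    SameEntry (Entry.e7c : Entry k) b ∨ Relation.TransGen Arrow (Entry.e7c : Entry k) b := by
  cases b with
  | e8a =>
    exact absurd h (not_specializesTo_of_reaches not_specializesTo_7c_7b .refl (.head .a_8a_7b .refl))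
  | e8b _ _ =>
    exact absurd h (not_specializesTo_of_reaches not_specializesTo_7c_7b .refl (.head (.a_8b_7b _ _) .refl))
  | e8c =>
    exact absurd h (not_specializesTo_of_reaches not_specializesTo_7c_7b .refl (.head .a_8c_7b .refl))
  | e7a =>
    exact absurd h (not_specializesTo_of_reaches not_specializesTo_8c_7a (.head .a_8c_7c .refl) .refl)
  | e7b => exact absurd h not_specializesTo_7c_7b
  | e7c => exact .inl (.refl _)
  | e6a =>
    exact absurd h (not_specializesTo_of_reaches not_specializesTo_8c_6a (.head .a_8c_7c .refl) .refl)
  | e6b => exact .inr (.head' .a_7c_6b .refl)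
  | e6c => exact .inr (.head' .a_7c_6c .refl)
  | e6d => exact .inr (.head' .a_7c_6d .refl)
  | e5a => exact .inr (.head' .a_7c_6b (.head .a_6b_5a .refl))
  | e5b => exact .inr (.head' .a_7c_6b (.head .a_6b_5b .refl))
  | e4 => exact .inr (.head' .a_7c_6b (.head .a_6b_5a (.head .a_5a_4 .refl)))
  | e2a => exact .inr (.head' .a_7c_6b (.head .a_6b_5a (.head .a_5a_4 (.head .a_4_2a .refl))))
  | e2b => exact .inr (.head' .a_7c_6b (.head .a_6b_5a (.head .a_5a_4 (.head .a_4_2b .refl))))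

theorem reaches_of_specializesTo_6a {b : Entry k}
    (h : SpecializesTo (Entry.e6a : Entry k).net b.net) :
    SameEntry (Entry.e6a : Entry k) b ∨ Relation.TransGen Arrow (Entry.e6a : Entry k) b := by
  cases b with
  | e8a =>
    exact absurd h (not_specializesTo_of_reaches not_specializesTo_7a_7b (.head .a_7a_6a .refl) (.head .a_8a_7b .refl))
  | e8b _ _ =>
    exact absurd h (not_specializesTo_of_reaches not_specializesTo_8a_8b (.head .a_8a_7a (.head .a_7a_6a .refl)) .refl)
  | e8c =>
    exact absurd h (not_specializesTo_of_reaches not_specializesTo_8a_8c (.head .a_8a_7a (.head .a_7a_6a .refl)) .refl)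
  | e7a =>
    exact absurd h (not_specializesTo_of_reaches not_specializesTo_6a_6b .refl (.head .a_7a_6b .refl))
  | e7b =>
    exact absurd h (not_specializesTo_of_reaches not_specializesTo_7a_7b (.head .a_7a_6a .refl) .refl)
  | e7c =>
    exact absurd h (not_specializesTo_of_reaches not_specializesTo_6a_6b .refl (.head .a_7c_6b .refl))
  | e6a => exact .inl (.refl _)
  | e6b => exact absurd h not_specializesTo_6a_6b
  | e6c => exact absurd h not_specializesTo_6a_6c
  | e6d =>
    exact absurd h (not_specializesTo_of_reaches not_specializesTo_6a_5b .refl (.head .a_6d_5b .refl))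
  | e5a => exact .inr (.head' .a_6a_5a .refl)
  | e5b => exact absurd h not_specializesTo_6a_5b
  | e4 => exact .inr (.head' .a_6a_5a (.head .a_5a_4 .refl))
  | e2a => exact .inr (.head' .a_6a_5a (.head .a_5a_4 (.head .a_4_2a .refl)))
  | e2b => exact .inr (.head' .a_6a_5a (.head .a_5a_4 (.head .a_4_2b .refl)))

theorem reaches_of_specializesTo_6b {b : Entry k}
    (h : SpecializesTo (Entry.e6b : Entry k).net b.net) :
    SameEntry (Entry.e6b : Entry k) b ∨ Relation.TransGen Arrow (Entry.e6b : Entry k) b := by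
  cases b with
  | e8a =>
    exact absurd h (not_specializesTo_of_reaches not_specializesTo_7c_7b (.head .a_7c_6b .refl) (.head .a_8a_7b .refl))
  | e8b _ _ =>
    exact absurd h (not_specializesTo_of_reaches not_specializesTo_7c_7b (.head .a_7c_6b .refl) (.head (.a_8b_7b _ _) .refl))
  | e8c =>
    exact absurd h (not_specializesTo_of_reaches not_specializesTo_7c_7b (.head .a_7c_6b .refl) (.head .a_8c_7b .refl))
  | e7a =>
    exact absurd h (not_specializesTo_of_reaches not_specializesTo_6b_6c .refl (.head .a_7a_6c .refl))
  | e7b =>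
    exact absurd h (not_specializesTo_of_reaches not_specializesTo_7c_7b (.head .a_7c_6b .refl) .refl)
  | e7c =>
    exact absurd h (not_specializesTo_of_reaches not_specializesTo_6b_6c .refl (.head .a_7c_6c .refl))
  | e6a =>
    exact absurd h (not_specializesTo_of_reaches not_specializesTo_8c_6a (.head .a_8c_7b (.head .a_7b_6b .refl)) .refl)
  | e6b => exact .inl (.refl _)
  | e6c => exact absurd h not_specializesTo_6b_6c
  | e6d =>
    exact absurd h (not_specializesTo_of_reaches not_specializesTo_8a_6d (.head .a_8a_7a (.head .a_7a_6b .refl)) .refl)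
  | e5a => exact .inr (.head' .a_6b_5a .refl)
  | e5b => exact .inr (.head' .a_6b_5b .refl)
  | e4 => exact .inr (.head' .a_6b_5a (.head .a_5a_4 .refl))
  | e2a => exact .inr (.head' .a_6b_5a (.head .a_5a_4 (.head .a_4_2a .refl)))
  | e2b => exact .inr (.head' .a_6b_5a (.head .a_5a_4 (.head .a_4_2b .refl)))

theorem reaches_of_specializesTo_6c {b : Entry k}
    (h : SpecializesTo (Entry.e6c : Entry k).net b.net) :
    SameEntry (Entry.e6c : Entry k) b ∨ Relation.TransGen Arrow (Entry.e6c : Entry k) b := by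
  cases b with
  | e8a =>
    exact absurd h (not_specializesTo_of_reaches not_specializesTo_7c_7b (.head .a_7c_6c .refl) (.head .a_8a_7b .refl))
  | e8b _ _ =>
    exact absurd h (not_specializesTo_of_reaches not_specializesTo_7c_7b (.head .a_7c_6c .refl) (.head (.a_8b_7b _ _) .refl))
  | e8c =>
    exact absurd h (not_specializesTo_of_reaches not_specializesTo_7c_7b (.head .a_7c_6c .refl) (.head .a_8c_7b .refl))
  | e7a =>
    exact absurd h (not_specializesTo_of_reaches not_specializesTo_6c_6b .refl (.head .a_7a_6b .refl))
  | e7b =>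
    exact absurd h (not_specializesTo_of_reaches not_specializesTo_7c_7b (.head .a_7c_6c .refl) .refl)
  | e7c =>
    exact absurd h (not_specializesTo_of_reaches not_specializesTo_6c_6b .refl (.head .a_7c_6b .refl))
  | e6a =>
    exact absurd h (not_specializesTo_of_reaches not_specializesTo_8c_6a (.head .a_8c_7b (.head .a_7b_6c .refl)) .refl)
  | e6b => exact absurd h not_specializesTo_6c_6b
  | e6c => exact .inl (.refl _)
  | e6d =>
    exact absurd h (not_specializesTo_of_reaches not_specializesTo_8a_6d (.head .a_8a_7a (.head .a_7a_6c .refl)) .refl)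
  | e5a => exact .inr (.head' .a_6c_5a .refl)
  | e5b => exact .inr (.head' .a_6c_5b .refl)
  | e4 => exact .inr (.head' .a_6c_5a (.head .a_5a_4 .refl))
  | e2a => exact .inr (.head' .a_6c_5a (.head .a_5a_4 (.head .a_4_2a .refl)))
  | e2b => exact .inr (.head' .a_6c_5a (.head .a_5a_4 (.head .a_4_2b .refl)))

theorem reaches_of_specializesTo_6d {b : Entry k}
    (h : SpecializesTo (Entry.e6d : Entry k).net b.net) :
    SameEntry (Entry.e6d : Entry k) b ∨ Relation.TransGen Arrow (Entry.e6d : Entry k) b := by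
  cases b with
  | e8a =>
    exact absurd h (not_specializesTo_of_reaches not_specializesTo_7c_7b (.head .a_7c_6d .refl) (.head .a_8a_7b .refl))
  | e8b _ _ =>
    exact absurd h (not_specializesTo_of_reaches not_specializesTo_7c_7b (.head .a_7c_6d .refl) (.head (.a_8b_7b _ _) .refl))
  | e8c =>
    exact absurd h (not_specializesTo_of_reaches not_specializesTo_7c_7b (.head .a_7c_6d .refl) (.head .a_8c_7b .refl))
  | e7a =>
    exact absurd h (not_specializesTo_of_reaches not_specializesTo_6d_6b .refl (.head .a_7a_6b .refl))
  | e7b =>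
    exact absurd h (not_specializesTo_of_reaches not_specializesTo_7c_7b (.head .a_7c_6d .refl) .refl)
  | e7c =>
    exact absurd h (not_specializesTo_of_reaches not_specializesTo_6d_6b .refl (.head .a_7c_6b .refl))
  | e6a =>
    exact absurd h (not_specializesTo_of_reaches not_specializesTo_6d_5a .refl (.head .a_6a_5a .refl))
  | e6b => exact absurd h not_specializesTo_6d_6b
  | e6c => exact absurd h not_specializesTo_6d_6c
  | e6d => exact .inl (.refl _)
  | e5a => exact absurd h not_specializesTo_6d_5a
  | e5b => exact .inr (.head' .a_6d_5b .refl)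
  | e4 => exact .inr (.head' .a_6d_5b (.head .a_5b_4 .refl))
  | e2a => exact .inr (.head' .a_6d_5b (.head .a_5b_4 (.head .a_4_2a .refl)))
  | e2b => exact .inr (.head' .a_6d_5b (.head .a_5b_4 (.head .a_4_2b .refl)))

theorem reaches_of_specializesTo_5a {b : Entry k}
    (h : SpecializesTo (Entry.e5a : Entry k).net b.net) :
    SameEntry (Entry.e5a : Entry k) b ∨ Relation.TransGen Arrow (Entry.e5a : Entry k) b := by
  cases b with
  | e8a =>
    exact absurd h (not_specializesTo_of_reaches not_specializesTo_7c_7b (.head .a_7c_6b (.head .a_6b_5a .refl)) (.head .a_8a_7b .refl))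
  | e8b _ _ =>
    exact absurd h (not_specializesTo_of_reaches not_specializesTo_7c_7b (.head .a_7c_6b (.head .a_6b_5a .refl)) (.head (.a_8b_7b _ _) .refl))
  | e8c =>
    exact absurd h (not_specializesTo_of_reaches not_specializesTo_7c_7b (.head .a_7c_6b (.head .a_6b_5a .refl)) (.head .a_8c_7b .refl))
  | e7a =>
    exact absurd h (not_specializesTo_of_reaches not_specializesTo_6b_6c (.head .a_6b_5a .refl) (.head .a_7a_6c .refl))
  | e7b =>
    exact absurd h (not_specializesTo_of_reaches not_specializesTo_7c_7b (.head .a_7c_6b (.head .a_6b_5a .refl)) .refl)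
  | e7c =>
    exact absurd h (not_specializesTo_of_reaches not_specializesTo_6b_6c (.head .a_6b_5a .refl) (.head .a_7c_6c .refl))
  | e6a =>
    exact absurd h (not_specializesTo_of_reaches not_specializesTo_8c_6a (.head .a_8c_7b (.head .a_7b_6b (.head .a_6b_5a .refl))) .refl)
  | e6b =>
    exact absurd h (not_specializesTo_of_reaches not_specializesTo_6c_6b (.head .a_6c_5a .refl) .refl)
  | e6c =>
    exact absurd h (not_specializesTo_of_reaches not_specializesTo_6b_6c (.head .a_6b_5a .refl) .refl)
  | e6d =>
    exact absurd h (not_specializesTo_of_reaches not_specializesTo_6a_5b (.head .a_6a_5a .refl) (.head .a_6d_5b .refl))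
  | e5a => exact .inl (.refl _)
  | e5b =>
    exact absurd h (not_specializesTo_of_reaches not_specializesTo_6a_5b (.head .a_6a_5a .refl) .refl)
  | e4 => exact .inr (.head' .a_5a_4 .refl)
  | e2a => exact .inr (.head' .a_5a_4 (.head .a_4_2a .refl))
  | e2b => exact .inr (.head' .a_5a_4 (.head .a_4_2b .refl))

theorem reaches_of_specializesTo_5b {b : Entry k}
    (h : SpecializesTo (Entry.e5b : Entry k).net b.net) :
    SameEntry (Entry.e5b : Entry k) b ∨ Relation.TransGen Arrow (Entry.e5b : Entry k) b := by
  cases b with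
  | e8a =>
    exact absurd h (not_specializesTo_of_reaches not_specializesTo_7c_7b (.head .a_7c_6b (.head .a_6b_5b .refl)) (.head .a_8a_7b .refl))
  | e8b _ _ =>
    exact absurd h (not_specializesTo_of_reaches not_specializesTo_7c_7b (.head .a_7c_6b (.head .a_6b_5b .refl)) (.head (.a_8b_7b _ _) .refl))
  | e8c =>
    exact absurd h (not_specializesTo_of_reaches not_specializesTo_7c_7b (.head .a_7c_6b (.head .a_6b_5b .refl)) (.head .a_8c_7b .refl))
  | e7a =>
    exact absurd h (not_specializesTo_of_reaches not_specializesTo_6d_6b (.head .a_6d_5b .refl) (.head .a_7a_6b .refl))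
  | e7b =>
    exact absurd h (not_specializesTo_of_reaches not_specializesTo_7c_7b (.head .a_7c_6b (.head .a_6b_5b .refl)) .refl)
  | e7c =>
    exact absurd h (not_specializesTo_of_reaches not_specializesTo_6d_6b (.head .a_6d_5b .refl) (.head .a_7c_6b .refl))
  | e6a =>
    exact absurd h (not_specializesTo_of_reaches not_specializesTo_6d_5a (.head .a_6d_5b .refl) (.head .a_6a_5a .refl))
  | e6b =>
    exact absurd h (not_specializesTo_of_reaches not_specializesTo_6d_6b (.head .a_6d_5b .refl) .refl)
  | e6c =>
    exact absurd h (not_specializesTo_of_reaches not_specializesTo_6d_6c (.head .a_6d_5b .refl) .refl)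
  | e6d =>
    exact absurd h (not_specializesTo_of_reaches not_specializesTo_8a_6d (.head .a_8a_7a (.head .a_7a_6b (.head .a_6b_5b .refl))) .refl)
  | e5a =>
    exact absurd h (not_specializesTo_of_reaches not_specializesTo_6d_5a (.head .a_6d_5b .refl) .refl)
  | e5b => exact .inl (.refl _)
  | e4 => exact .inr (.head' .a_5b_4 .refl)
  | e2a => exact .inr (.head' .a_5b_4 (.head .a_4_2a .refl))
  | e2b => exact .inr (.head' .a_5b_4 (.head .a_4_2b .refl))

theorem reaches_of_specializesTo_4 {b : Entry k}
    (h : SpecializesTo (Entry.e4 : Entry k).net b.net) :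
    SameEntry (Entry.e4 : Entry k) b ∨ Relation.TransGen Arrow (Entry.e4 : Entry k) b := by
  cases b with
  | e8a =>
    exact absurd h (not_specializesTo_of_reaches not_specializesTo_7c_7b (.head .a_7c_6b (.head .a_6b_5a (.head .a_5a_4 .refl))) (.head .a_8a_7b .refl))
  | e8b _ _ =>
    exact absurd h (not_specializesTo_of_reaches not_specializesTo_7c_7b (.head .a_7c_6b (.head .a_6b_5a (.head .a_5a_4 .refl))) (.head (.a_8b_7b _ _) .refl))
  | e8c =>
    exact absurd h (not_specializesTo_of_reaches not_specializesTo_7c_7b (.head .a_7c_6b (.head .a_6b_5a (.head .a_5a_4 .refl))) (.head .a_8c_7b .refl))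
  | e7a =>
    exact absurd h (not_specializesTo_of_reaches not_specializesTo_6d_6b (.head .a_6d_5b (.head .a_5b_4 .refl)) (.head .a_7a_6b .refl))
  | e7b =>
    exact absurd h (not_specializesTo_of_reaches not_specializesTo_7c_7b (.head .a_7c_6b (.head .a_6b_5a (.head .a_5a_4 .refl))) .refl)
  | e7c =>
    exact absurd h (not_specializesTo_of_reaches not_specializesTo_6d_6b (.head .a_6d_5b (.head .a_5b_4 .refl)) (.head .a_7c_6b .refl))
  | e6a =>
    exact absurd h (not_specializesTo_of_reaches not_specializesTo_6d_5a (.head .a_6d_5b (.head .a_5b_4 .refl)) (.head .a_6a_5a .refl))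
  | e6b =>
    exact absurd h (not_specializesTo_of_reaches not_specializesTo_6d_6b (.head .a_6d_5b (.head .a_5b_4 .refl)) .refl)
  | e6c =>
    exact absurd h (not_specializesTo_of_reaches not_specializesTo_6d_6c (.head .a_6d_5b (.head .a_5b_4 .refl)) .refl)
  | e6d =>
    exact absurd h (not_specializesTo_of_reaches not_specializesTo_6a_5b (.head .a_6a_5a (.head .a_5a_4 .refl)) (.head .a_6d_5b .refl))
  | e5a =>
    exact absurd h (not_specializesTo_of_reaches not_specializesTo_6d_5a (.head .a_6d_5b (.head .a_5b_4 .refl)) .refl)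
  | e5b =>
    exact absurd h (not_specializesTo_of_reaches not_specializesTo_6a_5b (.head .a_6a_5a (.head .a_5a_4 .refl)) .refl)
  | e4 => exact .inl (.refl _)
  | e2a => exact .inr (.head' .a_4_2a .refl)
  | e2b => exact .inr (.head' .a_4_2b .refl)

theorem reaches_of_specializesTo_2a {b : Entry k}
    (h : SpecializesTo (Entry.e2a : Entry k).net b.net) :
    SameEntry (Entry.e2a : Entry k) b ∨ Relation.TransGen Arrow (Entry.e2a : Entry k) b := by
  cases b with
  | e8a =>
    exact absurd h (not_specializesTo_of_reaches not_specializesTo_2a_4 .refl (.head .a_8a_7a (.head .a_7a_6a (.head .a_6a_5a (.head .a_5a_4 .refl)))))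
  | e8b _ _ =>
    exact absurd h (not_specializesTo_of_reaches not_specializesTo_2a_4 .refl (.head (.a_8b_7b _ _) (.head .a_7b_6b (.head .a_6b_5a (.head .a_5a_4 .refl)))))
  | e8c =>
    exact absurd h (not_specializesTo_of_reaches not_specializesTo_2a_4 .refl (.head .a_8c_7b (.head .a_7b_6b (.head .a_6b_5a (.head .a_5a_4 .refl)))))
  | e7a =>
    exact absurd h (not_specializesTo_of_reaches not_specializesTo_2a_4 .refl (.head .a_7a_6a (.head .a_6a_5a (.head .a_5a_4 .refl))))
  | e7b =>
    exact absurd h (not_specializesTo_of_reaches not_specializesTo_2a_4 .refl (.head .a_7b_6b (.head .a_6b_5a (.head .a_5a_4 .refl))))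
  | e7c =>
    exact absurd h (not_specializesTo_of_reaches not_specializesTo_2a_4 .refl (.head .a_7c_6b (.head .a_6b_5a (.head .a_5a_4 .refl))))
  | e6a =>
    exact absurd h (not_specializesTo_of_reaches not_specializesTo_2a_4 .refl (.head .a_6a_5a (.head .a_5a_4 .refl)))
  | e6b =>
    exact absurd h (not_specializesTo_of_reaches not_specializesTo_2a_4 .refl (.head .a_6b_5a (.head .a_5a_4 .refl)))
  | e6c =>
    exact absurd h (not_specializesTo_of_reaches not_specializesTo_2a_4 .refl (.head .a_6c_5a (.head .a_5a_4 .refl)))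
  | e6d =>
    exact absurd h (not_specializesTo_of_reaches not_specializesTo_2a_4 .refl (.head .a_6d_5b (.head .a_5b_4 .refl)))
  | e5a =>
    exact absurd h (not_specializesTo_of_reaches not_specializesTo_2a_4 .refl (.head .a_5a_4 .refl))
  | e5b =>
    exact absurd h (not_specializesTo_of_reaches not_specializesTo_2a_4 .refl (.head .a_5b_4 .refl))
  | e4 => exact absurd h not_specializesTo_2a_4
  | e2a => exact .inl (.refl _)
  | e2b => exact absurd h not_specializesTo_2a_2b

theorem reaches_of_specializesTo_2b {b : Entry k}
    (h : SpecializesTo (Entry.e2b : Entry k).net b.net) :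
    SameEntry (Entry.e2b : Entry k) b ∨ Relation.TransGen Arrow (Entry.e2b : Entry k) b := by
  cases b with
  | e8a =>
    exact absurd h (not_specializesTo_of_reaches not_specializesTo_2b_4 .refl (.head .a_8a_7a (.head .a_7a_6a (.head .a_6a_5a (.head .a_5a_4 .refl)))))
  | e8b _ _ =>
    exact absurd h (not_specializesTo_of_reaches not_specializesTo_2b_4 .refl (.head (.a_8b_7b _ _) (.head .a_7b_6b (.head .a_6b_5a (.head .a_5a_4 .refl)))))
  | e8c =>
    exact absurd h (not_specializesTo_of_reaches not_specializesTo_2b_4 .refl (.head .a_8c_7b (.head .a_7b_6b (.head .a_6b_5a (.head .a_5a_4 .refl)))))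
  | e7a =>
    exact absurd h (not_specializesTo_of_reaches not_specializesTo_2b_4 .refl (.head .a_7a_6a (.head .a_6a_5a (.head .a_5a_4 .refl))))
  | e7b =>
    exact absurd h (not_specializesTo_of_reaches not_specializesTo_2b_4 .refl (.head .a_7b_6b (.head .a_6b_5a (.head .a_5a_4 .refl))))
  | e7c =>
    exact absurd h (not_specializesTo_of_reaches not_specializesTo_2b_4 .refl (.head .a_7c_6b (.head .a_6b_5a (.head .a_5a_4 .refl))))
  | e6a =>
    exact absurd h (not_specializesTo_of_reaches not_specializesTo_2b_4 .refl (.head .a_6a_5a (.head .a_5a_4 .refl)))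
  | e6b =>
    exact absurd h (not_specializesTo_of_reaches not_specializesTo_2b_4 .refl (.head .a_6b_5a (.head .a_5a_4 .refl)))
  | e6c =>
    exact absurd h (not_specializesTo_of_reaches not_specializesTo_2b_4 .refl (.head .a_6c_5a (.head .a_5a_4 .refl)))
  | e6d =>
    exact absurd h (not_specializesTo_of_reaches not_specializesTo_2b_4 .refl (.head .a_6d_5b (.head .a_5b_4 .refl)))
  | e5a =>
    exact absurd h (not_specializesTo_of_reaches not_specializesTo_2b_4 .refl (.head .a_5a_4 .refl))
  | e5b =>
    exact absurd h (not_specializesTo_of_reaches not_specializesTo_2b_4 .refl (.head .a_5b_4 .refl))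
  | e4 => exact absurd h not_specializesTo_2b_4
  | e2a => exact absurd h not_specializesTo_2b_2a
  | e2b => exact .inl (.refl _)

theorem sameEntry_or_reaches_of_specializesTo {a b : Entry k} (h : SpecializesTo a.net b.net) :
    SameEntry a b ∨ Relation.TransGen Arrow a b := by
  cases a
  · exact reaches_of_specializesTo_8a h
  · exact reaches_of_specializesTo_8b h
  · exact reaches_of_specializesTo_8c h
  · exact reaches_of_specializesTo_7a h
  · exact reaches_of_specializesTo_7b h
  · exact reaches_of_specializesTo_7c h
  · exact reaches_of_specializesTo_6a h
  · exact reaches_of_specializesTo_6b h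
  · exact reaches_of_specializesTo_6c h
  · exact reaches_of_specializesTo_6d h
  · exact reaches_of_specializesTo_5a h
  · exact reaches_of_specializesTo_5b h
  · exact reaches_of_specializesTo_4 h
  · exact reaches_of_specializesTo_2a h
  · exact reaches_of_specializesTo_2b h

end Order

end NetsOfConics

end

open MvPolynomial

noncomputable section

namespace NetsOfConics

/-! ### Elementary specializations. -/

section Order

variable {k : Type*} [Field k] [CharZero k]

omit [CharZero k] in
theorem SameEntry.symm {a b : Entry k} (h : SameEntry a b) : SameEntry b a := by
  cases h with
  | refl => exact .refl _
  | family l m hl hm hj => exact .family m l hm hl hj.symm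

omit [CharZero k] in
theorem SameEntry.dim_eq {a b : Entry k} (h : SameEntry a b) : a.dim = b.dim := by
  cases h <;> rfl

omit [CharZero k] in
theorem Arrow.dim_lt {a b : Entry k} (h : Arrow a b) : b.dim < a.dim := by
  cases h <;> simp [Entry.dim]

omit [CharZero k] in
-- With the absence of dimension three, this leaves no room strictly between the ends of an arrow.
theorem Arrow.dim_le {a b : Entry k} (h : Arrow a b) :
    a.dim = b.dim + 1 ∨ a.dim = 4 ∧ b.dim = 2 := by
  cases h <;> simp [Entry.dim]

omit [CharZero k] in
theorem Entry.dim_ne_three (a : Entry k) : a.dim ≠ 3 := by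
  cases a <;> simp [Entry.dim]

omit [CharZero k] in
theorem dim_lt_of_transGen {a b : Entry k} (h : Relation.TransGen Arrow a b) : b.dim < a.dim := by
  induction h with
  | single h => exact h.dim_lt
  | tail _ h ih => exact h.dim_lt.trans ih

omit [CharZero k] in
-- Distinct equivalent entries occur only inside the family `8b`, where no arrow ends.
theorem Arrow.eq_of_sameEntry {a b c : Entry k} (h : Arrow a b) (h' : SameEntry b c) : b = c := by
  cases h' with
  | refl => rfl
  | family => cases h

variable [IsAlgClosed k]

theorem SameEntry.orbit_eq {a b : Entry k} (h : SameEntry a b) : orbit a.net = orbit b.net := by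
  cases h with
  | refl => rfl
  | family l m hl hm hj => exact orbit_8b_of_jInv_eq hl hm hj

theorem specializesTo_net_iff {a b : Entry k} : SpecializesTo a.net b.net ↔
    SameEntry a b ∨ Relation.TransGen Arrow a b := by
  refine ⟨sameEntry_or_reaches_of_specializesTo, ?_⟩
  rintro (h | h)
  · exact specializesTo_of_orbit_eq h.orbit_eq
  · exact Reaches.specializesTo h.to_reflTransGen

/-- Here `Entry.dim` serves only as a grading of the table: chains in both directions would lower it
twice and return to the start. That it is the actual dimension is not used. -/
theorem orbit_net_eq_iff {a b : Entry k} : orbit a.net = orbit b.net ↔ SameEntry a b := by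
  refine ⟨fun h => ?_, SameEntry.orbit_eq⟩
  rcases specializesTo_net_iff.1 (specializesTo_of_orbit_eq h) with h1 | h1
  · exact h1
  · rcases specializesTo_net_iff.1 (specializesTo_of_orbit_eq h.symm) with h2 | h2
    · exact h2.symm
    · exact absurd (dim_lt_of_transGen h1) (dim_lt_of_transGen h2).asymm

/-- In one direction, the end of the first arrow of a chain must be equivalent to the target, and is
then equal to it. In the other, completeness puts the intermediate orbit in the table and the
grading excludes it. -/
theorem isElementary_net_iff (hcl : ∀ V : Net k, ∃ a : Entry k, V ∈ orbit a.net)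
    {a b : Entry k} : IsElementary a.net b.net ↔ Arrow a b := by
  constructor
  · rintro ⟨h1, h2, h3⟩
    rcases specializesTo_net_iff.1 h1 with h | h
    · exact absurd h.orbit_eq h2
    · obtain ⟨c, hac, hcb⟩ := Relation.TransGen.head'_iff.1 h
      rcases h3 c.net (Reaches.specializesTo (.single hac)) (Reaches.specializesTo hcb) with e | e
      · exact absurd (orbit_net_eq_iff.1 e).dim_eq hac.dim_lt.ne
      · rwa [← hac.eq_of_sameEntry (orbit_net_eq_iff.1 e)]
  · intro h
    refine ⟨h.degenerates.specializesTo, fun e => h.dim_lt.ne' (orbit_net_eq_iff.1 e).dim_eq, ?_⟩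
    intro U hU hU'
    obtain ⟨c, hc⟩ := hcl U
    have e := orbit_eq_of_mem hc
    rw [specializesTo_congr rfl e] at hU
    rw [specializesTo_congr e rfl] at hU'
    rw [e]
    rcases specializesTo_net_iff.1 hU with h1 | h1
    · exact Or.inl h1.orbit_eq.symm
    rcases specializesTo_net_iff.1 hU' with h2 | h2
    · exact Or.inr h2.orbit_eq
    have h3 := dim_lt_of_transGen h1
    have h4 := dim_lt_of_transGen h2
    have h5 := c.dim_ne_three
    have h6 := h.dim_le
    omega

end Order

end NetsOfConics

end

open MvPolynomial

noncomputable section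

namespace NetsOfConics

/-! ### The classification of nets -/

section Coordinates

variable {k : Type*} [Field k]

/-- Three linear forms which form a coordinate system. -/
def Coords (x y z : MvPolynomial (Fin 3) k) : Prop :=
  ∃ M : Matrix (Fin 3) (Fin 3) k, M.det ≠ 0 ∧ x = lin (M 0) ∧ y = lin (M 1) ∧ z = lin (M 2)

theorem coords_X : Coords (X 0) (X 1) (X 2 : MvPolynomial (Fin 3) k) :=
  ⟨1, by simp, by simp [lin_eq], by simp [lin_eq], by simp [lin_eq]⟩

variable {x y z : MvPolynomial (Fin 3) k}

theorem Coords.change (h : Coords x y z) (N : Matrix (Fin 3) (Fin 3) k) (hN : N.det ≠ 0)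
    {x' y' z' : MvPolynomial (Fin 3) k}
    (hx : x' = C (N 0 0) * x + C (N 0 1) * y + C (N 0 2) * z)
    (hy : y' = C (N 1 0) * x + C (N 1 1) * y + C (N 1 2) * z)
    (hz : z' = C (N 2 0) * x + C (N 2 1) * y + C (N 2 2) * z) : Coords x' y' z' := by
  obtain ⟨M, hM, rfl, rfl, rfl⟩ := h
  refine ⟨N * M, by rw [Matrix.det_mul]; exact mul_ne_zero hN hM, ?_, ?_, ?_⟩
  · rw [hx]; simp [lin_eq, Matrix.mul_apply, Fin.sum_univ_three]; ring
  · rw [hy]; simp [lin_eq, Matrix.mul_apply, Fin.sum_univ_three]; ring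
  · rw [hz]; simp [lin_eq, Matrix.mul_apply, Fin.sum_univ_three]; ring

theorem Coords.exists_subst (h : Coords x y z) :
    ∃ g : GL (Fin 3) k, ∀ p, subst g p = aeval ![x, y, z] p := by
  obtain ⟨M, hM, rfl, rfl, rfl⟩ := h
  refine ⟨toGL M hM, fun p => ?_⟩
  have : subst (toGL M hM) = aeval ![lin (M 0), lin (M 1), lin (M 2)] :=
    MvPolynomial.algHom_ext fun i => by fin_cases i <;> simp
  rw [this]

theorem exists_eq_lin {p : MvPolynomial (Fin 3) k} (hp : p.IsHomogeneous 1) :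
    ∃ v : Fin 3 → k, p = lin v := by
  have h : p ∈ Submodule.span k (Set.range X) := homogeneousSubmodule_one_eq_span_X (R := k) ▸ hp
  obtain ⟨v, hv⟩ := (Submodule.mem_span_range_iff_exists_fun k).1 h
  exact ⟨v, by simp [← hv, lin, smul_eq_C_mul]⟩

/-- Euler's identity rebuilds the form from its first derivatives, which are linear; this divides by
two. -/
theorem exists_eq_quadratic_X [CharZero k] {q : MvPolynomial (Fin 3) k} (hq : q.IsHomogeneous 2) :
    ∃ a b c d e f : k, q = C a * X 0 ^ 2 + C b * X 1 ^ 2 + C c * X 2 ^ 2 + C d * (X 0 * X 1) +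
      C e * (X 0 * X 2) + C f * (X 1 * X 2) := by
  have h : ∀ i, ∃ v : Fin 3 → k, pderiv i q = lin v := fun i => exists_eq_lin hq.pderiv
  choose v hv using h
  have e := hq.sum_X_mul_pderiv
  have h2 : (C (2⁻¹ : k) : MvPolynomial (Fin 3) k) * 2 = 1 := by
    rw [← map_ofNat C, ← C_mul]; simp
  simp only [Fin.sum_univ_three, hv, lin_eq, nsmul_eq_mul, Nat.cast_ofNat] at e
  refine ⟨2⁻¹ * v 0 0, 2⁻¹ * v 1 1, 2⁻¹ * v 2 2, 2⁻¹ * (v 0 1 + v 1 0), 2⁻¹ * (v 0 2 + v 2 0),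
    2⁻¹ * (v 1 2 + v 2 1), ?_⟩
  simp only [C_mul, C_add]
  linear_combination -q * h2 - C 2⁻¹ * e

theorem Coords.exists_preimage (h : Coords x y z) {n : ℕ} {p : MvPolynomial (Fin 3) k}
    (hp : p.IsHomogeneous n) :
    ∃ P : MvPolynomial (Fin 3) k, P.IsHomogeneous n ∧ p = aeval ![x, y, z] P := by
  obtain ⟨g, hg⟩ := h.exists_subst
  refine ⟨subst g⁻¹ p, subst_isHomogeneous _ hp, ?_⟩
  rw [← hg, subst_subst, inv_mul_cancel, subst_one]

theorem Coords.exists_eq_quadratic [CharZero k] (h : Coords x y z) {q : MvPolynomial (Fin 3) k}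
    (hq : q.IsHomogeneous 2) : ∃ a b c d e f : k, q = C a * x ^ 2 + C b * y ^ 2 + C c * z ^ 2 +
      C d * (x * y) + C e * (x * z) + C f * (y * z) := by
  obtain ⟨P, hP, rfl⟩ := h.exists_preimage hq
  obtain ⟨a, b, c, d, e, f, rfl⟩ := exists_eq_quadratic_X hP
  exact ⟨a, b, c, d, e, f, by simp⟩

theorem Net.mem_of_eq {V : Net k} {p q r s : MvPolynomial (Fin 3) k} (hp : p ∈ V.carrier)
    (hq : q ∈ V.carrier) (hr : r ∈ V.carrier) (a b c : k)
    (h : s = C a * p + C b * q + C c * r) : s ∈ V.carrier := by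
  rw [h, ← smul_eq_C_mul, ← smul_eq_C_mul, ← smul_eq_C_mul]
  exact add_mem (add_mem (V.carrier.smul_mem _ hp) (V.carrier.smul_mem _ hq))
    (V.carrier.smul_mem _ hr)

theorem Net.exists_notMem (V : Net k) (p q : MvPolynomial (Fin 3) k) :
    ∃ r ∈ V.carrier, ∀ a b : k, r ≠ C a * p + C b * q := by
  by_contra! h
  have hle : V.carrier ≤ Submodule.span k (Set.range ![p, q]) := by
    intro r hr
    obtain ⟨a, b, rfl⟩ := h r hr
    rw [← smul_eq_C_mul, ← smul_eq_C_mul]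
    exact add_mem (Submodule.smul_mem _ _ (Submodule.subset_span ⟨0, rfl⟩))
      (Submodule.smul_mem _ _ (Submodule.subset_span ⟨1, rfl⟩))
  have : Module.Finite k (Submodule.span k (Set.range ![p, q])) :=
    Module.Finite.span_of_finite k (Set.finite_range _)
  have h1 := Submodule.finrank_mono hle
  have h2 := finrank_range_le_card (R := k) ![p, q]
  rw [V.finrank_eq] at h1
  simp only [Set.finrank, Fintype.card_fin] at h2
  omega

/-- A net in the orbit of an entry of the table. -/
def Classified [CharZero k] (V : Net k) : Prop := ∃ a : Entry k, V ∈ orbit a.net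

theorem Coords.classified [CharZero k] (h : Coords x y z) {V : Net k} (a : Entry k)
    {p q r : MvPolynomial (Fin 3) k} (hp : p ∈ V.carrier) (hq : q ∈ V.carrier)
    (hr : r ∈ V.carrier) (e : (fun i => aeval ![x, y, z] (a.forms i)) = ![p, q, r]) :
    Classified V := by
  obtain ⟨g, hg⟩ := h.exists_subst
  refine ⟨a, mem_orbit_net_iff.2 ⟨g, fun i => ?_⟩⟩
  rw [hg]
  rw [show aeval ![x, y, z] (a.forms i) = _ from congrFun e i]
  fin_cases i
  exacts [hp, hq, hr]

theorem forms_aeval {p q r : MvPolynomial (Fin 3) k} {f : Fin 3 → MvPolynomial (Fin 3) k}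
    (h0 : aeval ![x, y, z] (f 0) = p) (h1 : aeval ![x, y, z] (f 1) = q)
    (h2 : aeval ![x, y, z] (f 2) = r) : (fun i => aeval ![x, y, z] (f i)) = ![p, q, r] := by
  funext i
  fin_cases i
  exacts [h0, h1, h2]

end Coordinates

end NetsOfConics

end

open MvPolynomial

noncomputable section

namespace NetsOfConics

/-! ### Nets containing a double line. -/

section Squares

variable {k : Type*} [Field k] [CharZero k] {x y z : MvPolynomial (Fin 3) k} {V : Net k}

theorem classified_2a (h : Coords x y z) (h1 : x ^ 2 ∈ V.carrier) (h2 : x * y ∈ V.carrier)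
    (h3 : x * z ∈ V.carrier) : Classified V :=
  h.classified .e2a h1 h2 h3 (forms_aeval (by simp [Entry.forms]) (by simp [Entry.forms])
    (by simp [Entry.forms]))

omit [CharZero k] in
theorem C_mul_inv {a : k} (ha : a ≠ 0) :
    (C a * C a⁻¹ : MvPolynomial (Fin 3) k) = 1 := by
  rw [← C_mul, mul_inv_cancel₀ ha, C_1]

theorem C_half : (C (2⁻¹ : k) * 2 : MvPolynomial (Fin 3) k) = 1 := by
  rw [← map_ofNat C, ← C_mul]; simp

variable [IsAlgClosed k]

/-- The number of nonzero parameters among `b` and `d` decides between `6d`, `7c` and `8c`. -/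
theorem classified_two_squares (h : Coords x y z) {b d : k} (h1 : x ^ 2 ∈ V.carrier)
    (h2 : y ^ 2 + C b * (x * z) ∈ V.carrier) (h3 : z ^ 2 + C d * (x * y) ∈ V.carrier) :
    Classified V := by
  by_cases hb : b = 0
  · by_cases hd : d = 0
    · subst hb hd
      refine h.classified .e6d h1 h2 h3 (forms_aeval ?_ ?_ ?_) <;> simp [Entry.forms]
    · subst hb
      refine (h.change (x' := C d * x) (y' := y) (z' := z) !![d, 0, 0; 0, 1, 0; 0, 0, 1]
        (by simp [Matrix.det_fin_three, hd]) (by simp) (by simp) (by simp)).classified .e7c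
        (V.mem_of_eq h1 h1 h1 (d ^ 2) 0 0 rfl) h2 h3 (forms_aeval ?_ ?_ ?_) <;>
        simp [Entry.forms] <;> ring
  · by_cases hd : d = 0
    · subst hd
      refine (h.change (x' := C b * x) (y' := z) (z' := y) !![b, 0, 0; 0, 0, 1; 0, 1, 0]
        (by simp [Matrix.det_fin_three, hb]) (by simp) (by simp) (by simp)).classified .e7c
        (V.mem_of_eq h1 h1 h1 (b ^ 2) 0 0 rfl) h3 h2 (forms_aeval ?_ ?_ ?_) <;>
        simp [Entry.forms] <;> ring
    -- Scaling the coordinates absorbs both parameters; the condition `β ^ 3 * (d ^ 2 * b) = -1`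
    -- makes the rescaled generators match those of `8c`.
    · obtain ⟨β, hβ⟩ := IsAlgClosed.exists_pow_nat_eq (-(d ^ 2 * b)⁻¹) (n := 3) (by norm_num)
      have hβ' : β ^ 3 * (d ^ 2 * b) = -1 := by rw [hβ]; field_simp
      have hβ0 : β ≠ 0 := by rintro rfl; simp at hβ'
      have hC : (C β ^ 3 * (C d ^ 2 * C b) : MvPolynomial (Fin 3) k) = -1 := by
        simp only [← C_pow, ← C_mul, hβ', C_neg, C_1]
      refine (h.change (x' := -C (β ^ 2 * d) * y) (y' := C β * z) (z' := x)
        !![0, -(β ^ 2 * d), 0; 0, 0, β; 1, 0, 0]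
        (by simp [Matrix.det_fin_three, hβ0, hd]) (by simp) (by simp) (by simp)).classified .e8c
        h1 (V.mem_of_eq h2 h2 h2 ((β ^ 2 * d) ^ 2) 0 0 rfl) (V.mem_of_eq h3 h3 h3 (β ^ 2) 0 0 rfl)
        (forms_aeval ?_ ?_ ?_)
      · simp [Entry.forms]
      · simp [Entry.forms]
        linear_combination (-C β * (x * z)) * hC
      · simp [Entry.forms]
        ring

omit [IsAlgClosed k] in
-- The case `b = 0` gives `5b` or `6c`, according to `a`; otherwise the net is in `7b`.
theorem classified_square_product (h : Coords x y z) {a b : k} (h1 : x ^ 2 ∈ V.carrier)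
    (h2 : y ^ 2 + C a * (x * y) + C b * (x * z) ∈ V.carrier) (h3 : y * z ∈ V.carrier) :
    Classified V := by
  by_cases hb : b = 0
  · subst hb
    by_cases ha : a = 0
    · subst ha
      refine (h.change (x' := y) (y' := z) (z' := x) !![0, 1, 0; 0, 0, 1; 1, 0, 0]
        (by simp [Matrix.det_fin_three]) (by simp) (by simp) (by simp)).classified .e5b
        h2 h3 h1 (forms_aeval ?_ ?_ ?_) <;> simp [Entry.forms]
    · refine (h.change (x' := y + C a * x) (y' := y) (z' := z + y) !![a, 1, 0; 0, 1, 0; 0, 1, 1]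
        (by simp [Matrix.det_fin_three, ha]) (by simp; ring) (by simp) (by simp; ring)).classified
        .e6c h2 (V.mem_of_eq h2 h1 h3 2 (a ^ 2) 1 rfl) (V.mem_of_eq h2 h1 h3 2 (a ^ 2) 0 rfl)
        (forms_aeval ?_ ?_ ?_) <;> simp [Entry.forms, map_ofNat] <;> ring
  · by_cases ha : a = 0
    · subst ha
      refine (h.change (x' := y) (y' := C b * z) (z' := x) !![0, 1, 0; 0, 0, b; 1, 0, 0]
        (by simp [Matrix.det_fin_three, hb]) (by simp) (by simp) (by simp)).classified .e7b
        h2 (V.mem_of_eq h3 h3 h3 b 0 0 rfl) h1 (forms_aeval ?_ ?_ ?_) <;>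
        simp [Entry.forms] <;> ring
    · have hC := C_mul_inv ha
      set c := a⁻¹
      have hc : c ≠ 0 := inv_ne_zero ha
      refine (h.change (x' := 3 * y + C a * x)
        (y' := 9 * (C c * (C b * z + C a * y)) - 6 * y + 2 * (C a * x)) (z' := C a * x)
        !![a, 3, 0; 2 * a, 9 * (c * a) - 6, 9 * (c * b); a, 0, 0]
        (by simp [Matrix.det_fin_three, ha, hb, hc]) (by simp [map_ofNat]; ring)
        (by simp [map_ofNat]; ring) (by simp)).classified .e7b
        (V.mem_of_eq h2 h1 h3 9 (3 * a ^ 2) 0 rfl) (V.mem_of_eq h2 h1 h3 9 (2 * a ^ 2) (27 * (c * b)) rfl)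
        (V.mem_of_eq h2 h1 h3 0 (a ^ 2) 0 rfl) (forms_aeval ?_ ?_ ?_)
      · simp [Entry.forms, map_ofNat]
        linear_combination (9 * x * (C b * z + C a * y)) * hC
      · simp [Entry.forms, map_ofNat]
        linear_combination (9 * x * (C b * z + C a * y) + 27 * y ^ 2) * hC
      · simp [Entry.forms]
        ring

/-- The first monomial present in the third generator, in the order `z²`, `yz`, `y²`, `xz`, decides:
`5b` or `6b` after completing a square, then `5a`, then `4` or `2b`, and finally `2a`. -/
theorem classified_pencil_square (h : Coords x y z) {b c e f : k} (h1 : x ^ 2 ∈ V.carrier)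
    (h2 : x * y ∈ V.carrier)
    (h3 : C b * y ^ 2 + C c * z ^ 2 + C e * (x * z) + C f * (y * z) ∈ V.carrier)
    (h0 : ¬ (b = 0 ∧ c = 0 ∧ e = 0 ∧ f = 0)) : Classified V := by
  by_cases hc : c = 0
  · subst hc
    by_cases hf : f = 0
    · subst hf
      by_cases hb : b = 0
      · subst hb
        have he : e ≠ 0 := fun h => h0 ⟨rfl, rfl, h, rfl⟩
        have hC := C_mul_inv he
        refine classified_2a h h1 h2 (V.mem_of_eq h3 h3 h3 e⁻¹ 0 0 ?_)
        simp
        linear_combination (-x * z) * hC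
      · have hC := C_mul_inv hb
        by_cases he : e = 0
        · subst he
          refine h.classified .e2b h1 h2 (V.mem_of_eq h3 h3 h3 b⁻¹ 0 0 rfl) (forms_aeval ?_ ?_ ?_)
          · simp [Entry.forms]
          · simp [Entry.forms]
          · simp [Entry.forms]
            linear_combination (-y ^ 2) * hC
        · refine (h.change (x' := y) (y' := x) (z' := C (b⁻¹ * e) * z)
            !![0, 1, 0; 1, 0, 0; 0, 0, b⁻¹ * e]
            (by simp [Matrix.det_fin_three, hb, he]) (by simp) (by simp) (by simp)).classified .e4
            h2 (V.mem_of_eq h3 h3 h3 b⁻¹ 0 0 rfl) h1 (forms_aeval ?_ ?_ ?_)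
          · simp [Entry.forms]; ring
          · simp [Entry.forms]
            linear_combination (-y ^ 2) * hC
          · simp [Entry.forms]
    · have hC := C_mul_inv hf
      refine (h.change (x' := x) (y' := y + C (f⁻¹ * e) * x) (z' := C b * y + C f * z)
        !![1, 0, 0; f⁻¹ * e, 1, 0; 0, b, f] (by simp [Matrix.det_fin_three, hf]) (by simp)
        (by simp; ring) (by simp)).classified .e5a h1 (V.mem_of_eq h2 h1 h1 1 (f⁻¹ * e) 0 rfl)
        (V.mem_of_eq h3 h2 h2 1 (f⁻¹ * e * b) 0 rfl) (forms_aeval ?_ ?_ ?_)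
      · simp [Entry.forms]
      · simp [Entry.forms]; ring
      · simp [Entry.forms]
        linear_combination (C e * x * z) * hC
  · have hC := C_mul_inv hc
    set g := c⁻¹
    have hC2 := C_half (k := k)
    have h3' : (z + C (2⁻¹ * (g * f)) * y + C (2⁻¹ * (g * e)) * x) ^ 2 +
        C (g * b - (2⁻¹ * (g * f)) ^ 2) * y ^ 2 ∈ V.carrier := by
      refine V.mem_of_eq h3 h2 h1 g (2 * (2⁻¹ * (g * f)) * (2⁻¹ * (g * e))) ((2⁻¹ * (g * e)) ^ 2) ?_
      simp only [C_mul, C_sub, C_pow, map_ofNat]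
      linear_combination (-z ^ 2) * hC + (C g * C f * y * z + C g * C e * x * z) * hC2
    obtain ⟨β, hβ⟩ := IsAlgClosed.exists_pow_nat_eq (-(g * b - (2⁻¹ * (g * f)) ^ 2)) (n := 2)
      (by norm_num)
    rw [← neg_eq_iff_eq_neg] at hβ
    rw [← hβ] at h3'
    set p := 2⁻¹ * (g * f)
    set q := 2⁻¹ * (g * e)
    by_cases hβ0 : β = 0
    · subst hβ0
      refine (h.change (x' := x) (y' := y) (z' := z + C p * y + C q * x)
        !![1, 0, 0; 0, 1, 0; q, p, 1] (by simp [Matrix.det_fin_three]) (by simp) (by simp)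
        (by simp; ring)).classified .e5b h1 h2 h3' (forms_aeval ?_ ?_ ?_) <;> simp [Entry.forms]
    · refine (h.change (x' := x) (y' := 2 * C β * y) (z' := z + C p * y + C q * x - C β * y)
        !![1, 0, 0; 0, 2 * β, 0; q, p - β, 1] (by simp [Matrix.det_fin_three, hβ0]) (by simp)
        (by simp [map_ofNat]) (by simp; ring)).classified .e6b h1
        (V.mem_of_eq h2 h2 h2 (2 * β) 0 0 rfl) h3' (forms_aeval ?_ ?_ ?_)
      · simp [Entry.forms]
      · simp [Entry.forms, map_ofNat]; ring
      · simp [Entry.forms]; ring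

/-- The net contains a pencil of conics sharing the line `x`; the residual line is taken as the
second coordinate. -/
theorem classified_square_mul (h : Coords x y z) {d e : k} (h1 : x ^ 2 ∈ V.carrier)
    (h2 : C d * (x * y) + C e * (x * z) ∈ V.carrier) (h0 : ¬ (d = 0 ∧ e = 0)) :
    Classified V := by
  have key : ∀ {y z : MvPolynomial (Fin 3) k}, Coords x y z → x * y ∈ V.carrier →
      Classified V := by
    intro y z h h2
    obtain ⟨r, hr, hr'⟩ := V.exists_notMem (x ^ 2) (x * y)
    obtain ⟨a, b, c, d, e, f, rfl⟩ := h.exists_eq_quadratic (V.le_homogeneous hr)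
    refine classified_pencil_square h (b := b) (c := c) (e := e) (f := f) h1 h2
      (V.mem_of_eq hr h1 h2 1 (-a) (-d) (by simp; ring)) ?_
    rintro ⟨rfl, rfl, rfl, rfl⟩
    exact hr' a d (by simp)
  by_cases hd : d = 0
  · have he : e ≠ 0 := fun he => h0 ⟨hd, he⟩
    subst hd
    have hC := C_mul_inv he
    refine key (h.change (x' := x) (y' := z) (z' := y) !![1, 0, 0; 0, 0, 1; 0, 1, 0]
      (by simp [Matrix.det_fin_three]) (by simp) (by simp) (by simp))
      (V.mem_of_eq h2 h2 h2 e⁻¹ 0 0 ?_)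
    simp
    linear_combination (-x * z) * hC
  · refine key (h.change (x' := x) (y' := C d * y + C e * z) (z' := z)
      !![1, 0, 0; 0, d, e; 0, 0, 1] (by simp [Matrix.det_fin_three, hd]) (by simp) (by simp)
      (by simp)) (V.mem_of_eq h2 h2 h2 1 0 0 (by simp; ring))

/-- The third generator, reduced modulo the first two, is governed by its coefficients at `z²` and
`yz`. The three cases lead, after completing squares, to the preceding normal forms. -/
theorem classified_square_square (h : Coords x y z) {d e : k} (h1 : x ^ 2 ∈ V.carrier)
    (h2 : y ^ 2 + C d * (x * y) + C e * (x * z) ∈ V.carrier) : Classified V := by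
  obtain ⟨r, hr, hr'⟩ := V.exists_notMem (x ^ 2) (y ^ 2 + C d * (x * y) + C e * (x * z))
  obtain ⟨a, b, c, d', e', f, rfl⟩ := h.exists_eq_quadratic (V.le_homogeneous hr)
  have h3 : C c * z ^ 2 + C (d' - b * d) * (x * y) + C (e' - b * e) * (x * z) + C f * (y * z) ∈
      V.carrier := V.mem_of_eq hr h1 h2 1 (-a) (-b) (by simp; ring)
  have h3' : ¬ (c = 0 ∧ d' - b * d = 0 ∧ e' - b * e = 0 ∧ f = 0) := by
    rintro ⟨rfl, hd, he, rfl⟩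
    refine hr' a b ?_
    rw [show d' = b * d by linear_combination hd, show e' = b * e by linear_combination he]
    simp
    ring
  clear hr' hr
  generalize d' - b * d = D at *
  generalize e' - b * e = E at *
  have hC2 := C_half (k := k)
  by_cases hc : c = 0
  · subst hc
    by_cases hf : f = 0
    · subst hf
      refine classified_square_mul h (d := D) (e := E) h1 (V.mem_of_eq h3 h3 h3 1 0 0 (by simp))
        fun h => h3' ⟨rfl, h.1, h.2, rfl⟩
    · have hC := C_mul_inv hf
      set g := f⁻¹
      refine classified_square_product (h.change (x' := x) (y' := y + C (g * E) * x)
        (z' := z + C (g * D) * x) !![1, 0, 0; g * E, 1, 0; g * D, 0, 1]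
        (by simp [Matrix.det_fin_three]) (by simp) (by simp; ring) (by simp; ring))
        (a := d - 2 * (g * E)) (b := e) h1
        (V.mem_of_eq h2 h1 h1 1 (-(g * E) ^ 2 + d * (g * E) + e * (g * D)) 0 ?_)
        (V.mem_of_eq h3 h1 h1 g (g * E * (g * D)) 0 ?_)
      · simp [map_ofNat]; ring
      · simp
        linear_combination (-y * z) * hC
  · have hC := C_mul_inv hc
    set g := c⁻¹
    set p := 2⁻¹ * (g * f) with hp
    have hpC : (2 * C p : MvPolynomial (Fin 3) k) = C g * C f := by
      rw [hp]; simp only [C_mul]; linear_combination (C g * C f) * hC2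
    have h4 : (z + C p * y) ^ 2 + C (g * D - p * (g * E) + p ^ 2 * d - p ^ 3 * e) * (x * y) +
        C (g * E + p ^ 2 * e) * (x * (z + C p * y)) ∈ V.carrier := by
      refine V.mem_of_eq h3 h2 h2 g (p ^ 2) 0 ?_
      simp
      linear_combination (-z ^ 2) * hC + y * z * hpC
    have h5 : y ^ 2 + C (d - e * p) * (x * y) + C e * (x * (z + C p * y)) ∈ V.carrier := by
      refine V.mem_of_eq h2 h2 h2 1 0 0 ?_
      simp
      ring
    have h' : Coords x y (z + C p * y) := h.change !![1, 0, 0; 0, 1, 0; 0, p, 1]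
      (by simp [Matrix.det_fin_three]) (by simp) (by simp) (by simp; ring)
    generalize z + C p * y = w at *
    generalize g * D - p * (g * E) + p ^ 2 * d - p ^ 3 * e = D' at *
    generalize g * E + p ^ 2 * e = E' at *
    generalize d - e * p = d'' at *
    refine classified_two_squares (h'.change (x' := x) (y' := y + C (2⁻¹ * d'') * x)
      (z' := w + C (2⁻¹ * E') * x) !![1, 0, 0; 2⁻¹ * d'', 1, 0; 2⁻¹ * E', 0, 1]
      (by simp [Matrix.det_fin_three]) (by simp) (by simp; ring) (by simp; ring))
      (b := e) (d := D') h1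
      (V.mem_of_eq h5 h1 h1 1 ((2⁻¹ * d'') ^ 2 + e * (2⁻¹ * E')) 0 ?_)
      (V.mem_of_eq h4 h1 h1 1 ((2⁻¹ * E') ^ 2 + D' * (2⁻¹ * d'')) 0 ?_)
    · simp only [C_mul, C_add, C_pow, C_1, C_0]
      linear_combination (C d'' * x * y) * hC2
    · simp only [C_mul, C_add, C_pow, C_1, C_0]
      linear_combination (C E' * x * w) * hC2

omit [CharZero k] in
theorem exists_quadForm_eq_zero (a b c : k) :
    ∃ s t : k, ¬ (s = 0 ∧ t = 0) ∧ a * s ^ 2 + b * (s * t) + c * t ^ 2 = 0 := by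
  by_cases ha : a = 0
  · exact ⟨1, 0, by simp, by simp [ha]⟩
  · have hd : (Polynomial.C a * Polynomial.X ^ 2 + Polynomial.C b * Polynomial.X +
        Polynomial.C c).degree ≠ 0 := by
      rw [Polynomial.degree_quadratic ha]; norm_num
    obtain ⟨s, hs⟩ := IsAlgClosed.exists_root _ hd
    refine ⟨s, 1, by simp, ?_⟩
    simpa [Polynomial.IsRoot] using hs

/-- A net containing a double line is in the table. -/
theorem classified_of_square (h : Coords x y z) (h1 : x ^ 2 ∈ V.carrier) : Classified V := by
  obtain ⟨q₁, hq₁, hq₁'⟩ := V.exists_notMem (x ^ 2) (x ^ 2)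
  obtain ⟨q₂, hq₂, hq₂'⟩ := V.exists_notMem (x ^ 2) q₁
  obtain ⟨a₁, b₁, c₁, d₁, e₁, f₁, h₁⟩ := h.exists_eq_quadratic (V.le_homogeneous hq₁)
  obtain ⟨a₂, b₂, c₂, d₂, e₂, f₂, h₂⟩ := h.exists_eq_quadratic (V.le_homogeneous hq₂)
  -- On the line `x = 0` the remaining pencil becomes a pencil of binary quadratic forms. The
  -- discriminant is a quadratic form in `(s, t)`, so some member restricts to a perfect square.
  obtain ⟨s, t, hst, hd⟩ := exists_quadForm_eq_zero (f₁ ^ 2 - 4 * b₁ * c₁)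
    (2 * f₁ * f₂ - 4 * b₁ * c₂ - 4 * b₂ * c₁) (f₂ ^ 2 - 4 * b₂ * c₂)
  have h3 : C (s * b₁ + t * b₂) * y ^ 2 + C (s * c₁ + t * c₂) * z ^ 2 +
      C (s * d₁ + t * d₂) * (x * y) + C (s * e₁ + t * e₂) * (x * z) +
      C (s * f₁ + t * f₂) * (y * z) ∈ V.carrier :=
    V.mem_of_eq hq₁ hq₂ h1 s t (-(s * a₁ + t * a₂)) (by rw [h₁, h₂]; simp; ring)
  have h3' : ¬ (s * b₁ + t * b₂ = 0 ∧ s * c₁ + t * c₂ = 0 ∧ s * d₁ + t * d₂ = 0 ∧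
      s * e₁ + t * e₂ = 0 ∧ s * f₁ + t * f₂ = 0) := by
    rintro ⟨hb, hc, hd, he, hf⟩
    have e1 : C s * q₁ + C t * q₂ = C (s * a₁ + t * a₂) * x ^ 2 := by
      have : C s * q₁ + C t * q₂ = C (s * a₁ + t * a₂) * x ^ 2 + C (s * b₁ + t * b₂) * y ^ 2 +
          C (s * c₁ + t * c₂) * z ^ 2 + C (s * d₁ + t * d₂) * (x * y) +
          C (s * e₁ + t * e₂) * (x * z) + C (s * f₁ + t * f₂) * (y * z) := by
        rw [h₁, h₂]; simp; ring
      rw [this, hb, hc, hd, he, hf]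
      simp
    by_cases ht : t = 0
    · have hs : s ≠ 0 := fun hs => hst ⟨hs, ht⟩
      have hC := C_mul_inv hs
      subst ht
      refine hq₁' (s⁻¹ * (s * a₁ + 0 * a₂)) 0 ?_
      simp at e1 ⊢
      linear_combination C s⁻¹ * e1 - q₁ * hC
    · have hC := C_mul_inv ht
      refine hq₂' (t⁻¹ * (s * a₁ + t * a₂)) (-(t⁻¹ * s)) ?_
      simp only [C_mul, C_neg]
      linear_combination C t⁻¹ * e1 - q₂ * hC
  have hd' : (s * f₁ + t * f₂) ^ 2 = 4 * (s * b₁ + t * b₂) * (s * c₁ + t * c₂) := by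
    linear_combination hd
  clear hd hst hq₁' hq₂'
  generalize s * b₁ + t * b₂ = b at *
  generalize s * c₁ + t * c₂ = c at *
  generalize s * d₁ + t * d₂ = d at *
  generalize s * e₁ + t * e₂ = e at *
  generalize s * f₁ + t * f₂ = f at *
  obtain ⟨β, hβ⟩ := IsAlgClosed.exists_pow_nat_eq b (n := 2) (by norm_num)
  -- Square roots are determined only up to sign; the sign of `γ` is fixed by the mixed coefficient.
  have hγ : ∃ γ : k, γ ^ 2 = c ∧ 2 * β * γ = f := by
    obtain ⟨γ, hγ⟩ := IsAlgClosed.exists_pow_nat_eq c (n := 2) (by norm_num)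
    have : (2 * β * γ - f) * (2 * β * γ + f) = 0 := by
      linear_combination 4 * γ ^ 2 * hβ + 4 * b * hγ - hd'
    rcases mul_eq_zero.1 this with h | h
    · exact ⟨γ, hγ, by linear_combination h⟩
    · exact ⟨-γ, by rw [neg_sq, hγ], by linear_combination -h⟩
  obtain ⟨γ, hγ, hf⟩ := hγ
  subst hβ hγ hf
  by_cases hβ0 : β = 0
  · by_cases hγ0 : γ = 0
    · subst hβ0 hγ0
      refine classified_square_mul h (d := d) (e := e) h1
        (V.mem_of_eq h3 h3 h3 1 0 0 (by simp)) ?_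
      rintro ⟨rfl, rfl⟩
      exact h3' (by simp)
    · subst hβ0
      have hC := C_mul_inv hγ0
      refine classified_square_square (h.change (x' := x) (y' := C γ * z) (z' := y)
        !![1, 0, 0; 0, 0, γ; 0, 1, 0] (by simp [Matrix.det_fin_three, hγ0]) (by simp) (by simp)
        (by simp)) (d := γ⁻¹ * e) (e := d) h1 (V.mem_of_eq h3 h3 h3 1 0 0 ?_)
      simp
      linear_combination (C e * x * z) * hC
  · have hC := C_mul_inv hβ0
    refine classified_square_square (h.change (x' := x) (y' := C β * y + C γ * z) (z' := z)
      !![1, 0, 0; 0, β, γ; 0, 0, 1] (by simp [Matrix.det_fin_three, hβ0]) (by simp) (by simp)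
      (by simp)) (d := β⁻¹ * d) (e := e - β⁻¹ * d * γ) h1 (V.mem_of_eq h3 h3 h3 1 0 0 ?_)
    simp [map_ofNat]
    linear_combination (C d * x * y) * hC

end Squares

end NetsOfConics

end

open MvPolynomial

noncomputable section

namespace NetsOfConics

/-! ### Cubics whose polars lie in a net. -/

section Polar

variable {k : Type*} [Field k]

/-- The polars of the cubic form `f` lie in the net `V`. -/
structure IsPolarCubic (f : MvPolynomial (Fin 3) k) (V : Net k) : Prop where
  isHomogeneous : f.IsHomogeneous 3
  ne_zero : f ≠ 0
  pderiv_mem : ∀ i, pderiv i f ∈ V.carrier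

theorem IsPolarCubic.act {f : MvPolynomial (Fin 3) k} {V : Net k} (h : IsPolarCubic f V)
    (g : GL (Fin 3) k) : IsPolarCubic (subst g f) (V.act g) where
  isHomogeneous := subst_isHomogeneous g h.isHomogeneous
  ne_zero := fun h0 => h.ne_zero (subst_injective g (by rw [h0, map_zero]))
  pderiv_mem := fun i => by
    rw [pderiv_subst]
    refine sum_mem fun j _ => ?_
    rw [← smul_eq_C_mul]
    exact (V.act g).carrier.smul_mem _ ⟨_, h.pderiv_mem j, rfl⟩

theorem eval_subst (g : GL (Fin 3) k) (v : Fin 3 → k) (p : MvPolynomial (Fin 3) k) :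
    eval v (subst g p) = eval (g.1.mulVec v) p := by
  have : (aeval v : MvPolynomial (Fin 3) k →ₐ[k] k).comp (subst g) = aeval (g.1.mulVec v) :=
    MvPolynomial.algHom_ext fun i => by simp [lin, Matrix.mulVec, dotProduct]
  simpa [coe_aeval_eq_eval] using DFunLike.congr_fun this p

theorem pderiv_eq_sum_hess {p : MvPolynomial (Fin 3) k} (hp : p.IsHomogeneous 2) (j : Fin 3) :
    pderiv j p = ∑ a, X a * C (hess p a j) := by
  have h1 : (pderiv j p).IsHomogeneous 1 := hp.pderiv
  have h := h1.sum_X_mul_pderiv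
  rw [one_smul] at h
  rw [← h]
  refine Finset.sum_congr rfl fun a _ => ?_
  have h0 : (pderiv a (pderiv j p)).IsHomogeneous 0 := h1.pderiv
  rw [hess_apply]
  congr 1
  have h2 : (pderiv a (pderiv j p)).totalDegree = 0 := Nat.le_zero.1 h0.totalDegree_le
  exact totalDegree_eq_zero_iff_eq_C.1 h2

omit [Field k] in
-- The ninth closedness equation, `h 0 1 2 = h 1 0 2`, follows from `e0`, `e4` and the symmetry of
-- each Hessian. Saving it is what makes the dimension count in `exists_isPolarCubic` succeed.
theorem symm_of_curl_eq_zero {h : Fin 3 → Fin 3 → Fin 3 → k} (hs : ∀ i a b, h i a b = h i b a)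
    (e0 : h 1 2 0 = h 2 1 0) (e1 : h 1 2 1 = h 2 1 1) (e2 : h 1 2 2 = h 2 1 2)
    (e3 : h 2 0 0 = h 0 2 0) (e4 : h 2 0 1 = h 0 2 1) (e5 : h 2 0 2 = h 0 2 2)
    (e6 : h 0 1 0 = h 1 0 0) (e7 : h 0 1 1 = h 1 0 1) (i j a : Fin 3) :
    h i a j = h j a i := by
  have a0 := hs 0 0 1
  have a1 := hs 0 0 2
  have a2 := hs 0 1 2
  have b0 := hs 1 0 1
  have b1 := hs 1 0 2
  have b2 := hs 1 1 2
  have c0 := hs 2 0 1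
  have c1 := hs 2 0 2
  have c2 := hs 2 1 2
  fin_cases i <;> fin_cases j <;> fin_cases a <;>
    first
    | rfl
    | (simp only [Fin.zero_eta, Fin.mk_one, Fin.reduceFinMk]; grind)

/-- A net contains the polars of some cubic form. -/
theorem exists_isPolarCubic [CharZero k] (V : Net k) : ∃ f, IsPolarCubic f V := by
  have := V.finiteDimensional
  let H : Fin 3 → Fin 3 → Fin 3 → (Fin 3 → V.carrier) →ₗ[k] k := fun i a b =>
    { toFun := fun p => hess (p i : MvPolynomial (Fin 3) k) a b
      map_add' := by simp
      map_smul' := by simp }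
  let T : (Fin 3 → V.carrier) →ₗ[k] (Fin 8 → k) := LinearMap.pi
    ![H 1 2 0 - H 2 1 0, H 1 2 1 - H 2 1 1, H 1 2 2 - H 2 1 2,
      H 2 0 0 - H 0 2 0, H 2 0 1 - H 0 2 1, H 2 0 2 - H 0 2 2,
      H 0 1 0 - H 1 0 0, H 0 1 1 - H 1 0 1]
  -- Three members of a 3-dimensional net carry nine parameters, against eight linear equations.
  have hdim : Module.finrank k (Fin 8 → k) < Module.finrank k (Fin 3 → V.carrier) := by
    rw [Module.finrank_pi_fintype k (M := fun _ : Fin 3 => V.carrier)]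
    simp [V.finrank_eq]
  obtain ⟨p, hp, hp0⟩ := Submodule.exists_mem_ne_zero_of_ne_bot
    (LinearMap.ker_ne_bot_of_finrank_lt hdim (f := T))
  rw [LinearMap.mem_ker] at hp
  have hT : ∀ n, T p n = 0 := fun n => by rw [hp]; rfl
  have e0 := hT 0
  have e1 := hT 1
  have e2 := hT 2
  have e3 := hT 3
  have e4 := hT 4
  have e5 := hT 5
  have e6 := hT 6
  have e7 := hT 7
  simp [T, H] at e0 e1 e2 e3 e4 e5 e6 e7
  have key : ∀ i j a : Fin 3, hess (p i : MvPolynomial (Fin 3) k) a j =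
      hess (p j : MvPolynomial (Fin 3) k) a i :=
    symm_of_curl_eq_zero (h := fun i => hess (p i : MvPolynomial (Fin 3) k))
      (fun i => hess_symm _) (sub_eq_zero.1 e0) (sub_eq_zero.1 e1) (sub_eq_zero.1 e2)
      (sub_eq_zero.1 e3) (sub_eq_zero.1 e4) (sub_eq_zero.1 e5) (sub_eq_zero.1 e6)
      (sub_eq_zero.1 e7)
  have hq : ∀ i, (p i : MvPolynomial (Fin 3) k).IsHomogeneous 2 := fun i =>
    V.le_homogeneous (p i).2
  have hC3 : (C (3⁻¹ : k) * 3 : MvPolynomial (Fin 3) k) = 1 := by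
    rw [← map_ofNat C, ← C_mul]; simp
  -- Integration of a closed triple: by Euler, the `j`-th derivative of the sum of the `X i * p i`
  -- is `p j + 2 * p j`.
  have hpd : ∀ j, pderiv j (C (3⁻¹ : k) * ∑ i, X i * (p i : MvPolynomial (Fin 3) k)) = p j := by
    intro j
    have h1 : ∀ i, pderiv j (p i : MvPolynomial (Fin 3) k) = pderiv i (p j).1 := fun i => by
      rw [pderiv_eq_sum_hess (hq i), pderiv_eq_sum_hess (hq j)]
      simp_rw [key i j]
    have h2 := (hq j).sum_X_mul_pderiv
    have h3 : pderiv j (∑ i, X i * (p i : MvPolynomial (Fin 3) k)) =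
        (p j).1 + ∑ i, X i * pderiv i (p j).1 := by
      simp only [map_sum, Derivation.leibniz, smul_eq_mul, h1, Finset.sum_add_distrib, pderiv_X,
        Pi.single_apply, mul_ite, mul_one, mul_zero]
      rw [Finset.sum_ite_eq']
      simp [add_comm]
    rw [Derivation.leibniz, derivation_C, h3, h2, smul_zero, add_zero, smul_eq_mul, nsmul_eq_mul]
    push_cast
    linear_combination (p j).1 * hC3
  refine ⟨C (3⁻¹ : k) * ∑ i, X i * (p i : MvPolynomial (Fin 3) k), ?_, ?_, fun i => ?_⟩
  · have : (∑ i, X i * (p i : MvPolynomial (Fin 3) k)).IsHomogeneous 3 :=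
      IsHomogeneous.sum _ _ _ fun i _ => by
        simpa using (isHomogeneous_X k i).mul (hq i)
    simpa using (isHomogeneous_C (Fin 3) (3⁻¹ : k)).mul this
  · intro h0
    refine hp0 (funext fun j => Subtype.ext ?_)
    rw [← hpd j, h0]
    simp
  · rw [hpd]
    exact (p i).2

/-- The general ternary cubic form. -/
def cubic (a₁ a₂ a₃ a₄ a₅ a₆ a₇ a₈ a₉ b : k) : MvPolynomial (Fin 3) k :=
  C a₁ * X 0 ^ 3 + C a₂ * X 1 ^ 3 + C a₃ * X 2 ^ 3 + C a₄ * (X 0 ^ 2 * X 1) +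
    C a₅ * (X 0 ^ 2 * X 2) + C a₆ * (X 0 * X 1 ^ 2) + C a₇ * (X 1 ^ 2 * X 2) +
    C a₈ * (X 0 * X 2 ^ 2) + C a₉ * (X 1 * X 2 ^ 2) + C b * (X 0 * X 1 * X 2)

theorem exists_eq_cubic [CharZero k] {f : MvPolynomial (Fin 3) k} (hf : f.IsHomogeneous 3) :
    ∃ a₁ a₂ a₃ a₄ a₅ a₆ a₇ a₈ a₉ b : k, f = cubic a₁ a₂ a₃ a₄ a₅ a₆ a₇ a₈ a₉ b := by
  have h : ∀ i, (pderiv i f).IsHomogeneous 2 := fun i => hf.pderiv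
  obtain ⟨a₀, b₀, c₀, d₀, e₀, f₀, h₀⟩ := exists_eq_quadratic_X (h 0)
  obtain ⟨a₁, b₁, c₁, d₁, e₁, f₁, h₁⟩ := exists_eq_quadratic_X (h 1)
  obtain ⟨a₂, b₂, c₂, d₂, e₂, f₂, h₂⟩ := exists_eq_quadratic_X (h 2)
  have e := hf.sum_X_mul_pderiv
  have hC3 : (C (3⁻¹ : k) * 3 : MvPolynomial (Fin 3) k) = 1 := by
    rw [← map_ofNat C, ← C_mul]; simp
  simp only [Fin.sum_univ_three, h₀, h₁, h₂, nsmul_eq_mul, Nat.cast_ofNat] at e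
  refine ⟨3⁻¹ * a₀, 3⁻¹ * b₁, 3⁻¹ * c₂, 3⁻¹ * (d₀ + a₁), 3⁻¹ * (e₀ + a₂), 3⁻¹ * (b₀ + d₁),
    3⁻¹ * (f₁ + b₂), 3⁻¹ * (c₀ + e₂), 3⁻¹ * (c₁ + f₂), 3⁻¹ * (f₀ + e₁ + d₂), ?_⟩
  simp only [cubic, C_mul, C_add]
  linear_combination -f * hC3 - C 3⁻¹ * e

theorem pderiv_cubic_zero (a₁ a₂ a₃ a₄ a₅ a₆ a₇ a₈ a₉ b : k) :
    pderiv 0 (cubic a₁ a₂ a₃ a₄ a₅ a₆ a₇ a₈ a₉ b) = C (3 * a₁) * X 0 ^ 2 + C (2 * a₄) * (X 0 * X 1) +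
      C (2 * a₅) * (X 0 * X 2) + C a₆ * X 1 ^ 2 + C a₈ * X 2 ^ 2 + C b * (X 1 * X 2) := by
  simp [cubic, pderiv_X, Derivation.leibniz_pow, map_ofNat]
  ring

theorem pderiv_cubic_one (a₁ a₂ a₃ a₄ a₅ a₆ a₇ a₈ a₉ b : k) :
    pderiv 1 (cubic a₁ a₂ a₃ a₄ a₅ a₆ a₇ a₈ a₉ b) = C (3 * a₂) * X 1 ^ 2 + C a₄ * X 0 ^ 2 +
      C (2 * a₆) * (X 0 * X 1) + C (2 * a₇) * (X 1 * X 2) + C a₉ * X 2 ^ 2 + C b * (X 0 * X 2) := by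
  simp [cubic, pderiv_X, Derivation.leibniz_pow, map_ofNat]
  ring

theorem pderiv_cubic_two (a₁ a₂ a₃ a₄ a₅ a₆ a₇ a₈ a₉ b : k) :
    pderiv 2 (cubic a₁ a₂ a₃ a₄ a₅ a₆ a₇ a₈ a₉ b) = C (3 * a₃) * X 2 ^ 2 + C a₅ * X 0 ^ 2 +
      C a₇ * X 1 ^ 2 + C (2 * a₈) * (X 0 * X 2) + C (2 * a₉) * (X 1 * X 2) + C b * (X 0 * X 1) := by
  simp [cubic, pderiv_X, Derivation.leibniz_pow, map_ofNat]
  ring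

/-- Every nonzero vector is the last column of an invertible matrix. -/
theorem exists_mulVec_eq {p : Fin 3 → k} (hp : p ≠ 0) :
    ∃ g : GL (Fin 3) k, g.1.mulVec ![0, 0, 1] = p := by
  by_cases h2 : p 2 = 0
  · by_cases h1 : p 1 = 0
    · have h0 : p 0 ≠ 0 := fun h0 => hp (by ext i; fin_cases i <;> simp [h0, h1, h2])
      exact ⟨toGL !![0, 0, p 0; 1, 0, p 1; 0, 1, p 2] (by simp [Matrix.det_fin_three, h0]), by
        ext i; fin_cases i <;> simp [Matrix.mulVec, dotProduct, Fin.sum_univ_three]⟩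
    · exact ⟨toGL !![1, 0, p 0; 0, 0, p 1; 0, 1, p 2] (by simp [Matrix.det_fin_three, h1]), by
        ext i; fin_cases i <;> simp [Matrix.mulVec, dotProduct, Fin.sum_univ_three]⟩
  · exact ⟨toGL !![1, 0, p 0; 0, 1, p 1; 0, 0, p 2] (by simp [Matrix.det_fin_three, h2]), by
      ext i; fin_cases i <;> simp [Matrix.mulVec, dotProduct, Fin.sum_univ_three]⟩

theorem Classified.of_act [CharZero k] {V : Net k} {g : GL (Fin 3) k} (h : Classified (V.act g)) :
    Classified V := by
  obtain ⟨a, ha⟩ := h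
  exact ⟨a, mem_orbit_trans (mem_orbit_symm (act_mem_orbit g V)) ha⟩

/-- A nonzero binary form of discriminant zero is a square. -/
theorem classified_of_disc_eq_zero [CharZero k] [IsAlgClosed k] {V : Net k}
    {x y z : MvPolynomial (Fin 3) k} (h : Coords x y z) {a b c : k}
    (hd : b ^ 2 = 4 * a * c) (h0 : ¬ (a = 0 ∧ b = 0 ∧ c = 0))
    (hm : C a * x ^ 2 + C b * (x * y) + C c * y ^ 2 ∈ V.carrier) : Classified V := by
  have hC2 := C_half (k := k)
  by_cases ha : a = 0
  · subst ha
    have hb : b = 0 := by simpa using hd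
    subst hb
    have hc : c ≠ 0 := fun hc => h0 ⟨rfl, rfl, hc⟩
    have hC := C_mul_inv hc
    refine classified_of_square (h.change (x' := y) (y' := x) (z' := z)
      !![0, 1, 0; 1, 0, 0; 0, 0, 1] (by simp [Matrix.det_fin_three]) (by simp) (by simp) (by simp))
      (V.mem_of_eq hm hm hm c⁻¹ 0 0 ?_)
    simp
    linear_combination (-y ^ 2) * hC
  · have hC := C_mul_inv ha
    have hd' : (C b ^ 2 : MvPolynomial (Fin 3) k) = 4 * C a * C c := by
      rw [← C_pow, hd]; simp [map_ofNat]
    refine classified_of_square (h.change (x' := x + C (2⁻¹ * (a⁻¹ * b)) * y) (y' := y) (z' := z)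
      !![1, 2⁻¹ * (a⁻¹ * b), 0; 0, 1, 0; 0, 0, 1] (by simp [Matrix.det_fin_three]) (by simp)
      (by simp) (by simp)) (V.mem_of_eq hm hm hm a⁻¹ 0 0 ?_)
    simp only [C_mul, C_0]
    linear_combination (-x ^ 2) * hC + (C a⁻¹ * C b * x * y) * hC2 +
      (y ^ 2 * C a⁻¹ ^ 2 * C 2⁻¹ ^ 2) * hd' +
      (y ^ 2 * C a⁻¹ * C c) * (hC * (4 * C 2⁻¹ ^ 2) + (C 2⁻¹ * 2 + 1) * hC2)

end Polar

end NetsOfConics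

end

open MvPolynomial

noncomputable section

namespace NetsOfConics

/-! ### Nets containing the polars of a singular cubic. -/

section SingularPolar

variable {k : Type*} [Field k] [CharZero k] [IsAlgClosed k] {x y z : MvPolynomial (Fin 3) k}
  {V : Net k}

/-- The number of nonzero parameters decides between `6a`, `7a` and `8a`. -/
theorem classified_product (h : Coords x y z) {a d : k} (h1 : x * y ∈ V.carrier)
    (h2 : y * z + C a * x ^ 2 ∈ V.carrier) (h3 : x * z + C d * y ^ 2 ∈ V.carrier) :
    Classified V := by
  have key : ∀ {x y : MvPolynomial (Fin 3) k} {a : k}, Coords x y z → a ≠ 0 →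
      x * y ∈ V.carrier → y * z + C a * x ^ 2 ∈ V.carrier → x * z ∈ V.carrier →
      Classified V := by
    intro x y a h ha h1 h2 h3
    have hC := C_mul_inv ha
    refine (h.change (x' := x) (y' := C a⁻¹ * y) (z' := z) !![1, 0, 0; 0, a⁻¹, 0; 0, 0, 1]
      (by simp [Matrix.det_fin_three, ha]) (by simp) (by simp) (by simp)).classified .e7a
      (V.mem_of_eq h2 h2 h2 a⁻¹ 0 0 rfl) (V.mem_of_eq h1 h1 h1 a⁻¹ 0 0 rfl) h3
      (forms_aeval ?_ ?_ ?_) <;> simp [Entry.forms]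
    · linear_combination (-x ^ 2) * hC
    · ring
  by_cases ha : a = 0
  · subst ha
    by_cases hd : d = 0
    · subst hd
      exact h.classified .e6a h1 h3 h2 (forms_aeval (by simp [Entry.forms]) (by simp [Entry.forms])
        (by simp [Entry.forms]))
    · refine key (h.change (x' := y) (y' := x) (z' := z) !![0, 1, 0; 1, 0, 0; 0, 0, 1]
        (by simp [Matrix.det_fin_three]) (by simp) (by simp) (by simp)) hd (mul_comm x y ▸ h1) h3 ?_
      simpa using h2
  · by_cases hd : d = 0
    · subst hd
      exact key h ha h1 h2 (by simpa using h3)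
    -- Scaling `x` by `l` and `y` by `m` normalizes both parameters when `m * a = l ^ 2` and `m ^ 2
    -- = l * d`; eliminating `m` gives `l ^ 3 = a ^ 2 * d`.
    · obtain ⟨l, hl⟩ := IsAlgClosed.exists_pow_nat_eq (a ^ 2 * d) (n := 3) (by norm_num)
      have hl0 : l ≠ 0 := by
        rintro rfl
        simp [ha, hd] at hl
      obtain ⟨m, hm⟩ : ∃ m, m * a = l ^ 2 := ⟨l ^ 2 / a, by field_simp⟩
      have hm0 : m ≠ 0 := by
        rintro rfl
        rw [zero_mul] at hm
        exact pow_ne_zero 2 hl0 hm.symm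
      have hmd : m ^ 2 = l * d := by
        have : a ^ 2 * (m ^ 2 - l * d) = 0 := by linear_combination (m * a + l ^ 2) * hm + l * hl
        rcases mul_eq_zero.1 this with h | h
        · simp [ha] at h
        · linear_combination h
      have hmC : (C m * C a : MvPolynomial (Fin 3) k) = C l ^ 2 := by
        rw [← C_mul, hm, C_pow]
      have hmdC : (C m ^ 2 : MvPolynomial (Fin 3) k) = C l * C d := by
        rw [← C_pow, hmd, C_mul]
      refine (h.change (x' := C l * x) (y' := C m * y) (z' := z) !![l, 0, 0; 0, m, 0; 0, 0, 1]
        (by simp [Matrix.det_fin_three, hl0, hm0]) (by simp) (by simp) (by simp)).classified .e8a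
        (V.mem_of_eq h1 h1 h1 (l * m) 0 0 rfl) (V.mem_of_eq h2 h1 h1 m 0 0 rfl)
        (V.mem_of_eq h3 h1 h1 l 0 0 rfl) (forms_aeval ?_ ?_ ?_) <;> simp [Entry.forms]
      · ring
      · linear_combination (-x ^ 2) * hmC
      · linear_combination y ^ 2 * hmdC

variable {a₁ a₂ a₄ a₅ a₆ a₇ b : k}

/-- With tangent cone `XY` at the node, the polar in the third direction is a multiple of `XY`. It
cleans up the other two polars, once the `XY²` and `X²Y` terms are absorbed into `Z`. -/
theorem classified_of_node (hb : b ≠ 0) (h : IsPolarCubic (cubic a₁ a₂ 0 a₄ 0 a₆ 0 0 0 b) V) :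
    Classified V := by
  have h0 := h.pderiv_mem 0
  have h1 := h.pderiv_mem 1
  have h2 := h.pderiv_mem 2
  rw [pderiv_cubic_zero] at h0
  rw [pderiv_cubic_one] at h1
  rw [pderiv_cubic_two] at h2
  have hC := C_mul_inv hb
  refine classified_product (coords_X.change (x' := X 0) (y' := X 1)
    (z' := X 2 + C (b⁻¹ * a₆) * X 1 + C (b⁻¹ * a₄) * X 0)
    !![1, 0, 0; 0, 1, 0; b⁻¹ * a₄, b⁻¹ * a₆, 1] (by simp [Matrix.det_fin_three]) (by simp) (by simp)
    (by simp; ring)) (a := 3 * (b⁻¹ * a₁)) (d := 3 * (b⁻¹ * a₂))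
    (V.mem_of_eq h2 h2 h2 b⁻¹ 0 0 ?_) (V.mem_of_eq h0 h2 h2 b⁻¹ (-(b⁻¹ * (b⁻¹ * a₄))) 0 ?_)
    (V.mem_of_eq h1 h2 h2 b⁻¹ (-(b⁻¹ * (b⁻¹ * a₆))) 0 ?_)
  · simp
    linear_combination (-X 0 * X 1) * hC
  · simp [map_ofNat]
    linear_combination (-X 1 * X 2 + C b⁻¹ * C a₄ * X 0 * X 1) * hC
  · simp [map_ofNat]
    linear_combination (-X 0 * X 2 + C b⁻¹ * C a₆ * X 0 * X 1) * hC

/-- For a binary cubic, the discriminant of the polar in direction `(s, t)` is a multiple of the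
Hessian. A zero of the Hessian gives a polar that is a square; if that polar vanishes, the cubic is
a cube and another polar is a square. -/
theorem classified_of_cone (h : IsPolarCubic (cubic a₁ a₂ 0 a₄ 0 a₆ 0 0 0 0) V) :
    Classified V := by
  have h0 := h.pderiv_mem 0
  have h1 := h.pderiv_mem 1
  rw [pderiv_cubic_zero] at h0
  rw [pderiv_cubic_one] at h1
  have hne : ¬ (a₁ = 0 ∧ a₄ = 0 ∧ a₆ = 0 ∧ a₂ = 0) := by
    rintro ⟨rfl, rfl, rfl, rfl⟩
    exact h.ne_zero (by simp [cubic])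
  obtain ⟨s, t, hst, hd⟩ := exists_quadForm_eq_zero (a₄ ^ 2 - 3 * a₁ * a₆)
    (a₄ * a₆ - 9 * a₁ * a₂) (a₆ ^ 2 - 3 * a₂ * a₄)
  by_cases hz : s * (3 * a₁) + t * a₄ = 0 ∧ 2 * (s * a₄ + t * a₆) = 0 ∧ s * a₆ + t * (3 * a₂) = 0
  · obtain ⟨z1, z2, z3⟩ := hz
    have z2' : s * a₄ + t * a₆ = 0 := by simpa using z2
    by_cases ht : t = 0
    · subst ht
      have hs : s ≠ 0 := fun hs => hst ⟨hs, rfl⟩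
      have e1 : a₁ = 0 := by simpa [hs] using z1
      have e4 : a₄ = 0 := by simpa [hs] using z2'
      have e6 : a₆ = 0 := by simpa [hs] using z3
      subst e1 e4 e6
      refine classified_of_disc_eq_zero coords_X (a := 0) (b := 0) (c := 3 * a₂) (by simp) ?_
        (V.mem_of_eq h1 h1 h1 1 0 0 (by simp))
      rintro ⟨-, -, h⟩
      exact hne ⟨rfl, rfl, rfl, by simpa using h⟩
    · refine classified_of_disc_eq_zero coords_X (a := 3 * a₁) (b := 2 * a₄) (c := a₆) ?_ ?_
        (V.mem_of_eq h0 h0 h0 1 0 0 (by simp))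
      · have : t * ((2 * a₄) ^ 2 - 4 * (3 * a₁) * a₆) = 0 := by
          linear_combination 4 * a₄ * z1 - 12 * a₁ * z2'
        linear_combination (mul_eq_zero.1 this).resolve_left ht
      · rintro ⟨e1, e4, rfl⟩
        have e1 : a₁ = 0 := by simpa using e1
        have e4 : a₄ = 0 := by simpa using e4
        exact hne ⟨e1, e4, rfl, by simpa [ht] using z3⟩
  · exact classified_of_disc_eq_zero coords_X (by linear_combination 4 * hd) hz
      (V.mem_of_eq h0 h1 h1 s t 0 (by simp [map_ofNat]; ring))

omit [CharZero k] in
theorem exists_roots_of_disc_ne_zero {a b c : k} (h : b ^ 2 ≠ 4 * a * c) :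
    ∃ s t s' t' : k, s * t' - s' * t ≠ 0 ∧ a * s ^ 2 + b * (s * t) + c * t ^ 2 = 0 ∧
      a * s' ^ 2 + b * (s' * t') + c * t' ^ 2 = 0 := by
  by_cases ha : a = 0
  · subst ha
    exact ⟨1, 0, -c, b, by simpa using h, by ring, by ring⟩
  · obtain ⟨s, t, hst, hq⟩ := exists_quadForm_eq_zero a b c
    have ht : t ≠ 0 := by
      rintro rfl
      simp [ha] at hq
      exact hst ⟨hq, rfl⟩
    -- The second zero comes from Vieta's formula for the sum of the roots.
    refine ⟨s, t, -b * t - a * s, a * t, fun h0 => h ?_, hq, by linear_combination a ^ 2 * hq⟩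
    have h1 : t * (2 * a * s + b * t) = 0 := by linear_combination h0
    have h2 := (mul_eq_zero.1 h1).resolve_left ht
    have h3 : t ^ 2 * (b ^ 2 - 4 * a * c) = 0 := by
      linear_combination (2 * a * s + b * t) * h2 - 4 * a * hq
    linear_combination (mul_eq_zero.1 h3).resolve_left (pow_ne_zero 2 ht)

/-- The polar at the singular point is its tangent cone. If degenerate, it is zero (the cubic is a
cone) or a double line in the net; otherwise its two lines become coordinate lines and the point a
node. -/
theorem classified_of_singular (h : IsPolarCubic (cubic a₁ a₂ 0 a₄ a₅ a₆ a₇ 0 0 b) V) :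
    Classified V := by
  have h2 := h.pderiv_mem 2
  rw [pderiv_cubic_two] at h2
  by_cases hd : b ^ 2 = 4 * a₅ * a₇
  · by_cases h0 : a₅ = 0 ∧ b = 0 ∧ a₇ = 0
    · obtain ⟨rfl, rfl, rfl⟩ := h0
      exact classified_of_cone h
    · exact classified_of_disc_eq_zero coords_X hd h0 (V.mem_of_eq h2 h2 h2 1 0 0 (by simp; ring))
  · obtain ⟨s, t, s', t', hdet, hs, hs'⟩ := exists_roots_of_disc_ne_zero hd
    let g : GL (Fin 3) k := toGL !![s, s', 0; t, t', 0; 0, 0, 1]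
      (by simpa [Matrix.det_fin_three] using hdet)
    have hg : g.1 = !![s, s', 0; t, t', 0; 0, 0, 1] := rfl
    have h' := h.act g
    obtain ⟨c₁, c₂, c₃, c₄, c₅, c₆, c₇, c₈, c₉, d, hf⟩ := exists_eq_cubic h'.isHomogeneous
    have hp : pderiv 2 (subst g (cubic a₁ a₂ 0 a₄ a₅ a₆ a₇ 0 0 b)) =
        subst g (pderiv 2 (cubic a₁ a₂ 0 a₄ a₅ a₆ a₇ 0 0 b)) := by
      rw [pderiv_subst, hg]
      simp [Fin.sum_univ_three]
    rw [hf] at h' hp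
    rw [pderiv_cubic_two, pderiv_cubic_two] at hp
    -- Values at six points suffice to identify the coefficients of the transformed tangent cone.
    have ev := fun v : Fin 3 → k => congrArg (eval v) hp
    simp only [eval_subst, hg] at ev
    have e1 := ev ![0, 0, 1]
    have e2 := ev ![1, 0, 0]
    have e3 := ev ![0, 1, 0]
    have e4 := ev ![1, 0, 1]
    have e5 := ev ![0, 1, 1]
    have e6 := ev ![1, 1, 0]
    simp at e1 e2 e3 e4 e5 e6
    have z5 : c₅ = 0 := by linear_combination e2 + hs
    have z7 : c₇ = 0 := by linear_combination e3 + hs'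
    subst e1 z5 z7
    have z8 : c₈ = 0 := by
      have : 2 * c₈ = 0 := by linear_combination e4 + hs
      simpa using this
    have z9 : c₉ = 0 := by
      have : 2 * c₉ = 0 := by linear_combination e5 + hs'
      simpa using this
    subst z8 z9
    refine (classified_of_node ?_ h').of_act
    rintro rfl
    have : (b ^ 2 - 4 * a₅ * a₇) * (s * t' - s' * t) ^ 2 = 0 := by
      have e7 : 2 * a₅ * (s * s') + b * (s * t' + s' * t) + 2 * a₇ * (t * t') = 0 := by
        linear_combination -e6 - hs - hs'
      linear_combination (2 * a₅ * (s * s') + b * (s * t' + s' * t) + 2 * a₇ * (t * t')) * e7 -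
        4 * (a₅ * s' ^ 2 + b * (s' * t') + a₇ * t' ^ 2) * hs
    rcases mul_eq_zero.1 this with h | h
    · exact hd (by linear_combination h)
    · exact hdet (by simpa using h)

/-- A net containing the polars of a singular cubic form is in the table. -/
theorem IsPolarCubic.classified_of_singular {f : MvPolynomial (Fin 3) k} (h : IsPolarCubic f V)
    {p : Fin 3 → k} (hp : p ≠ 0) (hs : ∀ i, eval p (pderiv i f) = 0) : Classified V := by
  obtain ⟨g, rfl⟩ := exists_mulVec_eq hp
  have h' := h.act g
  have hs' : ∀ i, eval ![0, 0, 1] (pderiv i (subst g f)) = 0 := fun i => by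
    simp [pderiv_subst, eval_subst, hs]
  obtain ⟨c₁, c₂, c₃, c₄, c₅, c₆, c₇, c₈, c₉, d, hf⟩ := exists_eq_cubic h'.isHomogeneous
  rw [hf] at h' hs'
  have e0 := hs' 0
  have e1 := hs' 1
  have e2 := hs' 2
  rw [pderiv_cubic_zero] at e0
  rw [pderiv_cubic_one] at e1
  rw [pderiv_cubic_two] at e2
  simp at e0 e1 e2
  subst e0 e1 e2
  exact (NetsOfConics.classified_of_singular h').of_act

end SingularPolar

end NetsOfConics

end

open MvPolynomial

noncomputable section

namespace NetsOfConics

/-! ### From Weierstrass form to Hesse form. -/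

section SmoothPolar

variable {k : Type*} [Field k] [CharZero k] [IsAlgClosed k] {x y z : MvPolynomial (Fin 3) k}
  {V : Net k}

/-- The value `l ^ 3 = 8` is absent from the table because the net then contains a double line: with
`l = 2c`, the square of `x + y + cz`. -/
theorem classified_hesse (h : Coords x y z) {l : k} (hl0 : l ≠ 0) (hl1 : l ^ 3 ≠ -1)
    (h1 : x ^ 2 + C l * (y * z) ∈ V.carrier) (h2 : y ^ 2 + C l * (x * z) ∈ V.carrier)
    (h3 : z ^ 2 + C l * (x * y) ∈ V.carrier) : Classified V := by
  by_cases hl : l ^ 3 = 8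
  · obtain ⟨c, rfl⟩ : ∃ c, l = 2 * c := ⟨l / 2, by field_simp⟩
    have hc : c ^ 3 = 1 := by
      have : 8 * (c ^ 3 - 1) = 0 := by linear_combination hl
      have := (mul_eq_zero.1 this).resolve_left (by norm_num)
      linear_combination this
    have hcC : (C c ^ 3 : MvPolynomial (Fin 3) k) = 1 := by rw [← C_pow, hc, C_1]
    refine classified_of_square (h.change (x' := x + y + C c * z) (y' := y) (z' := z)
      !![1, 1, c; 0, 1, 0; 0, 0, 1] (by simp [Matrix.det_fin_three]) (by simp) (by simp) (by simp))
      (V.mem_of_eq h1 h2 h3 1 1 (c ^ 2) ?_)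
    simp [map_ofNat]
    linear_combination (-2 * x * y) * hcC
  · exact h.classified (.e8b l ⟨hl0, hl1, hl⟩) h1 h2 h3 (forms_aeval (by simp [Entry.forms])
      (by simp [Entry.forms]) (by simp [Entry.forms]))

/-- Rescaling `x` by a cube root of `m / n` equalizes the coefficients; `m ≠ n` becomes `l ^ 3 ≠
-1`. -/
theorem classified_hesse_scaled (h : Coords x y z) {m n : k} (hm : m ≠ 0) (hn : n ≠ 0)
    (hmn : m ≠ n) (h1 : C n * x ^ 2 - C m * (y * z) ∈ V.carrier) (h2 : y ^ 2 - x * z ∈ V.carrier)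
    (h3 : z ^ 2 - x * y ∈ V.carrier) : Classified V := by
  obtain ⟨t, ht⟩ := IsAlgClosed.exists_pow_nat_eq (m / n) (n := 3) (by norm_num)
  have hnt : n * t ^ 3 = m := by rw [ht]; field_simp
  have ht0 : t ≠ 0 := by
    rintro rfl
    exact hm (by rw [← hnt]; ring)
  have hC := C_mul_inv ht0
  have hCn := C_mul_inv hn
  have hntC : (C n * C t ^ 3 : MvPolynomial (Fin 3) k) = C m := by rw [← hnt, C_mul, C_pow]
  refine classified_hesse (h.change (x' := C t⁻¹ * x) (y' := y) (z' := z)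
    !![t⁻¹, 0, 0; 0, 1, 0; 0, 0, 1] (by simp [Matrix.det_fin_three, ht0]) (by simp) (by simp)
    (by simp)) (l := -t) (neg_ne_zero.2 ht0) ?_
    (V.mem_of_eq h1 h1 h1 (n⁻¹ * t⁻¹ ^ 2) 0 0 ?_) (V.mem_of_eq h2 h2 h2 1 0 0 ?_)
    (V.mem_of_eq h3 h3 h3 1 0 0 ?_)
  · intro e
    exact hmn (by rw [← hnt]; linear_combination (-n) * e)
  · simp only [C_mul, C_pow, C_neg, C_0]
    linear_combination (-(C t⁻¹ ^ 2 * x ^ 2) + C t * y * z) * hCn -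
      (C n⁻¹ * C t⁻¹ ^ 2 * y * z) * hntC +
      (C n * C n⁻¹ * C t * y * z) * (C t * C t⁻¹ + 1) * hC
  · simp
    linear_combination (-x * z) * hC
  · simp
    linear_combination (-x * y) * hC

/-- The generators are the polars of `m xyz + (x + y + z)³`, a cubic with three collinear flexes
whose tangents are the coordinate lines. The Fourier transform diagonalizes the cyclic symmetry and
yields Hesse form; for `m = -27` the cubic would be singular at `(1, 1, 1)`. -/
theorem classified_triangle (h : Coords x y z) {m : k} (hm : m ≠ 0) (hm' : m ≠ -27)
    (h1 : C m * (y * z) + 3 * (x + y + z) ^ 2 ∈ V.carrier)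
    (h2 : C m * (x * z) + 3 * (x + y + z) ^ 2 ∈ V.carrier)
    (h3 : C m * (x * y) + 3 * (x + y + z) ^ 2 ∈ V.carrier) : Classified V := by
  obtain ⟨w, hw⟩ := exists_cubeRoot (k := k)
  have hwC : (C w ^ 2 + C w + 1 : MvPolynomial (Fin 3) k) = 0 := by
    rw [← C_pow, ← C_1, ← C_add, ← C_add, hw, C_0]
  have hC3 : (C (3⁻¹ : k) * 3 : MvPolynomial (Fin 3) k) = 1 := by
    rw [← map_ofNat C, ← C_mul]; simp
  have hCm := C_mul_inv hm
  have hdet : (!![1, 1, 1; 1, w ^ 2, w; 1, w, w ^ 2] : Matrix (Fin 3) (Fin 3) k).det ≠ 0 := by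
    intro e
    simp [Matrix.det_fin_three] at e
    have : (3 : k) * 9 = 0 := by grind
    norm_num at this
  refine classified_hesse_scaled (h.change (x' := C 1 * x + C 1 * y + C 1 * z)
    (y' := C 1 * x + C (w ^ 2) * y + C w * z) (z' := C 1 * x + C w * y + C (w ^ 2) * z)
    !![1, 1, 1; 1, w ^ 2, w; 1, w, w ^ 2] hdet (by simp) (by simp) (by simp)) (m := 3 * m)
    (n := 3 * (m + 27)) (by simpa using hm) ?_ ?_
    (V.mem_of_eq h1 h2 h3 9 9 9 ?_) (V.mem_of_eq h1 h2 h3 (3 * m⁻¹) (3 * m⁻¹ * w)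
      (3 * m⁻¹ * w ^ 2) ?_)
    (V.mem_of_eq h1 h2 h3 (3 * m⁻¹) (3 * m⁻¹ * w ^ 2) (3 * m⁻¹ * w) ?_)
  · intro e
    have := (mul_eq_zero.1 e).resolve_left (by norm_num)
    exact hm' (by linear_combination this)
  · intro e
    have : (3 : k) * 27 = 0 := by linear_combination -e
    norm_num at this
  · simp [map_ofNat]
    grind
  · simp [map_ofNat]
    grind
  · simp [map_ofNat]
    grind

/-- This is the 3-division polynomial of the Weierstrass cubic: its roots are the `y`-coordinates of
the finite flexes. A nonzero root is needed because later steps divide by `s`. -/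
theorem exists_quartic_root {a b : k} (hab : ¬ (a = 0 ∧ b = 0)) :
    ∃ s : k, s ≠ 0 ∧ 3 * s ^ 4 + 6 * a * s ^ 2 + 12 * b * s - a ^ 2 = 0 := by
  by_cases ha : a = 0
  · subst ha
    have hb : b ≠ 0 := fun hb => hab ⟨rfl, hb⟩
    obtain ⟨s, hs⟩ := IsAlgClosed.exists_pow_nat_eq (-4 * b) (n := 3) (by norm_num)
    refine ⟨s, ?_, by linear_combination 3 * s * hs⟩
    rintro rfl
    simp [hb] at hs
  · let p : Polynomial k := Polynomial.C 3 * Polynomial.X ^ 4 + Polynomial.C 0 * Polynomial.X ^ 3 +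
      Polynomial.C (6 * a) * Polynomial.X ^ 2 + Polynomial.C (12 * b) * Polynomial.X +
      Polynomial.C (-a ^ 2)
    have hd : p.degree ≠ 0 := by
      have : p.coeff 4 = 3 := by
        simp [p, -map_mul, -map_neg, Polynomial.coeff_X_pow]
      intro h
      have h' := Polynomial.coeff_eq_zero_of_degree_lt (p := p) (n := 4) (by rw [h]; norm_num)
      rw [this] at h'
      norm_num at h'
    obtain ⟨s, hs⟩ := IsAlgClosed.exists_root p hd
    have hs' : 3 * s ^ 4 + 6 * a * s ^ 2 + 12 * b * s - a ^ 2 = 0 := by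
      simp [p, Polynomial.IsRoot] at hs
      linear_combination hs
    refine ⟨s, ?_, hs'⟩
    rintro rfl
    exact ha (by simpa using hs')

/-- The net contains the polars of `xz² + y³ + ax²y + bx³`. The line `y = sx` passes through the
flex at infinity and two finite flexes. The new coordinates are the three flex tangents, scaled so
that their sum is `y - sx`, and the cubic takes triangle form. -/
theorem classified_weierstrass (h : Coords x y z) {a b : k} (h1 : x * z ∈ V.carrier)
    (h2 : 3 * y ^ 2 + C a * x ^ 2 ∈ V.carrier)
    (h3 : z ^ 2 + 2 * C a * (x * y) + 3 * C b * x ^ 2 ∈ V.carrier)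
    (hns : ∀ s, ¬ (3 * s ^ 2 + a = 0 ∧ 2 * a * s + 3 * b = 0)) : Classified V := by
  obtain ⟨s, hs0, hs⟩ := exists_quartic_root (a := a) (b := b)
    fun h => hns 0 ⟨by simp [h.1], by simp [h.2]⟩
  obtain ⟨σ, hσ⟩ := IsAlgClosed.exists_pow_nat_eq (-3 * s) (n := 2) (by norm_num)
  have hσ0 : σ ≠ 0 := by
    rintro rfl
    simp [hs0] at hσ
  obtain ⟨r, hr⟩ : ∃ r, 6 * s * r = a - 3 * s ^ 2 := ⟨(a - 3 * s ^ 2) / (6 * s), by field_simp⟩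
  -- If `s + r = 0`, then `a = -3 * s ^ 2` and `b = 2 * s ^ 3`, so the Weierstrass cubic has a
  -- singular point with `y = s`.
  have hα : -(s + r) ≠ 0 := by
    intro e
    have e1 : a = -3 * s ^ 2 := by linear_combination -hr - 6 * s * e
    subst e1
    have e2 : b = 2 * s ^ 3 := by
      have : 12 * s * (b - 2 * s ^ 3) = 0 := by linear_combination hs
      have := (mul_eq_zero.1 this).resolve_left (by simp [hs0])
      linear_combination this
    exact hns s ⟨by ring, by rw [e2]; ring⟩
  obtain ⟨α, hαd⟩ : ∃ α, α = -(s + r) := ⟨_, rfl⟩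
  rw [← hαd] at hα
  have hrb : 3 * s * r ^ 2 = b + s ^ 3 := by
    have : 12 * s * (3 * s * r ^ 2 - b - s ^ 3) = 0 := by
      linear_combination (6 * s * r + a - 3 * s ^ 2) * hr - hs
    have := (mul_eq_zero.1 this).resolve_left (by simp [hs0])
    linear_combination this
  have hCα := C_mul_inv hα
  have hCσ := C_mul_inv (mul_ne_zero two_ne_zero hσ0)
  set i := α⁻¹
  set j := (2 * σ)⁻¹
  have hj : j ≠ 0 := inv_ne_zero (mul_ne_zero two_ne_zero hσ0)
  have hσC : (C σ ^ 2 : MvPolynomial (Fin 3) k) = -3 * C s := by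
    rw [← C_pow, hσ]; simp [map_ofNat]
  have hrC : (6 * C s * C r : MvPolynomial (Fin 3) k) = C a - 3 * C s ^ 2 := by
    have := congrArg (C (σ := Fin 3)) hr
    simpa [map_ofNat] using this
  have hrbC : (3 * C s * C r ^ 2 : MvPolynomial (Fin 3) k) = C b + C s ^ 3 := by
    have := congrArg (C (σ := Fin 3)) hrb
    simpa [map_ofNat] using this
  have hαC : (C α : MvPolynomial (Fin 3) k) = -(C s + C r) := by
    have := congrArg (C (σ := Fin 3)) hαd
    simpa using this
  simp only [C_mul, map_ofNat] at hCσ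
  refine classified_triangle (h.change (x' := C α * x) (y' := C j * z + C 2⁻¹ * (y + C r * x))
    (z' := -C j * z + C 2⁻¹ * (y + C r * x))
    !![α, 0, 0; 2⁻¹ * r, 2⁻¹, j; 2⁻¹ * r, 2⁻¹, -j] ?_ (by simp) (by simp; ring)
    (by simp; ring)) (m := 12 * s * i) (by simp [hs0, hα, i]) ?_
    (V.mem_of_eq h3 h2 h2 i (-(i * r)) 0 ?_) (V.mem_of_eq h2 h1 h1 1 (2 * σ) 0 ?_)
    (V.mem_of_eq h2 h1 h1 1 (-(2 * σ)) 0 ?_)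
  · have : (2⁻¹ * j * α : k) ≠ 0 := by simp [hj, hα]
    intro e
    apply this
    simp [Matrix.det_fin_three] at e
    grind
  · intro e
    have e0 : 12 * s = -27 * α := by
      have : α * i = 1 := mul_inv_cancel₀ hα
      linear_combination α * e - 12 * s * this
    rw [hαd] at e0
    have e1 : 9 * r = -5 * s := by linear_combination e0 / -3
    have e2 : s ^ 2 + 3 * a = 0 := by
      linear_combination (-3) * hr + 2 * s * e1
    have e3 : b = -(2 / 27) * s ^ 3 := by
      linear_combination -hrb + (s * r / 3 * 1 - 5 * s ^ 2 / 27) * e1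
    exact hns (-s / 3) ⟨by linear_combination e2 / 3, by
      rw [e3]; linear_combination (-2 * s / 9) * e2⟩
  · have hC2 := C_half (k := k)
    simp only [C_mul, C_neg, C_0, map_ofNat]
    clear_value i j
    clear h h1 h2 h3 hns hs hσ hr hrb hαd
    grind
  · have hC2 := C_half (k := k)
    simp only [C_mul, C_neg, C_0, C_1, map_ofNat]
    clear_value i j
    clear h h1 h2 h3 hns hs hσ hr hrb hαd
    grind
  · have hC2 := C_half (k := k)
    simp only [C_mul, C_neg, C_0, C_1, map_ofNat]
    clear_value i j
    clear h h1 h2 h3 hns hs hσ hr hrb hαd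
    grind

end SmoothPolar

end NetsOfConics

end

open MvPolynomial

noncomputable section

namespace NetsOfConics

/-! ### Intersection of two plane curves. -/

section CommonZero

variable {k : Type*} [Field k]

/-- The kernels of setting first one and then two variables to zero form a chain of primes below the
ideal of the origin. -/
theorem three_le_height_vanishingIdeal_zero :
    3 ≤ (vanishingIdeal k {(0 : Fin 3 → k)} : Ideal (MvPolynomial (Fin 3) k)).height := by
  let φ : MvPolynomial (Fin 3) k →ₐ[k] MvPolynomial (Fin 3) k := aeval ![0, X 1, X 2]
  let ψ : MvPolynomial (Fin 3) k →ₐ[k] MvPolynomial (Fin 3) k := aeval ![0, 0, X 2]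
  have e1 : ψ.comp φ = ψ := MvPolynomial.algHom_ext fun i => by fin_cases i <;> simp [φ, ψ]
  have e2 : ((aeval (0 : Fin 3 → k)) : MvPolynomial (Fin 3) k →ₐ[k] k).comp ψ = aeval 0 :=
    MvPolynomial.algHom_ext fun i => by fin_cases i <;> simp [ψ]
  have p0 : (RingHom.ker φ).IsPrime := RingHom.ker_isPrime _
  have p1 : (RingHom.ker ψ).IsPrime := RingHom.ker_isPrime _
  have l0 : (⊥ : Ideal (MvPolynomial (Fin 3) k)) < RingHom.ker φ := by
    refine bot_lt_iff_ne_bot.2 fun h => X_ne_zero (R := k) (0 : Fin 3) ?_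
    rw [← Ideal.mem_bot, ← h, RingHom.mem_ker]
    simp [φ]
  have l1 : RingHom.ker φ < RingHom.ker ψ := by
    refine lt_of_le_of_ne (fun p hp => ?_) fun h => X_ne_zero (R := k) (1 : Fin 3) ?_
    · rw [RingHom.mem_ker] at hp ⊢
      rw [← e1, AlgHom.comp_apply, hp, map_zero]
    · have : X 1 ∈ RingHom.ker φ := by rw [h, RingHom.mem_ker]; simp [ψ]
      simp [φ] at this
  have l2 : RingHom.ker ψ < vanishingIdeal k {(0 : Fin 3 → k)} := by
    refine lt_of_le_of_ne (fun p hp => ?_) fun h => X_ne_zero (R := k) (2 : Fin 3) ?_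
    · rw [mem_vanishingIdeal_singleton_iff, ← e2, AlgHom.comp_apply, RingHom.mem_ker.1 hp, map_zero]
    · have : X 2 ∈ RingHom.ker ψ := by rw [h, mem_vanishingIdeal_singleton_iff]; simp
      simp [ψ] at this
  calc (3 : ℕ∞) = 0 + 1 + 1 + 1 := by norm_num
    _ ≤ (⊥ : Ideal (MvPolynomial (Fin 3) k)).height + 1 + 1 + 1 := by gcongr; simp
    _ ≤ (RingHom.ker φ).height + 1 + 1 := by
      gcongr; exact Ideal.height_add_one_le_of_lt_of_isPrime l0
    _ ≤ (RingHom.ker ψ).height + 1 := by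
      gcongr; exact Ideal.height_add_one_le_of_lt_of_isPrime l1
    _ ≤ _ := Ideal.height_add_one_le_of_lt_of_isPrime l2

/-- Two plane curves intersect. -/
theorem exists_common_zero [IsAlgClosed k] {f h : MvPolynomial (Fin 3) k} (hf : eval 0 f = 0)
    (hh : eval 0 h = 0) : ∃ p : Fin 3 → k, p ≠ 0 ∧ eval p f = 0 ∧ eval p h = 0 := by
  classical
  by_contra! H
  -- If the origin were the only common zero, the Nullstellensatz would make its ideal a minimal
  -- prime over two generators, contradicting Krull's height theorem.
  have hz : zeroLocus k (Ideal.span {f, h}) = {0} := by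
    rw [zeroLocus_span]
    ext p
    simp only [Set.mem_insert_iff, Set.mem_singleton_iff, forall_eq_or_imp, forall_eq,
      Set.mem_ofPred_eq]
    refine ⟨fun hp => ?_, ?_⟩
    · by_contra hp0
      exact H p hp0 hp.1 hp.2
    · rintro rfl
      exact ⟨hf, hh⟩
  have hr := vanishingIdeal_zeroLocus_eq_radical (K := k) (Ideal.span {f, h})
  rw [hz] at hr
  have hm : vanishingIdeal k {(0 : Fin 3 → k)} ∈ (Ideal.span {f, h}).minimalPrimes := by
    refine ⟨⟨inferInstance, hr ▸ Ideal.le_radical⟩, fun q hq _ => ?_⟩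
    rw [hr]
    exact hq.1.radical_le_iff.2 hq.2
  have h2 := Ideal.height_le_card_of_mem_minimalPrimes_span (Set.toFinite _) hm
  have h3 := (three_le_height_vanishingIdeal_zero (k := k)).trans h2
  have h4 : (3 : ℕ) ≤ ({f, h} : Set (MvPolynomial (Fin 3) k)).ncard := by exact_mod_cast h3
  have := Set.ncard_insert_le f {h}
  rw [Set.ncard_singleton] at this
  omega

end CommonZero

/-! ### Flexes of smooth cubics, and completeness of the table. -/

section Flex

variable {k : Type*} [Field k] [CharZero k] [IsAlgClosed k] {V : Net k}

/-- The coefficients describe a flex at `(0, 0, 1)` with tangent `X = 0`. Completing the square in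
`Z` and the cube in `Y` gives Weierstrass form. -/
theorem classified_of_flex {a₁ a₂ a₄ a₅ a₆ b : k}
    (h : IsPolarCubic (cubic a₁ a₂ 0 a₄ a₅ a₆ 0 1 0 b) V)
    (hns : ∀ v, (∀ i, eval v (pderiv i (cubic a₁ a₂ 0 a₄ a₅ a₆ 0 1 0 b)) = 0) → v = 0) :
    Classified V := by
  have h0 := h.pderiv_mem 0
  have h1 := h.pderiv_mem 1
  have h2 := h.pderiv_mem 2
  have hns' : ∀ v : Fin 3 → k, v ≠ 0 → 3 * a₁ * v 0 ^ 2 + 2 * a₄ * (v 0 * v 1) +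
      2 * a₅ * (v 0 * v 2) + a₆ * v 1 ^ 2 + v 2 ^ 2 + b * (v 1 * v 2) = 0 →
      3 * a₂ * v 1 ^ 2 + a₄ * v 0 ^ 2 + 2 * a₆ * (v 0 * v 1) + b * (v 0 * v 2) = 0 →
      a₅ * v 0 ^ 2 + 2 * (v 0 * v 2) + b * (v 0 * v 1) = 0 → False := by
    intro v hv e0 e1 e2
    refine hv (hns v fun i => ?_)
    fin_cases i
    · simp [pderiv_cubic_zero]; linear_combination e0
    · simp [pderiv_cubic_one]; linear_combination e1
    · simp [pderiv_cubic_two]; linear_combination e2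
  rw [pderiv_cubic_zero] at h0
  rw [pderiv_cubic_one] at h1
  rw [pderiv_cubic_two] at h2
  clear hns h
  obtain ⟨b, rfl⟩ : ∃ c, b = 2 * c := ⟨b / 2, by field_simp⟩
  obtain ⟨a₅, rfl⟩ : ∃ c, a₅ = 2 * c := ⟨a₅ / 2, by field_simp⟩
  -- Without the `Y³` term the line `X = 0` is a component, and its intersection with the residual
  -- conic is singular.
  have ha₂ : a₂ ≠ 0 := by
    rintro rfl
    obtain ⟨t, ht⟩ := IsAlgClosed.exists_pow_nat_eq (b ^ 2 - a₆) (n := 2) (by norm_num)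
    refine hns' ![0, 1, t - b] (fun e => by simpa using congrFun e 1) ?_ (by simp) (by simp)
    simp
    linear_combination ht
  obtain ⟨r, rfl⟩ := IsAlgClosed.exists_pow_nat_eq a₂ (n := 3) (by norm_num)
  have hr : r ≠ 0 := by
    rintro rfl
    simp at ha₂
  -- The constants `t`, `a`, `c` solve for the cubic to be `XZ'² + Y'³ + aX²Y' + cX³`, with `Y' = rY
  -- + tX` and `Z' = Z + a₅X + bY`.
  obtain ⟨t, ht⟩ : ∃ t, a₆ = 3 * r ^ 2 * t + b ^ 2 :=
    ⟨(a₆ - b ^ 2) / (3 * r ^ 2), by field_simp; ring⟩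
  obtain ⟨a, ha⟩ : ∃ a, a₄ = 3 * r * t ^ 2 + r * a + 2 * a₅ * b :=
    ⟨(a₄ - 3 * r * t ^ 2 - 2 * a₅ * b) / r, by field_simp; ring⟩
  obtain ⟨c, hc⟩ : ∃ c, a₁ = t ^ 3 + a * t + c + a₅ ^ 2 :=
    ⟨a₁ - t ^ 3 - a * t - a₅ ^ 2, by ring⟩
  subst ht ha hc
  have hC := C_mul_inv hr
  set i := r⁻¹ with hi
  refine classified_weierstrass (coords_X.change (x' := X 0) (y' := C r * X 1 + C t * X 0)
    (z' := X 2 + C a₅ * X 0 + C b * X 1) !![1, 0, 0; t, r, 0; a₅, b, 1]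
    (by simp [Matrix.det_fin_three, hr]) (by simp) (by simp; ring) (by simp; ring))
    (a := a) (b := c) (V.mem_of_eq h2 h2 h2 2⁻¹ 0 0 ?_) (V.mem_of_eq h1 h2 h2 i (-(i * b)) 0 ?_)
    (V.mem_of_eq h0 h1 h2 1 (-(t * i)) (-a₅ + t * i * b) ?_) fun s hs => ?_
  · have hC2 := C_half (k := k)
    simp only [C_mul, C_0, C_1, map_ofNat]
    linear_combination (-(X 0 * (X 2 + C a₅ * X 0 + C b * X 1))) * hC2
  · simp only [C_mul, C_add, C_neg, C_pow, C_0, C_1, map_ofNat]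
    clear_value i
    clear hns'
    grind
  · simp only [C_mul, C_add, C_neg, C_pow, C_0, C_1, map_ofNat]
    clear_value i
    clear hns'
    grind
  · obtain ⟨e1, e2⟩ := hs
    have hri : r * i = 1 := mul_inv_cancel₀ hr
    refine hns' ![1, i * (s - t), -(a₅ + b * (i * (s - t)))]
      (fun e => by simpa using congrFun e 0) ?_ ?_ ?_ <;> simp <;> grind

/-- The Hessian of a cubic form. -/
def hessian (f : MvPolynomial (Fin 3) k) : MvPolynomial (Fin 3) k :=
  (Matrix.of fun i j => pderiv i (pderiv j f)).det

omit [CharZero k] [IsAlgClosed k] in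
theorem eval_hessian (f : MvPolynomial (Fin 3) k) (v : Fin 3 → k) :
    eval v (hessian f) = (Matrix.of fun i j => eval v (pderiv i (pderiv j f))).det := by
  rw [hessian, RingHom.map_det]
  rfl

omit [CharZero k] [IsAlgClosed k] in
theorem eval_hessian_subst (g : GL (Fin 3) k) (f : MvPolynomial (Fin 3) k) (v : Fin 3 → k) :
    eval v (hessian (subst g f)) = g.1.det ^ 2 * eval (g.1.mulVec v) (hessian f) := by
  have : (Matrix.of fun i j => eval v (pderiv i (pderiv j (subst g f)))) =
      g.1.transpose * (Matrix.of fun i j => eval (g.1.mulVec v) (pderiv i (pderiv j f))) * g.1 := by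
    ext i j
    simp only [Matrix.of_apply, pderiv_subst, map_sum, Derivation.leibniz, smul_eq_mul,
      derivation_C, map_mul, eval_C, eval_subst, Matrix.mul_apply, Matrix.transpose_apply,
      Finset.sum_mul, Finset.mul_sum, mul_zero, add_zero]
    exact Finset.sum_congr rfl fun a _ => Finset.sum_congr rfl fun b _ => by ring
  rw [eval_hessian, eval_hessian, this, Matrix.det_mul, Matrix.det_mul, Matrix.det_transpose]
  ring

omit [CharZero k] [IsAlgClosed k] in
/-- A linear form vanishing at `![0, 0, 1]` becomes the first coordinate. -/
theorem exists_block {a b : k} (h : ¬ (a = 0 ∧ b = 0)) :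
    ∃ g : GL (Fin 3) k, g.1.mulVec ![0, 0, 1] = ![0, 0, 1] ∧
      g.1 0 0 * a + g.1 1 0 * b = 1 ∧ g.1 0 1 * a + g.1 1 1 * b = 0 := by
  by_cases ha : a = 0
  · have hb : b ≠ 0 := fun hb => h ⟨ha, hb⟩
    refine ⟨toGL !![0, 1, 0; b⁻¹, 0, 0; 0, 0, 1] (by simp [Matrix.det_fin_three, hb]), ?_, ?_, ?_⟩
    · ext i; fin_cases i <;> simp [Matrix.mulVec, dotProduct, Fin.sum_univ_three]
    · simp [hb]
    · simp [ha]
  · refine ⟨toGL !![a⁻¹, -b, 0; 0, a, 0; 0, 0, 1] (by simp [Matrix.det_fin_three, ha]), ?_, ?_, ?_⟩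
    · ext i; fin_cases i <;> simp [Matrix.mulVec, dotProduct, Fin.sum_univ_three]
    · simp [ha]
    · simp; ring

omit [CharZero k] [IsAlgClosed k] in
theorem eval_zero_of_isHomogeneous {f : MvPolynomial (Fin 3) k} {n : ℕ} (h : f.IsHomogeneous n)
    (hn : n ≠ 0) : eval 0 f = 0 := by
  rw [eval_zero, constantCoeff_eq]
  exact h.coeff_eq_zero (by simpa using hn.symm)

/-- A net containing the polars of a smooth cubic form is in the table. -/
theorem IsPolarCubic.classified_of_smooth {f : MvPolynomial (Fin 3) k} (h : IsPolarCubic f V)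
    (hs : ∀ v, (∀ i, eval v (pderiv i f) = 0) → v = 0) : Classified V := by
  have hsub : ∀ (g : GL (Fin 3) k) (f : MvPolynomial (Fin 3) k),
      (∀ v, (∀ i, eval v (pderiv i f) = 0) → v = 0) →
      ∀ v, (∀ i, eval v (pderiv i (subst g f)) = 0) → v = 0 := by
    intro g f hs v hv
    have e : ∀ i, eval (g.1.mulVec v) (pderiv i f) = 0 := by
      intro i
      have h1 : g.1.transpose.mulVec (fun i => eval (g.1.mulVec v) (pderiv i f)) = 0 := by
        ext j
        have := hv j
        rw [pderiv_subst] at this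
        simpa [eval_subst, Matrix.mulVec, dotProduct] using this
      exact congrFun (Matrix.eq_zero_of_mulVec_eq_zero (by
        rw [Matrix.det_transpose]; exact (Matrix.GeneralLinearGroup.det_ne_zero g)) h1) i
    exact Matrix.eq_zero_of_mulVec_eq_zero (Matrix.GeneralLinearGroup.det_ne_zero g) (hs _ e)
  have hf0 : eval 0 f = 0 := eval_zero_of_isHomogeneous h.isHomogeneous (by norm_num)
  have hh0 : eval 0 (hessian f) = 0 := by
    rw [eval_hessian]
    have : (Matrix.of fun i j => eval 0 (pderiv i (pderiv j f))) = (0 : Matrix (Fin 3) (Fin 3) k) := by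
      ext i j
      exact eval_zero_of_isHomogeneous h.isHomogeneous.pderiv.pderiv (by norm_num)
    rw [this, Matrix.det_zero]
  -- A common zero of a smooth cubic and its Hessian is a flex; it is moved to `(0, 0, 1)`, and its
  -- tangent line then to `X = 0`.
  obtain ⟨p, hp, hpf, hph⟩ := exists_common_zero hf0 hh0
  obtain ⟨g, rfl⟩ := exists_mulVec_eq hp
  have h' := h.act g
  have hs' := hsub g f hs
  have hpf' : eval ![0, 0, 1] (subst g f) = 0 := by rw [eval_subst, hpf]
  have hph' : eval ![0, 0, 1] (hessian (subst g f)) = 0 := by rw [eval_hessian_subst, hph, mul_zero]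
  refine Classified.of_act (g := g) ?_
  generalize subst g f = f at *
  generalize V.act g = V at *
  obtain ⟨c₁, c₂, c₃, c₄, c₅, c₆, c₇, c₈, c₉, d, rfl⟩ := exists_eq_cubic h'.isHomogeneous
  have e3 : c₃ = 0 := by simpa [cubic] using hpf'
  subst e3
  have hne : ¬ (c₈ = 0 ∧ c₉ = 0) := by
    rintro ⟨rfl, rfl⟩
    have := hs' ![0, 0, 1] fun i => by
      fin_cases i
      · simp [pderiv_cubic_zero]
      · simp [pderiv_cubic_one]
      · simp [pderiv_cubic_two]
    simpa using congrFun this 2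
  obtain ⟨g', hg, hg0, hg1⟩ := exists_block hne
  have h'' := h'.act g'
  have hs'' := hsub g' _ hs'
  have hpf'' : eval ![0, 0, 1] (subst g' (cubic c₁ c₂ 0 c₄ c₅ c₆ c₇ c₈ c₉ d)) = 0 := by
    rw [eval_subst, hg, hpf']
  have hph'' : eval ![0, 0, 1] (hessian (subst g' (cubic c₁ c₂ 0 c₄ c₅ c₆ c₇ c₈ c₉ d))) = 0 := by
    rw [eval_hessian_subst, hg, hph', mul_zero]
  have ev : ∀ i, eval ![0, 0, 1] (pderiv i (subst g' (cubic c₁ c₂ 0 c₄ c₅ c₆ c₇ c₈ c₉ d))) =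
      g'.1 0 i * c₈ + g'.1 1 i * c₉ := fun i => by
    simp only [pderiv_subst, map_sum, map_mul, eval_C, eval_subst, hg]
    simp [Fin.sum_univ_three, pderiv_cubic_zero, pderiv_cubic_one, pderiv_cubic_two]
  have ev0 := (ev 0).trans hg0
  have ev1 := (ev 1).trans hg1
  refine Classified.of_act (g := g') ?_
  clear ev
  generalize subst g' (cubic c₁ c₂ 0 c₄ c₅ c₆ c₇ c₈ c₉ d) = f at *
  obtain ⟨c₁, c₂, c₃, c₄, c₅, c₆, c₇, c₈, c₉, d, rfl⟩ := exists_eq_cubic h''.isHomogeneous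
  have e3 : c₃ = 0 := by simpa [cubic] using hpf''
  have e8 : c₈ = 1 := by simpa [pderiv_cubic_zero] using ev0
  have e9 : c₉ = 0 := by simpa [pderiv_cubic_one] using ev1
  subst e3 e8 e9
  -- At this point the Hessian determinant is a nonzero multiple of `c₇`.
  have e7 : c₇ = 0 := by
    rw [eval_hessian, Matrix.det_fin_three] at hph''
    simp [pderiv_cubic_zero, pderiv_cubic_one, pderiv_cubic_two, Derivation.leibniz_pow] at hph''
    exact hph''
  subst e7
  exact classified_of_flex h'' hs''

/-- Every net is in the table. -/
theorem exists_mem_orbit_net (V : Net k) : ∃ a : Entry k, V ∈ orbit a.net := by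
  obtain ⟨f, hf⟩ := exists_isPolarCubic V
  by_cases h : ∃ p : Fin 3 → k, p ≠ 0 ∧ ∀ i, eval p (pderiv i f) = 0
  · obtain ⟨p, hp, hp'⟩ := h
    exact hf.classified_of_singular hp hp'
  · push Not at h
    refine hf.classified_of_smooth fun v hv => ?_
    by_contra hv0
    obtain ⟨i, hi⟩ := h v hv0
    exact hi (hv i)

end Flex

end NetsOfConics

end

open MvPolynomial

noncomputable section

namespace NetsOfConics

/-! ### Algebraic independence -/

section Jacobian

variable {k : Type*} [Field k] {σ τ : Type} [Fintype σ] [DecidableEq σ] [Fintype τ]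

omit [DecidableEq σ] in
theorem pderiv_aeval {ι : Type} (f : σ → MvPolynomial ι k) (i : ι) (P : MvPolynomial σ k) :
    pderiv i (aeval f P) = ∑ j, aeval f (pderiv j P) * pderiv i (f j) := by
  classical
  induction P using MvPolynomial.induction_on with
  | C a => simp only [algHom_C, algebraMap_eq, derivation_C, map_zero, zero_mul,
      Finset.sum_const_zero]
  | add p q hp hq => simp only [map_add, hp, hq, add_mul, Finset.sum_add_distrib]
  | mul_X p n hp =>
    have e : ∀ j, aeval f (pderiv j (p * X n)) * pderiv i (f j) =
        aeval f p * (if n = j then pderiv i (f j) else 0)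
          + f n * (aeval f (pderiv j p) * pderiv i (f j)) := by
      intro j
      rw [Derivation.leibniz, pderiv_X, Pi.single_apply, map_add, smul_eq_mul, smul_eq_mul, map_mul,
        map_mul, aeval_X]
      split_ifs <;> simp only [map_one, map_zero] <;> ring
    rw [map_mul, aeval_X, Derivation.leibniz, hp, smul_eq_mul, smul_eq_mul,
      Finset.sum_congr rfl fun j _ => e j, Finset.sum_add_distrib, ← Finset.mul_sum,
      ← Finset.mul_sum, Finset.sum_ite_eq]
    simp

/-- Polynomials whose Jacobian determinant does not vanish are algebraically independent. -/
theorem algebraicIndependent_of_jacobian [CharZero k] (f : σ → MvPolynomial σ k) (p : σ → k)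
    (h : (Matrix.of fun i j => eval p (pderiv i (f j))).det ≠ 0) : AlgebraicIndependent k f := by
  let J : Matrix σ σ (MvPolynomial σ k) := Matrix.of fun i j => pderiv i (f j)
  have hJ : J.det ≠ 0 := by
    intro h0
    apply h
    have := congrArg (eval p) h0
    rw [RingHom.map_det, map_zero] at this
    exact this
  rw [algebraicIndependent_iff]
  intro P
  induction hn : P.totalDegree using Nat.strong_induction_on generalizing P with
  | _ n ih =>
  intro hP
  -- Differentiating the relation puts the vector of values of the `∂ⱼP` in the kernel of an
  -- invertible Jacobian, so every `∂ⱼP` is again a relation, of smaller degree.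
  have h1 : ∀ j, aeval f (pderiv j P) = 0 := by
    refine congrFun (Matrix.eq_zero_of_mulVec_eq_zero hJ (v := fun j => aeval f (pderiv j P)) ?_)
    ext i
    have := pderiv_aeval f i P
    rw [hP, map_zero] at this
    simp [J, Matrix.mulVec, dotProduct, mul_comm, this]
  by_cases h0 : P.totalDegree = 0
  · obtain ⟨c, rfl⟩ : ∃ c, P = C c := ⟨_, totalDegree_eq_zero_iff_eq_C.1 h0⟩
    have : c = 0 := by simpa using hP
    rw [this, C_0]
  · have h2 : ∀ j, pderiv j P = 0 := fun j => by
      refine ih _ ?_ _ rfl (h1 j)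
      rw [← hn]
      refine (Finset.sup_lt_iff (Nat.pos_of_ne_zero h0)).2 fun m hm => ?_
      rw [mem_support_iff, coeff_pderiv] at hm
      have hm' := le_totalDegree (mem_support_iff.2 (left_ne_zero_of_mul hm))
      rw [Finsupp.sum_add_index' (by simp) (by simp)] at hm'
      simp at hm'
      omega
    -- All partial derivatives of `P` vanish, which in characteristic zero is impossible for
    -- positive degree.
    exfalso
    refine h0 (Finset.sup_eq_bot_iff _ _ |>.2 fun m hm => ?_)
    by_contra hm0
    have : ∃ j, m j ≠ 0 := by
      by_contra! hz
      exact hm0 (by simp [Finsupp.sum, hz])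
    obtain ⟨j, hj⟩ := this
    have e := coeff_pderiv (i := j) P (m - Finsupp.single j 1)
    have hle : Finsupp.single j 1 ≤ m := by simpa using Nat.one_le_iff_ne_zero.2 hj
    rw [h2, coeff_zero, tsub_add_cancel_of_le hle] at e
    have hne := mul_ne_zero (mem_support_iff.1 hm)
      (Nat.cast_add_one_ne_zero (R := k) ((m - Finsupp.single j 1 : σ →₀ ℕ) j))
    exact hne (by exact_mod_cast e.symm)

omit [DecidableEq σ] in
-- More polynomials than variables are dependent by transcendence degree; a relation among them is
-- not a relation among the independent `f`.
theorem exists_relation (h : Fintype.card τ < Fintype.card σ) (f : σ → MvPolynomial σ k)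
    (hf : AlgebraicIndependent k f) (g : σ → MvPolynomial τ k) :
    ∃ P : MvPolynomial σ k, aeval f P ≠ 0 ∧ aeval g P = 0 := by
  have hg : ¬ AlgebraicIndependent k g := by
    intro hg
    have h1 := hg.lift_cardinalMk_le_trdeg
    rw [MvPolynomial.trdeg_of_isDomain] at h1
    simp at h1
    omega
  rw [algebraicIndependent_iff] at hg
  push Not at hg
  obtain ⟨P, hP, hP0⟩ := hg
  exact ⟨P, fun h => hP0 (algebraicIndependent_iff.1 hf P h), hP⟩

end Jacobian

end NetsOfConics

end

open MvPolynomial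

noncomputable section

namespace NetsOfConics

/-! ### Transversal families in an orbit -/

section Transversal

variable {k : Type*} [Field k]

/-- The matrix with prescribed entries at the places in `s`, and zero elsewhere. -/
def suppMat {R : Type*} [Zero R] (s : Finset (Fin 3 × Fin 3)) (t : s → R) :
    Matrix (Fin 3) (Fin 3) R :=
  Matrix.of fun i j => if h : (i, j) ∈ s then t ⟨(i, j), h⟩ else 0

theorem suppMat_map {R S : Type*} [Zero R] [Zero S] (s : Finset (Fin 3 × Fin 3)) (t : s → R)
    (f : R → S) (hf : f 0 = 0) : (suppMat s t).map f = suppMat s fun x => f (t x) := by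
  ext i j
  by_cases h : (i, j) ∈ s <;> simp [suppMat, h, hf]

/-- The directions in `s` are transversal, at the identity matrix, to the stabilizer of the net with
Hessian matrices `A`. -/
def Transversal (A : Fin 3 → Matrix (Fin 3) (Fin 3) k) (s : Finset (Fin 3 × Fin 3)) : Prop :=
  ∀ B c : Matrix (Fin 3) (Fin 3) k, (∀ i j, (i, j) ∉ s → B i j = 0) →
    (∀ r, B.transpose * A r + A r * B = mix c A r) → B = 0

theorem Transversal.mono {A : Fin 3 → Matrix (Fin 3) (Fin 3) k} {s t : Finset (Fin 3 × Fin 3)}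
    (h : Transversal A t) (hst : s ⊆ t) : Transversal A s :=
  fun B c hB => h B c fun i j hij => hB i j fun h => hij (hst h)

/-- The parameters of the family attached to `s`: the entries of the coordinate change at the places
in `s`, and the entries of the change of basis. -/
abbrev Param (s : Finset (Fin 3 × Fin 3)) : Type := s ⊕ Fin 3 × Fin 3

def paramCoord (s : Finset (Fin 3 × Fin 3)) :
    Matrix (Fin 3) (Fin 3) (MvPolynomial (Param s) k) := 1 + suppMat s fun x => X (.inl x)

def paramBasis (s : Finset (Fin 3 × Fin 3)) :
    Matrix (Fin 3) (Fin 3) (MvPolynomial (Param s) k) := Matrix.of fun i j => X (.inr (i, j))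

def paramFamily (A : Fin 3 → Matrix (Fin 3) (Fin 3) k) (s : Finset (Fin 3 × Fin 3)) (r : Fin 3) :
    Matrix (Fin 3) (Fin 3) (MvPolynomial (Param s) k) :=
  ∑ j, paramBasis (k := k) s r j •
    ((paramCoord (k := k) s).transpose * (A j).map C * paramCoord (k := k) s)

variable (A : Fin 3 → Matrix (Fin 3) (Fin 3) k) (s : Finset (Fin 3 × Fin 3))

theorem paramCoord_map_eval (v : Param s → k) :
    (paramCoord s).map (eval v) = 1 + suppMat s fun x => v (.inl x) := by
  rw [paramCoord, Matrix.map_add _ (map_add _), suppMat_map _ _ _ (map_zero _),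
    Matrix.map_one _ (map_zero _) (map_one _)]
  simp

theorem paramBasis_map_eval (v : Param s → k) :
    (paramBasis s).map (eval v) = Matrix.of fun i j => v (.inr (i, j)) := by
  ext; simp [paramBasis]

theorem map_C_map_eval (M : Matrix (Fin 3) (Fin 3) k) (v : Param s → k) :
    (M.map C).map (eval v) = M := by
  ext; simp

theorem paramFamily_map_eval (v : Param s → k) (r : Fin 3) :
    (paramFamily A s r).map (eval v) =
      mix (Matrix.of fun i j => v (.inr (i, j))) (conj (1 + suppMat s fun x => v (.inl x)) A) r := by
  have h1 : ∀ j, ((paramCoord s).transpose * (A j).map C * paramCoord s).map (eval v) =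
      conj (1 + suppMat s fun x => v (.inl x)) A j := fun j => by
    rw [Matrix.map_mul, Matrix.map_mul, map_C_map_eval, Matrix.transpose_map, paramCoord_map_eval]
    rfl
  rw [mix, ← paramBasis_map_eval]
  ext a b
  have h1' := fun j => congrFun (congrFun (h1 j) a) b
  simp only [Matrix.map_apply] at h1'
  simp only [paramFamily, Matrix.sum_apply, ← h1', Matrix.map_apply, Matrix.smul_apply, smul_eq_mul,
    map_sum, map_mul]

/-- The derivative of the family at the identity. -/
def paramDeriv : (Param s → k) →ₗ[k] (Fin 3 → Matrix (Fin 3) (Fin 3) k) where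
  toFun w r := (suppMat s fun x => w (.inl x)).transpose * A r +
    A r * (suppMat s fun x => w (.inl x)) + mix (Matrix.of fun i j => w (.inr (i, j))) A r
  map_add' v w := by
    have : (suppMat s fun x => (v + w) (.inl x)) =
        (suppMat s fun x => v (.inl x)) + suppMat s fun x => w (.inl x) := by
      ext i j; by_cases h : (i, j) ∈ s <;> simp [suppMat, h]
    funext r
    rw [this]
    simp only [Matrix.transpose_add, add_mul, mul_add, mix, Matrix.of_apply, Pi.add_apply, add_smul,
      Finset.sum_add_distrib]
    abel
  map_smul' c w := by
    have : (suppMat s fun x => (c • w) (.inl x)) = c • suppMat s fun x => w (.inl x) := by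
      ext i j; by_cases h : (i, j) ∈ s <;> simp [suppMat, h]
    funext r
    rw [this]
    simp [mix, Finset.smul_sum, smul_smul, smul_add]

/-- The identity coordinate change and change of basis. -/
def paramOne : Param s → k := Sum.elim 0 fun x => if x.1 = x.2 then 1 else 0

theorem map_pderiv_mul (M N : Matrix (Fin 3) (Fin 3) (MvPolynomial (Param s) k)) (v : Param s)
    (p : Param s → k) : (M * N).map (fun f => eval p (pderiv v f)) =
      M.map (eval p) * N.map (fun f => eval p (pderiv v f)) +
        M.map (fun f => eval p (pderiv v f)) * N.map (eval p) := by
  ext i j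
  simp only [Matrix.map_apply, Matrix.mul_apply, map_sum, Derivation.leibniz, smul_eq_mul, map_add,
    map_mul, Matrix.add_apply, ← Finset.sum_add_distrib]
  exact Finset.sum_congr rfl fun _ _ => by ring

theorem paramCoord_map_pderiv (v : Param s) (p : Param s → k) :
    (paramCoord s).map (fun f => eval p (pderiv v f)) =
      suppMat s fun x => (Pi.single v 1 : Param s → k) (.inl x) := by
  ext i j
  by_cases h : (i, j) ∈ s
  · by_cases hij : i = j
    · subst hij
      simp [paramCoord, suppMat, h, pderiv_X, Pi.single_apply, eq_comm, apply_ite]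
    · simp [paramCoord, suppMat, h, pderiv_X, Pi.single_apply, eq_comm, apply_ite, hij]
  · by_cases hij : i = j
    · subst hij
      simp [paramCoord, suppMat, h]
    · simp [paramCoord, suppMat, h, hij]

theorem eval_pderiv_paramFamily (v : Param s) (r a b : Fin 3) :
    eval (paramOne s) (pderiv v (paramFamily A s r a b)) = paramDeriv A s (Pi.single v 1) r a b := by
  have e1 : (paramCoord s).map (eval (paramOne (k := k) s)) = 1 := by
    rw [paramCoord_map_eval]
    ext i j
    simp [suppMat, paramOne]
  have e2 : ∀ i j, eval (paramOne (k := k) s) (paramBasis s i j) = (1 : Matrix _ _ k) i j := by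
    intro i j
    simp [paramBasis, paramOne, Matrix.one_apply]
  have e3 : ∀ j, (((paramCoord s).transpose * (A j).map C * paramCoord s).map (eval (paramOne s))) =
      A j := by
    intro j
    rw [Matrix.map_mul, Matrix.map_mul, map_C_map_eval, Matrix.transpose_map, e1]
    simp
  have e4 : ∀ M : Matrix (Fin 3) (Fin 3) k,
      (M.map C).map (fun f => eval (paramOne s) (pderiv v f)) = 0 := by
    intro M; ext; simp
  have e5 : ∀ j, (((paramCoord s).transpose * (A j).map C * paramCoord s).map
      (fun f => eval (paramOne s) (pderiv v f))) =
      (suppMat s fun x => (Pi.single v 1 : Param s → k) (.inl x)).transpose * A j +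
        A j * suppMat s fun x => (Pi.single v 1 : Param s → k) (.inl x) := by
    intro j
    rw [map_pderiv_mul, map_pderiv_mul, Matrix.map_mul, Matrix.transpose_map, Matrix.transpose_map,
      paramCoord_map_pderiv, map_C_map_eval, e1, e4]
    simp [add_comm]
  have e6 : ∀ i j, eval (paramOne (k := k) s) (pderiv v (paramBasis s i j)) =
      (Pi.single v 1 : Param s → k) (.inr (i, j)) := by
    intro i j
    simp [paramBasis, pderiv_X, Pi.single_apply, eq_comm, apply_ite]
  have e7 : paramFamily A s r a b = ∑ j, paramBasis (k := k) s r j *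
      ((paramCoord (k := k) s).transpose * (A j).map C * paramCoord (k := k) s :
        Matrix (Fin 3) (Fin 3) (MvPolynomial (Param s) k)) a b := by
    simp [paramFamily, Matrix.sum_apply]
  have e3' := fun j => congrFun (congrFun (e3 j) a) b
  have e5' := fun j => congrFun (congrFun (e5 j) a) b
  simp only [Matrix.map_apply] at e3' e5'
  rw [e7]
  simp only [map_sum, Derivation.leibniz, smul_eq_mul, map_add, map_mul, e2, e6, e3', e5']
  rw [Finset.sum_add_distrib]
  congr 1
  · simp [Matrix.one_apply]
  · simp [mix, Matrix.sum_apply, mul_comm]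

/-- A kernel vector is an infinitesimal coordinate change supported in `s` and preserving the net,
hence zero by transversality; the base-change part then vanishes by independence. -/
theorem paramDeriv_injective {A : Fin 3 → Matrix (Fin 3) (Fin 3) k} (hA : LinearIndependent k A)
    {s : Finset (Fin 3 × Fin 3)} (h : Transversal A s) : Function.Injective (paramDeriv A s) := by
  refine (injective_iff_map_eq_zero _).2 fun w hw => ?_
  have h1 : (suppMat s fun x => w (.inl x)) = 0 := by
    refine h _ (-Matrix.of fun i j => w (.inr (i, j))) (fun i j hij => by simp [suppMat, hij])
      fun r => ?_
    have := congrFun hw r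
    simp only [paramDeriv, LinearMap.coe_mk, AddHom.coe_mk, Pi.zero_apply] at this
    rw [eq_neg_of_add_eq_zero_left this]
    simp [mix]
  have h2 : ∀ r, mix (Matrix.of fun i j => w (.inr (i, j))) A r = 0 := by
    intro r
    have := congrFun hw r
    simpa [paramDeriv, h1] using this
  rw [Fintype.linearIndependent_iff] at hA
  funext x
  rcases x with ⟨⟨i, j⟩, hx⟩ | ⟨i, j⟩
  · have := congrFun (congrFun h1 i) j
    simpa [suppMat, hx] using this
  · exact hA (fun j => w (.inr (i, j))) (by simpa [mix] using h2 i) j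

theorem polyFun_aeval {W : Type*} [AddCommGroup W] [Module k W] {ι : Type} {f : ι → W → k}
    (hf : ∀ i, f i ∈ polyFun k W) (P : MvPolynomial ι k) :
    (fun w => eval (fun i => f i w) P) ∈ polyFun k W := by
  induction P using MvPolynomial.induction_on with
  | C a => simpa using polyFun_const a
  | add p q hp hq => simpa using polyFun_add hp hq
  | mul_X p i hp => simpa using polyFun_mul hp (hf i)

theorem eval_aeval {ι κ : Type} (g : ι → MvPolynomial κ k) (w : κ → k) (P : MvPolynomial ι k) :
    eval w (aeval g P) = eval (fun i => eval w (g i)) P := by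
  induction P using MvPolynomial.induction_on with
  | C a => simp
  | add p q hp hq => simp only [map_add, hp, hq]
  | mul_X p i hp => simp only [map_mul, hp, aeval_X, eval_X]

/-- The linear combinations of the entries of the family which invert its derivative. -/
theorem exists_inverse_entries [CharZero k] {A : Fin 3 → Matrix (Fin 3) (Fin 3) k}
    (hA : LinearIndependent k A) {s : Finset (Fin 3 × Fin 3)} (h : Transversal A s) :
    ∃ L : Param s → Fin 3 → Fin 3 → Fin 3 → k, AlgebraicIndependent k fun v =>
      ∑ r, ∑ a, ∑ b, C (L v r a b) * paramFamily A s r a b := by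
  obtain ⟨π, hπ⟩ := (paramDeriv A s).exists_leftInverse_of_injective
    (LinearMap.ker_eq_bot.2 (paramDeriv_injective hA h))
  have key : ∀ (T : Fin 3 → Matrix (Fin 3) (Fin 3) k) v, π T v =
      ∑ r, ∑ a, ∑ b, π (Pi.single r (Matrix.single a b 1)) v * T r a b := by
    intro T v
    conv_lhs => rw [← Finset.univ_sum_single T, map_sum, Finset.sum_apply]
    refine Finset.sum_congr rfl fun r _ => ?_
    conv_lhs => rw [Matrix.matrix_eq_sum_single (T r)]
    rw [← LinearMap.single_apply (R := k), map_sum, map_sum, Finset.sum_apply]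
    refine Finset.sum_congr rfl fun a _ => ?_
    rw [map_sum, map_sum, Finset.sum_apply]
    refine Finset.sum_congr rfl fun b _ => ?_
    rw [show Matrix.single a b (T r a b) = T r a b • Matrix.single a b (1 : k) by simp, map_smul,
      map_smul, Pi.smul_apply, smul_eq_mul, mul_comm]
    rfl
  refine ⟨fun v r a b => π (Pi.single r (Matrix.single a b 1)) v,
    algebraicIndependent_of_jacobian _ (paramOne s) ?_⟩
  have : (Matrix.of fun i v => eval (paramOne s) (pderiv i (∑ r, ∑ a, ∑ b,
      C (π (Pi.single r (Matrix.single a b 1)) v) * paramFamily A s r a b))) = 1 := by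
    ext i v
    simp only [Matrix.of_apply, map_sum, pderiv_C_mul, map_mul, eval_C, eval_pderiv_paramFamily]
    rw [← key, ← LinearMap.comp_apply, hπ]
    simp [Matrix.one_apply, Pi.single_apply, eq_comm]
  rw [this, Matrix.det_one]
  exact one_ne_zero

/-- A function of triples which separates the family attached to `s` from a larger one. -/
theorem exists_separating [CharZero k] {A : Fin 3 → Matrix (Fin 3) (Fin 3) k}
    (hA : LinearIndependent k A) {s t : Finset (Fin 3 × Fin 3)} (hst : s.card < t.card)
    (h : Transversal A t) : ∃ F : (Fin 3 → Matrix (Fin 3) (Fin 3) k) → k,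
      (fun q => F (hessTriple q)) ∈ polyFun k (Triple k) ∧
      (∀ (m : Matrix (Fin 3) (Fin 3) k) (v : s → k), F (mix m (conj (1 + suppMat s v) A)) = 0) ∧
      ∃ (m : Matrix (Fin 3) (Fin 3) k) (v : t → k), m.det ≠ 0 ∧ (1 + suppMat t v).det ≠ 0 ∧
        F (mix m (conj (1 + suppMat t v) A)) ≠ 0 := by
  obtain ⟨L, hL⟩ := exists_inverse_entries hA h
  -- The same `t.card + 9` linear combinations, evaluated on the smaller family, depend on only
  -- `s.card + 9` parameters, so they satisfy a relation that fails on the larger family.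
  obtain ⟨P, hP, hP0⟩ := exists_relation (τ := Param s) (by simpa using hst) _ hL
    (fun v => ∑ r, ∑ a, ∑ b, C (L v r a b) * paramFamily A s r a b)
  let F : (Fin 3 → Matrix (Fin 3) (Fin 3) k) → k := fun T =>
    eval (fun v => ∑ r, ∑ a, ∑ b, L v r a b * T r a b) P
  have hF : ∀ (u : Finset (Fin 3 × Fin 3)) (w : Param u → k),
      F (mix (Matrix.of fun i j => w (.inr (i, j))) (conj (1 + suppMat u fun x => w (.inl x)) A)) =
      eval w (aeval (fun v => ∑ r, ∑ a, ∑ b, C (L v r a b) * paramFamily A u r a b) P) := by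
    intro u w
    have e : ∀ r a b, mix (Matrix.of fun i j => w (.inr (i, j)))
        (conj (1 + suppMat u fun x => w (.inl x)) A) r a b = eval w (paramFamily A u r a b) := by
      intro r a b
      rw [← paramFamily_map_eval]
      rfl
    simp only [F, e]
    rw [eval_aeval]
    simp only [map_sum, map_mul, eval_C]
  refine ⟨F, ?_, fun m v => ?_, ?_⟩
  · exact polyFun_aeval (fun v => polyFun_sum fun r _ => polyFun_sum fun a _ => polyFun_sum
      fun b _ => polyFun_mul (polyFun_const _) (polyFun_hessTriple r a b)) P
  · have := hF s (Sum.elim v fun x => m x.1 x.2)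
    rw [hP0, map_zero] at this
    exact this
  · have hd1 : (paramCoord (k := k) t).det ≠ 0 := by
      intro h0
      have := congrArg (eval 0) h0
      rw [RingHom.map_det, RingHom.mapMatrix_apply, paramCoord_map_eval, map_zero] at this
      have h2 : (suppMat t fun x => (0 : Param t → k) (.inl x)) = 0 := by
        ext i j; simp [suppMat]
      rw [h2, add_zero, Matrix.det_one] at this
      exact one_ne_zero this
    have hd2 : (paramBasis (k := k) t).det ≠ 0 := by
      intro h0
      have := congrArg (eval (paramOne t)) h0
      rw [RingHom.map_det, RingHom.mapMatrix_apply, paramBasis_map_eval, map_zero] at this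
      have h2 : (Matrix.of fun i j => paramOne (k := k) t (.inr (i, j))) = 1 := by
        ext i j; simp [paramOne, Matrix.one_apply]
      rw [h2, Matrix.det_one] at this
      exact one_ne_zero this
    obtain ⟨w, hw⟩ : ∃ w, eval w ((paramCoord (k := k) t).det * (paramBasis t).det * (aeval
        (fun v => ∑ r, ∑ a, ∑ b, C (L v r a b) * paramFamily A t r a b) P)) ≠ 0 := by
      by_contra! h0
      refine mul_ne_zero (mul_ne_zero hd1 hd2) hP (MvPolynomial.funext fun w => ?_)
      rw [h0, map_zero]
    rw [map_mul, map_mul, RingHom.map_det, RingHom.map_det, RingHom.mapMatrix_apply,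
      RingHom.mapMatrix_apply, paramCoord_map_eval, paramBasis_map_eval, ← hF] at hw
    exact ⟨_, _, right_ne_zero_of_mul (left_ne_zero_of_mul hw),
      left_ne_zero_of_mul (left_ne_zero_of_mul hw), right_ne_zero_of_mul hw⟩

end Transversal

end NetsOfConics

end

open MvPolynomial

noncomputable section

namespace NetsOfConics

/-! ### Lower bound for the dimension of an orbit. -/

theorem isIrreducible_preimage_val {X : Type*} [TopologicalSpace X] {O S : Set X} (h : S ⊆ O)
    (hS : IsIrreducible S) : IsIrreducible (Subtype.val ⁻¹' S : Set O) := by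
  refine ⟨?_, ?_⟩
  · obtain ⟨x, hx⟩ := hS.1
    exact ⟨⟨x, h hx⟩, hx⟩
  · rintro _ _ ⟨u, hu, rfl⟩ ⟨v, hv, rfl⟩ ⟨x, hxS, hxu⟩ ⟨y, hyS, hyv⟩
    obtain ⟨z, hzS, hzu, hzv⟩ := hS.2 u v hu hv ⟨x, hxS, hxu⟩ ⟨y, hyS, hyv⟩
    exact ⟨⟨z, h hzS⟩, hzS, hzu, hzv⟩

section LowerBound

variable {k : Type*} [Field k] [CharZero k]

theorem exists_frame_act (a : Entry k) (g : GL (Fin 3) k) {m : Matrix (Fin 3) (Fin 3) k}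
    (hm : m.det ≠ 0) : ∃ q : Frame k, spanNet q = a.net.act g ∧
      hessTriple q.1 = mix m (conj g.1 a.mat) := by
  let q₀ : Frame k := ⟨fun i => ⟨a.forms i, a.forms_mem i⟩,
    LinearIndependent.of_comp (homogeneousSubmodule (Fin 3) k 2).subtype a.forms_linearIndependent⟩
  have h₀ : spanNet q₀ = a.net := rfl
  refine ⟨⟨mixLinear m (substLinear g q₀.1), linearIndependent_mix hm
    (linearIndependent_substLinear g q₀.2)⟩, ?_, funext fun i => ?_⟩
  · rw [← h₀, ← spanNet_substLinear]
    exact spanNet_mix hm ⟨_, linearIndependent_substLinear g q₀.2⟩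
  · change hess ((mixLinear m (substLinear g q₀.1) i).1) = _
    rw [mixLinear_apply]
    simp only [Submodule.coe_sum, Submodule.coe_smul, map_sum, map_smul, mix, conj,
      substLinear_apply, hess_subst]
    rfl

theorem exists_mix_conj_of_act {a : Entry k} {g : GL (Fin 3) k} {q : Frame k}
    (hq : spanNet q = a.net.act g) :
    ∃ m : Matrix (Fin 3) (Fin 3) k, hessTriple q.1 = mix m (conj g.1 a.mat) := by
  rw [Entry.net, ← spanNet_substLinear] at hq
  obtain ⟨m, hm, h⟩ := exists_mix hq
  refine ⟨m, funext fun i => ?_⟩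
  rw [hessTriple, h, mixLinear_apply]
  simp only [Submodule.coe_sum, Submodule.coe_smul, map_sum, map_smul, mix, conj,
    substLinear_apply, hess_subst]
  rfl

/-- The translates of a net of the table by matrices which differ from the identity only at the
places in `s`. -/
def translates (a : Entry k) (s : Finset (Fin 3 × Fin 3)) : Set (Net k) :=
  {V | ∃ (v : s → k) (h : (1 + suppMat s v).det ≠ 0), V = a.net.act (toGL (1 + suppMat s v) h)}

theorem translates_subset (a : Entry k) (s : Finset (Fin 3 × Fin 3)) :
    translates a s ⊆ orbit a.net := by
  rintro _ ⟨v, h, rfl⟩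
  exact act_mem_orbit _ _

omit [CharZero k] in
theorem suppMat_extend {s t : Finset (Fin 3 × Fin 3)} (hst : s ⊆ t) (v : s → k) :
    suppMat s v = suppMat t fun x => if hx : x.1 ∈ s then v ⟨x.1, hx⟩ else 0 := by
  ext i j
  by_cases hs : (i, j) ∈ s
  · simp [suppMat, hs, hst hs]
  · by_cases ht : (i, j) ∈ t <;> simp [suppMat, hs, ht]

theorem translates_mono (a : Entry k) {s t : Finset (Fin 3 × Fin 3)} (hst : s ⊆ t) :
    translates a s ⊆ translates a t := by
  rintro _ ⟨v, h, rfl⟩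
  revert h
  rw [suppMat_extend hst]
  exact fun h => ⟨_, h, rfl⟩

omit [CharZero k] in
theorem isPolyMap_suppMat (s : Finset (Fin 3 × Fin 3)) :
    IsPolyMap k fun v : s → k => 1 + suppMat s v := by
  intro φ
  let L : (s → k) →ₗ[k] Matrix (Fin 3) (Fin 3) k :=
    { toFun := fun v => suppMat s v
      map_add' := fun v w => by ext i j; by_cases h : (i, j) ∈ s <;> simp [suppMat, h]
      map_smul' := fun c v => by ext i j; by_cases h : (i, j) ∈ s <;> simp [suppMat, h] }
  simp only [map_add]
  exact polyFun_add (polyFun_const _) (polyFun_dual (φ ∘ₗ L))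

theorem isIrreducible_translates (a : Entry k) (s : Finset (Fin 3 × Fin 3)) :
    IsIrreducible (translates a s) := by
  obtain ⟨q, hq⟩ := exists_spanNet a.net
  let c : (s → k) → Triple k := fun v i =>
    ⟨aeval (fun i => lin ((1 + suppMat s v) i)) (q.1 i).1, by
      simpa using (q.1 i).2.aeval (fun i => lin ((1 + suppMat s v) i)) (n := 1)
        fun i => lin_isHomogeneous _⟩
  have hc : IsPolyMap k c := isPolyMap_of_coeff fun i m =>
    (isPolyMap_suppMat s).comp (polyFun_coeff_aeval _ _)
  have hd : (fun v : s → k => (1 + suppMat s v).det) ∈ polyFun k _ :=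
    (isPolyMap_suppMat s).comp (polyFun_det polyFun_apply)
  have hi : ∀ v, Matrix.det (1 + suppMat s v) ≠ 0 → LinearIndependent k (c v) := fun v hv =>
    linearIndependent_substLinear (toGL _ hv) q.2
  convert isIrreducible_of_isPolyMap hc hd (w₁ := 0) (by
    have : suppMat s (0 : s → k) = 0 := by ext; simp [suppMat]
    simp [this]) hi using 1
  ext W
  constructor
  · rintro ⟨v, hv, rfl⟩
    refine ⟨v, hv, ?_⟩
    rw [← hq]
    exact (spanNet_substLinear (toGL _ hv) q).symm
  · rintro ⟨v, hv, rfl⟩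
    refine ⟨v, hv, ?_⟩
    rw [← hq]
    exact spanNet_substLinear (toGL _ hv) q

theorem linearIndependent_mat (a : Entry k) : LinearIndependent k a.mat := by
  rw [Fintype.linearIndependent_iff]
  intro c hc
  have h1 : hess (∑ i, c i • a.forms i) = 0 := by
    simpa [Entry.mat] using hc
  have hq : (∑ i, c i • a.forms i).IsHomogeneous 2 :=
    (homogeneousSubmodule (Fin 3) k 2).sum_mem fun i _ =>
      (homogeneousSubmodule (Fin 3) k 2).smul_mem _ (a.forms_mem i)
  have h2 : ∑ i, c i • a.forms i = 0 := by
    have e := hq.sum_X_mul_pderiv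
    have hp : ∀ j, pderiv j (∑ i, c i • a.forms i) = 0 := fun j => by
      rw [pderiv_eq_sum_hess hq]
      simp [h1]
    simp only [hp, mul_zero, Finset.sum_const_zero] at e
    simpa using e.symm
  exact Fintype.linearIndependent_iff.1 a.forms_linearIndependent c h2

/-- The closure, in the orbit, of a family of translates. -/
def translatesClosure (a : Entry k) (s : Finset (Fin 3 × Fin 3)) :
    TopologicalSpace.IrreducibleCloseds (orbit a.net) where
  carrier := closure (Subtype.val ⁻¹' translates a s)
  isIrreducible' :=
    (isIrreducible_preimage_val (translates_subset a s) (isIrreducible_translates a s)).closure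
  isClosed' := isClosed_closure

/-- The separating function vanishes on all frames of the smaller family, hence on those of its
closure in the orbit, but not at some frame of a member of the larger family. -/
theorem translatesClosure_lt (a : Entry k) {s t : Finset (Fin 3 × Fin 3)} (hst : s ⊂ t)
    (h : Transversal a.mat t) : translatesClosure a s < translatesClosure a t := by
  refine lt_of_le_not_ge (closure_mono (Set.preimage_mono (translates_mono a hst.1))) fun hle => ?_
  obtain ⟨F, hF, hF0, m, v, hm, hv, hne⟩ :=
    exists_separating (linearIndependent_mat a) (Finset.card_lt_card hst) h
  obtain ⟨q, hq, hqm⟩ := exists_frame_act a (toGL _ hv) hm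
  have h1 : a.net.act (toGL _ hv) ∈ closure (translates a s) := by
    have : (⟨a.net.act (toGL _ hv), act_mem_orbit _ _⟩ : orbit a.net) ∈
        closure (Subtype.val ⁻¹' translates a s) := hle (subset_closure ⟨v, hv, rfl⟩)
    exact closure_mono (Set.image_preimage_subset _ _) (image_closure_subset_closure_image
      continuous_subtype_val ⟨_, this, rfl⟩)
  rw [← hq] at h1
  refine notMem_closure_of_polyFun hF (fun q' hq' => ?_) q ?_ h1
  · obtain ⟨w, hw, e⟩ := hq'
    obtain ⟨m', hm'⟩ := exists_mix_conj_of_act e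
    simp only [hm']
    exact hF0 m' w
  · simp only [hqm]
    exact hne

/-- Freeing one matrix entry at a time gives a strict chain of irreducible closed sets. -/
theorem card_le_height_translatesClosure (a : Entry k) (s : Finset (Fin 3 × Fin 3))
    (h : Transversal a.mat s) : (s.card : ℕ∞) ≤ Order.height (translatesClosure a s) := by
  induction s using Finset.induction_on with
  | empty => simp
  | insert x s hx ih =>
    rw [Finset.card_insert_of_notMem hx]
    push_cast
    exact (add_le_add_left (ih (h.mono (Finset.subset_insert x s))) 1).trans
      (Order.height_add_one_le (translatesClosure_lt a (Finset.ssubset_insert hx) h))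

theorem card_le_topologicalKrullDim (a : Entry k) {s : Finset (Fin 3 × Fin 3)}
    (h : Transversal a.mat s) : ((s.card : ℕ∞) : WithBot ℕ∞) ≤ topologicalKrullDim (orbit a.net) :=
  (WithBot.coe_le_coe.2 (card_le_height_translatesClosure a s h)).trans
    (Order.height_le_krullDim _)

end LowerBound

end NetsOfConics

end

open MvPolynomial

noncomputable section

namespace NetsOfConics

/-! ### Infinitesimal stabilizers of the table entries. -/

section Stabilizers

variable {k : Type*} [Field k]

theorem transversal_of_entries {A : Fin 3 → Matrix (Fin 3) (Fin 3) k}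
    {s : Finset (Fin 3 × Fin 3)}
    (h : ∀ B c : Matrix (Fin 3) (Fin 3) k, (∀ i j, (i, j) ∉ s → B i j = 0) →
      (∀ r i j, B 0 i * A r 0 j + B 1 i * A r 1 j + B 2 i * A r 2 j +
        (A r i 0 * B 0 j + A r i 1 * B 1 j + A r i 2 * B 2 j) =
        c r 0 * A 0 i j + c r 1 * A 1 i j + c r 2 * A 2 i j) →
      (B 0 0 = 0 ∧ B 0 1 = 0 ∧ B 0 2 = 0) ∧ (B 1 0 = 0 ∧ B 1 1 = 0 ∧ B 1 2 = 0) ∧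
        B 2 0 = 0 ∧ B 2 1 = 0 ∧ B 2 2 = 0) : Transversal A s := by
  intro B c hB hr
  obtain ⟨⟨h1, h2, h3⟩, ⟨h4, h5, h6⟩, h7, h8, h9⟩ := h B c hB fun r i j => by
    have := congrFun (congrFun (hr r) i) j
    simpa [Matrix.mul_apply, Fin.sum_univ_three, mix] using this
  ext i j
  fin_cases i <;> fin_cases j <;> assumption

/-- Places complementary to the transversal directions. -/
def Entry.places : Entry k → Finset (Fin 3 × Fin 3)
  | e8a => {(0, 0)}
  | e8b _ _ => {(0, 0)}
  | e8c => {(0, 0)}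
  | e7a => {(0, 0), (1, 1)}
  | e7b => {(0, 0), (1, 1)}
  | e7c => {(0, 0), (1, 1)}
  | e6a => {(0, 0), (1, 1), (2, 2)}
  | e6b => {(0, 0), (1, 0), (1, 1)}
  | e6c => {(0, 0), (2, 0), (2, 1)}
  | e6d => {(0, 0), (1, 1), (2, 2)}
  | e5a => {(0, 0), (1, 1), (2, 0), (2, 2)}
  | e5b => {(0, 0), (1, 0), (1, 1), (2, 2)}
  | e4 => {(0, 0), (0, 1), (1, 1), (2, 0), (2, 1)}
  | e2a => {(0, 0), (1, 0), (1, 1), (1, 2), (2, 0), (2, 1), (2, 2)}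
  | e2b => {(0, 0), (0, 1), (1, 0), (1, 1), (2, 0), (2, 1), (2, 2)}

theorem Entry.card_compl_places (a : Entry k) : (Entry.places a)ᶜ.card = a.dim := by
  cases a <;> rfl

/-- The system is circulant, with determinant `(lam ^ 3 - 8) * (lam ^ 3 + 1)` up to sign. -/
theorem eq_zero_of_permissible {lam : k} (h : Permissible lam) {p q r : k}
    (h₁ : lam * p - lam ^ 2 * q + 2 * r = 0) (h₂ : lam * r - lam ^ 2 * p + 2 * q = 0)
    (h₃ : lam * q - lam ^ 2 * r + 2 * p = 0) : p = 0 := by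
  have : (lam ^ 3 - 8) * (lam ^ 3 + 1) * p = 0 := by
    linear_combination -3 * lam ^ 2 * h₁ - (lam ^ 4 - 2 * lam) * h₂ - (lam ^ 3 + 4) * h₃
  exact (mul_eq_zero.1 this).resolve_left
    (mul_ne_zero (sub_ne_zero.2 h.2.2) fun e => h.2.1 (eq_neg_of_add_eq_zero_left e))

-- Preserving the net infinitesimally is a linear system in `B` and `c`. There are nine minus `dim`
-- listed places, and once the entries of `B` there vanish the system forces `B = 0`.
set_option maxHeartbeats 1000000 in
theorem Entry.transversal [CharZero k] (a : Entry k) : Transversal a.mat (Entry.places a)ᶜ := by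
  refine transversal_of_entries fun B c hB h => ?_
  have hB' : ∀ i j, (i, j) ∈ a.places → B i j = 0 := fun i j hij => hB i j (by simpa using hij)
  clear hB
  have h0 := fun r => h r 0 0
  have h1 := fun r => h r 0 1
  have h2 := fun r => h r 0 2
  have h3 := fun r => h r 1 1
  have h4 := fun r => h r 1 2
  have h5 := fun r => h r 2 2
  clear h
  simp only [Fin.forall_fin_succ, Fin.forall_fin_zero] at h0 h1 h2 h3 h4 h5
  cases a with
  | e8a =>
    have z00 : B 0 0 = 0 := hB' _ _ (by simp [Entry.places])
    simp [Entry.mat_8a, z00] at h0 h1 h2 h3 h4 h5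
    simp only [z00, true_and]
    grind
  | e8b lam h =>
    have z00 : B 0 0 = 0 := hB' _ _ (by simp [Entry.places])
    have hl := h.1
    have hc : ∀ a b : k, a * lam + lam * a = b * 2 ↔ b = lam * a := fun a b =>
      ⟨fun e => mul_right_cancel₀ two_ne_zero (by linear_combination -e),
        fun e => by linear_combination -2 * e⟩
    simp [Entry.mat_8b lam h, z00, hc] at h0 h1 h2 h3 h4 h5
    obtain ⟨-, a1, a2⟩ := h0
    obtain ⟨b1, b2, b3⟩ := h1
    obtain ⟨c1, c2, c3⟩ := h2
    obtain ⟨d1, d2, d3⟩ := h3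
    obtain ⟨e1, e2, e3⟩ := h4
    obtain ⟨f1, f2, f3⟩ := h5
    rw [f1] at b1
    rw [d3] at c3
    rw [a1] at e2
    rw [d1] at c1
    rw [f2] at b2
    rw [a2] at e3
    have y11 : B 1 1 = 0 := mul_left_cancel₀ (mul_ne_zero three_ne_zero hl)
      (by linear_combination d2 * lam - 2 * c2 + f3 * lam / 2 - b3)
    have y22 : B 2 2 = 0 := mul_left_cancel₀ hl (by linear_combination c2 - d2 * lam / 2 + 2 * lam * y11)
    -- The six off-diagonal entries split into two circulant systems of three.
    have b1' : lam * B 2 0 - lam ^ 2 * B 1 2 + 2 * B 0 1 = 0 := by linear_combination b1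
    have e2' : lam * B 0 1 - lam ^ 2 * B 2 0 + 2 * B 1 2 = 0 := by linear_combination e2
    have c3' : lam * B 1 2 - lam ^ 2 * B 0 1 + 2 * B 2 0 = 0 := by linear_combination c3
    have b2' : lam * B 2 1 - lam ^ 2 * B 0 2 + 2 * B 1 0 = 0 := by linear_combination b2
    have c1' : lam * B 1 0 - lam ^ 2 * B 2 1 + 2 * B 0 2 = 0 := by linear_combination c1
    have e3' : lam * B 0 2 - lam ^ 2 * B 1 0 + 2 * B 2 1 = 0 := by linear_combination e3
    exact ⟨⟨z00, eq_zero_of_permissible h e2' c3' b1', eq_zero_of_permissible h e3' b2' c1'⟩,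
      ⟨eq_zero_of_permissible h c1' e3' b2', y11, eq_zero_of_permissible h c3' b1' e2'⟩,
      eq_zero_of_permissible h b1' e2' c3', eq_zero_of_permissible h b2' c1' e3', y22⟩
  | e8c =>
    have z00 : B 0 0 = 0 := hB' _ _ (by simp [Entry.places])
    simp [Entry.mat_8c, z00] at h0 h1 h2 h3 h4 h5
    simp only [z00, true_and]
    grind
  | e7a =>
    have z00 : B 0 0 = 0 := hB' _ _ (by simp [Entry.places])
    have z11 : B 1 1 = 0 := hB' _ _ (by simp [Entry.places])
    simp [Entry.mat_7a, z00, z11] at h0 h1 h2 h3 h4 h5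
    simp only [z00, z11, true_and]
    grind
  | e7b =>
    have z00 : B 0 0 = 0 := hB' _ _ (by simp [Entry.places])
    have z11 : B 1 1 = 0 := hB' _ _ (by simp [Entry.places])
    simp [Entry.mat_7b, z00, z11] at h0 h1 h2 h3 h4 h5
    simp only [z00, z11, true_and]
    grind
  | e7c =>
    have z00 : B 0 0 = 0 := hB' _ _ (by simp [Entry.places])
    have z11 : B 1 1 = 0 := hB' _ _ (by simp [Entry.places])
    simp [Entry.mat_7c, z00, z11] at h0 h1 h2 h3 h4 h5
    simp only [z00, z11, true_and]
    grind
  | e6a =>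
    have z00 : B 0 0 = 0 := hB' _ _ (by simp [Entry.places])
    have z11 : B 1 1 = 0 := hB' _ _ (by simp [Entry.places])
    have z22 : B 2 2 = 0 := hB' _ _ (by simp [Entry.places])
    simp [Entry.mat_6a, z00, z11, z22] at h0 h1 h2 h3 h4 h5
    simp only [z00, z11, z22, true_and]
    grind
  | e6b =>
    have z00 : B 0 0 = 0 := hB' _ _ (by simp [Entry.places])
    have z10 : B 1 0 = 0 := hB' _ _ (by simp [Entry.places])
    have z11 : B 1 1 = 0 := hB' _ _ (by simp [Entry.places])
    simp [Entry.mat_6b, z00, z10, z11] at h0 h1 h2 h3 h4 h5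
    simp only [z00, z10, z11, true_and]
    grind
  | e6c =>
    have z00 : B 0 0 = 0 := hB' _ _ (by simp [Entry.places])
    have z20 : B 2 0 = 0 := hB' _ _ (by simp [Entry.places])
    have z21 : B 2 1 = 0 := hB' _ _ (by simp [Entry.places])
    simp [Entry.mat_6c, z00, z20, z21] at h0 h1 h2 h3 h4 h5
    simp only [z00, z20, z21, true_and]
    grind
  | e6d =>
    have z00 : B 0 0 = 0 := hB' _ _ (by simp [Entry.places])
    have z11 : B 1 1 = 0 := hB' _ _ (by simp [Entry.places])
    have z22 : B 2 2 = 0 := hB' _ _ (by simp [Entry.places])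
    simp [Entry.mat_6d, z00, z11, z22] at h0 h1 h2 h3 h4 h5
    simp only [z00, z11, z22, true_and]
    grind
  | e5a =>
    have z00 : B 0 0 = 0 := hB' _ _ (by simp [Entry.places])
    have z11 : B 1 1 = 0 := hB' _ _ (by simp [Entry.places])
    have z20 : B 2 0 = 0 := hB' _ _ (by simp [Entry.places])
    have z22 : B 2 2 = 0 := hB' _ _ (by simp [Entry.places])
    simp [Entry.mat_5a, z00, z11, z20, z22] at h0 h1 h2 h3 h4 h5
    simp only [z00, z11, z20, z22, true_and]
    grind
  | e5b =>
    have z00 : B 0 0 = 0 := hB' _ _ (by simp [Entry.places])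
    have z10 : B 1 0 = 0 := hB' _ _ (by simp [Entry.places])
    have z11 : B 1 1 = 0 := hB' _ _ (by simp [Entry.places])
    have z22 : B 2 2 = 0 := hB' _ _ (by simp [Entry.places])
    simp [Entry.mat_5b, z00, z10, z11, z22] at h0 h1 h2 h3 h4 h5
    simp only [z00, z10, z11, z22, true_and]
    grind
  | e4 =>
    have z00 : B 0 0 = 0 := hB' _ _ (by simp [Entry.places])
    have z01 : B 0 1 = 0 := hB' _ _ (by simp [Entry.places])
    have z11 : B 1 1 = 0 := hB' _ _ (by simp [Entry.places])
    have z20 : B 2 0 = 0 := hB' _ _ (by simp [Entry.places])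
    have z21 : B 2 1 = 0 := hB' _ _ (by simp [Entry.places])
    simp [Entry.mat_4, z00, z01, z11, z20, z21] at h0 h1 h2 h3 h4 h5
    simp only [z00, z01, z11, z20, z21, true_and]
    grind
  | e2a =>
    have z00 : B 0 0 = 0 := hB' _ _ (by simp [Entry.places])
    have z10 : B 1 0 = 0 := hB' _ _ (by simp [Entry.places])
    have z11 : B 1 1 = 0 := hB' _ _ (by simp [Entry.places])
    have z12 : B 1 2 = 0 := hB' _ _ (by simp [Entry.places])
    have z20 : B 2 0 = 0 := hB' _ _ (by simp [Entry.places])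
    have z21 : B 2 1 = 0 := hB' _ _ (by simp [Entry.places])
    have z22 : B 2 2 = 0 := hB' _ _ (by simp [Entry.places])
    simp [Entry.mat_2a, z00, z10, z11, z12, z20, z21, z22] at h0 h1 h2 h3 h4 h5
    simp only [z00, z10, z11, z12, z20, z21, z22, true_and]
    grind
  | e2b =>
    have z00 : B 0 0 = 0 := hB' _ _ (by simp [Entry.places])
    have z01 : B 0 1 = 0 := hB' _ _ (by simp [Entry.places])
    have z10 : B 1 0 = 0 := hB' _ _ (by simp [Entry.places])
    have z11 : B 1 1 = 0 := hB' _ _ (by simp [Entry.places])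
    have z20 : B 2 0 = 0 := hB' _ _ (by simp [Entry.places])
    have z21 : B 2 1 = 0 := hB' _ _ (by simp [Entry.places])
    have z22 : B 2 2 = 0 := hB' _ _ (by simp [Entry.places])
    simp [Entry.mat_2b, z00, z01, z10, z11, z20, z21, z22] at h0 h1 h2 h3 h4 h5
    simp only [z00, z01, z10, z11, z20, z21, z22, true_and]
    grind

theorem dim_le_topologicalKrullDim [CharZero k] (a : Entry k) :
    ((a.dim : ℕ∞) : WithBot ℕ∞) ≤ topologicalKrullDim (orbit a.net) := by
  rw [← Entry.card_compl_places]
  exact card_le_topologicalKrullDim a a.transversal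

end Stabilizers

end NetsOfConics

end

open MvPolynomial

noncomputable section

namespace NetsOfConics

/-! ### An integer-valued dimension for irreducible closed sets of nets. -/

section UpperBound

variable {k : Type*} [Field k]

theorem ringKrullDim_polyFun_le (W : Type*) [AddCommGroup W] [Module k W] [Module.Finite k W] :
    ringKrullDim (polyFun k W) ≤ (Module.finrank k W : WithBot ℕ∞) := by
  let b := Module.finBasis k W
  let φ : MvPolynomial (Fin (Module.finrank k W)) k →ₐ[k] (W → k) :=
    aeval fun i w => b.repr w i
  have hφ : ∀ f ∈ polyFun k W, f ∈ φ.range := by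
    intro f hf
    refine Algebra.adjoin_le ?_ hf
    rintro _ ⟨ψ, rfl⟩
    refine ⟨∑ i, C (ψ (b i)) * X i, ?_⟩
    funext w
    simp only [φ, AlgHom.toRingHom_eq_coe, RingHom.coe_coe, map_sum, map_mul, aeval_X,
      algHom_C, Finset.sum_apply, Pi.mul_apply]
    conv_rhs => rw [← b.sum_repr w, map_sum]
    exact Finset.sum_congr rfl fun i _ => by
      rw [map_smul, smul_eq_mul, mul_comm]; rfl
  have hφ' : ∀ p, φ p ∈ polyFun k W := by
    intro p
    induction p using MvPolynomial.induction_on with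
    | C a => rw [algHom_C]; exact (polyFun k W).algebraMap_mem a
    | add p q hp hq => rw [map_add]; exact (polyFun k W).add_mem hp hq
    | mul_X p i hp =>
      rw [map_mul]
      refine (polyFun k W).mul_mem hp ?_
      rw [aeval_X]
      exact polyFun_of_dual (b.coord i) fun _ => rfl
  refine (ringKrullDim_le_of_surjective (φ.codRestrict (polyFun k W) hφ').toRingHom ?_).trans ?_
  · rintro ⟨f, hf⟩
    obtain ⟨p, hp⟩ := hφ f hf
    exact ⟨p, Subtype.ext hp⟩
  · rw [MvPolynomial.ringKrullDim_of_isNoetherianRing]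
    simp

theorem finrank_homogeneousSubmodule_le [CharZero k] :
    Module.Finite k (homogeneousSubmodule (Fin 3) k 2) ∧
      Module.finrank k (homogeneousSubmodule (Fin 3) k 2) ≤ 6 := by
  let v : Fin 6 → MvPolynomial (Fin 3) k :=
    ![X 0 ^ 2, X 1 ^ 2, X 2 ^ 2, X 0 * X 1, X 0 * X 2, X 1 * X 2]
  have h : homogeneousSubmodule (Fin 3) k 2 ≤ Submodule.span k (Set.range v) := by
    intro q hq
    obtain ⟨a, b, c, d, e, f, rfl⟩ := exists_eq_quadratic_X hq
    simp only [← smul_eq_C_mul]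
    have hv : ∀ i, v i ∈ Submodule.span k (Set.range v) := fun i => Submodule.subset_span ⟨i, rfl⟩
    have := fun c {x} => Submodule.smul_mem (Submodule.span k (Set.range v)) (x := x) c
    exact add_mem (add_mem (add_mem (add_mem (add_mem (this a (hv 0)) (this b (hv 1)))
      (this c (hv 2))) (this d (hv 3))) (this e (hv 4))) (this f (hv 5))
  have hf : Module.Finite k (Submodule.span k (Set.range v)) :=
    Module.Finite.span_of_finite k (Set.finite_range v)
  refine ⟨Submodule.finiteDimensional_of_le h, ?_⟩
  exact (Submodule.finrank_mono h).trans ((finrank_range_le_card v).trans (by simp))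

theorem ringKrullDim_polyFun_triple_le [CharZero k] :
    ringKrullDim (polyFun k (Triple k)) ≤ 18 := by
  have := (finrank_homogeneousSubmodule_le (k := k)).1
  refine (ringKrullDim_polyFun_le (Triple k)).trans ?_
  have h : Module.finrank k (Triple k) ≤ 18 := by
    rw [Module.finrank_pi_fintype]
    have := (finrank_homogeneousSubmodule_le (k := k)).2
    simp
    omega
  exact_mod_cast h

/-- A set on which the polynomial functions have no zero divisors. -/
def PolyIrreducible {W : Type*} [AddCommGroup W] [Module k W] (S : Set W) : Prop :=
  S.Nonempty ∧ ∀ f ∈ polyFun k W, ∀ g ∈ polyFun k W, ∀ x ∈ S, ∀ y ∈ S, f x ≠ 0 → g y ≠ 0 →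
    ∃ z ∈ S, f z * g z ≠ 0

/-- The prime ideal of the polynomial functions vanishing on an irreducible set. -/
def PolyIrreducible.prime {W : Type*} [AddCommGroup W] [Module k W] {S : Set W}
    (hS : PolyIrreducible (k := k) S) : PrimeSpectrum (polyFun k W) where
  asIdeal :=
    { carrier := {f | ∀ w ∈ S, f.1 w = 0}
      zero_mem' := fun _ _ => rfl
      add_mem' := fun {f g} hf hg w hw => by
        change f.1 w + g.1 w = 0
        rw [hf w hw, hg w hw, add_zero]
      smul_mem' := fun f g hg w hw => by
        change f.1 w * g.1 w = 0
        rw [hg w hw, mul_zero] }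
  isPrime := by
    refine Ideal.isPrime_iff.2 ⟨fun h => ?_, fun {f g} hfg => ?_⟩
    · obtain ⟨w, hw⟩ := hS.1
      have := (Ideal.eq_top_iff_one _).1 h w hw
      exact one_ne_zero this
    · by_contra! h
      obtain ⟨hf, hg⟩ := h
      obtain ⟨x, hx, hfx⟩ : ∃ x ∈ S, f.1 x ≠ 0 := by
        by_contra! h; exact hf h
      obtain ⟨y, hy, hgy⟩ : ∃ x ∈ S, g.1 x ≠ 0 := by
        by_contra! h; exact hg h
      obtain ⟨z, hz, hz'⟩ := hS.2 f.1 f.2 g.1 g.2 x hx y hy hfx hgy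
      exact hz' (hfg z hz)

theorem PolyIrreducible.prime_le {W : Type*} [AddCommGroup W] [Module k W] {S T : Set W}
    (hS : PolyIrreducible (k := k) S) (hT : PolyIrreducible (k := k) T) (h : S ⊆ T) :
    hT.prime ≤ hS.prime := fun _ hf w hw => hf w (h hw)

theorem PolyIrreducible.prime_lt {W : Type*} [AddCommGroup W] [Module k W] {S T : Set W}
    (hS : PolyIrreducible (k := k) S) (hT : PolyIrreducible (k := k) T) (h : S ⊆ T) {f : W → k}
    (hf : f ∈ polyFun k W) (hf0 : ∀ w ∈ S, f w = 0) {w : W} (hw : w ∈ T) (hfw : f w ≠ 0) :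
    hT.prime < hS.prime :=
  lt_of_le_not_ge (prime_le hS hT h) fun hle =>
    hfw (hle (show (⟨f, hf⟩ : polyFun k W) ∈ hS.prime.asIdeal from hf0) w hw)

theorem polyIrreducible_of_isPolyMap [Infinite k] {V W : Type*} [AddCommGroup W] [Module k W]
    [AddCommGroup V] [Module k V] {c : V → W} (hc : IsPolyMap k c) {f : V → k}
    (hf : f ∈ polyFun k V) {v : V} (hv : f v ≠ 0) :
    PolyIrreducible (k := k) {w | ∃ v, f v ≠ 0 ∧ c v = w} := by
  refine ⟨⟨_, v, hv, rfl⟩, ?_⟩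
  rintro g hg g' hg' _ ⟨x, hx, rfl⟩ _ ⟨y, hy, rfl⟩ hgx hgy
  obtain ⟨z, hz, hz'⟩ := exists_polyFun_mul_ne_zero (polyFun_mul hf (hc.comp hg)) (hc.comp hg')
    (mul_ne_zero hx hgx) hgy
  exact ⟨_, ⟨z, left_ne_zero_of_mul hz, rfl⟩, mul_ne_zero (right_ne_zero_of_mul hz) hz'⟩

/-- The frames of the nets in a set. -/
def frames (Z : Set (Net k)) : Set (Triple k) := {q | ∃ h : LinearIndependent k q, spanNet ⟨q, h⟩ ∈ Z}

theorem isPolyMap_mixLinear (q : Triple k) :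
    IsPolyMap k fun m : Matrix (Fin 3) (Fin 3) k => mixLinear m q := by
  let L : Matrix (Fin 3) (Fin 3) k →ₗ[k] Triple k :=
    { toFun := fun m => mixLinear m q
      map_add' := fun m n => by funext i; simp [mixLinear_apply, add_smul, Finset.sum_add_distrib]
      map_smul' := fun c m => by funext i; simp [mixLinear_apply, mul_smul, Finset.smul_sum] }
  exact L.isPolyMap

/-- Irreducibility of `Z` gives one net with a frame where `f ≠ 0` and another where `g ≠ 0`. They
differ by a base change, and irreducibility of the space of matrices provides one frame serving
both. -/
theorem polyIrreducible_frames [Infinite k] {Z : Set (Net k)} (hZ : IsIrreducible Z) :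
    PolyIrreducible (k := k) (frames Z) := by
  refine ⟨?_, ?_⟩
  · obtain ⟨V, hV⟩ := hZ.1
    obtain ⟨q, rfl⟩ := exists_spanNet V
    exact ⟨q.1, q.2, hV⟩
  · rintro f hf g hg x ⟨hx, hxZ⟩ y ⟨hy, hyZ⟩ hfx hgy
    obtain ⟨_, hV, ⟨q, rfl, hq⟩, q', hq', hgq⟩ := hZ.2 _ _ (isOpen_exists_frame hf)
      (isOpen_exists_frame hg) ⟨_, hxZ, ⟨x, hx⟩, rfl, hfx⟩ ⟨_, hyZ, ⟨y, hy⟩, rfl, hgy⟩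
    obtain ⟨m, hm, h⟩ := exists_mix hq'
    rw [h] at hgq
    have hd : (fun M : Matrix (Fin 3) (Fin 3) k => M.det) ∈ polyFun k _ := polyFun_det polyFun_apply
    have h1 : (1 : Matrix (Fin 3) (Fin 3) k).det * f (mixLinear 1 q.1) ≠ 0 := by
      have : mixLinear 1 q.1 = q.1 := by
        funext i; simp [mixLinear_apply, Matrix.one_apply]
      simpa [this] using hq
    obtain ⟨n, hn, hn'⟩ := exists_polyFun_mul_ne_zero
      (polyFun_mul hd ((isPolyMap_mixLinear q.1).comp hf)) ((isPolyMap_mixLinear q.1).comp hg)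
      h1 hgq
    have hn0 := left_ne_zero_of_mul hn
    refine ⟨mixLinear n q.1, ⟨linearIndependent_mix hn0 q.2, ?_⟩,
      mul_ne_zero (right_ne_zero_of_mul hn) hn'⟩
    rwa [spanNet_mix hn0]

theorem prime_frames_lt [Infinite k] {Y Z : Set (Net k)} (hY : IsIrreducible Y) (hZ : IsIrreducible Z)
    (hYc : IsClosed Y) (h : Y ⊂ Z) :
    (polyIrreducible_frames hZ).prime < (polyIrreducible_frames hY).prime := by
  obtain ⟨V, hVZ, hVY⟩ := Set.exists_of_ssubset h
  obtain ⟨q, rfl⟩ := exists_spanNet V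
  obtain ⟨f, hf, hfq, hf'⟩ := net_isOpen_iff.1 hYc.isOpen_compl q hVY
  refine PolyIrreducible.prime_lt _ _ (fun x hx => ⟨hx.1, h.1 hx.2⟩) hf (fun w hw => ?_)
    (w := q.1) ⟨q.2, hVZ⟩ hfq
  by_contra h0
  exact hf' ⟨w, hw.1⟩ h0 hw.2

/-- The triples obtained from a frame by changes of basis which differ from the identity only at the
places in `s`. -/
def mixtures (q : Triple k) (s : Finset (Fin 3 × Fin 3)) : Set (Triple k) :=
  {x | ∃ v : s → k, (1 + suppMat s v).det ≠ 0 ∧ mixLinear (1 + suppMat s v) q = x}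

theorem polyIrreducible_mixtures [Infinite k] (q : Triple k) (s : Finset (Fin 3 × Fin 3)) :
    PolyIrreducible (k := k) (mixtures q s) := by
  have hd : (fun v : s → k => (1 + suppMat s v).det) ∈ polyFun k _ :=
    (isPolyMap_suppMat s).comp (polyFun_det polyFun_apply)
  refine polyIrreducible_of_isPolyMap (c := fun v : s → k => mixLinear (1 + suppMat s v) q)
    (fun φ => (isPolyMap_suppMat s).comp (isPolyMap_mixLinear q φ)) hd (v := 0) ?_
  have : suppMat s (0 : s → k) = 0 := by ext; simp [suppMat]
  simp [this]

theorem mixtures_mono (q : Triple k) {s t : Finset (Fin 3 × Fin 3)} (hst : s ⊆ t) :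
    mixtures q s ⊆ mixtures q t := by
  rintro _ ⟨v, h, rfl⟩
  rw [suppMat_extend hst] at h ⊢
  exact ⟨_, h, rfl⟩

theorem exists_dual {q : Triple k} (hq : LinearIndependent k q) :
    ∃ φ : Fin 3 → Module.Dual k (homogeneousSubmodule (Fin 3) k 2),
      ∀ i j, φ j (q i) = if i = j then 1 else 0 := by
  obtain ⟨π, hπ⟩ := (Fintype.linearCombination k q).exists_leftInverse_of_injective
    (LinearMap.ker_eq_bot.2 hq.fintypeLinearCombination_injective)
  refine ⟨fun j => LinearMap.proj j ∘ₗ π, fun i j => ?_⟩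
  have := LinearMap.congr_fun hπ (Pi.single i 1)
  simp only [LinearMap.comp_apply, Fintype.linearCombination_apply_single, one_smul,
    LinearMap.id_apply] at this
  simp [this, Pi.single_apply, eq_comm]

/-- The coordinate of the `i`-th form along `q j`, minus its value at the identity, vanishes until
the entry `(i, j)` is freed. -/
theorem prime_mixtures_lt [CharZero k] {q : Triple k} (hq : LinearIndependent k q)
    {s : Finset (Fin 3 × Fin 3)} {x : Fin 3 × Fin 3} (hx : x ∉ s) :
    (polyIrreducible_mixtures q (insert x s)).prime < (polyIrreducible_mixtures q s).prime := by
  obtain ⟨φ, hφ⟩ := exists_dual hq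
  obtain ⟨i, j⟩ := x
  have key : ∀ m : Matrix (Fin 3) (Fin 3) k, φ j (mixLinear m q i) = m i j := fun m => by
    simp [mixLinear_apply, hφ]
  refine PolyIrreducible.prime_lt _ _ (mixtures_mono q (Finset.subset_insert _ s))
    (f := fun q' => φ j (q' i) - (1 : Matrix (Fin 3) (Fin 3) k) i j) ?_ ?_
    (w := mixLinear (1 + suppMat _ fun y => if y.1 = (i, j) then 1 else 0) q) ⟨_, ?_, rfl⟩ ?_
  · exact polyFun_sub (polyFun_of_dual (φ j ∘ₗ LinearMap.proj i) fun _ => rfl) (polyFun_const _)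
  · rintro _ ⟨v, -, rfl⟩
    simp [key, suppMat, hx]
  · have : (suppMat (insert (i, j) s) fun y => if y.1 = (i, j) then (1 : k) else 0) =
        Matrix.single i j 1 := by
      ext a b
      by_cases h : (a, b) = (i, j)
      · obtain ⟨rfl, rfl⟩ := Prod.mk.inj h
        simp [suppMat]
      · have h' : ¬ (i = a ∧ j = b) := fun e => h (by rw [e.1, e.2])
        rw [Matrix.single_apply_of_ne _ _ _ _ _ h']
        simp only [suppMat, Matrix.of_apply, h, if_false, dite_eq_ite, ite_self]
    rw [this, Matrix.det_fin_three]
    fin_cases i <;> fin_cases j <;>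
      simp [Matrix.single, Fin.ext_iff, one_add_one_eq_two]
  · rw [key]
    simp [suppMat]

/-- The frames of a single net already give a chain of length nine: the entries of the base change
are freed one by one. -/
theorem nine_le_coheight [CharZero k] {Z : Set (Net k)} (hZ : IsIrreducible Z) :
    9 ≤ Order.coheight (polyIrreducible_frames hZ).prime := by
  obtain ⟨V, hV⟩ := hZ.1
  obtain ⟨q, rfl⟩ := exists_spanNet V
  have key : ∀ s : Finset (Fin 3 × Fin 3),
      (s.card : ℕ∞) ≤ Order.coheight (polyIrreducible_mixtures q.1 s).prime := fun s => by
    induction s using Finset.induction_on with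
    | empty => simp
    | insert x s hx ih =>
      rw [Finset.card_insert_of_notMem hx]
      push_cast
      exact (add_le_add_left ih 1).trans (Order.coheight_add_one_le (prime_mixtures_lt q.2 hx))
  refine (key Finset.univ).trans (Order.coheight_anti ?_)
  refine PolyIrreducible.prime_le _ _ ?_
  rintro _ ⟨v, hv, rfl⟩
  exact ⟨linearIndependent_mix hv q.2, by rwa [spanNet_mix hv]⟩

theorem coheight_le_eighteen [CharZero k] (P : PrimeSpectrum (polyFun k (Triple k))) :
    Order.coheight P ≤ 18 := by
  have := (Order.coheight_le_krullDim P).trans (ringKrullDim_polyFun_triple_le (k := k))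
  exact WithBot.coe_le_coe.1 this

/-- The dimension of an irreducible closed set of nets: that of its set of frames, minus that of the
group of base changes. -/
def netDim [CharZero k] (Z : TopologicalSpace.IrreducibleCloseds (Net k)) : ℕ :=
  (Order.coheight (polyIrreducible_frames Z.isIrreducible).prime).toNat - 9

/-- The bounds 9 and 18 on the coheight make both the truncated subtraction and the passage from
`ℕ∞` to `ℕ` harmless. -/
theorem netDim_add_nine [CharZero k] (Z : TopologicalSpace.IrreducibleCloseds (Net k)) :
    ((netDim Z + 9 : ℕ) : ℕ∞) = Order.coheight (polyIrreducible_frames Z.isIrreducible).prime := by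
  have h1 := nine_le_coheight Z.isIrreducible
  have h2 := coheight_le_eighteen (polyIrreducible_frames Z.isIrreducible).prime
  rw [netDim]
  obtain ⟨n, hn⟩ := ENat.ne_top_iff_exists.1 (ne_top_of_le_ne_top (by simp) h2)
  rw [← hn] at h1 ⊢
  have : 9 ≤ n := by exact_mod_cast h1
  simp only [ENat.toNat_natCast]
  congr 1
  omega

theorem netDim_le_nine [CharZero k] (Z : TopologicalSpace.IrreducibleCloseds (Net k)) :
    netDim Z ≤ 9 := by
  have h := coheight_le_eighteen (polyIrreducible_frames Z.isIrreducible).prime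
  rw [← netDim_add_nine] at h
  have : netDim Z + 9 ≤ 18 := by exact_mod_cast h
  omega

theorem netDim_strictMono [CharZero k] : StrictMono (netDim (k := k)) := by
  intro Y Z h
  have := Order.coheight_add_one_le
    (prime_frames_lt Y.isIrreducible Z.isIrreducible Y.isClosed h)
  rw [← netDim_add_nine, ← netDim_add_nine] at this
  have : netDim Y + 9 + 1 ≤ netDim Z + 9 := by exact_mod_cast this
  omega

/-- A determinant of dual coordinates, nonzero only on independent triples, lets two principal open
sets of triples meet in a frame. -/
theorem isIrreducible_univ_net [CharZero k] : IsIrreducible (Set.univ : Set (Net k)) := by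
  refine ⟨⟨(Entry.e8a : Entry k).net, trivial⟩, ?_⟩
  rintro U U' hU hU' ⟨V, -, hV⟩ ⟨V', -, hV'⟩
  obtain ⟨q, rfl⟩ := exists_spanNet V
  obtain ⟨q', rfl⟩ := exists_spanNet V'
  obtain ⟨f, hf, hfq, hfU⟩ := net_isOpen_iff.1 hU q hV
  obtain ⟨g, hg, hgq, hgU⟩ := net_isOpen_iff.1 hU' q' hV'
  obtain ⟨φ, hφ⟩ := exists_dual q.2
  have hd : (fun x : Triple k => (Matrix.of fun i j => φ j (x i)).det) ∈ polyFun k _ :=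
    polyFun_det fun i j => polyFun_of_dual (φ j ∘ₗ LinearMap.proj i) fun _ => rfl
  have hd1 : (Matrix.of fun i j => φ j (q.1 i)) = 1 := by
    ext i j; simp [hφ, Matrix.one_apply]
  obtain ⟨z, hz, hz'⟩ := exists_polyFun_mul_ne_zero (polyFun_mul hd hf) hg (x := q.1)
    (by rw [hd1, Matrix.det_one, one_mul]; exact hfq) hgq
  have hi : LinearIndependent k z := by
    have h := Matrix.linearIndependent_rows_of_det_ne_zero (left_ne_zero_of_mul hz)
    exact LinearIndependent.of_comp (LinearMap.pi φ) h
  exact ⟨spanNet ⟨z, hi⟩, trivial, hfU _ (right_ne_zero_of_mul hz), hgU ⟨z, hi⟩ hz'⟩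

end UpperBound

end NetsOfConics

end

open MvPolynomial

noncomputable section

namespace NetsOfConics

/-! ### Comparison of dimensions along specializations. -/

section Dimension

variable {k : Type*} [Field k]

theorem krullDim_le_of_strictMono_nat {α : Type*} [Preorder α] {f : α → ℕ} (hf : StrictMono f)
    {d : ℕ} (h : ∀ x, f x ≤ d) : Order.krullDim α ≤ ((d : ℕ∞) : WithBot ℕ∞) := by
  refine iSup_le fun p => ?_
  have : p.length < Fintype.card (Fin (d + 1)) :=
    (p.map (fun x => (⟨f x, Nat.lt_succ_of_le (h x)⟩ : Fin (d + 1))) fun _ _ hxy =>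
      hf hxy).length_lt_card
  rw [Fintype.card_fin] at this
  exact WithBot.coe_le_coe.2 (Nat.cast_le.2 (Nat.lt_succ_iff.1 this))

/-- The closure of an orbit. -/
def orbitClosure [Infinite k] (V : Net k) : TopologicalSpace.IrreducibleCloseds (Net k) where
  carrier := closure (orbit V)
  isIrreducible' := (isIrreducible_orbit V).closure
  isClosed' := isClosed_closure

theorem orbitClosure_lt [Infinite k] {V W : Net k} (h : SpecializesTo V W)
    (h' : ¬ SpecializesTo W V) : orbitClosure W < orbitClosure V :=
  lt_of_le_not_ge (closure_minimal h isClosed_closure) fun hle => h' (subset_closure.trans hle)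

/-- Taking closures in the Grassmannian is strictly monotone on irreducible closed subsets of the
orbit, and the results lie in the closure of the orbit. -/
theorem topologicalKrullDim_orbit_le [CharZero k] (V : Net k) :
    topologicalKrullDim (orbit V) ≤ ((netDim (orbitClosure V) : ℕ∞) : WithBot ℕ∞) := by
  refine krullDim_le_of_strictMono_nat (netDim_strictMono.comp
    (TopologicalSpace.IrreducibleCloseds.map_strictMono_of_isInducing
      Topology.IsInducing.subtypeVal)) fun Z => netDim_strictMono.monotone ?_
  refine closure_mono ?_
  rintro _ ⟨x, -, rfl⟩
  exact x.2

theorem isPolyMap_of_entries {W : Type*} [AddCommGroup W] [Module k W]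
    {M : W → Matrix (Fin 3) (Fin 3) k} (h : ∀ i j, (fun w => M w i j) ∈ polyFun k W) :
    IsPolyMap k M := by
  intro φ
  have key : ∀ A : Matrix (Fin 3) (Fin 3) k, φ A = ∑ i, ∑ j, A i j * φ (Matrix.single i j 1) := by
    intro A
    conv_lhs => rw [Matrix.matrix_eq_sum_single A, map_sum]
    refine Finset.sum_congr rfl fun i _ => ?_
    rw [map_sum]
    refine Finset.sum_congr rfl fun j _ => ?_
    rw [show Matrix.single i j (A i j) = A i j • Matrix.single i j (1 : k) by simp, map_smul,
      smul_eq_mul]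
  rw [funext fun w => key (M w)]
  exact polyFun_sum fun i _ => polyFun_sum fun j _ => polyFun_mul (h i j) (polyFun_const _)

/-- The translates by generic matrices are dense in an orbit. -/
theorem orbit_subset_closure_act [Infinite k] (V : Net k) {h : Matrix (Fin 3) (Fin 3) k → k}
    (hh : h ∈ polyFun k (Matrix (Fin 3) (Fin 3) k)) {m : Matrix (Fin 3) (Fin 3) k} (hm : h m ≠ 0) :
    orbit V ⊆ closure {U | ∃ g : GL (Fin 3) k, h g.1 ≠ 0 ∧ U = V.act g} := by
  intro W hW
  obtain ⟨g, rfl⟩ := mem_orbit_iff_act.1 hW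
  obtain ⟨q, rfl⟩ := exists_spanNet V
  rw [mem_closure_iff]
  intro U hU hgU
  rw [← spanNet_substLinear] at hgU
  obtain ⟨f, hf, hfq, hfU⟩ := net_isOpen_iff.1 hU _ hgU
  let c : Matrix (Fin 3) (Fin 3) k → Triple k := fun M i =>
    ⟨aeval (fun i => lin (M i)) (q.1 i).1, by
      simpa using (q.1 i).2.aeval (fun i => lin (M i)) (n := 1) fun i => lin_isHomogeneous (M i)⟩
  have hc : IsPolyMap k c := isPolyMap_of_coeff fun i m => polyFun_coeff_aeval _ _
  have hd : (fun M : Matrix (Fin 3) (Fin 3) k => M.det) ∈ polyFun k _ := polyFun_det polyFun_apply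
  obtain ⟨z, hz, hz'⟩ := exists_polyFun_mul_ne_zero (polyFun_mul hd (hc.comp hf)) hh (x := g.1)
    (mul_ne_zero g.det_ne_zero hfq) hm
  have hz0 := left_ne_zero_of_mul hz
  refine ⟨_, ?_, toGL z hz0, hz', rfl⟩
  rw [← spanNet_substLinear]
  exact hfU ⟨_, linearIndependent_substLinear (toGL z hz0) q.2⟩ (right_ne_zero_of_mul hz)

/-- The determinant formed by three entries of three matrices. -/
def entryDet (e : Fin 3 → Fin 3 × Fin 3) (A : Fin 3 → Matrix (Fin 3) (Fin 3) k) : k :=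
  (Matrix.of fun r j => A r (e j).1 (e j).2).det

theorem polyFun_entryDet (e : Fin 3 → Fin 3 × Fin 3) :
    (fun q : Triple k => entryDet e (hessTriple q)) ∈ polyFun k (Triple k) :=
  polyFun_det (M := fun q : Triple k => Matrix.of fun r j => hessTriple q r (e j).1 (e j).2)
    fun r j => polyFun_hessTriple r (e j).1 (e j).2

theorem entryDet_mix (e : Fin 3 → Fin 3 × Fin 3) (m : Matrix (Fin 3) (Fin 3) k)
    (A : Fin 3 → Matrix (Fin 3) (Fin 3) k) : entryDet e (mix m A) = m.det * entryDet e A := by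
  rw [entryDet, entryDet, ← Matrix.det_mul]
  refine congrArg Matrix.det (Matrix.ext fun r j => ?_)
  simp [mix, Matrix.mul_apply, Matrix.sum_apply]

theorem hessTriple_mixLinear (m : Matrix (Fin 3) (Fin 3) k) (q : Triple k) :
    hessTriple (mixLinear m q) = mix m (hessTriple q) := by
  funext i
  rw [hessTriple, mixLinear_apply]
  simp only [Submodule.coe_sum, Submodule.coe_smul, map_sum, map_smul, mix]
  rfl

theorem entryDet_eq_zero_of_spanNet_eq {e : Fin 3 → Fin 3 × Fin 3} {q q' : Frame k}
    (h : spanNet q' = spanNet q) (hq : entryDet e (hessTriple q.1) = 0) :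
    entryDet e (hessTriple q'.1) = 0 := by
  obtain ⟨m, -, hm⟩ := exists_mix h
  rw [hm, hessTriple_mixLinear, entryDet_mix, hq, mul_zero]

theorem hessTriple_substLinear (g : GL (Fin 3) k) (q : Triple k) :
    hessTriple (substLinear g q) = conj g.1 (hessTriple q) := by
  funext i
  simp only [hessTriple, substLinear_apply, hess_subst]
  rfl

/-- The substitution of the linear forms with given coefficients into a triple of forms. -/
def substTriple (M : Matrix (Fin 3) (Fin 3) k) (q : Triple k) : Triple k := fun i =>
  ⟨aeval (fun i => lin (M i)) (q i).1, by
    simpa using (q i).2.aeval (fun i => lin (M i)) (n := 1) fun i => lin_isHomogeneous _⟩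

theorem substTriple_eq {M : Matrix (Fin 3) (Fin 3) k} (hM : M.det ≠ 0) (q : Triple k) :
    substTriple M q = substLinear (toGL M hM) q := rfl

theorem linearIndependent_substTriple {M : Matrix (Fin 3) (Fin 3) k} (hM : M.det ≠ 0) (q : Frame k) :
    LinearIndependent k (substTriple M q.1) := linearIndependent_substLinear (toGL M hM) q.2

theorem spanNet_substTriple {M : Matrix (Fin 3) (Fin 3) k} (hM : M.det ≠ 0) (q : Frame k) :
    spanNet ⟨substTriple M q.1, linearIndependent_substTriple hM q⟩ =
      (spanNet q).act (toGL M hM) := spanNet_substLinear (toGL M hM) q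

theorem isPolyMap_substTriple {W : Type*} [AddCommGroup W] [Module k W]
    {M : W → Matrix (Fin 3) (Fin 3) k} (hM : IsPolyMap k M) {Q : W → Triple k} {f : W → k}
    (hf : f ∈ polyFun k W) {P₀ P₁ : Fin 3 → MvPolynomial (Fin 3) k}
    (hQ : ∀ w i, (Q w i).1 = P₀ i + C (f w) * P₁ i) :
    IsPolyMap k fun w => substTriple (M w) (Q w) := isPolyMap_of_coeff fun i m => by
  have : (fun w => coeff m (substTriple (M w) (Q w) i).1) = fun w =>
      coeff m (aeval (fun i => lin (M w i)) (P₀ i)) +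
        f w * coeff m (aeval (fun i => lin (M w i)) (P₁ i)) := by
    funext w
    simp only [substTriple, hQ, map_add, map_mul, algHom_C, algebraMap_eq, coeff_add, coeff_C_mul]
  rw [this]
  exact polyFun_add (hM.comp (polyFun_coeff_aeval _ _))
    (polyFun_mul hf (hM.comp (polyFun_coeff_aeval _ _)))

/-- Between the closures of two orbits there is room for the closure of a family of nets on which
some determinant vanishes. -/
theorem netDim_orbitClosure_add_two_le [CharZero k] {a b : Entry k}
    (hab : ¬ SpecializesTo b.net a.net)
    {W : Type*} [AddCommGroup W] [Module k W] {M : W → Matrix (Fin 3) (Fin 3) k}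
    (hM : IsPolyMap k M) {w₀ : W} (hw₀ : (M w₀).det ≠ 0)
    {Q : k → Frame k} {P₀ P₁ : Fin 3 → MvPolynomial (Fin 3) k}
    (hQ : ∀ s i, ((Q s).1 i).1 = P₀ i + C s * P₁ i)
    (hQa : ∀ s, s ≠ 0 → spanNet (Q s) ∈ orbit a.net)
    {h : Matrix (Fin 3) (Fin 3) k → k} (hh : h ∈ polyFun k (Matrix (Fin 3) (Fin 3) k))
    {m : Matrix (Fin 3) (Fin 3) k} (hm : h m ≠ 0)
    (hb : ∀ g : GL (Fin 3) k, h g.1 ≠ 0 → ∃ w, ∃ hw : (M w).det ≠ 0,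
      b.net.act g = (spanNet (Q 0)).act (toGL _ hw))
    {e : Fin 3 → Fin 3 × Fin 3} (he : ∀ w s, entryDet e (conj (M w) (hessTriple (Q s).1)) = 0)
    {g : Matrix (Fin 3) (Fin 3) k} (hg : g.det ≠ 0) (hga : entryDet e (conj g a.mat) ≠ 0) :
    netDim (orbitClosure b.net) + 2 ≤ netDim (orbitClosure a.net) := by
  have hfst : IsPolyMap k fun x : W × k => M x.1 := fun φ =>
    (LinearMap.fst k W k).isPolyMap.comp (hM φ)
  have hsnd : (fun x : W × k => x.2) ∈ polyFun k (W × k) :=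
    polyFun_of_dual (LinearMap.snd k W k) fun _ => rfl
  have hc : IsPolyMap k fun x : W × k => substTriple (M x.1) (Q x.2).1 :=
    isPolyMap_substTriple hfst hsnd fun x i => hQ x.2 i
  have hd : (fun x : W × k => x.2 * (M x.1).det) ∈ polyFun k (W × k) :=
    polyFun_mul hsnd (hfst.comp (polyFun_det polyFun_apply))
  have hi : ∀ x : W × k, x.2 * (M x.1).det ≠ 0 →
      LinearIndependent k (substTriple (M x.1) (Q x.2).1) := fun x hx =>
    linearIndependent_substTriple (right_ne_zero_of_mul hx) _
  have hirr := isIrreducible_of_isPolyMap hc hd (w₁ := (w₀, 1)) (mul_ne_zero one_ne_zero hw₀) hi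
  set S : Set (Net k) := {V | ∃ x : W × k, ∃ hx : x.2 * (M x.1).det ≠ 0,
    V = spanNet ⟨_, hi x hx⟩} with hS
  let Z : TopologicalSpace.IrreducibleCloseds (Net k) := ⟨closure S, hirr.closure, isClosed_closure⟩
  have hSa : S ⊆ orbit a.net := by
    rintro _ ⟨x, hx, rfl⟩
    rw [spanNet_substTriple (right_ne_zero_of_mul hx)]
    exact mem_orbit_trans (act_mem_orbit _ _) (hQa _ (left_ne_zero_of_mul hx))
  have hbS : orbit b.net ⊆ closure S := by
    refine (orbit_subset_closure_act b.net hh hm).trans (closure_minimal ?_ isClosed_closure)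
    rintro _ ⟨g, hg, rfl⟩
    obtain ⟨w, hw, e⟩ := hb g hg
    rw [e, ← spanNet_substTriple hw]
    exact mem_closure_of_curve (S := S) (c := fun t => substTriple (M w) (Q t).1) (f := fun t => t)
      (t₁ := 1) (isPolyMap_substTriple (fun φ => polyFun_const _) polyFun_id hQ) polyFun_id
      one_ne_zero (fun t ht _ => ⟨(w, t), mul_ne_zero ht hw, rfl⟩)
      (fun t _ => linearIndependent_substTriple hw _) (linearIndependent_substTriple hw _)
  have hS1 : (spanNet (Q 1)).act (toGL _ hw₀) ∈ S :=
    ⟨(w₀, 1), mul_ne_zero one_ne_zero hw₀, (spanNet_substTriple hw₀ (Q 1)).symm⟩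
  -- The intermediate set contains a net of the orbit of `a`, which the closure of the orbit of `b`
  -- does not.
  have h1 : orbitClosure b.net < Z := by
    refine lt_of_le_not_ge (closure_minimal hbS isClosed_closure) fun hle => hab ?_
    have := specializesTo_iff.2 (hle (subset_closure hS1))
    exact this.trans (specializesTo_of_orbit_eq (orbit_eq_of_mem (hSa hS1)))
  -- The chosen determinant is a Plücker coordinate: it vanishes on the whole family but not at one
  -- translate of `a`.
  have h2 : Z < orbitClosure a.net := by
    refine lt_of_le_not_ge (closure_mono hSa) fun hle => ?_
    obtain ⟨q, hq, hqm⟩ := exists_frame_act a (toGL g hg) (m := 1) (by simp)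
    have hmem : spanNet q ∈ closure S := hle (subset_closure (hq ▸ act_mem_orbit _ _))
    refine notMem_closure_of_polyFun (polyFun_entryDet e) ?_ q ?_ hmem
    · rintro q' ⟨x, hx, hq'⟩
      refine entryDet_eq_zero_of_spanNet_eq hq' ?_
      have e' := he x.1 x.2
      rwa [← toGL_val (M x.1) (right_ne_zero_of_mul hx), ← hessTriple_substLinear,
        ← substTriple_eq] at e'
    · rw [hqm, entryDet_mix, Matrix.det_one, one_mul]
      exact hga
  have h3 := netDim_strictMono h1
  have h4 := netDim_strictMono h2
  omega

end Dimension

end NetsOfConics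

end

open MvPolynomial

noncomputable section

namespace NetsOfConics

/-! ### Exact dimensions of the orbits. -/

section DimensionOfOrbits

variable {k : Type*} [Field k] [CharZero k]

omit [CharZero k] in
/-- A pencil of nets, given by forms of degree one in the parameter. -/
theorem exists_pencil_frame {P₀ P₁ : Fin 3 → MvPolynomial (Fin 3) k}
    (hP : ∀ s i, (P₀ i + C s * P₁ i).IsHomogeneous 2)
    (hi : ∀ s, LinearIndependent k fun i => P₀ i + C s * P₁ i) :
    ∃ Q : k → Frame k, ∀ s i, ((Q s).1 i).1 = P₀ i + C s * P₁ i :=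
  ⟨fun s => ⟨fun i => ⟨_, hP s i⟩,
    LinearIndependent.of_comp (homogeneousSubmodule (Fin 3) k 2).subtype (hi s)⟩, fun _ _ => rfl⟩

omit [CharZero k] in
theorem linearIndependent_of_hess {p : Fin 3 → MvPolynomial (Fin 3) k}
    (h : LinearIndependent k fun i => hess (p i)) : LinearIndependent k p :=
  LinearIndependent.of_comp hess h

theorem lin_mul_lin_mem_act_2a (g : GL (Fin 3) k) (v : Fin 3 → k) :
    lin (g.1 0) * lin v ∈ ((Entry.e2a : Entry k).net.act g).carrier := by
  have h : ∀ c : Fin 3 → k, X 0 * lin c ∈ (Entry.e2a : Entry k).net.carrier := fun c => by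
    refine Net.mem_of_eq (spanNet_mem _ 0) (spanNet_mem _ 1) (spanNet_mem _ 2) (c 0) (c 1) (c 2) ?_
    simp [Entry.forms, lin_eq]
    ring
  refine ⟨_, h (Matrix.vecMul v g⁻¹.1), ?_⟩
  have : Matrix.vecMul (Matrix.vecMul v g⁻¹.1) g.1 = v := by
    rw [Matrix.vecMul_vecMul, ← Units.val_mul, inv_mul_cancel]
    simp
  rw [AlgHom.toLinearMap_apply, map_mul, subst_X, subst_lin, this]

theorem lin_mul_lin_mem_act_2b (g : GL (Fin 3) k) {p q : MvPolynomial (Fin 3) k} (a b c d : k)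
    (hp : p = C a * lin (g.1 0) + C b * lin (g.1 1)) (hq : q = C c * lin (g.1 0) + C d * lin (g.1 1)) :
    p * q ∈ ((Entry.e2b : Entry k).net.act g).carrier := by
  have h : ∀ i, subst g ((Entry.e2b : Entry k).forms i) ∈
      ((Entry.e2b : Entry k).net.act g).carrier := fun i => ⟨_, spanNet_mem _ i, rfl⟩
  refine Net.mem_of_eq (h 0) (h 1) (h 2) (a * c) (a * d + b * c) (b * d) ?_
  subst hp hq
  simp [Entry.forms]
  ring

omit [CharZero k] in
theorem spanNet_act_eq_of_mem {V : Net k} {q : Frame k} {M : Matrix (Fin 3) (Fin 3) k}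
    (hM : M.det ≠ 0) (h : ∀ i, aeval (fun i => lin (M i)) (q.1 i).1 ∈ V.carrier) :
    V = (spanNet q).act (toGL M hM) := by
  rw [← spanNet_substTriple hM]
  exact Net.eq_spanNet h

/-- In the intermediate family one generator is the fixed line `X` times another line. Its Hessian
entries at `Y²`, `YZ`, `Z²` are zero, and this kills the chosen determinant. -/
theorem netDim_2a_add_two_le (h : ¬ SpecializesTo (Entry.e2a : Entry k).net Entry.e4.net) :
    netDim (orbitClosure (Entry.e2a : Entry k).net) + 2 ≤
      netDim (orbitClosure (Entry.e4 : Entry k).net) := by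
  let P₀ : Fin 3 → MvPolynomial (Fin 3) k := ![X 0 * X 1, X 1 ^ 2, X 1 * X 2]
  let P₁ : Fin 3 → MvPolynomial (Fin 3) k := ![0, 0, X 0 ^ 2]
  have hhess : ∀ s, (fun i => hess (P₀ i + C s * P₁ i)) =
      ![!![0, 1, 0; 1, 0, 0; 0, 0, 0], !![0, 0, 0; 0, 2, 0; 0, 0, 0],
        !![s + s, 0, 0; 0, 0, 1; 0, 1, 0]] := fun s => by
    funext i; fin_cases i <;> ext a b <;> fin_cases a <;> fin_cases b <;>
      simp [P₀, P₁, sq, hess_X_mul_X, ← smul_eq_C_mul, one_add_one_eq_two]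
  obtain ⟨Q, hQ⟩ := exists_pencil_frame (P₀ := P₀) (P₁ := P₁) (fun s i => by
      have hm : ∀ i j : Fin 3, (X i * X j : MvPolynomial (Fin 3) k).IsHomogeneous 2 := fun i j =>
        (isHomogeneous_X k i).mul (isHomogeneous_X k j)
      fin_cases i
      · simpa [P₀, P₁] using hm 0 1
      · simpa [P₀, P₁, sq] using hm 1 1
      · simpa [P₀, P₁, sq] using (hm 1 2).add ((isHomogeneous_C (Fin 3) s).mul (hm 0 0)))
    (fun s => linearIndependent_of_hess (by
      rw [hhess, Fintype.linearIndependent_iff]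
      intro c hc
      have e := fun i j => congrFun (congrFun hc i) j
      have e1 := e 0 1
      have e2 := e 1 1
      have e3 := e 1 2
      simp [Fin.sum_univ_three] at e1 e2 e3
      intro i; fin_cases i <;> assumption))
  have hQh : ∀ s, hessTriple (Q s).1 = _ := fun s =>
    (_root_.funext fun i => by rw [hessTriple, hQ]).trans (hhess s)
  have hmem : ∀ s i, P₀ i + C s * P₁ i ∈ (spanNet (Q s)).carrier := fun s i =>
    hQ s i ▸ spanNet_mem (Q s) i
  refine netDim_orbitClosure_add_two_le (W := Fin 3 → k) h
    (M := fun w => !![1, 0, 0; w 0, w 1, w 2; 0, 0, 1]) (isPolyMap_of_entries fun i j => ?_)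
    (w₀ := fun _ => 1) (by simp [Matrix.det_fin_three]) hQ (fun s hs => ?_)
    (h := fun m => m 0 1) (polyFun_apply 0 1) (m := fun _ _ => 1) one_ne_zero
    (fun g hg => ⟨g.1 0, by simpa [Matrix.det_fin_three] using hg, ?_⟩)
    (e := ![(1, 1), (1, 2), (2, 2)]) (fun w s => ?_) (g := !![0, 1, 0; 0, 0, 1; 1, 0, 0])
    (by simp [Matrix.det_fin_three]) ?_
  · have hw : ∀ j, (fun w : Fin 3 → k => w j) ∈ polyFun k (Fin 3 → k) := fun j =>
      polyFun_of_dual (LinearMap.proj j) fun _ => rfl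
    fin_cases i <;> fin_cases j <;> first | exact polyFun_const _ | exact hw _
  · refine mem_orbit_net_of_matrix (Matrix.diagonal ![1, 1, s⁻¹])
      (by simp [Matrix.det_diagonal, Fin.prod_univ_three, hs]) fun i => ?_
    have hs' : (C s * C s⁻¹ : MvPolynomial (Fin 3) k) = 1 := by rw [← C_mul, mul_inv_cancel₀ hs, C_1]
    fin_cases i
    · exact Net.mem_of_eq (hmem s 0) (hmem s 1) (hmem s 2) 1 0 0
        (by simp [P₀, P₁, Entry.forms, lin_eq])
    · refine Net.mem_of_eq (hmem s 0) (hmem s 1) (hmem s 2) 0 0 s⁻¹ ?_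
      simp [P₀, P₁, Entry.forms, lin_eq]
      linear_combination -(X 0 ^ 2) * hs'
    · exact Net.mem_of_eq (hmem s 0) (hmem s 1) (hmem s 2) 0 1 0
        (by simp [P₀, P₁, Entry.forms, lin_eq])
  · refine spanNet_act_eq_of_mem _ fun i => ?_
    rw [hQ]
    have hX : ∀ j, X j = lin (Pi.single j (1 : k)) := fun j => by
      simp [lin, Pi.single_apply, apply_ite]
    fin_cases i
    · convert lin_mul_lin_mem_act_2a g (Pi.single 0 1) using 1
      rw [← hX]
      simp [P₀, P₁, lin_eq]
      ring
    · convert lin_mul_lin_mem_act_2a g (g.1 0) using 1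
      simp [P₀, P₁, lin_eq]
      ring
    · convert lin_mul_lin_mem_act_2a g (Pi.single 2 1) using 1
      rw [← hX]
      simp [P₀, P₁, lin_eq]
  · rw [hQh]
    simp [entryDet, conj, Matrix.det_fin_three, Matrix.mul_apply, Fin.sum_univ_three]
  · rw [Entry.mat_4]
    simp [entryDet, conj, Matrix.det_fin_three, Matrix.mul_apply, Fin.sum_univ_three]

/-- In the intermediate family one generator is the square of a line through `(0, 0, 1)`, so its
Hessian has zero last column and the chosen determinant vanishes. -/
theorem netDim_2b_add_two_le (h : ¬ SpecializesTo (Entry.e2b : Entry k).net Entry.e4.net) :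
    netDim (orbitClosure (Entry.e2b : Entry k).net) + 2 ≤
      netDim (orbitClosure (Entry.e4 : Entry k).net) := by
  let P₀ : Fin 3 → MvPolynomial (Fin 3) k := ![X 0 * X 1, X 1 ^ 2, X 0 ^ 2]
  let P₁ : Fin 3 → MvPolynomial (Fin 3) k := ![0, 0, X 1 * X 2]
  have hhess : ∀ s, (fun i => hess (P₀ i + C s * P₁ i)) =
      ![!![0, 1, 0; 1, 0, 0; 0, 0, 0], !![0, 0, 0; 0, 2, 0; 0, 0, 0],
        !![2, 0, 0; 0, 0, s; 0, s, 0]] := fun s => by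
    funext i; fin_cases i <;> ext a b <;> fin_cases a <;> fin_cases b <;>
      simp [P₀, P₁, sq, hess_X_mul_X, ← smul_eq_C_mul, one_add_one_eq_two]
  obtain ⟨Q, hQ⟩ := exists_pencil_frame (P₀ := P₀) (P₁ := P₁) (fun s i => by
      have hm : ∀ i j : Fin 3, (X i * X j : MvPolynomial (Fin 3) k).IsHomogeneous 2 := fun i j =>
        (isHomogeneous_X k i).mul (isHomogeneous_X k j)
      fin_cases i
      · simpa [P₀, P₁] using hm 0 1
      · simpa [P₀, P₁, sq] using hm 1 1
      · simpa [P₀, P₁, sq] using (hm 0 0).add ((isHomogeneous_C (Fin 3) s).mul (hm 1 2)))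
    (fun s => linearIndependent_of_hess (by
      rw [hhess, Fintype.linearIndependent_iff]
      intro c hc
      have e := fun i j => congrFun (congrFun hc i) j
      have e1 := e 0 1
      have e2 := e 1 1
      have e3 := e 0 0
      simp [Fin.sum_univ_three] at e1 e2 e3
      intro i; fin_cases i <;> assumption))
  have hQh : ∀ s, hessTriple (Q s).1 = _ := fun s =>
    (_root_.funext fun i => by rw [hessTriple, hQ]).trans (hhess s)
  have hmem : ∀ s i, P₀ i + C s * P₁ i ∈ (spanNet (Q s)).carrier := fun s i =>
    hQ s i ▸ spanNet_mem (Q s) i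
  refine netDim_orbitClosure_add_two_le (W := Fin 3 → k) h
    (M := fun w => !![1, 0, w 2; w 0, w 1, 0; 0, 0, 1]) (isPolyMap_of_entries fun i j => ?_)
    (w₀ := fun _ => 1) (by simp [Matrix.det_fin_three]) hQ (fun s hs => ?_)
    (h := fun m => (m 0 0 * m 1 1 - m 0 1 * m 1 0) * (m 0 1 * m 1 2 - m 0 2 * m 1 1))
    ?_ (m := !![1, 1, 0; 0, 1, 1; 0, 0, 0]) (by simp)
    -- In the pencil spanned by the first two rows of `g`, one member has no `Z`-coefficient, and
    -- another has `X`-coefficient 1 and `Y`-coefficient 0; `w` records their remaining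
    -- coefficients.
    (fun g hg => ⟨![g.1 0 2 * g.1 1 0 - g.1 1 2 * g.1 0 0, g.1 0 2 * g.1 1 1 - g.1 1 2 * g.1 0 1,
      (g.1 1 1 * g.1 0 2 - g.1 0 1 * g.1 1 2) / (g.1 0 0 * g.1 1 1 - g.1 0 1 * g.1 1 0)], ?_, ?_⟩)
    (e := ![(0, 2), (1, 2), (2, 2)]) (fun w s => ?_) (g := !![1, 0, 0; 0, 0, 1; 0, 1, 0])
    (by simp [Matrix.det_fin_three]) ?_
  · have hw : ∀ j, (fun w : Fin 3 → k => w j) ∈ polyFun k (Fin 3 → k) := fun j =>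
      polyFun_of_dual (LinearMap.proj j) fun _ => rfl
    fin_cases i <;> fin_cases j <;> first | exact polyFun_const _ | exact hw _
  · refine mem_orbit_net_of_matrix (Matrix.diagonal ![1, 1, s])
      (by simp [Matrix.det_diagonal, Fin.prod_univ_three, hs]) fun i => ?_
    fin_cases i
    · exact Net.mem_of_eq (hmem s 0) (hmem s 1) (hmem s 2) 1 0 0
        (by simp [P₀, P₁, Entry.forms, lin_eq])
    · refine Net.mem_of_eq (hmem s 0) (hmem s 1) (hmem s 2) 0 0 1 ?_
      simp [P₀, P₁, Entry.forms, lin_eq]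
      ring
    · exact Net.mem_of_eq (hmem s 0) (hmem s 1) (hmem s 2) 0 1 0
        (by simp [P₀, P₁, Entry.forms, lin_eq])
  · have ha : ∀ i j, (fun m : Matrix (Fin 3) (Fin 3) k => m i j) ∈ polyFun k _ := polyFun_apply
    exact polyFun_mul
      (polyFun_sub (polyFun_mul (ha 0 0) (ha 1 1)) (polyFun_mul (ha 0 1) (ha 1 0)))
      (polyFun_sub (polyFun_mul (ha 0 1) (ha 1 2)) (polyFun_mul (ha 0 2) (ha 1 1)))
  · simp only [Matrix.det_fin_three]
    simp
    intro e
    exact right_ne_zero_of_mul hg (by linear_combination -e)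
  · refine spanNet_act_eq_of_mem _ fun i => ?_
    rw [hQ]
    have hr := left_ne_zero_of_mul hg
    set r := g.1 0 0 * g.1 1 1 - g.1 0 1 * g.1 1 0 with hrdef
    have hx : lin ![1, 0, (g.1 1 1 * g.1 0 2 - g.1 0 1 * g.1 1 2) / r] =
        C (g.1 1 1 / r) * lin (g.1 0) + C (-g.1 0 1 / r) * lin (g.1 1) := by
      have e0 : g.1 1 1 / r * g.1 0 0 + -g.1 0 1 / r * g.1 1 0 = 1 := by
        field_simp; rw [hrdef]; ring
      have e1 : g.1 1 1 / r * g.1 0 1 + -g.1 0 1 / r * g.1 1 1 = 0 := by ring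
      have e2 : g.1 1 1 / r * g.1 0 2 + -g.1 0 1 / r * g.1 1 2 =
        (g.1 1 1 * g.1 0 2 - g.1 0 1 * g.1 1 2) / r := by ring
      simp only [lin_eq, mul_add, ← mul_assoc, ← C_mul]
      simp only [Matrix.cons_val]
      rw [← e0, ← e1, ← e2]
      simp only [C_add]
      ring
    have hy : lin ![g.1 0 2 * g.1 1 0 - g.1 1 2 * g.1 0 0, g.1 0 2 * g.1 1 1 - g.1 1 2 * g.1 0 1, 0] =
        C (-g.1 1 2) * lin (g.1 0) + C (g.1 0 2) * lin (g.1 1) := by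
      simp [lin_eq]
      ring
    fin_cases i
    · convert lin_mul_lin_mem_act_2b g _ _ _ _ hx hy using 1
      simp [P₀, P₁]
      rfl
    · convert lin_mul_lin_mem_act_2b g _ _ _ _ hy hy using 1
      simp [P₀, P₁, sq]
      rfl
    · convert lin_mul_lin_mem_act_2b g _ _ _ _ hx hx using 1
      simp [P₀, P₁, sq]
      rfl
  · rw [hQh]
    simp [entryDet, conj, Matrix.det_fin_three, Matrix.mul_apply, Fin.sum_univ_three]
  · rw [Entry.mat_4]
    simp [entryDet, conj, Matrix.det_fin_three, Matrix.mul_apply, Fin.sum_univ_three]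

variable [IsAlgClosed k]

theorem Arrow.not_specializesTo {a b : Entry k} (h : Arrow a b) :
    ¬ SpecializesTo b.net a.net := fun h' => by
  rcases specializesTo_net_iff.1 h' with e | e
  · exact h.dim_lt.ne e.dim_eq
  · exact h.dim_lt.asymm (dim_lt_of_transGen e)

theorem Arrow.netDim_lt {a b : Entry k} (h : Arrow a b) :
    netDim (orbitClosure b.net) < netDim (orbitClosure a.net) :=
  netDim_strictMono (orbitClosure_lt h.degenerates.specializesTo h.not_specializesTo)

/-- An orbit missing some net from its closure is not dense, and the whole irreducible Grassmannian
has `netDim` at most nine. -/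
theorem netDim_orbitClosure_le_eight {a b : Entry k} (h : ¬ SpecializesTo a.net b.net) :
    netDim (orbitClosure a.net) ≤ 8 := by
  let T : TopologicalSpace.IrreducibleCloseds (Net k) :=
    ⟨Set.univ, isIrreducible_univ_net, isClosed_univ⟩
  have hT : orbitClosure a.net < T :=
    lt_of_le_not_ge (Set.subset_univ _) fun hle => h fun V _ => hle (Set.mem_univ V)
  have h1 := netDim_strictMono hT
  have h2 := netDim_le_nine T
  omega

/-- The bound eight at the top descends by at least one along each arrow, and by two from `4` to
`2a` and `2b`. -/
theorem netDim_orbitClosure_le (a : Entry k) : netDim (orbitClosure a.net) ≤ a.dim := by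
  have hne : ∀ {a b : Entry k}, a.dim = b.dim → ¬ SameEntry a b → ¬ SpecializesTo a.net b.net :=
    fun hd hs h => (specializesTo_net_iff.1 h).elim hs fun e => (dim_lt_of_transGen e).ne' hd
  have h8a := netDim_orbitClosure_le_eight (hne (a := .e8a) (b := .e8c (k := k)) rfl nofun)
  have h8c := netDim_orbitClosure_le_eight (hne (a := .e8c) (b := .e8a (k := k)) rfl nofun)
  have h7a := (Arrow.a_8a_7a (k := k)).netDim_lt
  have h7b := (Arrow.a_8a_7b (k := k)).netDim_lt
  have h7c := (Arrow.a_8c_7c (k := k)).netDim_lt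
  have h6a := (Arrow.a_7a_6a (k := k)).netDim_lt
  have h6b := (Arrow.a_7a_6b (k := k)).netDim_lt
  have h6c := (Arrow.a_7a_6c (k := k)).netDim_lt
  have h6d := (Arrow.a_7c_6d (k := k)).netDim_lt
  have h5a := (Arrow.a_6a_5a (k := k)).netDim_lt
  have h5b := (Arrow.a_6d_5b (k := k)).netDim_lt
  have h4 := (Arrow.a_5a_4 (k := k)).netDim_lt
  have h2a := netDim_2a_add_two_le (k := k) Arrow.a_4_2a.not_specializesTo
  have h2b := netDim_2b_add_two_le (k := k) Arrow.a_4_2b.not_specializesTo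
  cases a with
  | e8b lam h =>
    exact netDim_orbitClosure_le_eight (hne (a := .e8b lam h) (b := .e8a) rfl nofun)
  | _ => simp only [Entry.dim]; omega

theorem topologicalKrullDim_orbit_net (a : Entry k) :
    topologicalKrullDim (orbit a.net) = (a.dim : ℕ∞) :=
  le_antisymm ((topologicalKrullDim_orbit_le a.net).trans
    (WithBot.coe_le_coe.2 (Nat.cast_le.2 (netDim_orbitClosure_le a))))
    (dim_le_topologicalKrullDim a)

end DimensionOfOrbits

end NetsOfConics

end

open NetsOfConics in
theorem theorem1p2 (k : Type*) [Field k] [IsAlgClosed k] [CharZero k] :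
    -- the table is complete
    (∀ V : Net k, ∃ a : Entry k, V ∈ orbit a.net) ∧
    -- the table is without repetition, the family being parametrized by the invariant `j`
    (∀ a b : Entry k, orbit a.net = orbit b.net ↔ SameEntry a b) ∧
    -- dimensions of the orbits
    (∀ a : Entry k, topologicalKrullDim (orbit a.net) = (a.dim : ℕ∞)) ∧
    -- the specialization order is the one generated by the arrows
    (∀ a b : Entry k, SpecializesTo a.net b.net ↔ SameEntry a b ∨ Relation.TransGen Arrow a b) ∧
    -- the arrows are exactly the elementary specializations
    (∀ a b : Entry k, IsElementary a.net b.net ↔ Arrow a b) ∧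
    -- each arrow is realized by a one-parameter family
    (∀ a b : Entry k, Arrow a b → ∃ F : k → Net k, IsAlgebraicFamily F ∧
      (∀ t : k, t ≠ 0 → F t ∈ orbit a.net) ∧ F 0 ∈ orbit b.net) := by
  have hcl : ∀ V : Net k, ∃ a : Entry k, V ∈ orbit a.net := exists_mem_orbit_net
  exact ⟨hcl, fun a b => orbit_net_eq_iff, topologicalKrullDim_orbit_net, fun a b => specializesTo_net_iff,
    fun a b => isElementary_net_iff hcl, fun a b h => h.degenerates⟩
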